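/- \textbf{Setting.} Let $r\ge 1$ and let $D$ be a compact domain in $\mathbb R^d$ or in a flat torus. Its boundary is a finite union of pieces $\Gamma_1,\dots,\Gamma_n$ which, off a closed corner set $\Gamma^*\subset\partial D$ containing the boundaries of the $\Gamma_i$, are $C^{r+1}$ hypersurfaces with $D$ on one side. Let $H=\frac12 p^2+V(q;\epsilon)$, $0<\epsilon<\epsilon_1$, have Hamiltonian flow $h^\epsilon_t$, and assume: (a) $V(\cdot;\epsilon)$ is $C^{r+1}$ and tends to $0$ in $C^{r+1}$ on compact subsets of the interior of $D$ as $\epsilon\to0^+$. (b) There are bounded neighbourhoods $N_i$ of $\Gamma_i\setminus\Gamma^*$ and a pattern function $Q(q;\epsilon)$, $0\le\epsilon<\epsilon_1$, defined on an open set containing all $\overline{N_i}\setminus\Gamma^*$. It is $C^{r+1}$ in $q$ and depends continuously on $\epsilon\ge 0$ in the $C^{r+1}$-topology, and its derivatives of order $r+1$ in $q$ are locally Lipschitz in $q$, uniformly in small $\epsilon>0$. (c) $Q(\cdot;0)=Q_i$ (a constant) on $\Gamma_i\setminus\Gamma^*$. On $\overline{N_i}\setminus\Gamma^*$ one has $Q(\cdot;0)>Q_i$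 exactly in the interior of $D$ and $Q(\cdot;0)<Q_i$ exactly outside $D$. On $N_i$ one has $\nabla Q\ne0$ for every $\epsilon\in[0,\epsilon_1)$, and for $\epsilon\in(0,\epsilon_1)$ the potential is given by the barrier $W(Q)=e^{-Q/\epsilon}$, that is, $V(q;\epsilon)=e^{-(Q(q;\epsilon)-Q_i)/\epsilon}$. For $s\in\mathbb R$ let $D^\epsilon(s)$ be the set of those $q\in D\cup\bigcup_iN_i$ with $Q(q;\epsilon)\ge Q_i+s$ for all $i$ with $q\in N_i$. Put $$\nu(\epsilon)=\epsilon^{1/(r+2)},\quad \eta(\epsilon)=-\epsilon\ln\nu(\epsilon),\quad \delta(\epsilon)=-\Bigl(r+1+\tfrac1{r+2}\Bigr)\epsilon\ln\epsilon,$$ $$D^\epsilon=D^\epsilon(\eta(\epsilon))\ \text{(the auxiliary billiard table, bounded by } Q=Q_i+\eta\text{)},\qquad D^\epsilon_{int}=D^\epsilon(\delta(\epsilon)).$$ Assume that $V$ is boundary dominated: for all sufficiently small $\epsilon>0$, $$\sup_{q\in D^\epsilon_{int},\,1\le l\le r+1}\|\partial^lV(q;\epsilon)\|=\sup_{q\in\partial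 D^\epsilon_{int},\,1\le l\le r+1}\|\partial^lV(q;\epsilon)\|$$ (if $\Gamma^*\neq\emptyset$: for arbitrarily small $c>0$ this holds, for all sufficiently small $\epsilon>0$, with the open $c$-neighbourhood of $\Gamma^*$ removed from both sets). A billiard trajectory in $D$ or $D^\epsilon$ is called regular if it has finitely many collisions, all non-tangent and off $\Gamma^*$. Let $b^\epsilon_t$ and $B^\epsilon$ be the billiard flow and the billiard map of $D^\epsilon$. Let $S_\epsilon$ be the set of $(q,p)$ with $q\in\partial D^\epsilon\setminus\Gamma^*$ and $p$ pointing strictly into $D^\epsilon$. The Poincaré map $\Phi^\epsilon$ sends a point of $S_\epsilon$ along its smooth orbit, which first crosses the interior of $D^\epsilon$, leaves $D^\epsilon$ through $\partial D^\epsilon$, runs outside $D^\epsilon$, and first returns to $\partial D^\epsilon$ at a point of $S_\epsilon$, which is its image. \textbf{Proposition.} $\eta(\epsilon)=O(\epsilon\ln\epsilon)$ as $\epsilon\to0^+$, and the following hold. (1) Flows. Let $\rho_0$ be an inner phase point with momentum of norm $1$ whose billiard trajectory in $D$ is regular on $[0,T]$, has $N$ collisions there, and ends at an inner point. Then there are a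 neighbourhood $U$ of $\rho_0$ in phase space and a constant $K$ such that for all sufficiently small $\epsilon>0$ and all $\rho\in U$: the trajectories of $\rho$ under $h^\epsilon_t$ and $b^\epsilon_t$ exist on $[0,T]$; the second is regular with exactly $N$ collisions; and there are $N$ closed intervals (impact intervals) of length at most $K\epsilon^{1/(r+2)}$, the $j$-th containing the $j$-th collision time, such that for every $t\in[0,T]$ outside them the smooth trajectory is in $D^\epsilon_{int}$, the maps $h^\epsilon_t$ and $b^\epsilon_t$ are $C^r$ near $\rho$, and their values and derivatives at $\rho$ up to order $r$ differ by at most $K\epsilon^{1/(r+2)}$. (2) Maps. Let $\rho_0$ be a phase point over $\partial D\setminus\Gamma^*$ with momentum of norm $1$ pointing strictly into $D$, whose next collision in $D$ is non-tangent and off $\Gamma^*$. Then there are a neighbourhood $U$ of $\rho_0$ in phase space and a constant $K$ such that for all sufficiently small $\epsilon>0$ and all $\rho\in U\cap S_\epsilon$: $B^\epsilon$ and $\Phi^\epsilon$ are defined at $\rho$; the time the smooth orbit spends outside $D^\epsilon$ before it returns to $S_\epsilon$ is at most $K\epsilon^{1/(r+2)}$; and $\Phi^\epsilon$ and $B^\epsilon$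 are $C^r$ at $\rho$ on $S_\epsilon$ and $K\epsilon^{1/(r+2)}$-close there in the $C^r$-sense (values and derivatives up to order $r$, measured along all $C^r$ maps into $S_\epsilon$ whose derivatives of orders $1,\dots,r$ are bounded by $1$). -/

import Mathlib

open Set Filter Topology
open scoped ENNReal RealInnerProductSpace

/-- Configuration space `ℝ^d` with the Euclidean norm. -/
abbrev Config (d : ℕ) : Type := EuclideanSpace ℝ (Fin d)

/-- Phase space: pairs (position, momentum). -/
abbrev Phase (d : ℕ) : Type := Config d × Config d

/-! ### Billiards in a closed set -/

/-- `n` is the inward unit normal of `Ω` at the boundary point `q`: directions on the positive side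
of `n` enter the interior of `Ω`, directions on the negative side leave `Ω`. There is at most one
such `n`; at a boundary point where `Ω` is locally `{g ≥ 0}` with `g` of class `C¹`, `g q = 0` and
`∇g q ≠ 0`, it is `∇g q / ‖∇g q‖`. -/
def IsInwardNormal {d : ℕ} (Ω : Set (Config d)) (q n : Config d) : Prop :=
  ‖n‖ = 1 ∧ ∀ v : Config d,
    (0 < ⟪n, v⟫ → ∀ᶠ s in 𝓝[>] (0 : ℝ), q + s • v ∈ interior Ω) ∧
    (⟪n, v⟫ < 0 → ∀ᶠ s in 𝓝[>] (0 : ℝ), q + s • v ∉ Ω)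

/-- Elastic reflection of the momentum `p` in the hyperplane orthogonal to the unit vector `n`. -/
noncomputable def reflectMomentum {d : ℕ} (n p : Config d) : Config d :=
  p - (2 * ⟪p, n⟫) • n

/-- `γ = (q, p)` is, on the time interval `[0, T]`, a regular billiard trajectory in `Ω` with
exactly the `N` collisions `τ 0 < τ 1 < ⋯` in `(0, T)`: free motion `q' = p`, `p' = 0` in the
interior of `Ω` off the collision times; every collision takes place off the corner set `C`, is not
tangent, and obeys the elastic reflection law (at a collision time `p` is the outgoing momentum). -/
structure IsBilliardOrbit {d : ℕ} (Ω C : Set (Config d)) (T : ℝ) (N : ℕ) (τ : Fin N → ℝ)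
    (γ : ℝ → Phase d) : Prop where
  strictMono : StrictMono τ
  mem_Ioo : ∀ j, τ j ∈ Ioo 0 T
  continuousOn : ContinuousOn (fun s => (γ s).1) (Icc 0 T)
  mem_interior : ∀ s ∈ Icc 0 T, s ∉ range τ → (γ s).1 ∈ interior Ω
  free : ∀ s ∈ Icc 0 T, s ∉ range τ → HasDerivWithinAt γ ((γ s).2, 0) (Icc 0 T) s
  collision : ∀ j, (γ (τ j)).1 ∈ frontier Ω \ C ∧
    ∃ n p : Config d, IsInwardNormal Ω (γ (τ j)).1 n ∧ ⟪p, n⟫ < 0 ∧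
      Tendsto (fun s => (γ s).2) (𝓝[<] (τ j)) (𝓝 p) ∧
      Tendsto (fun s => (γ s).2) (𝓝[>] (τ j)) (𝓝 (reflectMomentum n p)) ∧
      (γ (τ j)).2 = reflectMomentum n p

open Classical in
/-- The time-`t` map of the billiard flow in `Ω` (the identity where no regular billiard trajectory
on `[0, t]` starts). The trajectory is determined by its initial point. -/
noncomputable def billiardFlow {d : ℕ} (Ω C : Set (Config d)) (t : ℝ) (ρ : Phase d) : Phase d :=
  if h : ∃ γ : ℝ → Phase d, (∃ (N : ℕ) (τ : Fin N → ℝ), IsBilliardOrbit Ω C t N τ γ) ∧ γ 0 = ρ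
  then h.choose t else ρ

/-- The cross-section of boundary points (off the corner set) with momentum looking strictly
inwards. -/
def crossSection {d : ℕ} (Ω C : Set (Config d)) : Set (Phase d) :=
  {ρ | ρ.1 ∈ frontier Ω \ C ∧ ∃ n : Config d, IsInwardNormal Ω ρ.1 n ∧ 0 < ⟪ρ.2, n⟫}

/-- One regular step of the billiard map in `Ω`: free flight through the interior during time `t`,
followed by a non-tangent elastic reflection off the corner set. -/
def IsBilliardReturn {d : ℕ} (Ω C : Set (Config d)) (ρ : Phase d) (t : ℝ) (ρ' : Phase d) : Prop :=
  ρ ∈ crossSection Ω C ∧ 0 < t ∧ (∀ s ∈ Ioo 0 t, ρ.1 + s • ρ.2 ∈ interior Ω) ∧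
    ρ'.1 = ρ.1 + t • ρ.2 ∧ ρ'.1 ∈ frontier Ω \ C ∧
    ∃ n : Config d, IsInwardNormal Ω ρ'.1 n ∧ ⟪ρ.2, n⟫ < 0 ∧ ρ'.2 = reflectMomentum n ρ.2

open Classical in
/-- The billiard map of `Ω` (the identity where it is not defined). -/
noncomputable def billiardMap {d : ℕ} (Ω C : Set (Config d)) (ρ : Phase d) : Phase d :=
  if h : ∃ (ρ' : Phase d) (t : ℝ), IsBilliardReturn Ω C ρ t ρ' then h.choose else ρ

/-! ### The smooth Hamiltonian flow of `H = p² / 2 + V(q)` -/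

/-- `γ = (q, p)` solves `q' = p`, `p' = -∇V(q)` on `[0, T]` and stays over the set `G` on which the
potential is smooth. -/
def IsSmoothOrbit {d : ℕ} (G : Set (Config d)) (V : Config d → ℝ) (T : ℝ) (γ : ℝ → Phase d) :
    Prop :=
  ∀ s ∈ Icc 0 T, (γ s).1 ∈ G ∧
    HasDerivWithinAt γ ((γ s).2, -gradient V (γ s).1) (Icc 0 T) s

open Classical in
/-- The time-`t` map of the Hamiltonian flow (the identity where no solution on `[0, t]` starts). -/
noncomputable def smoothFlow {d : ℕ} (G : Set (Config d)) (V : Config d → ℝ) (t : ℝ)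
    (ρ : Phase d) : Phase d :=
  if h : ∃ γ : ℝ → Phase d, IsSmoothOrbit G V t γ ∧ γ 0 = ρ then h.choose t else ρ

/-- One step of the Poincaré map of the Hamiltonian flow on the cross-section over `∂Ω`: the orbit
of `ρ` runs inside `Ω` up to time `t₁`, when it meets `∂Ω` looking outwards (free-flight map), then
it runs outside `Ω` up to time `t₂`, when it is back on the cross-section (reflection map). -/
def IsSmoothReturn {d : ℕ} (G : Set (Config d)) (V : Config d → ℝ) (Ω C : Set (Config d))
    (ρ : Phase d) (t₁ t₂ : ℝ) (ρ' : Phase d) : Prop :=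
  ρ ∈ crossSection Ω C ∧ 0 < t₁ ∧ t₁ < t₂ ∧ ∃ γ : ℝ → Phase d, IsSmoothOrbit G V t₂ γ ∧ γ 0 = ρ ∧
    (∀ s ∈ Ioo 0 t₁, (γ s).1 ∈ interior Ω) ∧
    (γ t₁).1 ∈ frontier Ω \ C ∧ (∃ n, IsInwardNormal Ω (γ t₁).1 n ∧ ⟪(γ t₁).2, n⟫ < 0) ∧
    (∀ s ∈ Ioo t₁ t₂, (γ s).1 ∉ closure Ω) ∧
    γ t₂ = ρ' ∧ ρ' ∈ crossSection Ω C

open Classical in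
/-- The Poincaré map of the Hamiltonian flow (the identity where it is not defined). -/
noncomputable def poincareMap {d : ℕ} (G : Set (Config d)) (V : Config d → ℝ)
    (Ω C : Set (Config d)) (ρ : Phase d) : Phase d :=
  if h : ∃ (ρ' : Phase d) (t₁ t₂ : ℝ), IsSmoothReturn G V Ω C ρ t₁ t₂ ρ' then h.choose else ρ

/-! ### `C^r`-closeness -/

/-- `f` and `g` are of class `C^r` near `ρ`, and at `ρ` their values and their derivatives up to
order `r` differ by at most `c`. -/
def CrNear {d : ℕ} (r : ℕ) (f g : Phase d → Phase d) (ρ : Phase d) (c : ℝ) : Prop :=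
  ContDiffAt ℝ r f ρ ∧ ContDiffAt ℝ r g ρ ∧
    ∀ k ≤ r, ‖iteratedFDeriv ℝ k f ρ - iteratedFDeriv ℝ k g ρ‖ ≤ c

/-- The same for maps on a submanifold `S`, measured through every `C^r` map `σ` into `S` whose
derivatives of orders `1, …, r` are bounded by `1` (by the chain rule this is, up to a constant
factor, the same as in one fixed local chart of `S`; the bound `1` can be replaced by any other
one by rescaling the source of `σ`). -/
def CrNearOn {d : ℕ} (r : ℕ) (S : Set (Phase d)) (f g : Phase d → Phase d) (ρ : Phase d) (c : ℝ) :
    Prop :=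
  ∀ (σ : Phase d → Phase d) (x : Phase d), σ x = ρ → ContDiffAt ℝ r σ x →
    (∀ᶠ y in 𝓝 x, σ y ∈ S) → (∀ k, 1 ≤ k → k ≤ r → ‖iteratedFDeriv ℝ k σ x‖ ≤ 1) →
    CrNear r (f ∘ σ) (g ∘ σ) x c

/-! ### Billiard tables and steep potentials -/

/-- A set invariant under the translations in `Λ`. -/
def IsPeriodicSet {d : ℕ} (Λ : AddSubgroup (Config d)) (S : Set (Config d)) : Prop :=
  ∀ v ∈ Λ, ∀ x, x + v ∈ S ↔ x ∈ S

/-- A billiard table: a compact domain `D` of `ℝ^d` (`Λ = ⊥`) or of a flat torus `ℝ^d / Λ`, given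
by its `Λ`-periodic lift to `ℝ^d`. The boundary is a finite union of pieces `Γ i` which, off the
closed corner set (which contains the boundaries of the `Γ i`), are hypersurfaces of class
`C^(r+1)`, with `D` on one side of them. -/
structure BilliardTable (d r : ℕ) where
  Λ : AddSubgroup (Config d)
  discrete : DiscreteTopology Λ
  D : Set (Config d)
  pieces : ℕ
  Γ : Fin pieces → Set (Config d)
  corner : Set (Config d)
  isClosed_D : IsClosed D
  isClosed_Γ : ∀ i, IsClosed (Γ i)
  isClosed_corner : IsClosed corner
  periodic_D : IsPeriodicSet Λ D
  periodic_Γ : ∀ i, IsPeriodicSet Λ (Γ i)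
  periodic_corner : IsPeriodicSet Λ corner
  compact_D : ∃ K : Set (Config d), IsCompact K ∧ ∀ x ∈ D, ∃ v ∈ Λ, x + v ∈ K
  frontier_D : frontier D = ⋃ i, Γ i
  corner_subset : corner ⊆ frontier D
  smooth : ∀ i, ∀ q ∈ Γ i \ corner, ∃ O : Set (Config d), IsOpen O ∧ q ∈ O ∧
    ∃ g : Config d → ℝ, ContDiffOn ℝ ((r + 1 : ℕ) : WithTop ℕ∞) g O ∧ fderiv ℝ g q ≠ 0 ∧
      (∀ x ∈ O, x ∈ D ↔ 0 ≤ g x) ∧ (∀ x ∈ O, x ∈ Γ i ↔ g x = 0)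

/-- A family of steep potentials `V(·; ε)`, `0 < ε < ε₁`, on a billiard table, with pattern function
`Q(·; ε)`, `0 ≤ ε < ε₁`, boundary values `Qval i`, and the barrier function `W(Q; ε) = exp (-Q / ε)`
at every boundary piece. For this barrier `W(·; ε)` increases from `0` to `∞` across the boundary
(from `Q > 0` to `Q < 0`), has non-zero derivative, and its inverse `-ε log W` tends to `0` with all
derivatives, uniformly on compact subsets of `(0, ∞)`. -/
structure SteepExpPotential {d r : ℕ} (B : BilliardTable d r) where
  ε₁ : ℝ
  ε₁_pos : 0 < ε₁
  V : ℝ → Config d → ℝ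
  Q : ℝ → Config d → ℝ
  Qval : Fin B.pieces → ℝ
  /-- Neighbourhoods of the boundary pieces, off the corner set. -/
  Nbhd : Fin B.pieces → Set (Config d)
  /-- The open set on which the pattern function is smooth. -/
  Dt : Set (Config d)
  periodic_V : ∀ ε, ∀ v ∈ B.Λ, ∀ x, V ε (x + v) = V ε x
  periodic_Q : ∀ ε, ∀ v ∈ B.Λ, ∀ x, Q ε (x + v) = Q ε x
  periodic_Nbhd : ∀ i, IsPeriodicSet B.Λ (Nbhd i)
  isOpen_Nbhd : ∀ i, IsOpen (Nbhd i)
  subset_Nbhd : ∀ i, B.Γ i \ B.corner ⊆ Nbhd i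
  compact_Nbhd : ∀ i, ∃ K : Set (Config d), IsCompact K ∧ ∀ x ∈ Nbhd i, ∃ v ∈ B.Λ, x + v ∈ K
  isOpen_Dt : IsOpen Dt
  closure_Nbhd_subset : ∀ i, closure (Nbhd i) \ B.corner ⊆ Dt
  /-- `V(·; ε)` is of class `C^(r+1)`. -/
  contDiff_V : ∀ ε ∈ Ioo 0 ε₁,
    ContDiffOn ℝ ((r + 1 : ℕ) : WithTop ℕ∞) (V ε) (interior B.D ∪ ⋃ i, Nbhd i)
  /-- `Q(·; ε)` is of class `C^(r+1)` and depends continuously on `ε ≥ 0` in the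
  `C^(r+1)`-topology. -/
  contDiff_Q : ∀ ε ∈ Ico 0 ε₁, ContDiffOn ℝ ((r + 1 : ℕ) : WithTop ℕ∞) (Q ε) Dt
  continuous_Q : ∀ k ≤ r + 1, ContinuousOn
    (fun x : ℝ × Config d => iteratedFDeriv ℝ k (Q x.1) x.2) (Ico 0 ε₁ ×ˢ Dt)
  /-- The derivative of order `r + 1` of `Q(·; ε)` is locally Lipschitz, uniformly in small `ε`. -/
  lipschitz_Q : ∀ x ∈ Dt, ∃ L, ∃ s ∈ 𝓝 x, ∀ᶠ ε in 𝓝[>] (0 : ℝ),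
    LipschitzOnWith L (iteratedFDeriv ℝ (r + 1) (Q ε)) s
  /-- The potential vanishes in the limit, in `C^(r+1)`, on compact sets inside `D`. -/
  vanishing : ∀ K ⊆ interior B.D, IsCompact K → ∀ k ≤ r + 1,
    TendstoUniformlyOn (fun ε q => iteratedFDeriv ℝ k (V ε) q) 0 (𝓝[>] (0 : ℝ)) K
  /-- The boundary pieces are level sets of `Q(·; 0)`. -/
  levelSet : ∀ i, ∀ q ∈ B.Γ i \ B.corner, Q 0 q = Qval i
  /-- Near the boundary, `Q(·; 0)` is larger than its boundary value exactly inside the table, and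
  smaller exactly outside of it. -/
  side : ∀ i, ∀ q ∈ closure (Nbhd i) \ B.corner,
    (Qval i < Q 0 q ↔ q ∈ interior B.D) ∧ (Q 0 q < Qval i ↔ q ∉ B.D)
  /-- Near the boundary the potential is the exponential barrier of the pattern function. -/
  barrier : ∀ i, ∀ ε ∈ Ioo 0 ε₁, ∀ q ∈ Nbhd i, V ε q = Real.exp (-(Q ε q - Qval i) / ε)
  /-- The pattern function has no critical points near the boundary. -/
  gradient_ne : ∀ i, ∀ ε ∈ Ico 0 ε₁, ∀ q ∈ Nbhd i, gradient (Q ε) q ≠ 0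

namespace SteepExpPotential

variable {d r : ℕ} {B : BilliardTable d r}

/-- The set over which the Hamiltonian system is considered. -/
def domain (P : SteepExpPotential B) : Set (Config d) := interior B.D ∪ ⋃ i, P.Nbhd i

/-- The domain bounded by the surfaces `Q(q; ε) = Qval i + s`. -/
def table (P : SteepExpPotential B) (ε s : ℝ) : Set (Config d) :=
  {q | (q ∈ B.D ∨ ∃ i, q ∈ P.Nbhd i) ∧ ∀ i, q ∈ P.Nbhd i → P.Qval i + s ≤ P.Q ε q}

end SteepExpPotential

/-- The value of the barrier on the boundary of the auxiliary table: `ν(ε) = ε^(1/(r+2))`. -/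
noncomputable def nuExp (r : ℕ) (ε : ℝ) : ℝ := ε ^ (1 / ((r : ℝ) + 2))

/-- The level of the auxiliary table: `exp (-η / ε) = ν(ε)`, i.e. `η(ε) = -ε log ν(ε)`. -/
noncomputable def etaExp (r : ℕ) (ε : ℝ) : ℝ := -(ε * Real.log (nuExp r ε))

/-- The level bounding the interior region: `δ(ε) = -(r + 1 + 1/(r+2)) ε log ε`. -/
noncomputable def deltaExp (r : ℕ) (ε : ℝ) : ℝ :=
  -(((r : ℝ) + 1 + 1 / ((r : ℝ) + 2)) * ε * Real.log ε)

namespace SteepExpPotential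

variable {d r : ℕ} {B : BilliardTable d r}

/-- The auxiliary billiard table `D^ε`, bounded by `Q(q; ε) = Qval i + η(ε)`. -/
noncomputable def auxTable (P : SteepExpPotential B) (ε : ℝ) : Set (Config d) :=
  P.table ε (etaExp r ε)

/-- The interior region `D_int^ε`, bounded by `Q(q; ε) = Qval i + δ(ε)`. -/
noncomputable def intTable (P : SteepExpPotential B) (ε : ℝ) : Set (Config d) :=
  P.table ε (deltaExp r ε)

/-- The supremum over `q ∈ S` and `1 ≤ l ≤ r + 1` of `‖∂^l V(q; ε)‖`. -/
noncomputable def derivSup (P : SteepExpPotential B) (ε : ℝ) (S : Set (Config d)) : ℝ≥0∞ :=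
  ⨆ q ∈ S, ⨆ l ∈ Icc 1 (r + 1), ‖iteratedFDeriv ℝ l (P.V ε) q‖ₑ

/-- The potential is boundary dominated: the derivatives of orders `1, …, r + 1` of `V(·; ε)` are as
large on the boundary of `D_int^ε` as on all of `D_int^ε`. If there are corners, this is asked
outside arbitrarily small neighbourhoods of the corner set. -/
def BoundaryDominated (P : SteepExpPotential B) : Prop :=
  ∃ᶠ c in 𝓝[>] (0 : ℝ), ∀ᶠ ε in 𝓝[>] (0 : ℝ),
    P.derivSup ε (P.intTable ε \ Metric.thickening c B.corner) =
      P.derivSup ε (frontier (P.intTable ε) \ Metric.thickening c B.corner)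

end SteepExpPotential

open Metric (closedBall ball mem_closedBall ball_subset_closedBall isOpen_ball closedBall_mem_nhds
  thickening ball_mem_nhds closedBall_subset_closedBall mem_closedBall_self self_subset_thickening
  nhds_basis_closedBall)

local notation "𝕀" => Icc (0 : ℝ) 1

local notation "𝓝₀" => 𝓝[>] (0 : ℝ)

open Real (exp log)

open Function (uncurry comp_apply)

open ContinuousLinearMap (fst snd)

open scoped Gradient

local notation "𝒞" => ContDiffAt ℝ

/-! ### Relational calculus of families of smooth maps -/

section RelCalculus

/-- The tangent map `(x, v) ↦ (f x, Df(x) v)`. -/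
noncomputable def tmap {E F : Type} [NormedAddCommGroup E] [NormedSpace ℝ E]
    [NormedAddCommGroup F] [NormedSpace ℝ F] (f : E → F) (z : E × E) : F × F :=
  (f z.1, fderiv ℝ f z.1 z.2)

/-- Tangent vectors of norm at most `M` over `A`. -/
def tset {E : Type} [NormedAddCommGroup E] (A : Set E) (M : ℝ) : Set (E × E) := A ×ˢ closedBall 0 M

/-- The families `f` and `g` are related to order `k`, with error `κ`: their iterated tangent maps
satisfy `‖f x - g x'‖ ≤ C (‖x - x'‖ + κ)` over the sets `A` (for `f`) and `A'` (for `g`). -/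
def CR {ι : Type} (l : Filter ι) (κ : ι → ℝ) : (k : ℕ) → {E F : Type} →
    [NormedAddCommGroup E] → [NormedSpace ℝ E] → [NormedAddCommGroup F] → [NormedSpace ℝ F] →
    (f g : ι → E → F) → (A A' : ι → Set E) → Prop
  | 0, _, _, _, _, _, _, f, g, A, A' => ∃ C : ℝ, ∀ᶠ i in l, (∀ x ∈ A' i, ‖g i x‖ ≤ C) ∧
      ∀ x ∈ A i, ∀ x' ∈ A' i, ‖f i x - g i x'‖ ≤ C * (‖x - x'‖ + κ i)
  | k + 1, _, _, _, _, _, _, f, g, A, A' => ∀ M : ℝ, CR l κ k (fun i => tmap (f i))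
      (fun i => tmap (g i)) (fun i => tset (A i) M) (fun i => tset (A' i) M)

variable {ι ι' : Type} {E F H : Type} [NormedAddCommGroup E] [NormedSpace ℝ E]
  [NormedAddCommGroup F] [NormedSpace ℝ F] [NormedAddCommGroup H] [NormedSpace ℝ H]
  {l : Filter ι} {κ κ' : ι → ℝ} {k : ℕ} {f g f' g' : ι → E → F} {A A' A₁ A₁' : ι → Set E}

omit [NormedSpace ℝ E] in
lemma tset_mono {A B : Set E} (h : A ⊆ B) {M M' : ℝ} (hM : M ≤ M') : tset A M ⊆ tset B M' :=
  prod_mono h (closedBall_subset_closedBall hM)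

omit [NormedSpace ℝ E] in
lemma tset_subset_closedBall {A : Set E} {R : ℝ} (h : A ⊆ closedBall 0 R) (M : ℝ) :
    tset A M ⊆ closedBall 0 (max R M) := by
  intro z hz
  rw [mem_closedBall_zero_iff, Prod.norm_def]
  exact max_le_max (mem_closedBall_zero_iff.1 (h hz.1)) (mem_closedBall_zero_iff.1 hz.2)

lemma CR.mono_set (h : CR l κ k f g A A') (hA : ∀ᶠ i in l, A₁ i ⊆ A i)
    (hA' : ∀ᶠ i in l, A₁' i ⊆ A' i) : CR l κ k f g A₁ A₁' := by
  induction k generalizing E F with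
  | zero =>
    obtain ⟨C, hC⟩ := h
    refine ⟨C, ?_⟩
    filter_upwards [hC, hA, hA'] with i hi h1 h2
    exact ⟨fun x hx => hi.1 x (h2 hx), fun x hx x' hx' => hi.2 x (h1 hx) x' (h2 hx')⟩
  | succ k ih =>
    intro M
    exact ih (h M) (hA.mono fun i hi => tset_mono hi le_rfl)
      (hA'.mono fun i hi => tset_mono hi le_rfl)

lemma CR.mono_weight (h : CR l κ k f g A A') {c : ℝ} (hκ : ∀ᶠ i in l, 0 ≤ κ i)
    (hκ' : ∀ᶠ i in l, κ i ≤ c * κ' i) (hκ0 : ∀ᶠ i in l, 0 ≤ κ' i) : CR l κ' k f g A A' := by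
  induction k generalizing E F with
  | zero =>
    obtain ⟨C, hC⟩ := h
    refine ⟨max C 0 * max c 1, ?_⟩
    filter_upwards [hC, hκ, hκ', hκ0] with i hi h0 h1 h2
    refine ⟨fun x hx => (hi.1 x hx).trans ((le_max_left C 0).trans
      (le_mul_of_one_le_right (le_max_right _ _) (le_max_right _ _))), fun x hx x' hx' => ?_⟩
    refine (hi.2 x hx x' hx').trans ?_
    have h3 : ‖x - x'‖ + κ i ≤ max c 1 * (‖x - x'‖ + κ' i) := by
      have := mul_le_mul_of_nonneg_right (le_max_right c 1) (norm_nonneg (x - x'))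
      have := mul_le_mul_of_nonneg_right (le_max_left c 1) h2
      linarith
    calc C * (‖x - x'‖ + κ i) ≤ max C 0 * (‖x - x'‖ + κ i) := by
          gcongr
          · exact le_max_left _ _
      _ ≤ max C 0 * (max c 1 * (‖x - x'‖ + κ' i)) := by gcongr
      _ = _ := by ring
  | succ k ih => exact fun M => ih (h M)

lemma tmap_congr {f f' : E → F} {x : E} (h : f =ᶠ[𝓝 x] f') (v : E) :
    tmap f =ᶠ[𝓝 (x, v)] tmap f' := by
  filter_upwards [h.prod_inl_nhds v, (h.fderiv (𝕜 := ℝ)).prod_inl_nhds v] with z hz hz'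
  simp [tmap, hz, hz']

lemma CR.congr (h : CR l κ k f g A A') (hf : ∀ᶠ i in l, ∀ x ∈ A i, f i =ᶠ[𝓝 x] f' i)
    (hg : ∀ᶠ i in l, ∀ x ∈ A' i, g i =ᶠ[𝓝 x] g' i) : CR l κ k f' g' A A' := by
  induction k generalizing E F with
  | zero =>
    obtain ⟨C, hC⟩ := h
    refine ⟨C, ?_⟩
    filter_upwards [hC, hf, hg] with i hi h1 h2
    refine ⟨fun x hx => (h2 x hx).eq_of_nhds ▸ hi.1 x hx, fun x hx x' hx' => ?_⟩
    rw [← (h1 x hx).eq_of_nhds, ← (h2 x' hx').eq_of_nhds]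
    exact hi.2 x hx x' hx'
  | succ k ih =>
    exact fun M => ih (h M) (hf.mono fun i hi x hx => tmap_congr (hi x.1 hx.1) x.2)
      (hg.mono fun i hi x hx => tmap_congr (hi x.1 hx.1) x.2)

lemma CR.reindex (h : CR l κ k f g A A') {l' : Filter ι'} {j : ι' → ι} (hj : Tendsto j l' l) :
    CR l' (fun i => κ (j i)) k (fun i => f (j i)) (fun i => g (j i)) (fun i => A (j i))
      (fun i => A' (j i)) := by
  induction k generalizing E F with
  | zero => exact h.imp fun C hC => hj.eventually hC
  | succ k ih => exact fun M => ih (h M)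

lemma CR.pred (h : CR l κ (k + 1) f g A A') : CR l κ k f g A A' := by
  induction k generalizing E F with
  | zero =>
    obtain ⟨C, hC⟩ := h 0
    refine ⟨C, hC.mono fun i hi => ⟨fun x hx => ?_, fun x hx x' hx' => ?_⟩⟩
    · exact (norm_fst_le _).trans (hi.1 (x, 0) ⟨hx, by simp⟩)
    · have := (norm_fst_le _).trans (hi.2 (x, 0) ⟨hx, by simp⟩ (x', 0) ⟨hx', by simp⟩)
      simpa [tmap] using this
  | succ k ih => exact fun M => ih (h M)

lemma CR.of_le (h : CR l κ k f g A A') {j : ℕ} (hj : j ≤ k) : CR l κ j f g A A' := by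
  induction k with
  | zero => exact (Nat.le_zero.1 hj) ▸ h
  | succ k ih =>
    rcases Nat.lt_or_ge j (k + 1) with h1 | h1
    · exact ih h.pred (Nat.lt_succ_iff.1 h1)
    · exact (le_antisymm hj h1) ▸ h

lemma CR.exists_bound (h : CR l κ k f g A A') (hκ : ∀ᶠ i in l, 0 ≤ κ i)
    (hκ1 : ∀ᶠ i in l, κ i ≤ 1) (hA : ∀ᶠ i in l, A i ⊆ A' i) :
    ∃ C, ∀ᶠ i in l, (∀ x ∈ A i, ‖f i x‖ ≤ C) ∧ ∀ x ∈ A' i, ‖g i x‖ ≤ C := by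
  obtain ⟨C, hC⟩ := h.of_le (Nat.zero_le k)
  refine ⟨max C 0 + max C 0, ?_⟩
  filter_upwards [hC, hA, hκ, hκ1] with i h1 h2 h3 h4
  have h5 : ∀ x ∈ A' i, ‖g i x‖ ≤ max C 0 := fun x hx => (h1.1 x hx).trans (le_max_left _ _)
  refine ⟨fun x hx => (norm_le_norm_sub_add _ (g i x)).trans (add_le_add ?_ (h5 x (h2 hx))),
    fun x hx => (h5 x hx).trans (le_add_of_nonneg_left (le_max_right _ _))⟩
  refine (h1.2 x hx x (h2 hx)).trans ?_
  rw [sub_self, norm_zero, zero_add]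
  exact (mul_le_mul_of_nonneg_right (le_max_left C 0) h3).trans
    (mul_le_of_le_one_right (le_max_right _ _) h4)

lemma ContDiffAt.tmap' {f : E → F} {x : E} (h : 𝒞 (k + 1 : ℕ) f x)
    (v : E) : 𝒞 k (tmap f) (x, v) := by
  have h1 : 𝒞 k f x := h.of_le (by exact_mod_cast Nat.le_succ k)
  have h2 : 𝒞 k (fderiv ℝ f) x := h.fderiv_right (by norm_cast)
  exact (h1.comp (x, v) contDiffAt_fst).prodMk
    ((ContDiffAt.comp (x, v) h2 contDiffAt_fst).clm_apply contDiffAt_snd)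

lemma ContDiffAt.eventually_differentiableAt {f : E → F} {x : E}
    (h : 𝒞 (k + 1 : ℕ) f x) : ∀ᶠ y in 𝓝 x, DifferentiableAt ℝ f y := by
  filter_upwards [h.eventually (by simp)] with y hy
  exact hy.differentiableAt (by exact_mod_cast Nat.succ_ne_zero k)

lemma tmap_comp_eventuallyEq {f : F → H} {a : E → F} {x : E}
    (hf : 𝒞 (k + 1 : ℕ) f (a x))
    (ha : 𝒞 (k + 1 : ℕ) a x) (v : E) :
    tmap (f ∘ a) =ᶠ[𝓝 (x, v)] tmap f ∘ tmap a := by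
  filter_upwards [ha.eventually_differentiableAt.prod_inl_nhds v,
    (ha.continuousAt.eventually hf.eventually_differentiableAt).prod_inl_nhds v] with z hz hz'
  simp [tmap, fderiv_comp z.1 hz' hz]

/-- Related families of maps of class `C^k`. -/
structure CRel (l : Filter ι) (κ : ι → ℝ) (k : ℕ) (f g : ι → E → F) (A A' : ι → Set E) : Prop where
  left : ∀ᶠ i in l, ∀ x ∈ A i, 𝒞 k (f i) x
  right : ∀ᶠ i in l, ∀ x ∈ A' i, 𝒞 k (g i) x
  cr : CR l κ k f g A A'

lemma CRel.mono_set (h : CRel l κ k f g A A') (hA : ∀ᶠ i in l, A₁ i ⊆ A i)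
    (hA' : ∀ᶠ i in l, A₁' i ⊆ A' i) : CRel l κ k f g A₁ A₁' :=
  ⟨by filter_upwards [h.left, hA] with i h1 h2 x hx using h1 x (h2 hx),
   by filter_upwards [h.right, hA'] with i h1 h2 x hx using h1 x (h2 hx), h.cr.mono_set hA hA'⟩

lemma CRel.mono_weight (h : CRel l κ k f g A A') {c : ℝ} (hκ : ∀ᶠ i in l, 0 ≤ κ i)
    (hκ' : ∀ᶠ i in l, κ i ≤ c * κ' i) (hκ0 : ∀ᶠ i in l, 0 ≤ κ' i) : CRel l κ' k f g A A' :=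
  ⟨h.left, h.right, h.cr.mono_weight hκ hκ' hκ0⟩

lemma CRel.congr (h : CRel l κ k f g A A') (hf : ∀ᶠ i in l, ∀ x ∈ A i, f i =ᶠ[𝓝 x] f' i)
    (hg : ∀ᶠ i in l, ∀ x ∈ A' i, g i =ᶠ[𝓝 x] g' i) : CRel l κ k f' g' A A' :=
  ⟨(h.left.and hf).mono fun _ hi x hx => (hi.1 x hx).congr_of_eventuallyEq (hi.2 x hx).symm,
   (h.right.and hg).mono fun _ hi x hx => (hi.1 x hx).congr_of_eventuallyEq (hi.2 x hx).symm,
   h.cr.congr hf hg⟩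

lemma CRel.reindex (h : CRel l κ k f g A A') {l' : Filter ι'} {j : ι' → ι} (hj : Tendsto j l' l) :
    CRel l' (fun i => κ (j i)) k (fun i => f (j i)) (fun i => g (j i)) (fun i => A (j i))
      (fun i => A' (j i)) :=
  ⟨hj.eventually h.left, hj.eventually h.right, h.cr.reindex hj⟩

lemma CRel.of_le (h : CRel l κ k f g A A') {j : ℕ} (hj : j ≤ k) : CRel l κ j f g A A' :=
  ⟨h.left.mono fun _ hi x hx => (hi x hx).of_le (by exact_mod_cast hj),
   h.right.mono fun _ hi x hx => (hi x hx).of_le (by exact_mod_cast hj), h.cr.of_le hj⟩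

lemma CRel.tangent (h : CRel l κ (k + 1) f g A A') (M : ℝ) :
    CRel l κ k (fun i => tmap (f i)) (fun i => tmap (g i)) (fun i => tset (A i) M)
      (fun i => tset (A' i) M) :=
  ⟨h.left.mono fun _ hi x hx => (hi x.1 hx.1).tmap' x.2,
   h.right.mono fun _ hi x hx => (hi x.1 hx.1).tmap' x.2, h.cr M⟩

lemma CRel.comp {f g : ι → F → H} {a b : ι → E → F} {B B' : ι → Set F}
    (hf : CRel l κ k f g B B') (ha : CRel l κ k a b A A') (hκ : ∀ᶠ i in l, 0 ≤ κ i)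
    (hκ1 : ∀ᶠ i in l, κ i ≤ 1) (hA : ∀ᶠ i in l, A i ⊆ A' i)
    (hm : ∀ᶠ i in l, MapsTo (a i) (A i) (B i)) (hm' : ∀ᶠ i in l, MapsTo (b i) (A' i) (B' i)) :
    CRel l κ k (fun i => f i ∘ a i) (fun i => g i ∘ b i) A A' := by
  refine ⟨?_, ?_, ?_⟩
  · filter_upwards [hf.left, ha.left, hm] with i h1 h2 h3 x hx
    exact (h1 _ (h3 hx)).comp x (h2 x hx)
  · filter_upwards [hf.right, ha.right, hm'] with i h1 h2 h3 x hx
    exact (h1 _ (h3 hx)).comp x (h2 x hx)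
  induction k generalizing E F H with
  | zero =>
    obtain ⟨C, hC⟩ := hf.cr
    obtain ⟨D, hD⟩ := ha.cr
    refine ⟨max C 0 * (max D 0 + 1), ?_⟩
    filter_upwards [hC, hD, hm, hm', hκ] with i h1 h2 h3 h4 h0
    refine ⟨fun x hx => ?_, fun x hx x' hx' => ?_⟩
    · have := h1.1 _ (h4 hx)
      have h5 := le_max_left C 0
      have h6 := mul_nonneg (le_max_right C 0) (le_max_right D 0)
      simp only [comp_apply]
      linarith
    · have h5 := h1.2 _ (h3 hx) _ (h4 hx')
      have h6 := h2.2 _ hx _ hx'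
      have h7 : 0 ≤ ‖x - x'‖ := norm_nonneg _
      calc ‖f i (a i x) - g i (b i x')‖ ≤ C * (‖a i x - b i x'‖ + κ i) := h5
        _ ≤ max C 0 * (‖a i x - b i x'‖ + κ i) := by gcongr; exact le_max_left _ _
        _ ≤ max C 0 * (max D 0 * (‖x - x'‖ + κ i) + (‖x - x'‖ + κ i)) := by
            gcongr
            · refine h6.trans ?_
              gcongr
              exact le_max_left _ _
            · linarith
        _ = _ := by ring
  | succ k ih =>
    intro M
    have hA2 : ∀ᶠ i in l, tset (A i) M ⊆ tset (A' i) M := hA.mono fun i hi => tset_mono hi le_rfl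
    obtain ⟨C, key⟩ := (ha.tangent M).cr.exists_bound hκ hκ1 hA2
    have := ih (hf.tangent C) (ha.tangent M) hA2 (by
        filter_upwards [key, hm] with i h1 h2 z hz
        exact ⟨h2 hz.1, by simpa using (norm_snd_le _).trans (h1.1 z hz)⟩) (by
        filter_upwards [key, hm'] with i h1 h2 z hz
        exact ⟨h2 hz.1, by simpa using (norm_snd_le _).trans (h1.2 z hz)⟩)
    refine this.congr ?_ ?_
    · filter_upwards [hf.left, ha.left, hm] with i h1 h2 h3 z hz
      exact (tmap_comp_eventuallyEq (h1 _ (h3 hz.1)) (h2 _ hz.1) z.2).symm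
    · filter_upwards [hf.right, ha.right, hm'] with i h1 h2 h3 z hz
      exact (tmap_comp_eventuallyEq (h1 _ (h3 hz.1)) (h2 _ hz.1) z.2).symm

lemma CRel.clm_left (h : CRel l κ k f g A A') (L : F →L[ℝ] H) (hκ : ∀ᶠ i in l, 0 ≤ κ i) :
    CRel l κ k (fun i x => L (f i x)) (fun i x => L (g i x)) A A' := by
  refine ⟨h.left.mono fun i hi x hx => L.contDiff.contDiffAt.comp x (hi x hx),
    h.right.mono fun i hi x hx => L.contDiff.contDiffAt.comp x (hi x hx), ?_⟩
  induction k generalizing E F H with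
  | zero =>
    obtain ⟨C, hC⟩ := h.cr
    refine ⟨‖L‖ * max C 0, ?_⟩
    filter_upwards [hC, hκ] with i hi h0
    refine ⟨fun x hx => (L.le_opNorm _).trans ?_, fun x hx x' hx' => ?_⟩
    · gcongr
      exact (hi.1 x hx).trans (le_max_left _ _)
    · rw [← map_sub, mul_assoc]
      refine (L.le_opNorm _).trans ?_
      gcongr
      refine (hi.2 x hx x' hx').trans ?_
      gcongr
      exact le_max_left _ _
  | succ k ih =>
    intro M
    have aux : ∀ {f : E → F} {x : E}, 𝒞 (k + 1 : ℕ) f x → ∀ v : E,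
        (fun z => L.prodMap L (tmap f z)) =ᶠ[𝓝 (x, v)] tmap (fun y => L (f y)) := fun {f x} hf v =>
      ((tmap_comp_eventuallyEq (f := L) L.contDiff.contDiffAt hf v).trans
        (.of_forall fun z => by simp [tmap])).symm
    exact (ih (h.tangent M) (L.prodMap L)).congr (h.left.mono fun i hi z hz => aux (hi _ hz.1) z.2)
      (h.right.mono fun i hi z hz => aux (hi _ hz.1) z.2)

lemma CRel.prodMk {f' g' : ι → E → H} (h : CRel l κ k f g A A') (h' : CRel l κ k f' g' A A')
    (hκ : ∀ᶠ i in l, 0 ≤ κ i) :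
    CRel l κ k (fun i x => (f i x, f' i x)) (fun i x => (g i x, g' i x)) A A' := by
  refine ⟨by filter_upwards [h.left, h'.left] with i h1 h2 x hx using (h1 x hx).prodMk (h2 x hx),
    by filter_upwards [h.right, h'.right] with i h1 h2 x hx using (h1 x hx).prodMk (h2 x hx), ?_⟩
  induction k generalizing E F H with
  | zero =>
    obtain ⟨C, hC⟩ := h.cr
    obtain ⟨D, hD⟩ := h'.cr
    refine ⟨max C D, ?_⟩
    filter_upwards [hC, hD, hκ] with i h1 h2 h0
    refine ⟨fun x hx => ?_, fun x hx x' hx' => ?_⟩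
    · exact max_le_max (h1.1 x hx) (h2.1 x hx)
    · have h3 : 0 ≤ ‖x - x'‖ + κ i := by positivity
      rw [Prod.mk_sub_mk, max_mul_of_nonneg _ _ h3]
      exact max_le_max (h1.2 x hx x' hx') (h2.2 x hx x' hx')
  | succ k ih =>
    intro M
    let L : (F × F) × (H × H) →L[ℝ] (F × H) × (F × H) :=
      (((fst ℝ F F).prodMap (fst ℝ H H))).prod
        ((snd ℝ F F).prodMap (snd ℝ H H))
    have aux : ∀ {f : E → F} {g : E → H} {x : E}, 𝒞 (k + 1 : ℕ) f x →
        𝒞 (k + 1 : ℕ) g x → ∀ v : E,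
        (fun z => L (tmap f z, tmap g z)) =ᶠ[𝓝 (x, v)] tmap (fun y => (f y, g y)) := by
      intro f g x hf hg v
      filter_upwards [hf.eventually_differentiableAt.prod_inl_nhds v,
        hg.eventually_differentiableAt.prod_inl_nhds v] with z hz hz'
      simp [tmap, L, DifferentiableAt.fderiv_prodMk hz hz']
    have h2 : CRel l κ k _ _ _ _ :=
      ⟨((h.tangent M).left.and (h'.tangent M).left).mono fun i hi x hx =>
        (hi.1 x hx).prodMk (hi.2 x hx), ((h.tangent M).right.and (h'.tangent M).right).mono
          fun i hi x hx => (hi.1 x hx).prodMk (hi.2 x hx), ih (h.tangent M) (h'.tangent M)⟩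
    refine (h2.clm_left L hκ).cr.congr ?_ ?_
    · filter_upwards [h.left, h'.left] with i h1 h2 z hz using aux (h1 _ hz.1) (h2 _ hz.1) z.2
    · filter_upwards [h.right, h'.right] with i h1 h2 z hz using aux (h1 _ hz.1) (h2 _ hz.1) z.2

lemma CRel.add (h : CRel l κ k f g A A') (h' : CRel l κ k f' g' A A') (hκ : ∀ᶠ i in l, 0 ≤ κ i) :
    CRel l κ k (fun i x => f i x + f' i x) (fun i x => g i x + g' i x) A A' :=
  (h.prodMk h' hκ).clm_left (fst ℝ F F + snd ℝ F F) hκ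

lemma CRel.const (c : ι → F) {C : ℝ} (hc : ∀ᶠ i in l, ‖c i‖ ≤ C) (hκ : ∀ᶠ i in l, 0 ≤ κ i) :
    CRel l κ k (fun i _ => c i) (fun i _ => c i) A A' := by
  refine ⟨.of_forall fun i x _ => contDiffAt_const,
    .of_forall fun i x _ => contDiffAt_const, ?_⟩
  induction k generalizing E F with
  | zero =>
    refine ⟨max C 0, ?_⟩
    filter_upwards [hc, hκ] with i hi h0
    refine ⟨fun _ _ => hi.trans (le_max_left _ _), fun x _ x' _ => ?_⟩
    rw [sub_self, norm_zero]
    positivity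
  | succ k ih =>
    intro M
    have : ∀ i, tmap (fun _ : E => c i) = fun _ => (c i, 0) := fun i => by ext z <;> simp [tmap]
    simp only [this]
    exact ih (fun i => (c i, 0)) (by simpa using hc)

lemma CRel.clm (L : E →L[ℝ] F) {R : ℝ} (hR : ∀ᶠ i in l, A' i ⊆ closedBall 0 R)
    (hκ : ∀ᶠ i in l, 0 ≤ κ i) : CRel l κ k (fun _ => L) (fun _ => L) A A' := by
  refine ⟨.of_forall fun i x _ => L.contDiff.contDiffAt,
    .of_forall fun i x _ => L.contDiff.contDiffAt, ?_⟩
  induction k generalizing E F R with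
  | zero =>
    refine ⟨‖L‖ * max R 1, ?_⟩
    filter_upwards [hR, hκ] with i hi h0
    refine ⟨fun x hx => (L.le_opNorm _).trans ?_, fun x hx x' hx' => ?_⟩
    · gcongr
      exact (mem_closedBall_zero_iff.1 (hi hx)).trans (le_max_left _ _)
    · rw [← map_sub]
      refine (L.le_opNorm _).trans ?_
      rw [mul_assoc]
      gcongr
      have := mul_le_mul_of_nonneg_right (le_max_right R 1) (add_nonneg (norm_nonneg (x - x')) h0)
      linarith
  | succ k ih =>
    intro M
    have : tmap (L : E → F) = L.prodMap L := by ext z <;> simp [tmap]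
    simp only [this]
    exact ih (L.prodMap L) (hR.mono fun i hi => tset_subset_closedBall hi M)

lemma contDiffAt_infty_tmap {f : E → F} {x : E} (h : 𝒞 (⊤ : ℕ∞) f x) (v : E) :
    𝒞 (⊤ : ℕ∞) (tmap f) (x, v) := by
  have h2 : 𝒞 (⊤ : ℕ∞) (fderiv ℝ f) x := h.fderiv_right (by simp)
  exact (h.comp (x, v) contDiffAt_fst).prodMk
    ((ContDiffAt.comp (x, v) h2 contDiffAt_fst).clm_apply contDiffAt_snd)

lemma exists_lipschitzOnWith_of_contDiffAt {f : E → F} {K : Set E} (hK : IsCompact K)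
    (h : ∀ x ∈ K, 𝒞 1 f x) : ∃ C, LipschitzOnWith C f K := by
  refine LocallyLipschitzOn.exists_lipschitzOnWith_of_compact hK fun x hx => ?_
  obtain ⟨C, t, ht, h'⟩ := (h x hx).exists_lipschitzOnWith
  exact ⟨C, t, mem_nhdsWithin_of_mem_nhds ht, h'⟩

lemma CRel.fixed [FiniteDimensional ℝ E] {G : E → F} {K : Set E} (hK : IsCompact K)
    (hG : ∀ x ∈ K, 𝒞 (⊤ : ℕ∞) G x) (hA : ∀ᶠ i in l, A i ⊆ K)
    (hA' : ∀ᶠ i in l, A' i ⊆ K) (hκ : ∀ᶠ i in l, 0 ≤ κ i) :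
    CRel l κ k (fun _ => G) (fun _ => G) A A' := by
  refine ⟨hA.mono fun i hi x hx => (hG x (hi hx)).of_le (by exact_mod_cast le_top),
    hA'.mono fun i hi x hx => (hG x (hi hx)).of_le (by exact_mod_cast le_top), ?_⟩
  induction k generalizing E F with
  | zero =>
    obtain ⟨C, hC⟩ := exists_lipschitzOnWith_of_contDiffAt hK
      fun x hx => (hG x hx).of_le (by exact_mod_cast le_top)
    obtain ⟨D, hD⟩ := hK.exists_bound_of_continuousOn
      (fun x hx => (hG x hx).continuousAt.continuousWithinAt)
    refine ⟨max D C, ?_⟩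
    filter_upwards [hA, hA', hκ] with i h1 h2 h0
    refine ⟨fun x hx => (hD x (h2 hx)).trans (le_max_left _ _), fun x hx x' hx' => ?_⟩
    have h3 := hC.dist_le_mul x (h1 hx) x' (h2 hx')
    rw [dist_eq_norm, dist_eq_norm] at h3
    refine h3.trans ?_
    have : (0 : ℝ) ≤ max D C := C.2.trans (le_max_right _ _)
    gcongr
    · exact le_max_right _ _
    · linarith
  | succ k ih =>
    intro M
    have := FiniteDimensional.proper ℝ E
    exact ih (hK.prod (isCompact_closedBall (0 : E) M))
      (fun z hz => contDiffAt_infty_tmap (hG z.1 hz.1) z.2)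
      (hA.mono fun i hi => prod_mono hi subset_rfl) (hA'.mono fun i hi => prod_mono hi subset_rfl)

lemma CRel.smooth_comp [FiniteDimensional ℝ F] (h : CRel l κ k f g A A') {G : F → H} {K : Set F}
    (hK : IsCompact K) (hG : ∀ x ∈ K, 𝒞 (⊤ : ℕ∞) G x) (hκ : ∀ᶠ i in l, 0 ≤ κ i)
    (hκ1 : ∀ᶠ i in l, κ i ≤ 1) (hA : ∀ᶠ i in l, A i ⊆ A' i)
    (hm : ∀ᶠ i in l, MapsTo (f i) (A i) K) (hm' : ∀ᶠ i in l, MapsTo (g i) (A' i) K) :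
    CRel l κ k (fun i x => G (f i x)) (fun i x => G (g i x)) A A' :=
  (CRel.fixed (A := fun _ => K) (A' := fun _ => K) hK hG (.of_forall fun _ => subset_rfl)
    (.of_forall fun _ => subset_rfl) hκ).comp h hκ hκ1 hA hm hm'

lemma CRel.of_fderiv [FiniteDimensional ℝ E] [FiniteDimensional ℝ F] (h : CRel l κ k f g A A')
    (h' : CRel l κ k (fun i => fderiv ℝ (f i)) (fun i => fderiv ℝ (g i)) A A')
    (hf : ∀ᶠ i in l, ∀ x ∈ A i, 𝒞 (k + 1 : ℕ) (f i) x)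
    (hg : ∀ᶠ i in l, ∀ x ∈ A' i, 𝒞 (k + 1 : ℕ) (g i) x)
    {R : ℝ} (hR : ∀ᶠ i in l, A' i ⊆ closedBall 0 R) (hκ : ∀ᶠ i in l, 0 ≤ κ i)
    (hκ1 : ∀ᶠ i in l, κ i ≤ 1) (hA : ∀ᶠ i in l, A i ⊆ A' i) : CRel l κ (k + 1) f g A A' := by
  refine ⟨hf, hg, fun M => ?_⟩
  have hA2 : ∀ᶠ i in l, tset (A i) M ⊆ tset (A' i) M := hA.mono fun i hi => tset_mono hi le_rfl
  have hL : ∀ L : E × E →L[ℝ] E, CRel l κ k (fun _ => L) (fun _ => L) (fun i => tset (A i) M)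
      (fun i => tset (A' i) M) := fun L =>
    .clm L (hR.mono fun i hi => tset_subset_closedBall hi M) hκ
  have m : ∀ A : ι → Set E, ∀ᶠ i in l, MapsTo (fst ℝ E E) (tset (A i) M) (A i) :=
    fun A => .of_forall fun i z hz => hz.1
  have h3 := h.comp (hL (fst ℝ E E)) hκ hκ1 hA2 (m A) (m A')
  have h5 := (h'.comp (hL (fst ℝ E E)) hκ hκ1 hA2 (m A) (m A')).prodMk (hL (snd ℝ E E)) hκ
  obtain ⟨C, hC⟩ := h5.cr.exists_bound hκ hκ1 hA2
  have h6 := h5.smooth_comp (G := fun z : (E →L[ℝ] F) × E => z.1 z.2)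
    (isCompact_closedBall (0 : (E →L[ℝ] F) × E) C)
    (fun z _ => contDiffAt_fst.clm_apply contDiffAt_snd) hκ hκ1 hA2
    (hC.mono fun i hi z hz => mem_closedBall_zero_iff.2 (hi.1 z hz))
    (hC.mono fun i hi z hz => mem_closedBall_zero_iff.2 (hi.2 z hz))
  exact (h3.prodMk h6 hκ).cr

lemma norm_iteratedFDeriv_succ_sub (f g : E → F) (x y : E) (j : ℕ) :
    ‖iteratedFDeriv ℝ (j + 1) f x - iteratedFDeriv ℝ (j + 1) g y‖ =
      ‖iteratedFDeriv ℝ j (fderiv ℝ f) x - iteratedFDeriv ℝ j (fderiv ℝ g) y‖ := by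
  rw [iteratedFDeriv_succ_eq_comp_right, iteratedFDeriv_succ_eq_comp_right]
  simp only [comp_apply]
  exact (continuousMultilinearCurryRightEquiv' ℝ j E F).symm.dist_map _ _ |> fun h => by
    simpa only [dist_eq_norm] using h

lemma CRel.of_iteratedFDeriv [FiniteDimensional ℝ E] [FiniteDimensional ℝ F]
    (hf : ∀ᶠ i in l, ∀ x ∈ A i, 𝒞 k (f i) x)
    (hg : ∀ᶠ i in l, ∀ x ∈ A' i, 𝒞 k (g i) x) {C : ℝ}
    (h : ∀ j ≤ k, ∀ᶠ i in l, (∀ x ∈ A' i, ‖iteratedFDeriv ℝ j (g i) x‖ ≤ C) ∧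
      ∀ x ∈ A i, ∀ x' ∈ A' i,
        ‖iteratedFDeriv ℝ j (f i) x - iteratedFDeriv ℝ j (g i) x'‖ ≤ C * (‖x - x'‖ + κ i))
    {R : ℝ} (hR : ∀ᶠ i in l, A' i ⊆ closedBall 0 R) (hκ : ∀ᶠ i in l, 0 ≤ κ i)
    (hκ1 : ∀ᶠ i in l, κ i ≤ 1) (hA : ∀ᶠ i in l, A i ⊆ A' i) : CRel l κ k f g A A' := by
  induction k generalizing F with
  | zero =>
    refine ⟨hf, hg, C, (h 0 le_rfl).mono fun i hi => ⟨fun x hx => ?_, fun x hx x' hx' => ?_⟩⟩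
    · simpa using hi.1 x hx
    · have := hi.2 x hx x' hx'
      rw [iteratedFDeriv_zero_eq_comp, iteratedFDeriv_zero_eq_comp] at this
      simpa only [comp_apply, ← map_sub, LinearIsometryEquiv.norm_map] using this
  | succ k ih =>
    have hle : (k : WithTop ℕ∞) ≤ (k + 1 : ℕ) := by exact_mod_cast Nat.le_succ k
    refine CRel.of_fderiv (ih (hf.mono fun i hi x hx => (hi x hx).of_le hle)
        (hg.mono fun i hi x hx => (hi x hx).of_le hle) fun j hj => h j (hj.trans (Nat.le_succ k)))
      (ih (hf.mono fun i hi x hx => (hi x hx).fderiv_right (by norm_cast))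
        (hg.mono fun i hi x hx => (hi x hx).fderiv_right (by norm_cast)) fun j hj => ?_)
      hf hg hR hκ hκ1 hA
    refine (h (j + 1) (Nat.succ_le_succ hj)).mono fun i hi => ⟨fun x hx => ?_, fun x hx x' hx' =>
        ?_⟩
    · rw [norm_iteratedFDeriv_fderiv]
      exact hi.1 x hx
    · rw [← norm_iteratedFDeriv_succ_sub]
      exact hi.2 x hx x' hx'

lemma CRel.smul_index {c : ι → ℝ} (hc : ∀ᶠ i in l, 0 ≤ c i)
    (hf : ∀ᶠ i in l, ∀ x ∈ A i, 𝒞 k (f i) x)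
    (h : CR l κ k f f A A) :
    CRel l c k (fun i x => c i • f i x) (fun _ _ => 0) A A' := by
  refine ⟨hf.mono fun i hi x hx => contDiffAt_const.smul (hi x hx),
    .of_forall fun i x _ => contDiffAt_const, ?_⟩
  induction k generalizing E F with
  | zero =>
    obtain ⟨C, hC⟩ := h
    refine ⟨max C 0, ?_⟩
    filter_upwards [hC, hc] with i hi h0
    refine ⟨fun _ _ => by simp, fun x hx x' _ => ?_⟩
    rw [sub_zero, norm_smul, Real.norm_of_nonneg h0, mul_comm]
    have := hi.1 x hx
    have h1 := le_max_left C 0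
    have h2 := le_max_right C 0
    have h3 := norm_nonneg (x - x')
    nlinarith [norm_nonneg (f i x)]
  | succ k ih =>
    intro M
    refine (ih (hf.mono fun i hi z hz => (hi z.1 hz.1).tmap' z.2) (h M)).congr ?_ ?_
    · filter_upwards [hf] with i hi z hz
      filter_upwards [(hi z.1 hz.1).eventually_differentiableAt.prod_inl_nhds z.2] with y hy
      simp [tmap, fderiv_fun_const_smul hy]
    · exact .of_forall fun i z _ => .of_forall fun y => by
        simp [tmap, Prod.ext_iff]

lemma iteratedFDeriv_fderiv_apply {f : E → F} {x : E} {j : ℕ}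
    (hf : 𝒞 (j + 1 : ℕ) f x) (m : Fin j → E) (v : E) :
    iteratedFDeriv ℝ j (fderiv ℝ f) x m v =
      (iteratedFDeriv ℝ j (tmap f) (x, v) fun i => (m i, 0)).2 := by
  have h1 : 𝒞 j (fderiv ℝ f) x := hf.fderiv_right (by norm_cast)
  have h2 := (ContinuousLinearMap.apply ℝ F v).iteratedFDeriv_comp_left h1 (i := j) le_rfl
  have h3 := (snd ℝ F F).iteratedFDeriv_comp_left (hf.tmap' v) (i := j) le_rfl
  have h4 := DFunLike.congr_fun h2 m
  have h5 := DFunLike.congr_fun h3 fun i => (m i, 0)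
  simp only [ContinuousLinearMap.compContinuousMultilinearMap_coe, comp_apply,
    ContinuousLinearMap.apply_apply, ContinuousLinearMap.coe_snd'] at h4 h5
  rw [← h4, ← h5]
  obtain ⟨u, hu, hxu, hd⟩ : ∃ u : Set E, IsOpen u ∧ x ∈ u ∧
      ContDiffOn ℝ (j + 1 : ℕ) f u := by
    obtain ⟨u, hu, h⟩ := (hf.eventually (by simp)).exists_mem
    obtain ⟨w, hw, h1, h2⟩ := mem_nhds_iff.1 hu
    exact ⟨w, h1, h2, fun y hy => (h y (hw hy)).contDiffWithinAt⟩
  set G : E × E → F := (Prod.snd : F × F → F) ∘ tmap f with hG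
  have e1 : (⇑(ContinuousLinearMap.apply ℝ F v) ∘ fderiv ℝ f) =
      (fun z => G (z + ((0 : E), v))) ∘ (ContinuousLinearMap.inl ℝ E E) := by
    ext y
    simp [hG, tmap]
  have hGu : ContDiffOn ℝ j (fun z => G (z + ((0 : E), v))) (u ×ˢ univ) := by
    intro z hz
    have : 𝒞 j G (z + ((0 : E), v)) := by
      refine contDiffAt_snd.comp _ ?_
      exact ((hd.contDiffAt (hu.mem_nhds (by simpa using hz.1)) :
        𝒞 _ f (z + ((0 : E), v)).1)).tmap' _
    exact (this.comp z (contDiffAt_id.add contDiffAt_const)).contDiffWithinAt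
  have hp : (⇑(ContinuousLinearMap.inl ℝ E E)) ⁻¹' (u ×ˢ (univ : Set E)) = u := by ext; simp
  have hopen : IsOpen (u ×ˢ (univ : Set E)) := hu.prod isOpen_univ
  have h6 := (ContinuousLinearMap.inl ℝ E E).iteratedFDerivWithin_comp_right hGu hopen.uniqueDiffOn
    (hp.symm ▸ hu.uniqueDiffOn) (x := x) (by simpa using hxu) (i := j) le_rfl
  rw [hp, iteratedFDerivWithin_of_isOpen j hu hxu,
    iteratedFDerivWithin_of_isOpen j hopen (by simpa using hxu)] at h6
  rw [e1, h6, iteratedFDeriv_comp_add_right]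
  simp [hG]

lemma CRel.exists_iteratedFDeriv_sub_le (h : CRel l κ k f g A A') (hκ : ∀ᶠ i in l, 0 ≤ κ i)
    (hA : ∀ᶠ i in l, A i ⊆ A' i) : ∃ C, ∀ᶠ i in l, ∀ x ∈ A i, ∀ j ≤ k,
      ‖iteratedFDeriv ℝ j (f i) x - iteratedFDeriv ℝ j (g i) x‖ ≤ C * κ i := by
  induction k generalizing E F with
  | zero =>
    obtain ⟨C, hC⟩ := h.cr
    refine ⟨C, ?_⟩
    filter_upwards [hC, hA] with i hi hA x hx j hj
    obtain rfl := Nat.le_zero.1 hj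
    rw [iteratedFDeriv_zero_eq_comp, iteratedFDeriv_zero_eq_comp]
    simp only [comp_apply, ← map_sub, LinearIsometryEquiv.norm_map]
    simpa using hi.2 x hx x (hA hx)
  | succ k ih =>
    obtain ⟨C, hC⟩ := ih (h.of_le (Nat.le_succ k)) hA
    obtain ⟨D, hD⟩ := ih (h.tangent 1) (hA.mono fun i hi => tset_mono hi le_rfl)
    refine ⟨max C (max D 0), ?_⟩
    filter_upwards [hC, hD, hκ, h.left, h.right, hA] with i h1 h2 h0 hl hr hA x hx j hj
    rcases j with _ | j
    · exact (h1 x hx 0 (Nat.zero_le _)).trans (by gcongr; exact le_max_left _ _)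
    · have hj' : j ≤ k := Nat.le_of_succ_le_succ hj
      rw [norm_iteratedFDeriv_succ_sub]
      have hle : ((j + 1 : ℕ) : WithTop ℕ∞) ≤ (k + 1 : ℕ) := by exact_mod_cast hj
      have key : ‖iteratedFDeriv ℝ j (fderiv ℝ (f i)) x - iteratedFDeriv ℝ j (fderiv ℝ (g i)) x‖
          ≤ max D 0 * κ i := by
        refine ContinuousMultilinearMap.opNorm_le_bound (by positivity) fun m => ?_
        refine ContinuousLinearMap.opNorm_le_of_unit_norm (by positivity) fun v hv => ?_
        rw [_root_.sub_apply, _root_.sub_apply, iteratedFDeriv_fderiv_apply ((hl x hx).of_le hle),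
          iteratedFDeriv_fderiv_apply ((hr x (hA hx)).of_le hle), ← Prod.snd_sub,
          ← _root_.sub_apply]
        refine (norm_snd_le _).trans ((ContinuousMultilinearMap.le_opNorm _ _).trans ?_)
        have h3 := h2 (x, v) ⟨hx, by simp [hv]⟩ j hj'
        have h4 : ∏ a, ‖((m a, 0) : E × E)‖ = ∏ a, ‖m a‖ :=
          Finset.prod_congr rfl fun a _ => by simp [Prod.norm_def]
        rw [h4]
        refine mul_le_mul_of_nonneg_right (h3.trans ?_) (by positivity)
        gcongr
        exact le_max_left _ _
      exact key.trans (mul_le_mul_of_nonneg_right (le_max_right C (max D 0)) h0)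

end RelCalculus

/-! ### Ordinary differential equations on `[0, 1]` -/

section ODE

variable {E : Type} [NormedAddCommGroup E] [NormedSpace ℝ E]

/-- `M` is a primitive of the weight `m` on `[0, 1]`, of total mass at most `b`. -/
structure IsPrimitive (m M : ℝ → ℝ) (b : ℝ) : Prop where
  zero : M 0 = 0
  weight : ∀ s ∈ 𝕀, 0 ≤ m s ∧ HasDerivWithinAt M (m s) 𝕀 s ∧ 0 ≤ M s ∧ M s ≤ b

lemma isPrimitive_zero : IsPrimitive (fun _ => 0) (fun _ => 0) 0 :=
  ⟨rfl, fun _ _ => ⟨le_rfl, hasDerivWithinAt_const _ _ _, le_rfl, le_rfl⟩⟩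

/-- A Gronwall inequality with an integrable kernel `m`; the differential inequality is only needed
as long as `f` stays in the ball of radius `d`. -/
lemma norm_le_of_fence {f f' : ℝ → E} {m M : ℝ → ℝ} {C Mt d : ℝ} (hC : 0 ≤ C)
    (hf : ∀ s ∈ 𝕀, HasDerivWithinAt f (f' s) 𝕀 s) (hM : IsPrimitive m M Mt)
    (hb : ∀ s ∈ 𝕀, ‖f s‖ < d → ‖f' s‖ ≤ C * (1 + m s) * ‖f s‖ + C * m s)
    (hd : (‖f 0‖ + C * Mt) * exp (C * (1 + Mt)) < d) :
    ∀ s ∈ 𝕀, ‖f s‖ ≤ (‖f 0‖ + C * Mt) * exp (C * (1 + Mt)) := by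
  have hlim : Tendsto (fun η : ℝ => (‖f 0‖ + η + C * Mt) * exp (C * (1 + Mt) + η)) 𝓝₀
      (𝓝 ((‖f 0‖ + C * Mt) * exp (C * (1 + Mt)))) := by
    have : ContinuousAt (fun η : ℝ => (‖f 0‖ + η + C * Mt) * exp (C * (1 + Mt) + η)) 0 := by
      fun_prop
    simpa [ContinuousAt] using (this.tendsto).mono_left nhdsWithin_le_nhds
  intro s hs
  refine ge_of_tendsto hlim ?_
  filter_upwards [hlim.eventually_lt_const hd, self_mem_nhdsWithin] with η h1 h2
  rw [mem_Ioi] at h2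
  have hle : ∀ s ∈ 𝕀, (‖f 0‖ + η + C * M s) * exp (C * (s + M s) + η * s) ≤
      (‖f 0‖ + η + C * Mt) * exp (C * (1 + Mt) + η) := by
    intro s hs
    obtain ⟨-, -, h3, h4⟩ := hM.2 s hs
    have h5 : 0 ≤ Mt := h3.trans h4
    have := hs.1
    have := hs.2
    have h6 : η * s ≤ η := by nlinarith
    gcongr
  have hder : ∀ s ∈ 𝕀, HasDerivWithinAt
      (fun s => (‖f 0‖ + η + C * M s) * exp (C * (s + M s) + η * s))
      (C * m s * exp (C * (s + M s) + η * s) + (‖f 0‖ + η + C * M s) *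
        (exp (C * (s + M s) + η * s) * (C * (1 + m s) + η))) 𝕀 s := by
    intro s hs
    have h3 := (((hM.2 s hs).2.1.const_mul C).const_add (‖f 0‖ + η))
    have h4 := ((((hasDerivWithinAt_id s 𝕀).add (hM.2 s hs).2.1).const_mul C).add
      ((hasDerivWithinAt_id s 𝕀).const_mul η)).exp
    refine (h3.mul h4).congr_deriv ?_
    simp only [mul_one, Pi.add_apply, id]
  refine (image_norm_le_of_norm_deriv_right_lt_deriv_boundary' (a := 0) (b := 1) (f := f)
    (f' := f') (fun s hs => (hf s hs).continuousWithinAt) (fun s hs =>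
      (hf s (Ico_subset_Icc_self hs)).mono_of_mem_nhdsWithin (Icc_mem_nhdsGE_of_mem hs))
    (B := fun s => (‖f 0‖ + η + C * M s) * exp (C * (s + M s) + η * s)) ?_
    (fun s hs => (hder s hs).continuousWithinAt) (fun s hs =>
      (hder s (Ico_subset_Icc_self hs)).mono_of_mem_nhdsWithin (Icc_mem_nhdsGE_of_mem hs)) ?_
      hs).trans (hle s hs)
  · simp [hM.1, h2.le]
  · intro s hs heq
    have hs' := Ico_subset_Icc_self hs
    have h3 := hb s hs' (by rw [heq]; exact (hle s hs').trans_lt h1)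
    obtain ⟨h4, -, h5, -⟩ := hM.2 s hs'
    have h6 : 1 ≤ exp (C * (s + M s) + η * s) := by
      refine Real.one_le_exp ?_
      have := hs.1
      positivity
    have h7 : 0 < ‖f s‖ := by
      rw [heq]
      positivity
    have h8 : C * m s ≤ C * m s * exp (C * (s + M s) + η * s) :=
      le_mul_of_one_le_right (by positivity) h6
    calc ‖f' s‖ ≤ C * (1 + m s) * ‖f s‖ + C * m s := h3
      _ < C * m s * exp (C * (s + M s) + η * s) + ‖f s‖ * (C * (1 + m s) + η) := by
          nlinarith [mul_pos h7 h2]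
      _ = _ := by rw [heq]; ring

lemma exists_sol_of_lipschitz [CompleteSpace E] {X : ℝ → E → E} {K L : ℝ}
    (hL : ∀ s ∈ 𝕀, ∀ x, ‖X s x‖ ≤ L)
    (hK : ∀ s ∈ 𝕀, ∀ x y, ‖X s x - X s y‖ ≤ K * ‖x - y‖)
    (hc : ∀ x, ContinuousOn (fun s => X s x) 𝕀) (x₀ : E) :
    ∃ γ : ℝ → E, γ 0 = x₀ ∧ ∀ s ∈ 𝕀, HasDerivWithinAt γ (X s (γ s)) 𝕀 s := by
  have hL0 : 0 ≤ L := (norm_nonneg _).trans (hL 0 (by simp) 0)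
  have hP : IsPicardLindelof X (tmin := 0) (tmax := 1) ⟨0, by simp⟩ x₀ L.toNNReal 0 L.toNNReal
      K.toNNReal := by
    refine ⟨fun t ht => LipschitzOnWith.of_dist_le_mul fun x _ y _ => ?_, fun x _ => hc x,
      fun t ht x _ => ?_, ?_⟩
    · rw [dist_eq_norm, dist_eq_norm]
      refine (hK t ht x y).trans ?_
      gcongr
      exact Real.le_coe_toNNReal K
    · exact (hL t ht x).trans (Real.le_coe_toNNReal L)
    · simp
  exact hP.exists_eq_forall_mem_Icc_hasDerivWithinAt₀

lemma exists_sol_tube_of_lipschitz [CompleteSpace E] {X : ℝ → E → E} {c v : ℝ → E}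
    {m M : ℝ → ℝ} {C Mt d K L : ℝ} (hC : 0 ≤ C) (hd0 : 0 < d)
    (hL : ∀ s ∈ 𝕀, ∀ x, ‖x - c s‖ ≤ d → ‖X s x‖ ≤ L)
    (hK : ∀ s ∈ 𝕀, ∀ x y, ‖x - c s‖ ≤ d → ‖y - c s‖ ≤ d → ‖X s x - X s y‖ ≤ K * ‖x - y‖)
    (hX : ∀ s ∈ 𝕀, ∀ x, ‖x - c s‖ ≤ d → ContinuousWithinAt (fun s => X s x) 𝕀 s)
    (hcv : ∀ s ∈ 𝕀, HasDerivWithinAt c (v s) 𝕀 s) (hM : IsPrimitive m M Mt)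
    (hb : ∀ s ∈ 𝕀, ∀ x, ‖x - c s‖ ≤ d →
      ‖X s x - v s‖ ≤ C * (1 + m s) * ‖x - c s‖ + C * m s) {x₀ : E}
    (hd : (‖x₀ - c 0‖ + C * Mt) * exp (C * (1 + Mt)) < d / 2) :
    ∃ γ : ℝ → E, γ 0 = x₀ ∧ (∀ s ∈ 𝕀, HasDerivWithinAt γ (X s (γ s)) 𝕀 s) ∧
      ∀ s ∈ 𝕀, ‖γ s - c s‖ ≤ (‖x₀ - c 0‖ + C * Mt) * exp (C * (1 + Mt)) := by
  set χ : ℝ → E → ℝ := fun s x => max 0 (min 1 (2 - 2 / d * ‖x - c s‖)) with hχ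
  have hχ0 : ∀ s x, 0 ≤ χ s x := fun s x => le_max_left _ _
  have hχ1 : ∀ s x, χ s x ≤ 1 := fun s x => max_le zero_le_one (min_le_left _ _)
  have hχd : ∀ s x, d ≤ ‖x - c s‖ → χ s x = 0 := fun s x h => by
    have : 2 - 2 / d * ‖x - c s‖ ≤ 0 := by
      have : 2 / d * d ≤ 2 / d * ‖x - c s‖ := by gcongr
      rw [div_mul_cancel₀ _ hd0.ne'] at this
      linarith
    exact max_eq_left ((min_le_right _ _).trans this)
  have hχe : ∀ s x, ‖x - c s‖ ≤ d / 2 → χ s x = 1 := fun s x h => by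
    have : 1 ≤ 2 - 2 / d * ‖x - c s‖ := by
      have : 2 / d * ‖x - c s‖ ≤ 2 / d * (d / 2) := by gcongr
      rw [div_mul_div_cancel₀ hd0.ne'] at this
      linarith
    simp [hχ, min_eq_left this]
  have hχl : ∀ s x y, |χ s x - χ s y| ≤ 2 / d * ‖x - y‖ := fun s x y => by
    have h1 : ∀ a b : ℝ, |max 0 (min 1 a) - max 0 (min 1 b)| ≤ |a - b| := fun a b =>
      (abs_max_sub_max_le_max 0 (min 1 a) 0 (min 1 b)).trans (by
        have h2 := abs_min_sub_min_le_max 1 a 1 b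
        rw [sub_self, abs_zero, max_eq_right (abs_nonneg _)] at h2 ⊢
        exact h2)
    refine (h1 _ _).trans ?_
    have h2 : (2 - 2 / d * ‖x - c s‖) - (2 - 2 / d * ‖y - c s‖) =
      2 / d * (‖y - c s‖ - ‖x - c s‖) := by ring
    rw [h2, abs_mul, abs_of_pos (by positivity : 0 < 2 / d)]
    gcongr
    refine (abs_norm_sub_norm_le (y - c s) (x - c s)).trans ?_
    rw [sub_sub_sub_cancel_right, norm_sub_rev]
  have h0 : (0 : ℝ) ∈ 𝕀 := by simp
  have hL0 : 0 ≤ L := (norm_nonneg _).trans (hL 0 h0 (c 0) (by simpa using hd0.le))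
  have hcc : ContinuousOn c 𝕀 := fun s hs => (hcv s hs).continuousWithinAt
  obtain ⟨γ, hγ0, hγ⟩ := exists_sol_of_lipschitz (X := fun s x => χ s x • X s x) (L := L)
    (K := max K 0 + 2 / d * L) (fun s hs x => by
      rcases le_total ‖x - c s‖ d with h | h
      · rw [norm_smul, Real.norm_of_nonneg (hχ0 s x)]
        exact (mul_le_of_le_one_left (norm_nonneg _) (hχ1 s x)).trans (hL s hs x h)
      · simp [hχd s x h, hL0]) (fun s hs x y => by
      have key : ∀ x y, ‖x - c s‖ ≤ d →
          ‖χ s x • X s x - χ s y • X s y‖ ≤ (max K 0 + 2 / d * L) * ‖x - y‖ := by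
        intro x y hx
        rcases le_total ‖y - c s‖ d with h | h
        · have e : χ s x • X s x - χ s y • X s y =
              χ s y • (X s x - X s y) + (χ s x - χ s y) • X s x := by
            rw [smul_sub, sub_smul]; abel
          rw [e, add_mul]
          refine (norm_add_le _ _).trans (add_le_add ?_ ?_)
          · rw [norm_smul, Real.norm_of_nonneg (hχ0 s y)]
            refine (mul_le_of_le_one_left (norm_nonneg _) (hχ1 s y)).trans ?_
            refine (hK s hs x y hx h).trans ?_
            gcongr
            exact le_max_left _ _
          · rw [norm_smul, mul_right_comm]
            exact mul_le_mul (hχl s x y) (hL s hs x hx) (norm_nonneg _) (by positivity)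
        · have e : χ s x • X s x - χ s y • X s y = (χ s x - χ s y) • X s x := by simp [hχd s y h]
          rw [e, add_mul, norm_smul]
          have h1 := mul_le_mul (hχl s x y) (hL s hs x hx) (norm_nonneg _) (by positivity)
          have h2 := mul_nonneg (le_max_right K 0) (norm_nonneg (x - y))
          rw [Real.norm_eq_abs]
          linarith
      rcases le_total ‖x - c s‖ d with h | h
      · exact key x y h
      rcases le_total ‖y - c s‖ d with h' | h'
      · rw [norm_sub_rev, norm_sub_rev x]
        exact key y x h'
      · have := le_max_right K 0
        simpa [hχd s x h, hχd s y h'] using by positivity) (fun x s hs => by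
      have hχc : ContinuousWithinAt (fun s => χ s x) 𝕀 s := by
        have : ContinuousOn (fun s => χ s x) 𝕀 := by
          simp only [hχ]
          fun_prop
        exact this s hs
      rcases le_or_gt ‖x - c s‖ d with h | h
      · exact hχc.smul (hX s hs x h)
      · have : ∀ᶠ t in 𝓝[𝕀] s, d < ‖x - c t‖ :=
          ((continuousOn_const.sub hcc).norm s hs).eventually_const_lt h
        refine ContinuousWithinAt.congr_of_eventuallyEq (continuousWithinAt_const (b := (0 : E)))
          (this.mono fun t ht => by simp [hχd t x ht.le]) (by simp [hχd s x h.le])) x₀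
  have hclose := norm_le_of_fence (f := fun s => γ s - c s) (d := d / 2) hC
    (fun s hs => (hγ s hs).sub (hcv s hs)) hM (fun s hs h => by
      rw [hχe s _ h.le, one_smul]
      exact hb s hs _ (by linarith)) (by simpa [hγ0] using hd)
  simp only [hγ0] at hclose
  refine ⟨γ, hγ0, fun s hs => ?_, hclose⟩
  simpa [hχe s _ ((hclose s hs).trans hd.le)] using hγ s hs

/-- `γ` solves `γ' = X(s, γ)` on `[0, 1]`. -/
def IsSol (X : ℝ → E → E) (γ : ℝ → E) : Prop := ∀ s ∈ 𝕀, HasDerivWithinAt γ (X s (γ s)) 𝕀 s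

/-- The field `X` is jointly of class `C^k` along `γ`. -/
def RegAlong (k : ℕ) (X : ℝ → E → E) (γ : ℝ → E) : Prop :=
  ∀ s ∈ 𝕀, 𝒞 k (uncurry X) (s, γ s)

/-- `φ` is a flow of `X` on `[0, 1]`, near `x`. -/
def LocalFlow (X : ℝ → E → E) (φ : ℝ → E → E) (x : E) : Prop :=
  ∀ᶠ y in 𝓝 x, φ 0 y = y ∧ IsSol X (fun s => φ s y)

variable {X : ℝ → E → E} {γ : ℝ → E} {φ : ℝ → E → E} {x : E}

lemma IsSol.continuousOn (h : IsSol X γ) : ContinuousOn γ 𝕀 :=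
  fun s hs => (h s hs).continuousWithinAt

lemma RegAlong.of_le {k j : ℕ} (h : RegAlong k X γ) (hj : j ≤ k) : RegAlong j X γ :=
  fun s hs => (h s hs).of_le (by exact_mod_cast hj)

lemma hasFDerivAt_partial {s : ℝ} {y : E} (h : 𝒞 (1 : ℕ) (uncurry X) (s, y)) :
    HasFDerivAt (X s) ((fderiv ℝ (uncurry X) (s, y)).comp
      (ContinuousLinearMap.inr ℝ ℝ E)) y :=
  ((h.differentiableAt (by simp)).hasFDerivAt).comp y (hasFDerivAt_prodMk_right s y)

lemma continuousOn_fderiv_along (h : RegAlong 1 X γ) (hγ : ContinuousOn γ 𝕀) :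
    ContinuousOn (fun s => fderiv ℝ (X s) (γ s)) 𝕀 := by
  have h1 : ContinuousOn (fun s => (fderiv ℝ (uncurry X) (s, γ s)).comp
      (ContinuousLinearMap.inr ℝ ℝ E)) 𝕀 := by
    intro s hs
    have h2 : ContinuousAt (fderiv ℝ (uncurry X)) (s, γ s) :=
      ((h s hs).fderiv_right (m := 0) (by norm_cast)).continuousAt
    have h3 : ContinuousWithinAt (fun s => (s, γ s)) 𝕀 s :=
      continuousWithinAt_id.prodMk (hγ s hs)
    have h4 := ContinuousAt.comp_continuousWithinAt (f := fun s => (s, γ s)) h2 h3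
    exact ((ContinuousLinearMap.compL ℝ E (ℝ × E) E).flip
      (ContinuousLinearMap.inr ℝ ℝ E)).continuous.continuousAt.comp_continuousWithinAt h4
  exact h1.congr fun s hs => (hasFDerivAt_partial (h s hs)).fderiv

/-- Uniform strict differentiability of a `C^1` field along a compact curve. -/
lemma exists_tube_strict (h : RegAlong 1 X γ) (hγ : ContinuousOn γ 𝕀) {η : ℝ}
    (hη : 0 < η) : ∃ d > 0, ∀ s ∈ 𝕀, ∀ y, ‖y - γ s‖ ≤ d →
      𝒞 (1 : ℕ) (uncurry X) (s, y) ∧ ∀ y', ‖y' - γ s‖ ≤ d →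
        ‖X s y - X s y' - fderiv ℝ (X s) (γ s) (y - y')‖ ≤ η * ‖y - y'‖ := by
  refine (isCompact_Icc (a := (0 : ℝ)) (b := 1)).induction_on
    ⟨1, one_pos, by simp⟩ (fun S T hST ⟨d, hd, h⟩ => ⟨d, hd, fun s hs => h s (hST hs)⟩)
    (fun S T ⟨d, hd, h⟩ ⟨d', hd', h'⟩ => ⟨min d d', lt_min hd hd', fun s hs y hy => by
      rcases hs with hs | hs
      · have := h s hs y (hy.trans (min_le_left _ _))
        exact ⟨this.1, fun y' hy' => this.2 y' (hy'.trans (min_le_left _ _))⟩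
      · have := h' s hs y (hy.trans (min_le_right _ _))
        exact ⟨this.1, fun y' hy' => this.2 y' (hy'.trans (min_le_right _ _))⟩⟩) fun s₀ hs₀ => ?_
  have hc := h s₀ hs₀
  have h1 : HasStrictFDerivAt (uncurry X)
      (fderiv ℝ (uncurry X) (s₀, γ s₀)) (s₀, γ s₀) :=
    hc.hasStrictFDerivAt (by simp)
  have h2 := h1.isLittleO.def (half_pos hη)
  have h3 := hc.eventually (by simp)
  rw [nhds_prod_eq, Metric.nhds_basis_ball.prod_self.eventually_iff] at h2
  obtain ⟨ρ, hρ, h2⟩ := h2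
  obtain ⟨ρ', hρ', h3⟩ := Metric.eventually_nhds_iff_ball.1 h3
  set R := min ρ ρ'
  have hRpos : 0 < R := lt_min hρ hρ'
  have h4 := (continuousOn_fderiv_along h hγ) s₀ hs₀
  refine ⟨_, (h4.eventually (ball_mem_nhds _ (half_pos hη))).and
    (((hγ s₀ hs₀).eventually (ball_mem_nhds _ (half_pos hRpos))).and
      (nhdsWithin_le_nhds (ball_mem_nhds _ hRpos))), R / 4, by positivity,
    fun s ⟨g5, g6, g7⟩ y hy => ?_⟩
  have hmem : ∀ y, ‖y - γ s‖ ≤ R / 4 → dist ((s, y) : ℝ × E) (s₀, γ s₀) < R := fun y hy => by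
    rw [Prod.dist_eq, max_lt_iff]
    refine ⟨g7, ?_⟩
    have := dist_triangle y (γ s) (γ s₀)
    rw [dist_eq_norm y (γ s)] at this
    simp only
    linarith
  refine ⟨h3 _ ((hmem y hy).trans_le (min_le_right _ _)), fun y' hy' => ?_⟩
  have h8 := h2 (x := ((s, y), (s, y'))) ⟨(hmem y hy).trans_le (min_le_left _ _),
    (hmem y' hy').trans_le (min_le_left _ _)⟩
  simp only [Function.uncurry_apply_pair, Prod.mk_sub_mk, sub_self] at h8
  have h9 : fderiv ℝ (uncurry X) (s₀, γ s₀) (0, y - y') =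
      fderiv ℝ (X s₀) (γ s₀) (y - y') := by
    rw [(hasFDerivAt_partial hc).fderiv]
    simp
  have h10 : ‖((0, y - y') : ℝ × E)‖ = ‖y - y'‖ := by simp [Prod.norm_def]
  rw [h9, h10] at h8
  have h11 : ‖(fderiv ℝ (X s₀) (γ s₀) - fderiv ℝ (X s) (γ s)) (y - y')‖ ≤ η / 2 * ‖y - y'‖ := by
    refine (ContinuousLinearMap.le_opNorm _ _).trans ?_
    gcongr
    rw [← dist_eq_norm, dist_comm]
    exact g5.le
  have e : X s y - X s y' - fderiv ℝ (X s) (γ s) (y - y') =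
      (X s y - X s y' - fderiv ℝ (X s₀) (γ s₀) (y - y')) +
        (fderiv ℝ (X s₀) (γ s₀) - fderiv ℝ (X s) (γ s)) (y - y') := by
    simp only [_root_.sub_apply]
    abel
  rw [e]
  refine (norm_add_le _ _).trans ?_
  linarith

lemma exists_tube_lipschitz (h : RegAlong 1 X γ) (hγ : ContinuousOn γ 𝕀) :
    ∃ d > 0, ∃ C ≥ 0, (∀ s ∈ 𝕀, ∀ y, ‖y - γ s‖ ≤ d →
      𝒞 (1 : ℕ) (uncurry X) (s, y) ∧ ∀ y', ‖y' - γ s‖ ≤ d →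
        ‖X s y - X s y'‖ ≤ C * ‖y - y'‖) ∧ ∀ s ∈ 𝕀, ‖fderiv ℝ (X s) (γ s)‖ ≤ C := by
  obtain ⟨d, hd, h1⟩ := exists_tube_strict h hγ one_pos
  obtain ⟨C, hC⟩ := isCompact_Icc.exists_bound_of_continuousOn (continuousOn_fderiv_along h hγ)
  have hC0 : 0 ≤ C := (norm_nonneg _).trans (hC 0 (by simp))
  refine ⟨d, hd, C + 1, by positivity, fun s hs y hy => ⟨(h1 s hs y hy).1, fun y' hy' => ?_⟩,
    fun s hs => (hC s hs).trans (by linarith)⟩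
  have h2 := (h1 s hs y hy).2 y' hy'
  have h3 := (ContinuousLinearMap.le_opNorm (fderiv ℝ (X s) (γ s)) (y - y')).trans
    (mul_le_mul_of_nonneg_right (hC s hs) (norm_nonneg _))
  have h4 := norm_add_le (X s y - X s y' - fderiv ℝ (X s) (γ s) (y - y'))
    (fderiv ℝ (X s) (γ s) (y - y'))
  rw [sub_add_cancel] at h4
  linarith

lemma IsSol.dist_le {γ' : ℝ → E} {d C : ℝ} (h : IsSol X γ) (h' : IsSol X γ') (hC : 0 ≤ C)
    (hb : ∀ s ∈ 𝕀, ‖γ' s - γ s‖ ≤ d → ‖X s (γ' s) - X s (γ s)‖ ≤ C * ‖γ' s - γ s‖)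
    (hd : ‖γ' 0 - γ 0‖ * exp C < d) :
    ∀ s ∈ 𝕀, ‖γ' s - γ s‖ ≤ ‖γ' 0 - γ 0‖ * exp C := by
  have := norm_le_of_fence (f := fun s => γ' s - γ s) (d := d) hC
    (fun s hs => (h' s hs).sub (h s hs)) isPrimitive_zero
    (fun s hs h1 => by simpa using hb s hs h1.le) (by simpa using hd)
  simpa using this

lemma IsSol.eqOn {γ' : ℝ → E} (h : IsSol X γ) (hr : RegAlong 1 X γ) (h' : IsSol X γ')
    (h0 : γ' 0 = γ 0) : EqOn γ' γ 𝕀 := by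
  obtain ⟨d, hd, C, hC, h1, -⟩ := exists_tube_lipschitz hr h.continuousOn
  intro s hs
  have := h.dist_le h' (d := d) hC (fun s hs hle => (h1 s hs _ hle).2 _ (by simpa using hd.le))
    (by simpa [h0] using hd) s hs
  simpa [h0, sub_eq_zero] using this

omit [NormedSpace ℝ E] in
lemma eventually_norm_sub_mul_lt (x : E) (c : ℝ) {d : ℝ} (hd : 0 < d) :
    ∀ᶠ y in 𝓝 x, ‖y - x‖ * c < d := by
  have := (tendsto_norm_sub_self x).mul_const c
  exact this.eventually_lt_const (by simpa using hd)

end ODE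

section ODESmooth

variable {E : Type} [NormedAddCommGroup E] [NormedSpace ℝ E]
  {X : ℝ → E → E} {γ : ℝ → E} {φ : ℝ → E → E} {x : E}

lemma LocalFlow.isSol (h : LocalFlow X φ x) : IsSol X (fun s => φ s x) := h.self_of_nhds.2

lemma LocalFlow.apply_zero (h : LocalFlow X φ x) : φ 0 x = x := h.self_of_nhds.1

lemma LocalFlow.exists_lipschitz (h : LocalFlow X φ x) (hr : RegAlong 1 X (fun s => φ s x)) :
    ∃ C ≥ 0, (∀ s ∈ 𝕀, ‖fderiv ℝ (X s) (φ s x)‖ ≤ C) ∧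
      ∀ᶠ p in 𝓝 x ×ˢ 𝓝 x, RegAlong 1 X (fun s => φ s p.1) ∧
        ∀ s ∈ 𝕀, ‖φ s p.1 - φ s p.2‖ ≤ ‖p.1 - p.2‖ * exp C := by
  obtain ⟨d, hd, C, hC, h1, h2⟩ := exists_tube_lipschitz hr h.isSol.continuousOn
  refine ⟨C, hC, h2, ?_⟩
  have hev : ∀ᶠ y in 𝓝 x, φ 0 y = y ∧ IsSol X (fun s => φ s y) ∧ ∀ s ∈ 𝕀, ‖φ s y - φ s x‖ ≤ d := by
    filter_upwards [h, eventually_norm_sub_mul_lt x (exp C) hd] with y hy hy'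
    refine ⟨hy.1, hy.2, fun s hs => ?_⟩
    have h4 : ‖φ 0 y - φ 0 x‖ * exp C < d := by rwa [hy.1, h.apply_zero]
    exact (h.isSol.dist_le (γ' := fun s => φ s y) (d := d) hy.2 hC (fun s hs hle =>
      (h1 s hs _ hle).2 _ (by simpa using hd.le)) h4 s hs).trans h4.le
  filter_upwards [hev.prod_mk hev] with p hp
  obtain ⟨⟨a1, a2, a3⟩, b1, b2, b3⟩ := hp
  refine ⟨fun s hs => (h1 s hs _ (a3 s hs)).1, fun s hs => ?_⟩
  have := b2.dist_le (γ' := fun s => φ s p.1) (d := ‖p.1 - p.2‖ * exp C + 1) a2 hC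
    (fun s hs _ => (h1 s hs _ (a3 s hs)).2 _ (b3 s hs)) (by rw [a1, b1]; linarith) s hs
  rwa [a1, b1] at this

lemma LocalFlow.exists_strict [CompleteSpace E] (h : LocalFlow X φ x)
    (hr : RegAlong 1 X (fun s => φ s x)) : ∃ Φ : ℝ → E →L[ℝ] E, (∀ s ∈ 𝕀,
        HasDerivWithinAt Φ ((fderiv ℝ (X s) (φ s x)).comp (Φ s)) 𝕀 s) ∧
      ∀ s ∈ 𝕀, HasStrictFDerivAt (φ s) (Φ s) x := by
  obtain ⟨C, hC, hA, hev⟩ := h.exists_lipschitz hr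
  have hAc := continuousOn_fderiv_along hr h.isSol.continuousOn
  set A := fun s => fderiv ℝ (X s) (φ s x) with hAdef
  set d : ℝ := 2 * (‖ContinuousLinearMap.id ℝ E‖ * exp C + 1) with hd
  have hd0 : 0 < d := by positivity
  obtain ⟨Φ, hΦ0, hΦ, -⟩ := exists_sol_tube_of_lipschitz (E := E →L[ℝ] E)
    (X := fun s Ψ => (A s).comp Ψ) (c := fun _ => 0) (v := fun _ => 0) (d := d)
    (K := C) (L := C * d) hC hd0
    (fun s hs Ψ hΨ => by
      refine (ContinuousLinearMap.opNorm_comp_le _ _).trans ?_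
      rw [sub_zero] at hΨ
      exact mul_le_mul (hA s hs) hΨ (norm_nonneg _) hC)
    (fun s hs Ψ Ψ' _ _ => by
      rw [← ContinuousLinearMap.comp_sub]
      refine (ContinuousLinearMap.opNorm_comp_le _ _).trans ?_
      gcongr
      exact hA s hs)
    (fun s hs Ψ _ => (((ContinuousLinearMap.compL ℝ E E E).flip
      Ψ).continuous.continuousAt.comp_continuousWithinAt (hAc s hs)))
    (fun s _ => hasDerivWithinAt_const _ _ _) isPrimitive_zero (fun s hs Ψ _ => by
      simp only [sub_zero, add_zero, mul_one, mul_zero]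
      refine (ContinuousLinearMap.opNorm_comp_le _ _).trans ?_
      gcongr
      exact hA s hs) (x₀ := ContinuousLinearMap.id ℝ E) (by simp [hd])
  refine ⟨Φ, hΦ, fun s hs => .of_isLittleO (Asymptotics.isLittleO_iff.2 fun c hc => ?_)⟩
  set C₁ := max C 1 with hC₁
  have hC₁0 : 0 < C₁ := lt_max_of_lt_right one_pos
  set η := c / (C₁ * exp (2 * C₁) * exp C) with hη
  have hη0 : 0 < η := by positivity
  obtain ⟨d₂, hd₂, h1⟩ := exists_tube_strict hr h.isSol.continuousOn hη0
  have hsmall : ∀ᶠ p in 𝓝 x ×ˢ 𝓝 x, η * (‖p.1 - p.2‖ * exp C) < 1 := by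
    rw [← nhds_prod_eq]
    have : ContinuousAt (fun p : E × E => η * (‖p.1 - p.2‖ * exp C)) (x, x) := by fun_prop
    exact this.eventually_lt_const (by simp)
  have hnear : ∀ᶠ y in 𝓝 x, φ 0 y = y ∧ IsSol X (fun s => φ s y) ∧
      ∀ s ∈ 𝕀, ‖φ s y - φ s x‖ ≤ d₂ := by
    filter_upwards [h, eventually_norm_sub_mul_lt x (exp C) hd₂, hev.curry] with y hy hy' hy''
    exact ⟨hy.1, hy.2, fun s hs => (hy''.self_of_nhds.2 s hs).trans hy'.le⟩
  rw [nhds_prod_eq]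
  filter_upwards [hev, hsmall, hnear.prod_mk hnear] with p hp hps hpn
  obtain ⟨⟨a1, a2, a3⟩, b1, b2, b3⟩ := hpn
  set μ := η * (‖p.1 - p.2‖ * exp C) with hμ
  have hμ0 : 0 ≤ μ := by positivity
  have key := norm_le_of_fence (f := fun s => φ s p.1 - φ s p.2 - Φ s (p.1 - p.2))
    (m := fun _ => μ) (M := fun s => μ * s) (C := C₁) hC₁0.le
    (fun s hs => ((a2 s hs).sub (b2 s hs)).sub ((hΦ s hs).clm_apply
      (hasDerivWithinAt_const s _ (p.1 - p.2))))
    ⟨mul_zero μ, fun s hs => ⟨hμ0, by simpa using (hasDerivWithinAt_id s 𝕀).const_mul μ,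
      mul_nonneg hμ0 hs.1, mul_le_of_le_one_right hμ0 hs.2⟩⟩
    (fun t ht _ => by
      have e1 : X t (φ t p.1) - X t (φ t p.2) - (((A t).comp (Φ t)) (p.1 - p.2) + (Φ t) 0) =
          (X t (φ t p.1) - X t (φ t p.2) - A t (φ t p.1 - φ t p.2)) +
            A t (φ t p.1 - φ t p.2 - Φ t (p.1 - p.2)) := by
        simp only [map_sub, map_zero, add_zero, ContinuousLinearMap.comp_apply]
        abel
      rw [e1]
      refine (norm_add_le _ _).trans ?_
      have e2 := (h1 t ht _ (a3 t ht)).2 _ (b3 t ht)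
      have e3 := mul_le_mul_of_nonneg_left (hp.2 t ht) hη0.le
      have e4 := (A t).le_opNorm (φ t p.1 - φ t p.2 - Φ t (p.1 - p.2))
      have e5 := mul_le_mul_of_nonneg_right (hA t ht)
        (norm_nonneg (φ t p.1 - φ t p.2 - Φ t (p.1 - p.2)))
      have e6 : 1 ≤ C₁ := le_max_right _ _
      have e7 : C ≤ C₁ := le_max_left _ _
      have e8 := norm_nonneg (φ t p.1 - φ t p.2 - Φ t (p.1 - p.2))
      have e9 : μ ≤ C₁ * μ := le_mul_of_one_le_left hμ0 e6
      have e10 := mul_le_mul_of_nonneg_right e7 e8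
      have e11 : 0 ≤ C₁ * μ * ‖φ t p.1 - φ t p.2 - Φ t (p.1 - p.2)‖ := by positivity
      linarith) (lt_add_one _) s hs
  refine key.trans ?_
  have h0 : φ 0 p.1 - φ 0 p.2 - Φ 0 (p.1 - p.2) = 0 := by simp [a1, b1, hΦ0]
  rw [h0, norm_zero, zero_add]
  calc C₁ * μ * exp (C₁ * (1 + μ)) ≤ C₁ * μ * exp (2 * C₁) := by
        exact mul_le_mul_of_nonneg_left (Real.exp_le_exp.2 (by nlinarith)) (by positivity)
    _ = c * ‖p.1 - p.2‖ := by
        rw [hμ, hη]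
        field_simp

lemma LocalFlow.eventually_regAlong (h : LocalFlow X φ x) (hr : RegAlong 1 X (fun s => φ s x)) :
    ∀ᶠ y in 𝓝 x, LocalFlow X φ y ∧ RegAlong 1 X (fun s => φ s y) := by
  obtain ⟨C, -, -, hev⟩ := h.exists_lipschitz hr
  filter_upwards [eventually_eventually_nhds.2 h, hev.curry] with y hy hy'
  exact ⟨hy, hy'.self_of_nhds.1⟩

lemma HasStrictFDerivAt.continuousAt_fderiv {F : Type} [NormedAddCommGroup F] [NormedSpace ℝ F]
    {f : E → F} {f' : E →L[ℝ] F} (h : HasStrictFDerivAt f f' x)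
    (hd : ∀ᶠ y in 𝓝 x, DifferentiableAt ℝ f y) : ContinuousAt (fderiv ℝ f) x := by
  rw [ContinuousAt, h.hasFDerivAt.fderiv, Metric.tendsto_nhds]
  intro ε hε
  have h1 := h.isLittleO.def (half_pos hε)
  rw [nhds_prod_eq, Metric.nhds_basis_ball.prod_self.eventually_iff] at h1
  obtain ⟨ρ, hρ, h1⟩ := h1
  filter_upwards [hd, ball_mem_nhds x hρ] with y hy hyρ
  have h2 : HasFDerivAt (fun z => f z - f' z) (fderiv ℝ f y - f') y :=
    hy.hasFDerivAt.sub f'.hasFDerivAt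
  have h3 : LipschitzOnWith (ε / 2).toNNReal (fun z => f z - f' z) (ball x ρ) :=
    LipschitzOnWith.of_dist_le_mul fun a ha b hb => by
      rw [dist_eq_norm, dist_eq_norm, Real.coe_toNNReal _ (half_pos hε).le]
      have := h1 (x := (a, b)) ⟨ha, hb⟩
      refine le_trans (le_of_eq ?_) this
      simp only [map_sub]
      congr 1
      abel
  have h4 := h2.le_of_lipschitzOn (isOpen_ball.mem_nhds hyρ) h3
  rw [Real.coe_toNNReal _ (half_pos hε).le] at h4
  rw [dist_eq_norm]
  linarith

lemma LocalFlow.contDiffAt_one [CompleteSpace E] (h : LocalFlow X φ x)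
    (hr : RegAlong 1 X (fun s => φ s x)) {s : ℝ} (hs : s ∈ 𝕀) :
    𝒞 (1 : ℕ) (φ s) x := by
  have h1 : ∀ᶠ y in 𝓝 x, DifferentiableAt ℝ (φ s) y ∧
      ∃ f' : E →L[ℝ] E, HasStrictFDerivAt (φ s) f' y := by
    filter_upwards [h.eventually_regAlong hr] with y hy
    obtain ⟨Φ, -, hΦ⟩ := hy.1.exists_strict hy.2
    exact ⟨(hΦ s hs).differentiableAt, _, hΦ s hs⟩
  have h2 : ∀ᶠ y in 𝓝 x, DifferentiableAt ℝ (φ s) y ∧ ContinuousAt (fderiv ℝ (φ s)) y := by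
    filter_upwards [eventually_eventually_nhds.2 h1] with y hy
    obtain ⟨h3, f', h4⟩ := hy.self_of_nhds
    exact ⟨h3, h4.continuousAt_fderiv (hy.mono fun z hz => hz.1)⟩
  rw [Nat.cast_one, contDiffAt_one_iff]
  exact ⟨fderiv ℝ (φ s), _, h2, fun y hy => hy.2.continuousWithinAt, fun y hy => hy.1.hasFDerivAt⟩

lemma LocalFlow.tangent [CompleteSpace E] (h : LocalFlow X φ x)
    (hr : RegAlong 1 X (fun s => φ s x)) (v : E) :
    LocalFlow (fun s => tmap (X s)) (fun s => tmap (φ s)) (x, v) := by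
  filter_upwards [(h.eventually_regAlong hr).prod_inl_nhds v] with z hz
  obtain ⟨Φ, hΦ, hΦ'⟩ := hz.1.exists_strict hz.2
  refine ⟨?_, fun s hs => ?_⟩
  · have h2 : φ 0 =ᶠ[𝓝 z.1] id := hz.1.mono fun y hy => hy.1
    simp [tmap, h2.eq_of_nhds, h2.fderiv_eq]
  · have h3 := (hz.1.isSol s hs).prodMk ((hΦ s hs).clm_apply (hasDerivWithinAt_const s 𝕀 z.2))
    refine (h3.congr (fun t ht => ?_) ?_).congr_deriv ?_
    · simp [tmap, (hΦ' t ht).hasFDerivAt.fderiv]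
    · simp [tmap, (hΦ' s hs).hasFDerivAt.fderiv]
    · simp [tmap, (hΦ' s hs).hasFDerivAt.fderiv]

lemma RegAlong.tangent {k : ℕ} (h : RegAlong (k + 1) X γ) (w : ℝ → E) :
    RegAlong k (fun s => tmap (X s)) (fun s => (γ s, w s)) := by
  intro s hs
  have h1 := h s hs
  have h2 : 𝒞 k (fderiv ℝ (uncurry X)) (s, γ s) :=
    h1.fderiv_right (by norm_cast)
  have hp : 𝒞 k (fun z : ℝ × E × E => (z.1, z.2.1)) (s, γ s, w s) :=
    contDiffAt_fst.prodMk (contDiffAt_fst.comp _ contDiffAt_snd)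
  have h3 : 𝒞 k (fun z : ℝ × E × E => (uncurry X (z.1, z.2.1),
      fderiv ℝ (uncurry X) (z.1, z.2.1) (0, z.2.2))) (s, γ s, w s) := by
    refine ContDiffAt.prodMk ?_ ?_
    · exact ContDiffAt.comp (s, γ s, w s) (h1.of_le (by exact_mod_cast Nat.le_succ k)) hp
    · exact (ContDiffAt.comp (s, γ s, w s) h2 hp).clm_apply
        (contDiffAt_const.prodMk (contDiffAt_snd.comp _ contDiffAt_snd))
  refine h3.congr_of_eventuallyEq ?_
  have h4 : ∀ᶠ z in 𝓝 (s, γ s), 𝒞 (1 : ℕ) (uncurry X) z :=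
    (h1.of_le (by exact_mod_cast Nat.succ_le_succ (Nat.zero_le k))).eventually (by simp)
  filter_upwards [hp.continuousAt.eventually h4] with z hz
  simp [tmap, uncurry, (hasFDerivAt_partial hz).fderiv]

lemma contDiffAt_clm_apply {D F G : Type} [NormedAddCommGroup D] [NormedSpace ℝ D]
    [NormedAddCommGroup F] [NormedSpace ℝ F] [NormedAddCommGroup G] [NormedSpace ℝ G]
    [FiniteDimensional ℝ F] {n : WithTop ℕ∞} {f : D → F →L[ℝ] G} {x : D}
    (h : ∀ y, 𝒞 n (fun x => f x y) x) : 𝒞 n f x := by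
  have hd : Module.finrank ℝ F = Module.finrank ℝ (Fin (Module.finrank ℝ F) → ℝ) :=
    (Module.finrank_fin_fun ℝ).symm
  let e₁ := ContinuousLinearEquiv.ofFinrankEq hd
  let e₂ := (e₁.arrowCongr (1 : G ≃L[ℝ] G)).trans
    (ContinuousLinearEquiv.piRing (Fin (Module.finrank ℝ F)))
  rw [← Function.id_comp f, ← e₂.symm_comp_self]
  exact e₂.symm.contDiff.contDiffAt.comp x (contDiffAt_pi.mpr fun i => h _)

lemma LocalFlow.contDiffAt [FiniteDimensional ℝ E] {k : ℕ} (h : LocalFlow X φ x)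
    (hr : RegAlong (k + 1) X (fun s => φ s x)) {s : ℝ} (hs : s ∈ 𝕀) :
    𝒞 (k + 1 : ℕ) (φ s) x := by
  induction k generalizing E with
  | zero =>
    have := FiniteDimensional.complete ℝ E
    exact h.contDiffAt_one hr hs
  | succ k ih =>
    have := FiniteDimensional.complete ℝ E
    have hr1 : RegAlong 1 X (fun s => φ s x) := hr.of_le (by omega)
    have h1 : 𝒞 (k + 1 : ℕ) (fderiv ℝ (φ s)) x := by
      refine contDiffAt_clm_apply fun v => ?_
      have h2 := ih (h.tangent hr1 v) (hr.tangent fun s => fderiv ℝ (φ s) x v)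
      exact (contDiffAt_snd.comp x (ContDiffAt.comp x h2 (contDiffAt_id.prodMk contDiffAt_const)) :
        𝒞 (k + 1 : ℕ) (fun y => (tmap (φ s) (y, v)).2) x)
    have h2 := ((h.contDiffAt_one hr1 hs).eventually (by simp))
    rw [Nat.cast_succ, contDiffAt_succ_iff_hasFDerivAt]
    exact ⟨fderiv ℝ (φ s), ⟨_, h2, fun y hy =>
      ((show 𝒞 (1 : ℕ) (φ s) y from hy).differentiableAt (by simp)).hasFDerivAt⟩, h1⟩

/-- The tangent maps of `φ` up to order `k` are flows of the tangent maps of the field. -/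
def FlowJet : (k : ℕ) → {E : Type} → [NormedAddCommGroup E] → [NormedSpace ℝ E] →
    (X φ : ℝ → E → E) → (x : E) → Prop
  | 0, _, _, _, X, φ, x => LocalFlow X φ x
  | k + 1, _, _, _, X, φ, x => LocalFlow X φ x ∧
      ∀ v, FlowJet k (fun s => tmap (X s)) (fun s => tmap (φ s)) (x, v)

lemma FlowJet.localFlow {k : ℕ} (h : FlowJet k X φ x) : LocalFlow X φ x := by
  cases k with
  | zero => exact h
  | succ k => exact h.1

lemma LocalFlow.flowJet [CompleteSpace E] {k : ℕ} (h : LocalFlow X φ x)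
    (hr : RegAlong k X (fun s => φ s x)) : FlowJet k X φ x := by
  induction k generalizing E with
  | zero => exact h
  | succ k ih => exact ⟨h, fun v => ih (h.tangent (hr.of_le (by omega)) v) (hr.tangent _)⟩

/-- `m` is a weight on `[0, 1]` with primitive `M`, of total mass at most `b κ`. -/
def IsWeight {ι : Type} (l : Filter ι) (κ : ι → ℝ) (m : ι × ℝ → ℝ) (M : ι → ℝ → ℝ) (b : ℝ) : Prop :=
  ∀ᶠ i in l, IsPrimitive (fun s => m (i, s)) (M i) (b * κ i)

lemma isWeight_const {ι : Type} {l : Filter ι} {κ : ι → ℝ} (h : ∀ᶠ i in l, 0 ≤ κ i) :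
    IsWeight l κ (fun i => κ i.1) (fun i s => s * κ i) 1 := by
  filter_upwards [h] with i hi
  exact ⟨by simp, fun s hs => ⟨hi, by simpa using (hasDerivWithinAt_id s 𝕀).mul_const (κ i),
    mul_nonneg hs.1 hi, mul_le_mul_of_nonneg_right hs.2 hi⟩⟩

/-- Closeness of flows, from closeness of the fields up to an integrable error `m`. -/
lemma CR.flow {ι : Type} {l : Filter ι} {κ : ι → ℝ} {m : ι × ℝ → ℝ} {M : ι → ℝ → ℝ}
    {k : ℕ} {X Y φ ψ : ι → ℝ → E → E} {A A' : ι → Set E} {B B' : ι × ℝ → Set E} {c R : ℝ}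
    (hXY : CR (l ×ˢ 𝓟 𝕀) m k (fun j => X j.1 j.2) (fun j => Y j.1 j.2) B B')
    (hB : ∀ᶠ i in l, ∀ s ∈ 𝕀, B (i, s) ⊆ B' (i, s))
    (hR : ∀ᶠ i in l, ∀ s ∈ 𝕀, B' (i, s) ⊆ closedBall 0 R)
    (hφ : ∀ᶠ i in l, ∀ x ∈ A i, FlowJet k (X i) (φ i) x ∧ ∀ s ∈ 𝕀, φ i s x ∈ B (i, s))
    (hψ : ∀ᶠ i in l, ∀ x ∈ A' i, FlowJet k (Y i) (ψ i) x ∧ ∀ s ∈ 𝕀, ψ i s x ∈ B' (i, s))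
    (hM : IsWeight l κ m M c)
    (hc : 0 ≤ c) (hκ : ∀ᶠ i in l, 0 ≤ κ i) (hκ1 : ∀ᶠ i in l, κ i ≤ 1) :
    CR l κ k (fun i => φ i 1) (fun i => ψ i 1) A A' := by
  have h01 : (1 : ℝ) ∈ 𝕀 := by simp
  induction k generalizing E R with
  | zero =>
    obtain ⟨C, hC⟩ := hXY
    rw [eventually_prod_principal_iff] at hC
    set C₀ := max C 0 with hC₀
    have hC₀0 : 0 ≤ C₀ := le_max_right _ _
    refine ⟨max R ((1 + C₀ * c) * exp (C₀ * (1 + c))), ?_⟩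
    filter_upwards [hC, hR, hφ, hψ, hM, hκ, hκ1] with i h1 h2 h3 h4 h5 h6 h7
    refine ⟨fun x hx => ?_, fun x hx x' hx' => ?_⟩
    · exact (mem_closedBall_zero_iff.1 (h2 1 h01 ((h4 x hx).2 1 h01))).trans (le_max_left _ _)
    · have hf0 : φ i 0 x - ψ i 0 x' = x - x' := by
        rw [(h3 x hx).1.localFlow.apply_zero, (h4 x' hx').1.localFlow.apply_zero]
      have key := norm_le_of_fence (f := fun s => φ i s x - ψ i s x') (C := C₀) hC₀0
        (fun s hs => ((h3 x hx).1.localFlow.isSol s hs).sub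
          ((h4 x' hx').1.localFlow.isSol s hs)) h5 (fun s hs _ => by
          have a1 := (h1 s hs).2 _ ((h3 x hx).2 s hs) _ ((h4 x' hx').2 s hs)
          have a2 := (h5.2 s hs).1
          have a3 := norm_nonneg (φ i s x - ψ i s x')
          have a4 : C * (‖φ i s x - ψ i s x'‖ + m (i, s)) ≤
            C₀ * (‖φ i s x - ψ i s x'‖ + m (i, s)) := by gcongr; exact le_max_left _ _
          have a5 : 0 ≤ C₀ * m (i, s) * ‖φ i s x - ψ i s x'‖ := by positivity
          linarith) (lt_add_one _) 1 h01
      simp only [hf0] at key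
      refine key.trans ?_
      calc (‖x - x'‖ + C₀ * (c * κ i)) * exp (C₀ * (1 + c * κ i))
          ≤ ((1 + C₀ * c) * (‖x - x'‖ + κ i)) * exp (C₀ * (1 + c)) := by
            gcongr
            · have b1 := norm_nonneg (x - x')
              have b2 : 0 ≤ C₀ * c * ‖x - x'‖ := by positivity
              nlinarith
            · exact mul_le_of_le_one_right hc h7
        _ = (1 + C₀ * c) * exp (C₀ * (1 + c)) * (‖x - x'‖ + κ i) := by ring
        _ ≤ _ := by
            gcongr
            exact le_max_right _ _
  | succ k ih =>
    intro N
    obtain ⟨C, hC⟩ := (hXY 1).of_le (Nat.zero_le k)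
    rw [eventually_prod_principal_iff] at hC
    set C₀ := max C 0 with hC₀
    have hC₀0 : 0 ≤ C₀ := le_max_right _ _
    set N' := (N + C₀ * c) * exp (C₀ * (1 + c)) with hN'
    have scale : ∀ (L : E →L[ℝ] E) (a : ℝ), (∀ v, ‖v‖ ≤ 1 → ‖L v‖ ≤ a) → ∀ v, ‖L v‖ ≤ a * ‖v‖ := by
      intro L a h v
      have ha : 0 ≤ a := (norm_nonneg _).trans (h 0 (by simp))
      exact L.le_of_opNorm_le (ContinuousLinearMap.opNorm_le_of_unit_norm ha
        fun v hv => h v hv.le) v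
    have grow : ∀ (i : ι) (Z : ℝ → E → E) (χ : ℝ → E → E) (x v : E), 0 ≤ κ i → κ i ≤ 1 →
        IsPrimitive (fun s => m (i, s)) (M i) (c * κ i) →
        LocalFlow (fun s => tmap (Z s)) (fun s => tmap (χ s)) (x, v) → ‖v‖ ≤ N →
        (∀ s ∈ 𝕀, ∀ w, ‖fderiv ℝ (Z s) (χ s x) w‖ ≤ C₀ * (1 + m (i, s)) * ‖w‖) →
        ∀ s ∈ 𝕀, ‖fderiv ℝ (χ s) x v‖ ≤ N' := by
      intro i Z χ x v g1 g2 g3 g4 g5 g6 s hs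
      have h0 : fderiv ℝ (χ 0) x v = v := (Prod.ext_iff.1 g4.apply_zero).2
      have key := norm_le_of_fence (f := fun s => fderiv ℝ (χ s) x v) (C := C₀) hC₀0
        (fun s hs => ((snd ℝ E E).hasFDerivAt.comp_hasDerivWithinAt s
          (g4.isSol s hs))) g3 (fun s hs _ => by
          have a1 := g6 s hs (fderiv ℝ (χ s) x v)
          have a2 := mul_nonneg hC₀0 (g3.2 s hs).1
          simp only [tmap, ContinuousLinearMap.coe_snd'] at a1 ⊢
          linarith) (lt_add_one _) s hs
      refine key.trans ?_
      rw [h0, hN']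
      have : 0 ≤ N := (norm_nonneg _).trans g5
      gcongr <;> exact mul_le_of_le_one_right hc g2
    have hX : ∀ᶠ i in l, ∀ x ∈ tset (A i) N, ∀ s ∈ 𝕀, tmap (φ i s) x ∈ tset (B (i, s)) N' := by
      filter_upwards [hC, hφ, hM, hκ, hκ1, hB] with i h1 h3 h5 h6 h7 h8 z hz s hs
      refine ⟨(h3 z.1 hz.1).2 s hs, ?_⟩
      rw [mem_closedBall_zero_iff]
      refine grow i (X i) (φ i) z.1 z.2 h6 h7 h5 ((h3 z.1 hz.1).1.2 z.2).localFlow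
        (by simpa using hz.2) (fun t ht => scale _ _ fun w hw => ?_) s hs
      have hw1 : ((φ i t z.1, w) : E × E) ∈ tset (B (i, t)) 1 :=
        ⟨(h3 z.1 hz.1).2 t ht, by simpa using hw⟩
      have hw2 : ((φ i t z.1, w) : E × E) ∈ tset (B' (i, t)) 1 := tset_mono (h8 t ht) le_rfl hw1
      have a1 := (norm_snd_le _).trans ((h1 t ht).1 _ hw2)
      have a2 := (norm_snd_le _).trans ((h1 t ht).2 _ hw1 _ hw2)
      simp only [tmap, Prod.snd_sub, sub_self, norm_zero, zero_add] at a1 a2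
      have a3 := norm_le_norm_sub_add (a := fderiv ℝ (X i t) (φ i t z.1) w)
        (b := fderiv ℝ (Y i t) (φ i t z.1) w)
      have a4 := mul_le_mul_of_nonneg_right (le_max_left C 0) (h5.2 t ht).1
      have a5 := le_max_left C 0
      linarith
    have hY : ∀ᶠ i in l, ∀ x ∈ tset (A' i) N, ∀ s ∈ 𝕀, tmap (ψ i s) x ∈ tset (B' (i, s)) N' := by
      filter_upwards [hC, hψ, hM, hκ, hκ1] with i h1 h3 h5 h6 h7 z hz s hs
      refine ⟨(h3 z.1 hz.1).2 s hs, ?_⟩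
      rw [mem_closedBall_zero_iff]
      refine grow i (Y i) (ψ i) z.1 z.2 h6 h7 h5 ((h3 z.1 hz.1).1.2 z.2).localFlow
        (by simpa using hz.2) (fun t ht => scale _ _ fun w hw => ?_) s hs
      have hw2 : ((ψ i t z.1, w) : E × E) ∈ tset (B' (i, t)) 1 :=
        ⟨(h3 z.1 hz.1).2 t ht, by simpa using hw⟩
      have a1 := (norm_snd_le _).trans ((h1 t ht).1 _ hw2)
      simp only [tmap] at a1
      have a4 := mul_nonneg hC₀0 (h5.2 t ht).1
      have a5 := le_max_left C 0
      linarith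
    refine ih (X := fun i s => tmap (X i s)) (Y := fun i s => tmap (Y i s))
      (φ := fun i s => tmap (φ i s)) (ψ := fun i s => tmap (ψ i s)) (hXY N')
      (hB.mono fun i hi s hs => tset_mono (hi s hs) le_rfl)
      (hR.mono fun i hi s hs => tset_subset_closedBall (hi s hs) N') ?_ ?_
    · filter_upwards [hφ, hX] with i hi hi' z hz
      exact ⟨(hi z.1 hz.1).1.2 z.2, hi' z hz⟩
    · filter_upwards [hψ, hY] with i hi hi' z hz
      exact ⟨(hi z.1 hz.1).1.2 z.2, hi' z hz⟩

open Classical in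
noncomputable def flowMap (X : ℝ → E → E) (s : ℝ) (x : E) : E :=
  if h : ∃ γ : ℝ → E, γ 0 = x ∧ IsSol X γ ∧ RegAlong 1 X γ then h.choose s else x

lemma flowMap_eqOn (h : IsSol X γ) (hr : RegAlong 1 X γ) :
    EqOn (fun s => flowMap X s (γ 0)) γ 𝕀 := by
  have hex : ∃ γ' : ℝ → E, γ' 0 = γ 0 ∧ IsSol X γ' ∧ RegAlong 1 X γ' := ⟨γ, rfl, h, hr⟩
  have e : (fun s => flowMap X s (γ 0)) = hex.choose := by
    ext s
    simp only [flowMap, dif_pos hex]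
  rw [e]
  exact h.eqOn hr hex.choose_spec.2.1 hex.choose_spec.1

lemma flowMap_isSol (h : IsSol X γ) (hr : RegAlong 1 X γ) :
    flowMap X 0 (γ 0) = γ 0 ∧ IsSol X (fun s => flowMap X s (γ 0)) := by
  have e := flowMap_eqOn h hr
  refine ⟨e (by simp), fun s hs => ?_⟩
  have := (h s hs).congr (fun t ht => e ht) (e hs)
  rwa [← e hs] at this

lemma localFlow_flowMap [CompleteSpace E] (h : IsSol X γ) (hr : RegAlong 1 X γ) :
    LocalFlow X (flowMap X) (γ 0) := by
  obtain ⟨d, hd, C, hC, h1, -⟩ := exists_tube_lipschitz hr h.continuousOn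
  have hc : ContinuousOn (fun s => X s (γ s)) 𝕀 := fun s hs => by
    have h2 : ContinuousWithinAt (fun s => (s, γ s)) 𝕀 s :=
      continuousWithinAt_id.prodMk (h.continuousOn s hs)
    exact ContinuousAt.comp_continuousWithinAt (f := fun s => (s, γ s)) (hr s hs).continuousAt h2
  obtain ⟨L, hL⟩ := isCompact_Icc.exists_bound_of_continuousOn hc
  filter_upwards [eventually_norm_sub_mul_lt (γ 0) (exp C) (half_pos hd)] with y hy
  have h0 : ∀ s, ‖γ s - γ s‖ ≤ d := fun s => by simpa using hd.le
  obtain ⟨γ', g0, g1, g2⟩ := exists_sol_tube_of_lipschitz (X := X) (c := γ)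
    (v := fun s => X s (γ s)) (d := d) (K := C)
    (L := L + C * d) hC hd (fun s hs x hx => by
      have a1 := (h1 s hs x hx).2 _ (h0 s)
      have a2 := hL s hs
      have a3 := norm_le_norm_sub_add (a := X s x) (b := X s (γ s))
      have a4 := mul_le_mul_of_nonneg_left hx hC
      linarith) (fun s hs x y hx hy => (h1 s hs x hx).2 y hy)
    (fun s hs x hx => ContinuousAt.comp_continuousWithinAt (f := fun s => (s, x))
      (h1 s hs x hx).1.continuousAt (by fun_prop)) h isPrimitive_zero (fun s hs x hx => by
      simpa using (h1 s hs x hx).2 _ (h0 s)) (x₀ := y) (by simpa using hy)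
  have hr' : RegAlong 1 X γ' := fun s hs => (h1 s hs _ ((g2 s hs).trans (by
    simp only [mul_zero, add_zero, mul_one]
    linarith))).1
  have := flowMap_isSol g1 hr'
  rwa [g0] at this

end ODESmooth

section Tube

variable {E : Type} [NormedAddCommGroup E] [NormedSpace ℝ E] [FiniteDimensional ℝ E]

lemma isCompact_tube {c : ℝ → E} (hc : ContinuousOn c 𝕀) (d : ℝ) :
    IsCompact {z : ℝ × E | z.1 ∈ 𝕀 ∧ ‖z.2 - c z.1‖ ≤ d} := by
  have := FiniteDimensional.proper ℝ E
  have h1 : IsCompact (𝕀 ×ˢ closedBall (0 : E) d) := isCompact_Icc.prod (isCompact_closedBall _ _)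
  have h2 : ContinuousOn (fun z : ℝ × E => (z.1, c z.1 + z.2)) (𝕀 ×ˢ closedBall (0 : E) d) :=
    continuousOn_fst.prodMk ((hc.comp continuousOn_fst fun z hz => hz.1).add continuousOn_snd)
  convert h1.image_of_continuousOn h2 using 1
  ext ⟨s, x⟩
  constructor
  · rintro ⟨h, h'⟩
    exact ⟨(s, x - c s), ⟨h, by simpa using h'⟩, by simp⟩
  · rintro ⟨⟨t, y⟩, ⟨h, h'⟩, he⟩
    obtain ⟨rfl, rfl⟩ := Prod.mk.inj he
    exact ⟨h, by simpa using h'⟩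

lemma exists_sol_tube {X : ℝ → E → E} {c v : ℝ → E} {m M : ℝ → ℝ} {C Mt d : ℝ} (hC : 0 ≤ C)
    (hd : 0 < d)
    (hX : ∀ s ∈ 𝕀, ∀ x, ‖x - c s‖ ≤ d → 𝒞 (1 : ℕ) (uncurry X) (s, x))
    (hcv : ∀ s ∈ 𝕀, HasDerivWithinAt c (v s) 𝕀 s) (hM : IsPrimitive m M Mt)
    (hb : ∀ s ∈ 𝕀, ∀ x, ‖x - c s‖ ≤ d →
      ‖X s x - v s‖ ≤ C * (1 + m s) * ‖x - c s‖ + C * m s) {x₀ : E}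
    (hx₀ : (‖x₀ - c 0‖ + C * Mt) * exp (C * (1 + Mt)) < d / 2) :
    (flowMap X 0 x₀ = x₀ ∧ IsSol X (fun s => flowMap X s x₀)) ∧ ∀ s ∈ 𝕀, ‖flowMap X s x₀ - c s‖ ≤
        (‖x₀ - c 0‖ + C * Mt) * exp (C * (1 + Mt)) := by
  have hK := isCompact_tube (fun s hs => (hcv s hs).continuousWithinAt) d (c := c)
  obtain ⟨K, hK1⟩ := exists_lipschitzOnWith_of_contDiffAt hK (f := uncurry X)
    fun z hz => by simpa using hX z.1 hz.1 z.2 hz.2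
  obtain ⟨L, hL⟩ := hK.exists_bound_of_continuousOn (f := uncurry X)
    fun z hz => (hX z.1 hz.1 z.2 hz.2).continuousAt.continuousWithinAt
  obtain ⟨γ, g0, g1, g2⟩ := exists_sol_tube_of_lipschitz (X := X) hC hd
    (fun s hs x hx => hL (s, x) ⟨hs, hx⟩) (fun s hs x y hx hy => by
      have := hK1.dist_le_mul (s, x) ⟨hs, hx⟩ (s, y) ⟨hs, hy⟩
      simpa [dist_eq_norm, Prod.norm_def] using this)
    (fun s hs x hx => ContinuousAt.comp_continuousWithinAt (f := fun s => (s, x))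
      (hX s hs x hx).continuousAt (by fun_prop)) hcv hM hb hx₀
  have hr : RegAlong 1 X γ := fun s hs => hX s hs _ ((g2 s hs).trans (by linarith))
  have h1 := flowMap_isSol g1 hr
  have h2 := flowMap_eqOn g1 hr
  rw [g0] at h1 h2
  exact ⟨h1, fun s hs => by rw [show flowMap X s x₀ = γ s from h2 hs]; exact g2 s hs⟩

variable {ι : Type} {l : Filter ι} {κ e : ι → ℝ} {m : ι × ℝ → ℝ} {M : ι → ℝ → ℝ} {r : ℕ}
  {X Y : ι → ℝ → E → E} {c v : ℝ → E} {C d b : ℝ}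

/-- The flow of `X` starting at `x` exists on `[0, 1]` and stays in the tube. -/
def FlowIn (X : ℝ → E → E) (c : ℝ → E) (d : ℝ) (x : E) : Prop :=
  (flowMap X 0 x = x ∧ IsSol X (fun s => flowMap X s x)) ∧ ∀ s ∈ 𝕀, ‖flowMap X s x - c s‖ ≤ d

lemma flowMap_of_isSol {X : ℝ → E → E} {k : ℕ} {x : E} (h0 : flowMap X 0 x = x)
    (h : IsSol X (fun s => flowMap X s x)) (hr : RegAlong (k + 1) X (fun s => flowMap X s x)) :
    FlowJet (k + 1) X (flowMap X) x ∧ 𝒞 (k + 1 : ℕ) (flowMap X 1) x := by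
  have := FiniteDimensional.complete ℝ E
  have h1 : LocalFlow X (flowMap X) x := by
    simpa only [h0] using localFlow_flowMap h (hr.of_le (by omega))
  exact ⟨h1.flowJet hr, h1.contDiffAt hr (by simp)⟩

lemma flow_tube_aux (hr : 1 ≤ r) (hC : 1 ≤ C) (hd : 0 < d) {D : ℝ} (hD : 0 ≤ D)
    (hX : ∀ᶠ i in l, ∀ s ∈ 𝕀, ∀ x, ‖x - c s‖ ≤ d → 𝒞 r (uncurry (X i)) (s, x))
    (hcv : ∀ s ∈ 𝕀, HasDerivWithinAt c (v s) 𝕀 s)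
    (hXv : ∀ᶠ i in l, ∀ s ∈ 𝕀, ∀ x, ‖x - c s‖ ≤ d →
      ‖X i s x - v s‖ ≤ C * ‖x - c s‖ + e i + D * m (i, s))
    (he : Tendsto e l (𝓝 0)) (hM : IsWeight l κ m M b) (hκ0 : Tendsto κ l (𝓝 0)) :
    (∀ᶠ i in l, ∀ x ∈ closedBall (c 0) (d * exp (-C) / 4), FlowIn (X i) c d x) ∧
      Tendsto (fun z : ι × E => flowMap (X z.1) 1 z.2) (l ×ˢ 𝓝 (c 0)) (𝓝 (c 1)) := by
  set μ : ι → ℝ := fun i => |e i| + D * (b * κ i) with hμ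
  have hμ0 : Tendsto μ l (𝓝 0) := by
    have h1 : Tendsto (fun i => |e i| + D * (b * κ i)) l (𝓝 (|0| + D * (b * 0))) :=
      he.abs.add ((hκ0.const_mul b).const_mul D)
    simpa using h1
  have hcont : Continuous (fun z : ℝ × ℝ => (z.1 + C * z.2) * exp (C * (1 + z.2))) := by fun_prop
  have hlim := hcont.tendsto' (d * exp (-C) / 4, 0) (d / 4) (by
    simp only [mul_zero, add_zero, mul_one, Real.exp_neg]
    field_simp)
  have hev : ∀ᶠ i in l, (d * exp (-C) / 4 + C * μ i) * exp (C * (1 + μ i)) < d / 2 :=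
    (hlim.comp (tendsto_const_nhds.prodMk_nhds hμ0)).eventually_lt_const (by linarith)
  have hC0 : 0 ≤ C := by linarith
  have main : ∀ᶠ i in l, ∀ x, ‖x - c 0‖ ≤ d * exp (-C) / 4 →
      (flowMap (X i) 0 x = x ∧ IsSol (X i) (fun s => flowMap (X i) s x)) ∧
      ∀ s ∈ 𝕀, ‖flowMap (X i) s x - c s‖ ≤ (‖x - c 0‖ + C * μ i) * exp (C * (1 + μ i)) ∧
        (‖x - c 0‖ + C * μ i) * exp (C * (1 + μ i)) ≤ d := by
    filter_upwards [hX, hXv, hM, hev] with i h1 h2 h3 h4 x hx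
    have hμ1 : 0 ≤ μ i := by
      have := h3.2 0 (by simp)
      have : 0 ≤ b * κ i := this.2.2.1.trans this.2.2.2
      positivity
    have h5 : (‖x - c 0‖ + C * μ i) * exp (C * (1 + μ i)) < d / 2 :=
      lt_of_le_of_lt (by gcongr) h4
    have h6 := exists_sol_tube (X := X i) (m := fun s => |e i| + D * m (i, s))
      (M := fun s => |e i| * s + D * M i s) (Mt := μ i) hC0 hd
      (fun s hs x hx => (h1 s hs x hx).of_le (by exact_mod_cast hr)) hcv
      ⟨by simp [h3.1], fun s hs => by
        obtain ⟨b1, b2, b3, b4⟩ := h3.2 s hs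
        have a1 := (hasDerivWithinAt_id s 𝕀).const_mul |e i|
        rw [mul_one] at a1
        have a2 := mul_le_of_le_one_right (abs_nonneg (e i)) hs.2
        have := hs.1
        exact ⟨by positivity, a1.add (b2.const_mul D), by positivity,
          add_le_add a2 (mul_le_mul_of_nonneg_left b4 hD)⟩⟩ (fun s hs x hx => by
        refine (h2 s hs x hx).trans ?_
        have a1 := (h3.2 s hs).1
        have a2 := le_abs_self (e i)
        have a3 : 0 ≤ |e i| + D * m (i, s) := by positivity
        have a4 := le_mul_of_one_le_left a3 hC
        have a5 : 0 ≤ C * (|e i| + D * m (i, s)) * ‖x - c s‖ := by positivity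
        linarith) h5
    exact ⟨h6.1, fun s hs => ⟨h6.2 s hs, by linarith⟩⟩
  refine ⟨?_, ?_⟩
  · filter_upwards [main] with i hi x hx
    have := hi x (by simpa [dist_eq_norm] using hx)
    exact ⟨this.1, fun s hs => (this.2 s hs).1.trans (this.2 s hs).2⟩
  · rw [tendsto_iff_norm_sub_tendsto_zero]
    have h1 : Tendsto (fun z : ι × E => (‖z.2 - c 0‖ + C * μ z.1) * exp (C * (1 + μ z.1)))
        (l ×ˢ 𝓝 (c 0)) (𝓝 0) := by
      have a1 : Tendsto (fun z : ι × E => (‖z.2 - c 0‖, μ z.1)) (l ×ˢ 𝓝 (c 0)) (𝓝 (0, 0)) :=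
        ((tendsto_norm_sub_self _).comp tendsto_snd).prodMk_nhds (hμ0.comp tendsto_fst)
      simpa [Function.comp_def] using (hcont.tendsto (0, 0)).comp a1
    have h2 := (tendsto_norm_sub_self (c 0)).eventually_le_const
      (by positivity : 0 < d * exp (-C) / 4)
    refine squeeze_zero' (.of_forall fun _ => norm_nonneg _) ?_ h1
    filter_upwards [main.prod_mk h2] with z hz
    exact ((hz.1 z.2 hz.2).2 1 (by simp)).1

/-- Closeness of two flows in the tube around a reference curve which almost solves the second
equation. -/
lemma CRel.flow_tube (hr : 1 ≤ r) (hC : 1 ≤ C) (hd : 0 < d) (hb : 0 ≤ b)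
    (hXY : CRel (l ×ˢ 𝓟 𝕀) m r (fun j => X j.1 j.2) (fun j => Y j.1 j.2)
      (fun j => closedBall (c j.2) d) (fun j => closedBall (c j.2) d))
    (hX : ∀ᶠ i in l, ∀ s ∈ 𝕀, ∀ x, ‖x - c s‖ ≤ d → 𝒞 r (uncurry (X i)) (s, x))
    (hY : ∀ᶠ i in l, ∀ s ∈ 𝕀, ∀ x, ‖x - c s‖ ≤ d → 𝒞 r (uncurry (Y i)) (s, x))
    (hcv : ∀ s ∈ 𝕀, HasDerivWithinAt c (v s) 𝕀 s)
    (hYv : ∀ᶠ i in l, ∀ s ∈ 𝕀, ∀ x, ‖x - c s‖ ≤ d → ‖Y i s x - v s‖ ≤ C * ‖x - c s‖ + e i)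
    (he : Tendsto e l (𝓝 0)) (hM : IsWeight l κ m M b) (hκ : ∀ᶠ i in l, 0 ≤ κ i)
    (hκ0 : Tendsto κ l (𝓝 0)) :
    (∀ᶠ i in l, ∀ x ∈ closedBall (c 0) (d * exp (-C) / 4),
      FlowIn (X i) c d x ∧ FlowIn (Y i) c d x) ∧
    Tendsto (fun z : ι × E => flowMap (X z.1) 1 z.2) (l ×ˢ 𝓝 (c 0)) (𝓝 (c 1)) ∧
    Tendsto (fun z : ι × E => flowMap (Y z.1) 1 z.2) (l ×ˢ 𝓝 (c 0)) (𝓝 (c 1)) ∧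
    CRel l κ r (fun i => flowMap (X i) 1) (fun i => flowMap (Y i) 1)
      (fun _ => closedBall (c 0) (d * exp (-C) / 4))
      (fun _ => closedBall (c 0) (d * exp (-C) / 4)) := by
  obtain ⟨D, hD⟩ := hXY.cr.of_le (Nat.zero_le r)
  rw [eventually_prod_principal_iff] at hD
  obtain ⟨x1, x2⟩ := flow_tube_aux (X := X) (e := e) (D := max D 0) hr hC hd (le_max_right _ _)
    hX hcv (by
      filter_upwards [hYv, hD, hM] with i h1 h2 h3 s hs x hx
      have hx' : x ∈ closedBall (c s) d := by simpa [dist_eq_norm] using hx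
      have a1 := h1 s hs x hx
      have a2 := (h2 s hs).2 x hx' x hx'
      rw [sub_self, norm_zero, zero_add] at a2
      have a3 := norm_add_le (X i s x - Y i s x) (Y i s x - v s)
      have a4 := mul_le_mul_of_nonneg_right (le_max_left D 0) (h3.2 s hs).1
      rw [sub_add_sub_cancel] at a3
      linarith) he hM hκ0
  obtain ⟨y1, y2⟩ := flow_tube_aux (X := Y) (e := e) (D := 0) hr hC hd le_rfl hY hcv (by
      filter_upwards [hYv] with i h1 s hs x hx
      simpa using h1 s hs x hx) he hM hκ0
  have hcont : ContinuousOn c 𝕀 := fun s hs => (hcv s hs).continuousWithinAt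
  obtain ⟨R, hR⟩ := isCompact_Icc.exists_bound_of_continuousOn hcont
  obtain ⟨k, rfl⟩ : ∃ k, r = k + 1 := ⟨r - 1, by omega⟩
  have hj {Z : ℝ → E → E} (h : ∀ s ∈ 𝕀, ∀ x, ‖x - c s‖ ≤ d → 𝒞 (k + 1 : ℕ) (uncurry Z) (s, x))
      {x : E} (h' : FlowIn Z c d x) := flowMap_of_isSol h'.1.1 h'.1.2 fun s hs => h s hs _ (h'.2 s
          hs)
  have hXj := (x1.and hX).mono fun i h x hx => hj h.2 (h.1 x hx)
  have hYj := (y1.and hY).mono fun i h x hx => hj h.2 (h.1 x hx)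
  refine ⟨(x1.and y1).mono fun i hi x hx => ⟨hi.1 x hx, hi.2 x hx⟩, x2, y2,
    hXj.mono fun i hi x hx => (hi x hx).2, hYj.mono fun i hi x hx => (hi x hx).2, ?_⟩
  refine CR.flow (R := R + d) hXY.cr (.of_forall fun i s _ => subset_rfl)
    (.of_forall fun i s hs x hx => ?_)
    (((hXj.and x1)).mono fun i hi x hx => ⟨(hi.1 x hx).1, fun s hs => ?_⟩)
    (((hYj.and y1)).mono fun i hi x hx => ⟨(hi.1 x hx).1, fun s hs => ?_⟩) hM hb hκ
    (hκ0.eventually_le_const one_pos)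
  · rw [mem_closedBall_zero_iff]
    rw [mem_closedBall, dist_eq_norm] at hx
    have a1 := norm_le_norm_sub_add (a := x) (b := c s)
    have a2 := hR s hs
    linarith
  · simpa [dist_eq_norm] using (hi.2 x hx).2 s hs
  · simpa [dist_eq_norm] using (hi.2 x hx).2 s hs

end Tube

/-! ### Scales -/

section Scales

variable {r : ℕ}

lemma nuExp_pos {ε : ℝ} (h : 0 < ε) : 0 < nuExp r ε := Real.rpow_pos_of_pos h _

lemma tendsto_nuExp : Tendsto (nuExp r) 𝓝₀ (𝓝 0) := by
  have h : 0 < 1 / ((r : ℝ) + 2) := by positivity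
  have := (Real.continuousAt_rpow_const 0 (1 / ((r : ℝ) + 2)) (Or.inr h.le)).tendsto
  rw [Real.zero_rpow h.ne'] at this
  exact this.mono_left nhdsWithin_le_nhds

lemma etaExp_eq {ε : ℝ} (h : 0 < ε) : etaExp r ε = -(1 / ((r : ℝ) + 2) * (ε * log ε)) := by
  rw [etaExp, nuExp, Real.log_rpow h]
  ring

lemma exp_neg_etaExp {ε : ℝ} (h : 0 < ε) : exp (-etaExp r ε / ε) = nuExp r ε := by
  rw [etaExp, neg_neg, mul_div_cancel_left₀ _ h.ne', Real.exp_log (nuExp_pos h)]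

lemma exp_neg_deltaExp {ε : ℝ} (h : 0 < ε) :
    exp (-deltaExp r ε / ε) = ε ^ (r + 1) * nuExp r ε := by
  rw [deltaExp, neg_neg, show ((r : ℝ) + 1 + 1 / ((r : ℝ) + 2)) * ε * log ε / ε =
    log ε * ((r : ℝ) + 1 + 1 / ((r : ℝ) + 2)) by field_simp, ← Real.rpow_def_of_pos h,
    Real.rpow_add h, nuExp]
  norm_cast

lemma mul_log_neg {ε : ℝ} (h : 0 < ε) (h1 : ε < 1) : ε * log ε < 0 :=
  mul_neg_of_pos_of_neg h (Real.log_neg h h1)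

lemma etaExp_pos {ε : ℝ} (h : 0 < ε) (h1 : ε < 1) : 0 < etaExp r ε := by
  rw [etaExp_eq h]
  have : 0 < 1 / ((r : ℝ) + 2) := by positivity
  nlinarith [mul_log_neg h h1]

lemma etaExp_lt_deltaExp {ε : ℝ} (h : 0 < ε) (h1 : ε < 1) : etaExp r ε < deltaExp r ε := by
  rw [etaExp_eq h, deltaExp]
  have : (0 : ℝ) < r + 1 := by positivity
  nlinarith [mul_log_neg h h1]

lemma tendsto_mul_log : Tendsto (fun ε : ℝ => ε * log ε) 𝓝₀ (𝓝 0) := by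
  have := Real.continuous_mul_log.tendsto 0
  simp only [zero_mul] at this
  exact this.mono_left nhdsWithin_le_nhds

lemma tendsto_etaExp : Tendsto (etaExp r) 𝓝₀ (𝓝 0) := by
  have h := (tendsto_mul_log.const_mul (1 / ((r : ℝ) + 2))).neg
  rw [mul_zero, neg_zero] at h
  exact h.congr' (eventually_mem_nhdsWithin.mono fun ε hε => (etaExp_eq hε).symm)

lemma tendsto_deltaExp : Tendsto (deltaExp r) 𝓝₀ (𝓝 0) := by
  have h := (tendsto_mul_log.const_mul ((r : ℝ) + 1 + 1 / ((r : ℝ) + 2))).neg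
  rw [mul_zero, neg_zero] at h
  exact h.congr fun ε => by rw [deltaExp]; ring

lemma eventually_deltaExp_le : ∃ K, ∀ᶠ ε in 𝓝₀, deltaExp r ε ≤ K * nuExp r ε := by
  have hs : 0 < 1 - 1 / ((r : ℝ) + 2) := by
    rw [sub_pos, div_lt_one (by positivity)]
    have : (0 : ℝ) ≤ r := by positivity
    linarith
  have h1 := (tendsto_log_mul_rpow_nhdsGT_zero hs).eventually (Icc_mem_nhds (a := -1) (b := 1)
    (by norm_num) (by norm_num))
  refine ⟨(r : ℝ) + 1 + 1 / ((r : ℝ) + 2), ?_⟩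
  filter_upwards [h1, eventually_mem_nhdsWithin] with ε h2 h3
  have h4 : ε * log ε = nuExp r ε * (log ε * ε ^ (1 - 1 / ((r : ℝ) + 2))) := by
    have : ε = nuExp r ε * ε ^ (1 - 1 / ((r : ℝ) + 2)) := by
      rw [nuExp, ← Real.rpow_add h3]
      simp
    nth_rewrite 1 [this]
    ring
  have h5 := nuExp_pos (r := r) h3
  have h6 : 0 < (r : ℝ) + 1 + 1 / ((r : ℝ) + 2) := by positivity
  have h7 : -(nuExp r ε) ≤ ε * log ε := by
    rw [h4]
    nlinarith [h2.1]
  rw [deltaExp]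
  nlinarith

lemma eventually_lt_one : ∀ᶠ ε in 𝓝₀, ε < 1 :=
  eventually_nhdsWithin_of_eventually_nhds (eventually_lt_nhds one_pos)

lemma etaExp_isBigO : etaExp r =O[𝓝₀] fun ε => ε * log ε := by
  refine Asymptotics.IsBigO.of_bound (1 / ((r : ℝ) + 2)) ?_
  filter_upwards [eventually_mem_nhdsWithin] with ε hε
  rw [etaExp_eq hε, norm_neg, norm_mul, Real.norm_of_nonneg (by positivity)]

end Scales

/-! ### Normals -/

section Normals

variable {d : ℕ}

lemma IsInwardNormal.unique {Ω : Set (Config d)} {q n n' : Config d}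
    (h : IsInwardNormal Ω q n) (h' : IsInwardNormal Ω q n') : n = n' := by
  by_contra hne
  have h1 : ⟪n, n'⟫ < 1 := inner_lt_one_iff_real_of_norm_eq_one h.1 h'.1 |>.2 hne
  have h2 : 0 < ⟪n, n - n'⟫ := by
    rw [inner_sub_right, real_inner_self_eq_norm_sq, h.1]
    linarith
  have h3 : ⟪n', n - n'⟫ < 0 := by
    rw [inner_sub_right, real_inner_self_eq_norm_sq, h'.1, real_inner_comm]
    linarith
  obtain ⟨s, hs, hs'⟩ := (((h.2 _).1 h2).and ((h'.2 _).2 h3)).exists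
  exact hs' (interior_subset hs)

lemma hasDerivAt_line {g : Config d → ℝ} {q : Config d} (v : Config d) {s : ℝ}
    (hg : DifferentiableAt ℝ g (q + s • v)) :
    HasDerivAt (fun s : ℝ => g (q + s • v)) ⟪∇ g (q + s • v), v⟫ s := by
  have h1 : HasDerivAt (fun s : ℝ => q + s • v) v s := by
    simpa using ((hasDerivAt_id s).smul_const v).const_add q
  have h2 := hg.hasGradientAt.hasFDerivAt.comp_hasDerivAt s h1
  rwa [InnerProductSpace.toDual_apply_apply] at h2

variable {Ω : Set (Config d)} {g : Config d → ℝ} {q : Config d} {c : ℝ}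

lemma eventually_gt_of_inner_pos {v : Config d} (hg : DifferentiableAt ℝ g q)
    (hv : 0 < ⟪∇ g q, v⟫) : ∀ᶠ s in 𝓝₀, g q < g (q + s • v) := by
  have h1 := hasDerivAt_line (q := q) (s := 0) v (by simpa using hg)
  simp only [zero_smul, add_zero] at h1
  have h2 := h1.hasDerivWithinAt (s := Ioi 0)
  rw [hasDerivWithinAt_iff_tendsto_slope' (by simp)] at h2
  filter_upwards [h2.eventually_const_lt hv, eventually_mem_nhdsWithin] with s h3 h4
  rw [slope_def_field, zero_smul, add_zero, sub_zero] at h3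
  have := (div_pos_iff_of_pos_right h4).1 h3
  linarith

lemma mem_interior_of_lt (h : ∀ᶠ x in 𝓝 q, x ∈ Ω ↔ c ≤ g x) (hg : ContinuousAt g q)
    (hc : c < g q) : q ∈ interior Ω := by
  rw [mem_interior_iff_mem_nhds]
  filter_upwards [h, hg.eventually_const_lt hc] with x hx hx'
  exact hx.2 hx'.le

lemma notMem_closure_of_lt (h : ∀ᶠ x in 𝓝 q, x ∈ Ω ↔ c ≤ g x) (hg : ContinuousAt g q)
    (hc : g q < c) : q ∉ closure Ω := by
  rw [mem_closure_iff_frequently, not_frequently]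
  filter_upwards [h, hg.eventually_lt_const hc] with x hx hx'
  rw [hx]
  exact not_le.2 hx'

lemma isInwardNormal_gradient (h : ∀ᶠ x in 𝓝 q, x ∈ Ω ↔ c ≤ g x)
    (hg : ∀ᶠ x in 𝓝 q, DifferentiableAt ℝ g x) (hc : g q = c) (hn : ∇ g q ≠ 0) :
    IsInwardNormal Ω q (‖∇ g q‖⁻¹ • ∇ g q) := by
  have hpos : 0 < ‖∇ g q‖⁻¹ := inv_pos.2 (norm_pos_iff.2 hn)
  have hline : ∀ v, Tendsto (fun s : ℝ => q + s • v) 𝓝₀ (𝓝 q) := fun v => by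
    have : ContinuousAt (fun s : ℝ => q + s • v) 0 := by fun_prop
    have := this.tendsto
    simp only [zero_smul, add_zero] at this
    exact this.mono_left nhdsWithin_le_nhds
  refine ⟨by rw [norm_smul, norm_inv, norm_norm, inv_mul_cancel₀ (norm_ne_zero_iff.2 hn)],
    fun v => ⟨fun hv => ?_, fun hv => ?_⟩⟩
  · rw [real_inner_smul_left, mul_pos_iff_of_pos_left hpos] at hv
    filter_upwards [eventually_gt_of_inner_pos hg.self_of_nhds hv,
      (hline v).eventually (eventually_eventually_nhds.2 h),
      (hline v).eventually hg] with s h1 h2 h3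
    exact mem_interior_of_lt h2 h3.continuousAt (hc ▸ h1)
  · rw [real_inner_smul_left] at hv
    have hv' : ⟪∇ g q, v⟫ < 0 := by
      by_contra hcon
      exact absurd (mul_nonneg hpos.le (not_lt.1 hcon)) (not_le.2 hv)
    have hg' : DifferentiableAt ℝ (fun x => -g x) q := hg.self_of_nhds.neg
    have e : ∇ (fun x => -g x) q = -∇ g q := by
      rw [gradient, gradient, fderiv_fun_neg, map_neg]
    have h1 := eventually_gt_of_inner_pos (v := v) hg' (by rw [e, inner_neg_left]; linarith)
    filter_upwards [h1, (hline v).eventually h] with s h1 h2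
    rw [h2, not_le]
    linarith

lemma mem_frontier_of_eq (h : ∀ᶠ x in 𝓝 q, x ∈ Ω ↔ c ≤ g x)
    (hg : ∀ᶠ x in 𝓝 q, DifferentiableAt ℝ g x) (hc : g q = c) (hn : ∇ g q ≠ 0) :
    q ∈ frontier Ω := by
  refine ⟨subset_closure (h.self_of_nhds.2 hc.ge), fun hq => ?_⟩
  have h1 := ((isInwardNormal_gradient h hg hc hn).2 (-∇ g q)).2 (by
    rw [inner_neg_right, real_inner_smul_left, real_inner_self_eq_norm_sq]
    have := norm_pos_iff.2 hn
    have : 0 < ‖∇ g q‖⁻¹ * ‖∇ g q‖ ^ 2 := by positivity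
    linarith)
  have h2 : Tendsto (fun s : ℝ => q + s • (-∇ g q)) 𝓝₀ (𝓝 q) := by
    have : ContinuousAt (fun s : ℝ => q + s • (-∇ g q)) 0 := by fun_prop
    have := this.tendsto
    simp only [zero_smul, add_zero] at this
    exact this.mono_left nhdsWithin_le_nhds
  obtain ⟨s, hs, hs'⟩ := (h1.and (h2.eventually (mem_interior_iff_mem_nhds.1 hq))).exists
  exact hs hs'

end Normals

/-! ### Geometry of the tables -/

lemma IsCompact.eventually_forall_prod {ι X : Type} [TopologicalSpace X] {l : Filter ι}
    {K : Set X} (hK : IsCompact K) {p : ι → X → Prop}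
    (h : ∀ x ∈ K, ∀ᶠ z in l ×ˢ 𝓝 x, p z.1 z.2) : ∀ᶠ i in l, ∀ x ∈ K, p i x := by
  refine hK.induction_on (p := fun S => ∀ᶠ i in l, ∀ x ∈ S, p i x) (by simp)
    (fun S T hST hT => hT.mono fun i hi x hx => hi x (hST hx))
    (fun S T hS hT => (hS.and hT).mono fun i hi x hx => hx.elim (hi.1 x) (hi.2 x))
    fun x hx => ?_
  obtain ⟨u, hu, v, hv, huv⟩ := mem_prod_iff.1 (h x hx)
  exact ⟨v, mem_nhdsWithin_of_mem_nhds hv, mem_of_superset hu fun i hi y hy => @huv (i, y) ⟨hi, hy⟩⟩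

noncomputable def dualIso (d : ℕ) : (Config d →L[ℝ] ℝ) ≃ₗᵢ[ℝ] Config d where
  toFun := (InnerProductSpace.toDual ℝ (Config d)).symm
  invFun := InnerProductSpace.toDual ℝ (Config d)
  map_add' := map_add _
  map_smul' c x := by simp
  left_inv x := by simp
  right_inv x := by simp
  norm_map' x := by simp

lemma dualIso_fderiv {d : ℕ} (f : Config d → ℝ) (x : Config d) :
    dualIso d (fderiv ℝ f x) = ∇ f x := rfl

lemma ContDiffAt.gradient {d k : ℕ} {f : Config d → ℝ} {x : Config d}
    (h : 𝒞 (k + 1 : ℕ) f x) : 𝒞 k (∇ f) x := by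
  have h1 : 𝒞 k (fderiv ℝ f) x := h.fderiv_right (by norm_cast)
  exact (dualIso d).contDiff.contDiffAt.comp x h1

namespace SteepExpPotential

variable {d r : ℕ} {B : BilliardTable d r} {P : SteepExpPotential B}

lemma _root_.BilliardTable.notMem_corner_of_interior {x : Config d} (hx : x ∈ interior B.D) :
    x ∉ B.corner := fun h => (B.corner_subset h).2 hx

lemma _root_.BilliardTable.corner_subset_D : B.corner ⊆ B.D :=
  B.corner_subset.trans B.isClosed_D.frontier_subset

lemma eventually_lt (P : SteepExpPotential B) : ∀ᶠ ε in 𝓝₀, ε ∈ Ioo 0 P.ε₁ :=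
  Ioo_mem_nhdsGT P.ε₁_pos

lemma contDiffAt_Q (P : SteepExpPotential B) {ε : ℝ} (hε : ε ∈ Ico 0 P.ε₁) {x : Config d}
    (hx : x ∈ P.Dt) : 𝒞 (r + 1 : ℕ) (P.Q ε) x :=
  (P.contDiff_Q ε hε).contDiffAt (P.isOpen_Dt.mem_nhds hx)

lemma tendsto_iteratedFDeriv_Q (P : SteepExpPotential B) {k : ℕ} (hk : k ≤ r + 1) {x : Config d}
    (hx : x ∈ P.Dt) : Tendsto (fun z : ℝ × Config d => iteratedFDeriv ℝ k (P.Q z.1) z.2)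
      (𝓝₀ ×ˢ 𝓝 x) (𝓝 (iteratedFDeriv ℝ k (P.Q 0) x)) := by
  have h1 := P.continuous_Q k hk (0, x) ⟨⟨le_rfl, P.ε₁_pos⟩, hx⟩
  refine h1.tendsto.mono_left ?_
  rw [nhdsWithin_prod_eq]
  refine Filter.prod_mono ?_ ?_
  · exact nhdsWithin_le_iff.2 (mem_of_superset P.eventually_lt Ioo_subset_Ico_self)
  · rw [P.isOpen_Dt.nhdsWithin_eq hx]

lemma tendsto_Q (P : SteepExpPotential B) {x : Config d} (hx : x ∈ P.Dt) :
    Tendsto (fun z : ℝ × Config d => P.Q z.1 z.2) (𝓝₀ ×ˢ 𝓝 x) (𝓝 (P.Q 0 x)) := by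
  have h := P.tendsto_iteratedFDeriv_Q (Nat.zero_le _) hx
  have h2 := ((ContinuousMultilinearMap.apply ℝ (fun _ : Fin 0 => Config d) ℝ
    0).continuous.tendsto _).comp h
  simpa [Function.comp_def] using h2

lemma tendsto_gradient_Q (P : SteepExpPotential B) {x : Config d} (hx : x ∈ P.Dt) :
    Tendsto (fun z : ℝ × Config d => ∇ (P.Q z.1) z.2) (𝓝₀ ×ˢ 𝓝 x)
      (𝓝 (∇ (P.Q 0) x)) := by
  have h := P.tendsto_iteratedFDeriv_Q (k := 0 + 1) (by omega) hx
  rw [tendsto_iff_norm_sub_tendsto_zero] at h ⊢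
  refine h.congr fun z => ?_
  rw [norm_iteratedFDeriv_succ_sub, iteratedFDeriv_zero_eq_comp, iteratedFDeriv_zero_eq_comp]
  simp only [comp_apply, ← map_sub, LinearIsometryEquiv.norm_map, ← dualIso_fderiv]

lemma eventually_mem_closure_Nbhd (P : SteepExpPotential B) (x : Config d) :
    ∀ᶠ y in 𝓝 x, ∀ i, y ∈ P.Nbhd i → x ∈ closure (P.Nbhd i) := by
  rw [eventually_all]
  intro i
  by_cases hx : x ∈ closure (P.Nbhd i)
  · exact .of_forall fun _ _ => hx
  · filter_upwards [isClosed_closure.isOpen_compl.mem_nhds hx] with y hy hy'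
    exact absurd (subset_closure hy') hy

lemma eventually_mem_interior_table (P : SteepExpPotential B) {s : ℝ → ℝ}
    (hs : Tendsto s 𝓝₀ (𝓝 0)) {x : Config d} (hx : x ∈ interior B.D) :
    ∀ᶠ z in 𝓝₀ ×ˢ 𝓝 x, z.2 ∈ interior (P.table z.1 (s z.1)) := by
  have h1 : ∀ᶠ y in 𝓝 x, (∀ i, y ∈ P.Nbhd i → x ∈ closure (P.Nbhd i)) ∧ y ∈ B.D :=
    (P.eventually_mem_closure_Nbhd x).and (mem_interior_iff_mem_nhds.1 hx)
  have h2 : ∀ᶠ z in 𝓝₀ ×ˢ 𝓝 x, ∀ i, x ∈ closure (P.Nbhd i) → P.Qval i + s z.1 ≤ P.Q z.1 z.2 := by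
    rw [eventually_all]
    intro i
    by_cases hi : x ∈ closure (P.Nbhd i)
    · have hc : x ∈ closure (P.Nbhd i) \ B.corner := ⟨hi, B.notMem_corner_of_interior hx⟩
      have h3 := (P.side i x hc).1.2 hx
      have h4 : Tendsto (fun z : ℝ × Config d => P.Qval i + s z.1) (𝓝₀ ×ˢ 𝓝 x)
          (𝓝 (P.Qval i + 0)) := (hs.comp tendsto_fst).const_add _
      rw [add_zero] at h4
      exact ((h4.eventually_lt (P.tendsto_Q (P.closure_Nbhd_subset i hc)) h3).mono
        fun z hz _ => hz.le)
    · exact .of_forall fun z h => absurd h hi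
  have h3 : ∀ᶠ z in 𝓝₀ ×ˢ 𝓝 x, z.2 ∈ P.table z.1 (s z.1) := by
    filter_upwards [h2, h1.prod_inr _] with z hz hz'
    exact ⟨Or.inl hz'.2, fun i hi => hz i (hz'.1 i hi)⟩
  obtain ⟨u, hu, v, hv, huv⟩ := mem_prod_iff.1 h3
  refine mem_prod_iff.2 ⟨u, hu, interior v, interior_mem_nhds.2 hv, fun z hz => ?_⟩
  exact interior_mono (fun y hy => @huv (z.1, y) ⟨hz.1, hy⟩) hz.2

lemma eventually_subset_interior_table (P : SteepExpPotential B) {s : ℝ → ℝ}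
    (hs : Tendsto s 𝓝₀ (𝓝 0)) {K : Set (Config d)} (hK : IsCompact K)
    (hx : K ⊆ interior B.D) : ∀ᶠ ε in 𝓝₀, ∀ q ∈ K, q ∈ interior (P.table ε (s ε)) :=
  hK.eventually_forall_prod fun _ hq => P.eventually_mem_interior_table hs (hx hq)

lemma eventually_notMem_table (P : SteepExpPotential B) {s : ℝ → ℝ}
    (hs : Tendsto s 𝓝₀ (𝓝 0)) {x : Config d} (hx : x ∉ B.D) :
    ∀ᶠ z in 𝓝₀ ×ˢ 𝓝 x, z.2 ∉ P.table z.1 (s z.1) := by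
  have h1 : ∀ᶠ y in 𝓝 x, (∀ i, y ∈ P.Nbhd i → x ∈ closure (P.Nbhd i)) ∧ y ∉ B.D :=
    (P.eventually_mem_closure_Nbhd x).and (B.isClosed_D.isOpen_compl.mem_nhds hx)
  have h2 : ∀ᶠ z in 𝓝₀ ×ˢ 𝓝 x, ∀ i, x ∈ closure (P.Nbhd i) → P.Q z.1 z.2 < P.Qval i + s z.1 := by
    rw [eventually_all]
    intro i
    by_cases hi : x ∈ closure (P.Nbhd i)
    · have hc : x ∈ closure (P.Nbhd i) \ B.corner := ⟨hi, fun h => hx (B.corner_subset_D h)⟩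
      have h3 := (P.side i x hc).2.2 hx
      have h4 : Tendsto (fun z : ℝ × Config d => P.Qval i + s z.1) (𝓝₀ ×ˢ 𝓝 x)
          (𝓝 (P.Qval i + 0)) := (hs.comp tendsto_fst).const_add _
      rw [add_zero] at h4
      exact (((P.tendsto_Q (P.closure_Nbhd_subset i hc)).eventually_lt h4 h3).mono fun z hz _ => hz)
    · exact .of_forall fun z h => absurd h hi
  filter_upwards [h2, h1.prod_inr _] with z hz hz' hmem
  rcases hmem.1 with h | ⟨i, hi⟩
  · exact hz'.2 h
  · exact absurd (hmem.2 i hi) (not_le.2 (hz i (hz'.1 i hi)))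

/-- `O` is a set near a smooth piece of the boundary, on which the tables are the superlevel sets of
the pattern function. -/
structure IsPatch (P : SteepExpPotential B) (j : Fin B.pieces) (O : Set (Config d)) : Prop where
  subset : O ⊆ P.Nbhd j
  notMem_corner : ∀ x ∈ O, x ∉ B.corner
  Qval_eq : ∀ i, ∀ x ∈ O, x ∈ P.Nbhd i → P.Qval i = P.Qval j
  lip : ∃ L, ∀ᶠ ε in 𝓝₀, LipschitzOnWith L (iteratedFDeriv ℝ (r + 1) (P.Q ε)) O

lemma IsPatch.mono {j : Fin B.pieces} {O O' : Set (Config d)} (h : P.IsPatch j O)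
    (hO : O' ⊆ O) : P.IsPatch j O' :=
  ⟨hO.trans h.subset, fun x hx => h.notMem_corner x (hO hx), fun i x hx => h.Qval_eq i x (hO hx),
    h.lip.imp fun _ hL => hL.mono fun _ h => h.mono hO⟩

lemma exists_isPatch (P : SteepExpPotential B) {q : Config d} (hq : q ∈ frontier B.D \ B.corner) :
    ∃ j, P.Q 0 q = P.Qval j ∧ ∃ R > 0, P.IsPatch j (closedBall q R) := by
  obtain ⟨j, hj⟩ := mem_iUnion.1 (B.frontier_D ▸ hq.1)
  have hQ := P.levelSet j q ⟨hj, hq.2⟩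
  have hN := P.subset_Nbhd j ⟨hj, hq.2⟩
  have hDt := P.closure_Nbhd_subset j ⟨subset_closure hN, hq.2⟩
  obtain ⟨L, s, hs, hL⟩ := P.lipschitz_Q q hDt
  have hev : ∀ᶠ x in 𝓝 q, x ∈ P.Nbhd j ∧ x ∉ B.corner ∧
      (∀ i, x ∈ P.Nbhd i → q ∈ closure (P.Nbhd i)) ∧ x ∈ s := by
    filter_upwards [(P.isOpen_Nbhd j).mem_nhds hN, B.isClosed_corner.isOpen_compl.mem_nhds hq.2,
      P.eventually_mem_closure_Nbhd q, hs] with x h1 h2 h3 h4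
    exact ⟨h1, h2, h3, h4⟩
  obtain ⟨R, hR, hsub⟩ := nhds_basis_closedBall.eventually_iff.1 hev
  refine ⟨j, hQ, R, hR, fun x hx => (hsub hx).1, fun x hx => (hsub hx).2.1, fun i x hx hi => ?_,
    L, hL.mono fun ε h => h.mono fun x hx => (hsub hx).2.2.2⟩
  have hqi : q ∈ closure (P.Nbhd i) \ B.corner := ⟨(hsub hx).2.2.1 i hi, hq.2⟩
  have h1 := P.side i q hqi
  have h2 : ¬ P.Qval i < P.Q 0 q := fun h => hq.1.2 (h1.1.1 h)
  have h3 : ¬ P.Q 0 q < P.Qval i := fun h => h1.2.1 h (B.isClosed_D.frontier_subset hq.1)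
  rw [← hQ]
  exact le_antisymm (not_lt.1 h3) (not_lt.1 h2)

section Patch

variable {j : Fin B.pieces} {O : Set (Config d)}

lemma IsPatch.subset_Dt (h : P.IsPatch j O) : O ⊆ P.Dt := fun x hx =>
  P.closure_Nbhd_subset j ⟨subset_closure (h.subset hx), h.notMem_corner x hx⟩

lemma IsPatch.mem_table (h : P.IsPatch j O) {x : Config d} (hx : x ∈ O) (ε s : ℝ) :
    x ∈ P.table ε s ↔ P.Qval j + s ≤ P.Q ε x :=
  ⟨fun h1 => h1.2 j (h.subset hx), fun h1 => ⟨Or.inr ⟨j, h.subset hx⟩, fun i hi => by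
    rwa [h.Qval_eq i x hx hi]⟩⟩

lemma IsPatch.eventually_mem_table (h : P.IsPatch j O) {x : Config d} (hx : O ∈ 𝓝 x) (ε s : ℝ) :
    ∀ᶠ y in 𝓝 x, y ∈ P.table ε s ↔ P.Qval j + s ≤ P.Q ε y :=
  mem_of_superset hx fun _ hy => h.mem_table hy ε s

lemma IsPatch.contDiffAt (h : P.IsPatch j O) {x : Config d} (hx : x ∈ O) {ε : ℝ}
    (hε : ε ∈ Ico 0 P.ε₁) : 𝒞 (r + 1 : ℕ) (P.Q ε) x :=
  P.contDiffAt_Q hε (h.subset_Dt hx)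

lemma IsPatch.differentiableAt (h : P.IsPatch j O) {x : Config d} (hx : x ∈ O) {ε : ℝ}
    (hε : ε ∈ Ico 0 P.ε₁) : DifferentiableAt ℝ (P.Q ε) x :=
  (h.contDiffAt hx hε).differentiableAt (by norm_cast)

lemma IsPatch.eventually_differentiableAt (h : P.IsPatch j O) {x : Config d} (hx : O ∈ 𝓝 x)
    {ε : ℝ} (hε : ε ∈ Ico 0 P.ε₁) : ∀ᶠ y in 𝓝 x, DifferentiableAt ℝ (P.Q ε) y :=
  mem_of_superset hx fun _ hy => h.differentiableAt hy hε

lemma IsPatch.gradient_ne (h : P.IsPatch j O) {x : Config d} (hx : x ∈ O) {ε : ℝ}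
    (hε : ε ∈ Ico 0 P.ε₁) : ∇ (P.Q ε) x ≠ 0 :=
  P.gradient_ne j ε hε x (h.subset hx)

lemma IsPatch.mem_interior (h : P.IsPatch j O) {x : Config d} (hx : O ∈ 𝓝 x) {ε s : ℝ}
    (hε : ε ∈ Ico 0 P.ε₁) (hQ : P.Qval j + s < P.Q ε x) : x ∈ interior (P.table ε s) :=
  mem_interior_of_lt (h.eventually_mem_table hx ε s)
    (h.differentiableAt (mem_of_mem_nhds hx) hε).continuousAt hQ

lemma IsPatch.mem_frontier (h : P.IsPatch j O) {x : Config d} (hx : O ∈ 𝓝 x) {ε s : ℝ}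
    (hε : ε ∈ Ico 0 P.ε₁) (hQ : P.Q ε x = P.Qval j + s) : x ∈ frontier (P.table ε s) :=
  mem_frontier_of_eq (h.eventually_mem_table hx ε s) (h.eventually_differentiableAt hx hε) hQ
    (h.gradient_ne (mem_of_mem_nhds hx) hε)

lemma IsPatch.notMem_closure (h : P.IsPatch j O) {x : Config d} (hx : O ∈ 𝓝 x) {ε s : ℝ}
    (hε : ε ∈ Ico 0 P.ε₁) (hQ : P.Q ε x < P.Qval j + s) : x ∉ closure (P.table ε s) :=
  notMem_closure_of_lt (h.eventually_mem_table hx ε s)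
    (h.differentiableAt (mem_of_mem_nhds hx) hε).continuousAt hQ

lemma IsPatch.eq_of_mem_frontier (h : P.IsPatch j O) {x : Config d} (hx : O ∈ 𝓝 x) {ε s : ℝ}
    (hε : ε ∈ Ico 0 P.ε₁) (hf : x ∈ frontier (P.table ε s)) : P.Q ε x = P.Qval j + s := by
  rcases lt_trichotomy (P.Q ε x) (P.Qval j + s) with h1 | h1 | h1
  · exact absurd (frontier_subset_closure hf) (h.notMem_closure hx hε h1)
  · exact h1
  · exact absurd (h.mem_interior hx hε h1) hf.2

lemma IsPatch.isInwardNormal (h : P.IsPatch j O) {x : Config d} (hx : O ∈ 𝓝 x) {ε s : ℝ}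
    (hε : ε ∈ Ico 0 P.ε₁) (hQ : P.Q ε x = P.Qval j + s) : IsInwardNormal (P.table ε s) x
      (‖∇ (P.Q ε) x‖⁻¹ • ∇ (P.Q ε) x) :=
  isInwardNormal_gradient (h.eventually_mem_table hx ε s) (h.eventually_differentiableAt hx hε) hQ
    (h.gradient_ne (mem_of_mem_nhds hx) hε)

lemma IsPatch.mem_D (h : P.IsPatch j O) {x : Config d} (hx : x ∈ O) :
    x ∈ B.D ↔ P.Qval j ≤ P.Q 0 x := by
  have := (P.side j x ⟨subset_closure (h.subset hx), h.notMem_corner x hx⟩).2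
  rw [← not_lt, this, not_not]

lemma IsPatch.mem_interior_D (h : P.IsPatch j O) {x : Config d} (hx : x ∈ O) :
    x ∈ interior B.D ↔ P.Qval j < P.Q 0 x :=
  (P.side j x ⟨subset_closure (h.subset hx), h.notMem_corner x hx⟩).1.symm

lemma IsPatch.isInwardNormal_D (h : P.IsPatch j O) {x : Config d} (hx : O ∈ 𝓝 x)
    (hQ : P.Q 0 x = P.Qval j) : IsInwardNormal B.D x
      (‖∇ (P.Q 0) x‖⁻¹ • ∇ (P.Q 0) x) :=
  isInwardNormal_gradient (mem_of_superset hx fun _ hy => h.mem_D hy)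
    (h.eventually_differentiableAt hx ⟨le_rfl, P.ε₁_pos⟩) hQ
    (h.gradient_ne (mem_of_mem_nhds hx) ⟨le_rfl, P.ε₁_pos⟩)

lemma exists_bound_iteratedFDeriv_Q (P : SteepExpPotential B) {K : Set (Config d)}
    (hK : IsCompact K) (hKD : K ⊆ P.Dt) : ∃ C ≥ 0, ∀ᶠ ε in 𝓝₀, ∀ k ≤ r + 1, ∀ x ∈ K,
      ‖iteratedFDeriv ℝ k (P.Q ε) x‖ ≤ C := by
  have h1 : ∀ k ≤ r + 1, ∃ C, ∀ z ∈ Icc 0 (P.ε₁ / 2) ×ˢ K,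
      ‖iteratedFDeriv ℝ k (P.Q z.1) z.2‖ ≤ C := fun k hk =>
    (isCompact_Icc.prod hK).exists_bound_of_continuousOn
      (f := fun z : ℝ × Config d => iteratedFDeriv ℝ k (P.Q z.1) z.2)
      ((P.continuous_Q k hk).mono (prod_mono
        (fun x hx => ⟨hx.1, lt_of_le_of_lt hx.2 (half_lt_self P.ε₁_pos)⟩) hKD))
  choose! C hC using h1
  refine ⟨∑ k ∈ Finset.range (r + 2), |C k|, Finset.sum_nonneg fun _ _ => abs_nonneg _, ?_⟩
  filter_upwards [Ioo_mem_nhdsGT (half_pos P.ε₁_pos)] with ε hε k hk x hx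
  refine (hC k hk (ε, x) ⟨⟨hε.1.le, hε.2.le⟩, hx⟩).trans ((le_abs_self _).trans ?_)
  exact Finset.single_le_sum (f := fun k => |C k|) (fun _ _ => abs_nonneg _)
    (Finset.mem_range.2 (by omega))

lemma IsPatch.cRel_gradient {q : Config d} {R : ℝ} (h : P.IsPatch j (closedBall q R))
    {κ : ℝ → ℝ} (hκ : ∀ᶠ ε in 𝓝₀, 0 ≤ κ ε) (hκ1 : ∀ᶠ ε in 𝓝₀, κ ε ≤ 1) :
    CRel 𝓝₀ κ r (fun ε => ∇ (P.Q ε)) (fun ε => ∇ (P.Q ε))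
      (fun _ => closedBall q R) (fun _ => closedBall q R) := by
  obtain ⟨C, hC0, hC⟩ := P.exists_bound_iteratedFDeriv_Q (isCompact_closedBall q R) h.subset_Dt
  obtain ⟨L, hL⟩ := h.lip
  have hc : ∀ᶠ ε in 𝓝₀, ∀ x ∈ closedBall q R, 𝒞 r (fderiv ℝ (P.Q ε)) x :=
    P.eventually_lt.mono fun ε hε x hx =>
      (h.contDiffAt hx (Ioo_subset_Ico_self hε)).fderiv_right (by norm_cast)
  have key : CRel 𝓝₀ κ r (fun ε => fderiv ℝ (P.Q ε)) (fun ε => fderiv ℝ (P.Q ε))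
      (fun _ => closedBall q R) (fun _ => closedBall q R) := by
    refine CRel.of_iteratedFDeriv (C := C + L) (R := ‖q‖ + R) hc hc (fun k hk => ?_)
      (.of_forall fun _ x hx => ?_) hκ hκ1 (.of_forall fun _ => subset_rfl)
    · filter_upwards [hC, hL, hκ, P.eventually_lt] with ε h1 h2 h3 h4
      refine ⟨fun x hx => ?_, fun x hx y hy => ?_⟩
      · rw [norm_iteratedFDeriv_fderiv]
        exact (h1 _ (by omega) x hx).trans (by simp)
      · rw [← norm_iteratedFDeriv_succ_sub]
        rcases hk.lt_or_eq with hk | rfl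
        · have h5 := (convex_closedBall q R).norm_image_sub_le_of_norm_fderiv_le (𝕜 := ℝ)
            (f := iteratedFDeriv ℝ (k + 1) (P.Q ε)) (C := C)
            (fun z hz => (h.contDiffAt hz
              (Ioo_subset_Ico_self h4)).differentiableAt_iteratedFDeriv (by
                exact_mod_cast Nat.succ_lt_succ hk))
            (fun z hz => by
              rw [norm_fderiv_iteratedFDeriv]
              exact h1 _ (by omega) z hz) hy hx
          have := L.2
          have := norm_nonneg (x - y)
          refine h5.trans ?_
          gcongr
          · simp
          · linarith
        · have h5 := h2.dist_le_mul x hx y hy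
          rw [dist_eq_norm, dist_eq_norm] at h5
          refine h5.trans ?_
          have := L.2
          gcongr
          · simpa using hC0
          · linarith
    · rw [mem_closedBall_zero_iff]
      rw [mem_closedBall, dist_eq_norm] at hx
      linarith [norm_le_norm_sub_add (a := x) (b := q)]
  exact key.clm_left (dualIso d).toContinuousLinearEquiv.toContinuousLinearMap hκ

lemma IsPatch.gradient_V (h : P.IsPatch j O) {x : Config d} (hx : x ∈ O) {ε : ℝ}
    (hε : ε ∈ Ioo 0 P.ε₁) :
    ∇ (P.V ε) x = -((exp (-(P.Q ε x - P.Qval j) / ε) / ε) • ∇ (P.Q ε) x) := by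
  have h1 : P.V ε =ᶠ[𝓝 x] fun y => exp (-(P.Q ε y - P.Qval j) / ε) :=
    mem_of_superset ((P.isOpen_Nbhd j).mem_nhds (h.subset hx)) (P.barrier j ε hε)
  have h2 := (h.differentiableAt hx (Ioo_subset_Ico_self hε)).hasFDerivAt
  have h3 := ((h2.sub_const (P.Qval j)).neg.const_smul ε⁻¹).exp
  have h4 : fderiv ℝ (P.V ε) x =
      -((exp (-(P.Q ε x - P.Qval j) / ε) / ε) • fderiv ℝ (P.Q ε) x) := by
    rw [h1.fderiv_eq]
    refine HasFDerivAt.fderiv (h3.congr_of_eventuallyEq ?_ |>.congr_fderiv ?_)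
    · refine .of_forall fun y => ?_
      simp only [smul_eq_mul, Pi.smul_apply, Pi.neg_apply]
      ring_nf
    · ext v
      simp
      ring_nf
  rw [← dualIso_fderiv, ← dualIso_fderiv, h4, map_neg, map_smul]

lemma contDiffAt_V (P : SteepExpPotential B) {ε : ℝ} (hε : ε ∈ Ioo 0 P.ε₁) {x : Config d}
    (hx : x ∈ P.domain) : 𝒞 (r + 1 : ℕ) (P.V ε) x :=
  (P.contDiff_V ε hε).contDiffAt ((isOpen_interior.union (isOpen_iUnion P.isOpen_Nbhd)).mem_nhds hx)

lemma mem_domain_of_mem_table {ε s : ℝ} {x : Config d} (hx : x ∈ P.table ε s)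
    (hc : x ∉ B.corner) : x ∈ P.domain := by
  rcases hx.1 with h | ⟨i, hi⟩
  · by_cases hx' : x ∈ interior B.D
    · exact Or.inl hx'
    · have : x ∈ frontier B.D := ⟨subset_closure h, hx'⟩
      obtain ⟨i, hi⟩ := mem_iUnion.1 (B.frontier_D ▸ this)
      exact Or.inr (mem_iUnion.2 ⟨i, P.subset_Nbhd i ⟨hi, hc⟩⟩)
  · exact Or.inr (mem_iUnion.2 ⟨i, hi⟩)

lemma IsPatch.subset_domain (h : P.IsPatch j O) : O ⊆ P.domain := fun _ hx =>
  Or.inr (mem_iUnion.2 ⟨j, h.subset hx⟩)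

lemma IsPatch.exists_bound_iteratedFDeriv_V {q : Config d} {R : ℝ}
    (h : P.IsPatch j (closedBall q R)) : ∃ K, ∀ᶠ ε in 𝓝₀,
      ∀ x ∈ ball q R, P.Q ε x = P.Qval j + deltaExp r ε →
        ∀ l ≤ r + 1, ‖iteratedFDeriv ℝ l (P.V ε) x‖ ≤ K * nuExp r ε := by
  obtain ⟨C, hC0, hC⟩ := P.exists_bound_iteratedFDeriv_Q (isCompact_closedBall q R) h.subset_Dt
  set D := max C 1 with hD
  have hD1 : 1 ≤ D := le_max_right _ _
  refine ⟨(r + 1).factorial * D ^ (r + 1), ?_⟩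
  filter_upwards [hC, P.eventually_lt, eventually_lt_one] with ε h1 h2 h3 x hx hQ l hl
  have hε := h2.1
  set f : Config d → ℝ := fun y => -ε⁻¹ • (P.Q ε y - P.Qval j) with hf
  have hV : P.V ε =ᶠ[𝓝 x] exp ∘ f := by
    filter_upwards [(P.isOpen_Nbhd j).mem_nhds (h.subset (ball_subset_closedBall hx))] with y hy
    rw [P.barrier j ε h2 y hy]
    simp only [hf, comp_apply, smul_eq_mul]
    ring_nf
  rw [(hV.iteratedFDeriv ℝ l).eq_of_nhds]
  have hcd : ∀ y ∈ ball q R, 𝒞 (r + 1 : ℕ) (P.Q ε) y :=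
    fun y hy => h.contDiffAt (ball_subset_closedBall hy) (Ioo_subset_Ico_self h2)
  have hfc : ∀ y ∈ ball q R, 𝒞 (r + 1 : ℕ) f y :=
    fun y hy => ((hcd y hy).sub contDiffAt_const).const_smul (-ε⁻¹)
  have hval : exp (f x) = ε ^ (r + 1) * nuExp r ε := by
    rw [← exp_neg_deltaExp hε]
    congr 1
    simp only [hf, hQ, smul_eq_mul]
    field_simp
    ring
  have key := norm_iteratedFDerivWithin_comp_le (𝕜 := ℝ) (g := exp) (f := f) (n := l)
    (s := ball q R) (t := univ) (N := (r + 1 : ℕ)) (x := x)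
    (C := ε ^ (r + 1) * nuExp r ε) (D := D / ε)
    Real.contDiff_exp.contDiffOn (fun y hy => (hfc y hy).contDiffWithinAt) (by exact_mod_cast hl)
    uniqueDiffOn_univ isOpen_ball.uniqueDiffOn (mapsTo_univ _ _) hx
    (fun i _ => by
      rw [iteratedFDerivWithin_univ, norm_iteratedFDeriv_eq_norm_iteratedDeriv,
          iteratedDeriv_eq_iterate,
        Real.iter_deriv_exp, Real.norm_of_nonneg (Real.exp_pos _).le, hval])
    (fun i hi1 hi => by
      rw [iteratedFDerivWithin_of_isOpen i isOpen_ball hx]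
      obtain ⟨i, rfl⟩ : ∃ k, i = k + 1 := ⟨i - 1, by omega⟩
      have e1 : iteratedFDeriv ℝ (i + 1) f x =
          (-ε⁻¹) • iteratedFDeriv ℝ (i + 1) (fun y => P.Q ε y - P.Qval j) x :=
        iteratedFDeriv_const_smul_apply (a := -ε⁻¹) (f := fun y => P.Q ε y - P.Qval j)
          (((hcd x hx).sub contDiffAt_const).of_le (by exact_mod_cast hi.trans hl))
      have e2 : ‖iteratedFDeriv ℝ (i + 1) (fun y => P.Q ε y - P.Qval j) x‖ =
          ‖iteratedFDeriv ℝ (i + 1) (P.Q ε) x‖ := by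
        rw [← norm_iteratedFDeriv_fderiv, ← norm_iteratedFDeriv_fderiv]
        congr 2
        ext y
        rw [fderiv_sub_const]
      rw [e1, norm_smul, e2, norm_neg, norm_inv, Real.norm_of_nonneg hε.le]
      have a1 := h1 (i + 1) (hi.trans hl) x (ball_subset_closedBall hx)
      have a2 : 1 ≤ D / ε := by rw [one_le_div hε]; linarith
      calc ε⁻¹ * ‖iteratedFDeriv ℝ (i + 1) (P.Q ε) x‖ ≤ ε⁻¹ * D := by
            gcongr
            exact a1.trans (le_max_left _ _)
        _ = D / ε := by ring
        _ ≤ (D / ε) ^ (i + 1) := le_self_pow₀ a2 (by omega))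
  rw [iteratedFDerivWithin_of_isOpen l isOpen_ball hx] at key
  refine key.trans ?_
  have hν := nuExp_pos (r := r) hε
  calc (l.factorial : ℝ) * (ε ^ (r + 1) * nuExp r ε) * (D / ε) ^ l
      ≤ ((r + 1).factorial : ℝ) * (ε ^ (r + 1) * nuExp r ε) * (D / ε) ^ (r + 1) := by
        gcongr
        rw [one_le_div hε]
        linarith
    _ = (r + 1).factorial * D ^ (r + 1) * nuExp r ε := by
        rw [div_pow]
        field_simp

end Patch

lemma periodic_table (P : SteepExpPotential B) (ε s : ℝ) : IsPeriodicSet B.Λ (P.table ε s) := by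
  intro v hv x
  simp only [table, mem_ofPred_eq, B.periodic_D v hv x, P.periodic_Q ε v hv x,
    fun i => P.periodic_Nbhd i v hv x]

lemma periodic_frontier_table (P : SteepExpPotential B) (ε s : ℝ) :
    IsPeriodicSet B.Λ (frontier (P.table ε s)) := by
  intro v hv x
  have h1 := (Homeomorph.addRight v).preimage_frontier (P.table ε s)
  have h2 : (Homeomorph.addRight v) ⁻¹' P.table ε s = P.table ε s := by
    ext y
    exact P.periodic_table ε s v hv y
  rw [h2] at h1
  exact Set.ext_iff.1 h1 x

lemma iteratedFDeriv_V_add (P : SteepExpPotential B) (ε : ℝ) {v : Config d} (hv : v ∈ B.Λ)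
    (l : ℕ) (x : Config d) :
    iteratedFDeriv ℝ l (P.V ε) (x + v) = iteratedFDeriv ℝ l (P.V ε) x := by
  rw [← iteratedFDeriv_comp_add_right]
  congr 1
  ext y
  exact P.periodic_V ε v hv y

lemma exists_compact_cover (P : SteepExpPotential B) : ∃ K : Set (Config d), IsCompact K ∧
    ∀ ε s, ∀ x ∈ closure (P.table ε s), ∃ v ∈ B.Λ, x + v ∈ K := by
  obtain ⟨K₀, hK₀, h₀⟩ := B.compact_D
  choose K hK h using P.compact_Nbhd
  have hc : IsCompact (K₀ ∪ ⋃ i, K i) := hK₀.union (isCompact_iUnion hK)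
  refine ⟨Metric.cthickening 1 (K₀ ∪ ⋃ i, K i), hc.cthickening, fun ε s x hx => ?_⟩
  obtain ⟨y, hy, hxy⟩ := Metric.mem_closure_iff.1 hx 1 one_pos
  have h1 : ∃ v ∈ B.Λ, y + v ∈ K₀ ∪ ⋃ i, K i := by
    rcases hy.1 with h2 | ⟨i, hi⟩
    · obtain ⟨v, hv, hv'⟩ := h₀ y h2
      exact ⟨v, hv, Or.inl hv'⟩
    · obtain ⟨v, hv, hv'⟩ := h i y hi
      exact ⟨v, hv, Or.inr (mem_iUnion.2 ⟨i, hv'⟩)⟩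
  obtain ⟨v, hv, hv'⟩ := h1
  refine ⟨v, hv, Metric.mem_cthickening_of_dist_le _ (y + v) _ _ hv' ?_⟩
  rw [dist_add_right]
  exact hxy.le

lemma exists_bound_frontier (P : SteepExpPotential B) {c : ℝ} (hc : 0 < c) :
    ∃ K, ∀ᶠ ε in 𝓝₀, ∀ q ∈ frontier (P.intTable ε) \ thickening c B.corner,
      ∀ l ≤ r + 1, ‖iteratedFDeriv ℝ l (P.V ε) q‖ ≤ K * nuExp r ε := by
  obtain ⟨S, hS, hcov⟩ := P.exists_compact_cover
  have key : ∃ K, ∀ᶠ ε in 𝓝₀, ∀ q ∈ S, q ∈ frontier (P.intTable ε) \ thickening c B.corner →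
      ∀ l ≤ r + 1, ‖iteratedFDeriv ℝ l (P.V ε) q‖ ≤ K * nuExp r ε := by
    refine hS.induction_on (p := fun S => ∃ K, ∀ᶠ ε in 𝓝₀, ∀ q ∈ S,
      q ∈ frontier (P.intTable ε) \ thickening c B.corner →
      ∀ l ≤ r + 1, ‖iteratedFDeriv ℝ l (P.V ε) q‖ ≤ K * nuExp r ε) ⟨0, by simp⟩
      (fun S T hST ⟨K, hK⟩ => ⟨K, hK.mono fun ε h q hq => h q (hST hq)⟩) ?_ fun x _ => ?_
    · rintro S T ⟨K, hK⟩ ⟨K', hK'⟩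
      refine ⟨max K K', ?_⟩
      filter_upwards [hK, hK', eventually_mem_nhdsWithin] with ε h1 h2 h3 q hq hq' l hl
      have hν := (nuExp_pos (r := r) h3).le
      rcases hq with hq | hq
      · exact (h1 q hq hq' l hl).trans (mul_le_mul_of_nonneg_right (le_max_left _ _) hν)
      · exact (h2 q hq hq' l hl).trans (mul_le_mul_of_nonneg_right (le_max_right _ _) hν)
    · have hnone : (∀ᶠ z in 𝓝₀ ×ˢ 𝓝 x, z.2 ∉ frontier (P.intTable z.1) \ thickening c B.corner) →
          ∃ t ∈ 𝓝[S] x, ∃ K, ∀ᶠ ε in 𝓝₀, ∀ q ∈ t,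
            q ∈ frontier (P.intTable ε) \ thickening c B.corner →
            ∀ l ≤ r + 1, ‖iteratedFDeriv ℝ l (P.V ε) q‖ ≤ K * nuExp r ε := fun h => by
        obtain ⟨u, hu, v, hv, huv⟩ := mem_prod_iff.1 h
        exact ⟨v, mem_nhdsWithin_of_mem_nhds hv, 0, mem_of_superset hu fun ε hε q hq hq' =>
          absurd hq' (@huv (ε, q) ⟨hε, hq⟩)⟩
      by_cases h1 : x ∈ B.corner
      · have h2 : ∀ᶠ y in 𝓝 x, y ∈ thickening c B.corner :=
          Metric.isOpen_thickening.mem_nhds (self_subset_thickening hc B.corner h1)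
        exact hnone ((h2.prod_inr _).mono fun z hz hz' => hz'.2 hz)
      by_cases h2 : x ∈ interior B.D
      · exact hnone ((P.eventually_mem_interior_table tendsto_deltaExp h2).mono
          fun z hz hz' => hz'.1.2 hz)
      by_cases h3 : x ∈ B.D
      · obtain ⟨j, -, R, hR, hp⟩ := P.exists_isPatch ⟨⟨subset_closure h3, h2⟩, h1⟩
        obtain ⟨K, hK⟩ := hp.exists_bound_iteratedFDeriv_V
        refine ⟨ball x R, mem_nhdsWithin_of_mem_nhds (ball_mem_nhds x hR), K, ?_⟩
        filter_upwards [hK, P.eventually_lt] with ε h4 h5 q hq hq' l hl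
        refine h4 q hq ?_ l hl
        exact hp.eq_of_mem_frontier (mem_of_superset (isOpen_ball.mem_nhds hq)
          ball_subset_closedBall) (Ioo_subset_Ico_self h5) hq'.1
      · refine hnone ?_
        obtain ⟨u, hu, v, hv, huv⟩ := mem_prod_iff.1
          (P.eventually_notMem_table (tendsto_deltaExp (r := r)) h3)
        refine mem_prod_iff.2 ⟨u, hu, interior v, interior_mem_nhds.2 hv, fun z hz hz' => ?_⟩
        obtain ⟨y, hy, hy'⟩ := mem_closure_iff.1 hz'.1.1 (interior v) isOpen_interior hz.2
        exact @huv (z.1, y) ⟨hz.1, interior_subset hy⟩ hy'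
  obtain ⟨K, hK⟩ := key
  refine ⟨K, hK.mono fun ε h q hq l hl => ?_⟩
  obtain ⟨v, hv, hv'⟩ := hcov ε (deltaExp r ε) q (frontier_subset_closure hq.1)
  rw [← P.iteratedFDeriv_V_add ε hv]
  refine h _ hv' ⟨(P.periodic_frontier_table ε _ v hv q).2 hq.1, fun hth => hq.2 ?_⟩ l hl
  rw [Metric.mem_thickening_iff] at hth ⊢
  obtain ⟨z, hz, hz'⟩ := hth
  refine ⟨z - v, (B.periodic_corner v hv _).1 (by simpa using hz), ?_⟩
  rwa [← dist_add_right _ _ v, sub_add_cancel]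

lemma BoundaryDominated.exists_bound (hP : P.BoundaryDominated) {c : ℝ} (hc : 0 < c) :
    ∃ K, ∀ᶠ ε in 𝓝₀, ∀ q ∈ P.intTable ε \ thickening c B.corner,
      ∀ l, 1 ≤ l → l ≤ r + 1 → ‖iteratedFDeriv ℝ l (P.V ε) q‖ ≤ K * nuExp r ε := by
  obtain ⟨c', h1, h2⟩ := (hP.and_eventually (Ioo_mem_nhdsGT hc)).exists
  obtain ⟨K, hK⟩ := P.exists_bound_frontier h2.1
  refine ⟨K ⊔ 0, ?_⟩
  filter_upwards [h1, hK, eventually_mem_nhdsWithin] with ε h3 h4 h5 q hq l hl hl'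
  have hν := (nuExp_pos (r := r) h5).le
  have hq' : q ∈ P.intTable ε \ thickening c' B.corner :=
    ⟨hq.1, fun h => hq.2 (Metric.thickening_mono h2.2.le _ h)⟩
  have h6 : ‖iteratedFDeriv ℝ l (P.V ε) q‖ₑ ≤
      P.derivSup ε (P.intTable ε \ thickening c' B.corner) :=
    le_iSup₂_of_le q hq' (le_iSup₂_of_le l ⟨hl, hl'⟩ le_rfl)
  have h7 : P.derivSup ε (frontier (P.intTable ε) \ thickening c' B.corner) ≤
      ENNReal.ofReal ((K ⊔ 0) * nuExp r ε) := by
    refine iSup₂_le fun q hq => iSup₂_le fun l hl => ?_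
    rw [← ofReal_norm]
    refine ENNReal.ofReal_le_ofReal ((h4 q hq l hl.2).trans ?_)
    gcongr
    exact le_sup_left
  rw [← h3, ← ofReal_norm] at *
  have h8 := h6.trans h7
  exact (ENNReal.ofReal_le_ofReal_iff (mul_nonneg le_sup_right hν)).1 h8

lemma BoundaryDominated.cRel_gradient (hP : P.BoundaryDominated) {c : ℝ} (hc : 0 < c)
    {ι : Type} {l : Filter ι} {e : ι → ℝ} (he : Tendsto e l 𝓝₀) {A : ι → Set (Config d)}
    (hA : ∀ᶠ i in l, A i ⊆ P.intTable (e i) \ thickening c B.corner) {R : ℝ}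
    {A' : ι → Set (Config d)} (hA' : ∀ᶠ i in l, A i ⊆ A' i)
    (hR : ∀ᶠ i in l, A' i ⊆ closedBall 0 R) :
    CRel l (fun i => nuExp r (e i)) r (fun i q => -∇ (P.V (e i)) q) (fun _ _ => 0) A A' := by
  obtain ⟨K, hK⟩ := hP.exists_bound hc
  have hpos : ∀ᶠ i in l, 0 ≤ nuExp r (e i) :=
    (he.eventually eventually_mem_nhdsWithin).mono fun i hi => (nuExp_pos hi).le
  have h1 : CRel l (fun i => nuExp r (e i)) r (fun i => fderiv ℝ (P.V (e i)))
      (fun _ _ => 0) A A' := by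
    refine CRel.of_iteratedFDeriv (C := K ⊔ 0) (R := R) ?_
      (.of_forall fun _ _ _ => contDiffAt_const) (fun j hj => ?_) hR hpos
      ((tendsto_nuExp.comp he).eventually_le_const one_pos) hA'
    · filter_upwards [hA, he.eventually P.eventually_lt] with i hi hi' x hx
      refine (P.contDiffAt_V hi' (mem_domain_of_mem_table (hi hx).1 fun h =>
        (hi hx).2 (self_subset_thickening hc _ h))).fderiv_right (by norm_cast)
    · filter_upwards [hA, he.eventually hK, hpos] with i hi hi' h0
      have hz : ∀ x, iteratedFDeriv ℝ j (fun _ : Config d => (0 : Config d →L[ℝ] ℝ)) x = 0 := by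
        intro x
        rcases j with _ | j
        · ext
          simp
        · rw [iteratedFDeriv_const_of_ne (by omega)]
          rfl
      refine ⟨fun x _ => by rw [hz]; simp, fun x hx x' _ => ?_⟩
      rw [hz, sub_zero, norm_iteratedFDeriv_fderiv]
      refine (hi' x (hi hx) (j + 1) (by omega) (by omega)).trans ?_
      have := norm_nonneg (x - x')
      calc K * nuExp r (e i) ≤ (K ⊔ 0) * nuExp r (e i) := by gcongr; exact le_sup_left
        _ ≤ _ := by
          gcongr
          linarith
  have h2 := h1.clm_left (-(dualIso d).toContinuousLinearEquiv.toContinuousLinearMap) hpos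
  refine h2.congr (.of_forall fun i x _ => .of_forall fun y => ?_)
    (.of_forall fun i x _ => .of_forall fun y => ?_)
  · rfl
  · simp

end SteepExpPotential

/-! ### Reparametrization of orbits -/

section Reparam

variable {E : Type} [NormedAddCommGroup E] [NormedSpace ℝ E]

lemma eq_add_of_hasDerivWithinAt {f : ℝ → E} {c : E} {a b : ℝ}
    (h : ∀ s ∈ Icc a b, HasDerivWithinAt f c (Icc a b) s) {s : ℝ} (hs : s ∈ Icc a b) :
    f s = f a + (s - a) • c := by
  have h1 : ∀ t ∈ Icc a b, HasDerivWithinAt (fun t => f t - (t - a) • c) 0 (Icc a b) t := by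
    intro t ht
    have := (h t ht).sub (((hasDerivWithinAt_id t (Icc a b)).sub_const a).smul_const c)
    rwa [one_smul, sub_self] at this
  have h2 := (convex_Icc a b).norm_image_sub_le_of_norm_hasDerivWithin_le (C := 0) h1
    (fun t _ => by simp) ⟨le_rfl, hs.1.trans hs.2⟩ hs
  rw [zero_mul, norm_le_zero_iff, sub_eq_zero] at h2
  rw [sub_self, zero_smul, sub_zero] at h2
  rw [← h2]
  abel

lemma eq_of_hasDerivWithinAt_zero {f : ℝ → E} {a b : ℝ}
    (h : ∀ s ∈ Icc a b, HasDerivWithinAt f 0 (Icc a b) s) {s : ℝ} (hs : s ∈ Icc a b) :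
    f s = f a := by
  simpa using eq_add_of_hasDerivWithinAt h hs

lemma sub_lt_of_hasDerivWithinAt {f f' : ℝ → ℝ} {a b : ℝ} {c : ℝ}
    (h : ∀ s ∈ Icc a b, HasDerivWithinAt f (f' s) (Icc a b) s) (hc : ∀ s ∈ Icc a b, c ≤ f' s)
    {s s' : ℝ} (hs : s ∈ Icc a b) (hs' : s' ∈ Icc a b) (hss : s ≤ s') :
    c * (s' - s) ≤ f s' - f s := by
  have hD : ∀ x ∈ interior (Icc a b), HasDerivAt f (f' x) x := fun x hx =>
    (h x (interior_subset hx)).hasDerivAt (mem_interior_iff_mem_nhds.1 hx)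
  exact (convex_Icc a b).mul_sub_le_image_sub_of_le_deriv (fun x hx => (h x hx).continuousWithinAt)
    (fun x hx => (hD x hx).differentiableAt.differentiableWithinAt)
    (fun x hx => by rw [(hD x hx).deriv]; exact hc x (interior_subset hx)) s hs s' hs' hss

lemma exists_reparam {ζ v : ℝ → E} {t c : ℝ → ℝ}
    (ht : ∀ s ∈ 𝕀, HasDerivWithinAt t (c s) 𝕀 s)
    (hcc : ContinuousOn c 𝕀) (hc : ∀ s ∈ 𝕀, 0 < c s)
    (hζ : ∀ s ∈ 𝕀, HasDerivWithinAt ζ (c s • v s) 𝕀 s) :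
    ∃ σ : ℝ → ℝ, (∀ s ∈ 𝕀, t s ∈ Icc (t 0) (t 1) ∧ σ (t s) = s) ∧
      (∀ τ ∈ Icc (t 0) (t 1), σ τ ∈ 𝕀 ∧ t (σ τ) = τ ∧
        HasDerivWithinAt (fun τ => ζ (σ τ)) (v (σ τ)) (Icc (t 0) (t 1)) τ) ∧
      StrictMonoOn t 𝕀 := by
  obtain ⟨m, hm, hmin⟩ := isCompact_Icc.exists_isMinOn (nonempty_Icc.2 zero_le_one) hcc
  have hc0 := hc m hm
  have hlow : ∀ s ∈ 𝕀, ∀ s' ∈ 𝕀, s ≤ s' → c m * (s' - s) ≤ t s' - t s :=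
    fun s hs s' hs' => sub_lt_of_hasDerivWithinAt ht (fun x hx => hmin hx) hs hs'
  have hmono : StrictMonoOn t 𝕀 := fun s hs s' hs' hss => by
    have := hlow s hs s' hs' hss.le
    have := mul_pos hc0 (sub_pos.2 hss)
    linarith
  have htc : ContinuousOn t 𝕀 := fun s hs => (ht s hs).continuousWithinAt
  have hsurj : ∀ τ ∈ Icc (t 0) (t 1), ∃ s ∈ 𝕀, t s = τ := fun τ hτ =>
    intermediate_value_Icc zero_le_one htc hτ
  set σ := Function.invFunOn t 𝕀 with hσ
  have h1 : ∀ s ∈ 𝕀, σ (t s) = s := fun s hs => hmono.injOn.leftInvOn_invFunOn hs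
  have h2 : ∀ τ ∈ Icc (t 0) (t 1), σ τ ∈ 𝕀 ∧ t (σ τ) = τ := fun τ hτ =>
    ⟨Function.invFunOn_mem (hsurj τ hτ), Function.invFunOn_eq (hsurj τ hτ)⟩
  have hlip : ∀ τ ∈ Icc (t 0) (t 1), ∀ τ' ∈ Icc (t 0) (t 1), |σ τ - σ τ'| ≤ (c m)⁻¹ * |τ - τ'| := by
    have aux : ∀ τ ∈ Icc (t 0) (t 1), ∀ τ' ∈ Icc (t 0) (t 1), σ τ ≤ σ τ' →
        |σ τ - σ τ'| ≤ (c m)⁻¹ * |τ - τ'| := by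
      intro τ hτ τ' hτ' hle
      have h3 := hlow _ (h2 τ hτ).1 _ (h2 τ' hτ').1 hle
      rw [(h2 τ hτ).2, (h2 τ' hτ').2] at h3
      rw [abs_sub_comm, abs_of_nonneg (sub_nonneg.2 hle), abs_sub_comm, inv_mul_eq_div,
        le_div_iff₀' hc0]
      exact h3.trans (le_abs_self _)
    intro τ hτ τ' hτ'
    rcases le_total (σ τ) (σ τ') with h | h
    · exact aux τ hτ τ' hτ' h
    · rw [abs_sub_comm, abs_sub_comm τ]
      exact aux τ' hτ' τ hτ h
  have hσc : ContinuousOn σ (Icc (t 0) (t 1)) :=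
    (LipschitzOnWith.of_dist_le_mul (K := (c m)⁻¹.toNNReal) fun τ hτ τ' hτ' => by
      rw [Real.dist_eq, Real.dist_eq, Real.coe_toNNReal _ (inv_pos.2 hc0).le]
      exact hlip τ hτ τ' hτ').continuousOn
  refine ⟨σ, fun s hs => ⟨⟨hmono.monotoneOn (by simp) hs hs.1, hmono.monotoneOn hs (by simp) hs.2⟩,
    h1 s hs⟩, fun τ hτ => ⟨(h2 τ hτ).1, (h2 τ hτ).2, ?_⟩, hmono⟩
  have hcpos := hc _ (h2 τ hτ).1
  have h3 : HasDerivWithinAt σ (c (σ τ))⁻¹ (Icc (t 0) (t 1)) τ := by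
    have h5 : HasFDerivWithinAt t (ContinuousLinearEquiv.unitsEquivAut ℝ
        (Units.mk0 (c (σ τ)) hcpos.ne') : ℝ →L[ℝ] ℝ) 𝕀 (σ τ) :=
      (ht _ (h2 τ hτ).1).hasFDerivWithinAt.congr_fderiv (by ext; simp)
    have h4 := HasFDerivWithinAt.of_local_left_inverse (g := σ)
      (tendsto_nhdsWithin_iff.2 ⟨hσc τ hτ, eventually_mem_nhdsWithin.mono fun x hx => (h2 x hx).1⟩)
      h5 hτ (eventually_mem_nhdsWithin.mono fun x hx => (h2 x hx).2)
    exact (h4.congr_fderiv (g' := ContinuousLinearMap.toSpanSingleton ℝ (c (σ τ))⁻¹)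
      (by ext; simp)).hasDerivWithinAt.congr_deriv (by simp)
  have h4 := (hζ _ (h2 τ hτ).1).scomp τ h3 (fun x hx => (h2 x hx).1)
  rw [smul_smul, inv_mul_cancel₀ hcpos.ne', one_smul] at h4
  exact h4

end Reparam

lemma Filter.Eventually.exists_closedBall {ι X : Type} [PseudoMetricSpace X] {l : Filter ι} {x : X}
    {p : ι → X → Prop} (h : ∀ᶠ w in l ×ˢ 𝓝 x, p w.1 w.2) :
    ∃ d > 0, ∀ d' ≤ d, ∀ᶠ i in l, ∀ y ∈ closedBall x d', p i y := by
  obtain ⟨u, hu, v, hv, huv⟩ := mem_prod_iff.1 h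
  obtain ⟨d, hd, hd'⟩ := nhds_basis_closedBall.mem_iff.1 hv
  exact ⟨d, hd, fun d' hle => mem_of_superset hu fun i hi y hy =>
    @huv (i, y) ⟨hi, hd' (closedBall_subset_closedBall hle hy)⟩⟩

/-! ### The extended phase space -/

/-- States `((q, p), (t, L))`: a phase point, the time, and a parameter. -/
abbrev State (d : ℕ) : Type := (Config d × Config d) × (ℝ × ℝ)

/-- `γ` is an orbit of the Hamiltonian system over the time interval `[a, b]`. -/
def OrbitOn {d : ℕ} (G : Set (Config d)) (V : Config d → ℝ) (a b : ℝ) (γ : ℝ → Phase d) : Prop :=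
  ∀ s ∈ Icc a b, (γ s).1 ∈ G ∧ HasDerivWithinAt γ ((γ s).2, -∇ V (γ s).1) (Icc a b) s

namespace SteepExpPotential

variable {d r : ℕ} {B : BilliardTable d r} {P : SteepExpPotential B} {j : Fin B.pieces}

lemma IsPatch.exists_bound_gradient {q : Config d} {R : ℝ}
    (h : P.IsPatch j (closedBall q R)) : ∃ C, ∀ᶠ ε in 𝓝₀,
      (∀ x ∈ closedBall q R, ‖∇ (P.Q ε) x‖ ≤ C) ∧
      ∀ x ∈ closedBall q R, ∀ y ∈ closedBall q R,
        ‖∇ (P.Q ε) x - ∇ (P.Q ε) y‖ ≤ C * ‖x - y‖ := by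
  obtain ⟨C, hC⟩ := (h.cRel_gradient (κ := fun _ => 0) (.of_forall fun _ => le_rfl)
    (.of_forall fun _ => zero_le_one)).cr.of_le (Nat.zero_le r)
  exact ⟨C, hC.mono fun ε hε => ⟨hε.1, fun x hx y hy => by simpa using hε.2 x hx y hy⟩⟩

lemma IsPatch.cRel_smooth {q : Config d} {R : ℝ} (h : P.IsPatch j (closedBall q R))
    {ι : Type} {l : Filter ι} {e : ι → ℝ} (he : Tendsto e l 𝓝₀) {W F : Type}
    [NormedAddCommGroup W] [NormedSpace ℝ W] [FiniteDimensional ℝ W] [NormedAddCommGroup F]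
    [NormedSpace ℝ F] {A : ι → Set (State d)} {R' R'' : ℝ}
    (hA : ∀ᶠ i in l, ∀ z ∈ A i, z.1.1 ∈ closedBall q R ∧ ‖z‖ ≤ R') {w : ι → W}
    (hw : ∀ᶠ i in l, ‖w i‖ ≤ R'') {H : W × Config d × State d → F} {K : Set (W × Config d × State
        d)}
    (hK : IsCompact K) (hH : ∀ x ∈ K, 𝒞 (⊤ : ℕ∞) H x)
    (hm : ∀ᶠ i in l, ∀ z ∈ A i, (w i, ∇ (P.Q (e i)) z.1.1, z) ∈ K) {κ : ι → ℝ}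
    (hκ : ∀ᶠ i in l, 0 ≤ κ i) :
    CRel l κ r (fun i z => H (w i, ∇ (P.Q (e i)) z.1.1, z))
      (fun i z => H (w i, ∇ (P.Q (e i)) z.1.1, z)) A A := by
  have h0 : ∀ᶠ i in l, (0 : ℝ) ≤ (fun _ : ι => (0 : ℝ)) i := .of_forall fun _ => le_rfl
  have h1 : ∀ᶠ i in l, (fun _ : ι => (0 : ℝ)) i ≤ 1 := .of_forall fun _ => zero_le_one
  have hAA : ∀ᶠ i in l, A i ⊆ A i := .of_forall fun _ => subset_rfl
  have hb : ∀ᶠ i in l, A i ⊆ closedBall 0 R' :=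
    hA.mono fun i hi z hz => mem_closedBall_zero_iff.2 (hi z hz).2
  have a1 : CRel l (fun _ => 0) r (fun i => ∇ (P.Q (e i))) (fun i => ∇ (P.Q (e i)))
      (fun _ => closedBall q R) (fun _ => closedBall q R) :=
    (h.cRel_gradient (κ := fun _ => 0) (.of_forall fun _ => le_rfl)
      (.of_forall fun _ => zero_le_one)).reindex he
  have hm1 : ∀ᶠ i in l, MapsTo ((fst ℝ (Config d) (Config d)).comp
      (fst ℝ (Config d × Config d) (ℝ × ℝ))) (A i) (closedBall q R) :=
    hA.mono fun i hi z hz => (hi z hz).1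
  have a2 := a1.comp (CRel.clm ((fst ℝ (Config d) (Config d)).comp
    (fst ℝ (Config d × Config d) (ℝ × ℝ))) hb h0) h0 h1 hAA hm1 hm1
  have a3 := (CRel.const (A := A) (A' := A) (k := r) w hw h0).prodMk
    (a2.prodMk (CRel.clm (ContinuousLinearMap.id ℝ (State d)) hb h0) h0) h0
  exact (a3.smooth_comp hK hH h0 h1 hAA hm hm).mono_weight (c := 0) h0
    (hκ.mono fun i hi => by simp) hκ

end SteepExpPotential

/-! ### Motion with the level of the pattern function as the time -/

section Level

variable {d : ℕ}

lemma _root_.ContDiffAt.gradient_q {k : ℕ} {f : Config d → ℝ} {s : ℝ} {z : State d}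
    (h : 𝒞 (k + 1 : ℕ) f z.1.1) :
    𝒞 k (fun w : ℝ × State d => ∇ f w.2.1.1) (s, z) :=
  ContDiffAt.comp (g := ∇ f) (s, z) h.gradient contDiffAt_snd.fst.fst

def State.qL : State d →L[ℝ] Config d := (fst ℝ (Config d) (Config d)).comp
    (fst ℝ (Config d × Config d) (ℝ × ℝ))

def State.pL : State d →L[ℝ] Config d := (snd ℝ (Config d) (Config d)).comp
    (fst ℝ (Config d × Config d) (ℝ × ℝ))

def State.tL : State d →L[ℝ] ℝ := (fst ℝ ℝ ℝ).comp
    (snd ℝ (Config d × Config d) (ℝ × ℝ))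

def State.lL : State d →L[ℝ] ℝ := (snd ℝ ℝ ℝ).comp
    (snd ℝ (Config d × Config d) (ℝ × ℝ))

lemma State.q_le (z : State d) : ‖z.1.1‖ ≤ ‖z‖ := (norm_fst_le z.1).trans (norm_fst_le z)
lemma State.p_le (z : State d) : ‖z.1.2‖ ≤ ‖z‖ := (norm_snd_le z.1).trans (norm_fst_le z)
lemma State.t_le (z : State d) : |z.2.1| ≤ ‖z‖ := (norm_fst_le z.2).trans (norm_snd_le z)
lemma State.l_le (z : State d) : |z.2.2| ≤ ‖z‖ := (norm_snd_le z.2).trans (norm_snd_le z)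

section Sol

variable {ζ ζ' : ℝ → State d} {s a b : ℝ}

lemma hasDerivWithinAt_q {z : State d} (h : HasDerivWithinAt ζ z (Icc a b) s) :
    HasDerivWithinAt (fun s => (ζ s).1.1) z.1.1 (Icc a b) s :=
  (State.qL (d := d)).hasFDerivAt.comp_hasDerivWithinAt s h

lemma hasDerivWithinAt_p {z : State d} (h : HasDerivWithinAt ζ z (Icc a b) s) :
    HasDerivWithinAt (fun s => (ζ s).1.2) z.1.2 (Icc a b) s :=
  (State.pL (d := d)).hasFDerivAt.comp_hasDerivWithinAt s h

lemma hasDerivWithinAt_t {z : State d} (h : HasDerivWithinAt ζ z (Icc a b) s) :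
    HasDerivWithinAt (fun s => (ζ s).2.1) z.2.1 (Icc a b) s :=
  (State.tL (d := d)).hasFDerivAt.comp_hasDerivWithinAt s h

lemma hasDerivWithinAt_l {z : State d} (h : HasDerivWithinAt ζ z (Icc a b) s) :
    HasDerivWithinAt (fun s => (ζ s).2.2) z.2.2 (Icc a b) s :=
  (State.lL (d := d)).hasFDerivAt.comp_hasDerivWithinAt s h

lemma hasDerivWithinAt_phase {z : State d} (h : HasDerivWithinAt ζ z (Icc a b) s) :
    HasDerivWithinAt (fun s => (ζ s).1) z.1 (Icc a b) s :=
  (fst ℝ (Config d × Config d) (ℝ × ℝ)).hasFDerivAt.comp_hasDerivWithinAt s h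

end Sol

/-- The velocity `(p, u)`, slowed down in such a way that a function with gradient `g` changes
at the rate `L`. -/
noncomputable def levelField (g u : Config d) (z : State d) : State d :=
  (z.2.2 / ⟪g, z.1.2⟫) • ((z.1.2, u), ((1 : ℝ), (0 : ℝ)))

lemma contDiffAt_levelField {E : Type} [NormedAddCommGroup E] [NormedSpace ℝ E]
    {n : WithTop ℕ∞} {g u : E → Config d} {z : E → State d} {x : E} (hg : 𝒞 n g x)
    (hu : 𝒞 n u x) (hz : 𝒞 n z x) (h : ⟪g x, (z x).1.2⟫ ≠ (0 : ℝ)) :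
    𝒞 n (fun x => levelField (g x) (u x) (z x)) x := by
  have hp : 𝒞 n (fun x => (z x).1.2) x := hz.fst.snd
  exact (hz.snd.snd.div (hg.inner ℝ hp) h).smul
    ((hp.prodMk hu).prodMk (contDiffAt_const.prodMk contDiffAt_const))

section LevelSol

variable {Q : Config d → ℝ} {u : ℝ → Config d} {ζ : ℝ → State d}
  (hζ : ∀ s ∈ 𝕀, HasDerivWithinAt ζ (levelField (∇ Q (ζ s).1.1) (u s) (ζ s)) 𝕀 s)

include hζ

lemma level_L_eq {s : ℝ} (hs : s ∈ 𝕀) : (ζ s).2.2 = (ζ 0).2.2 :=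
  eq_of_hasDerivWithinAt_zero (f := fun s => (ζ s).2.2)
    (fun t ht => (hasDerivWithinAt_l (hζ t ht)).congr_deriv (by simp [levelField])) hs

lemma level_Q_eq (hQ : ∀ s ∈ 𝕀, DifferentiableAt ℝ Q (ζ s).1.1)
    (hy : ∀ s ∈ 𝕀, ⟪∇ Q (ζ s).1.1, (ζ s).1.2⟫ ≠ (0 : ℝ)) {s : ℝ}
    (hs : s ∈ 𝕀) : Q (ζ s).1.1 = Q (ζ 0).1.1 + s * (ζ 0).2.2 := by
  have h := eq_add_of_hasDerivWithinAt (f := fun s => Q (ζ s).1.1) (c := (ζ 0).2.2) (a := 0)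
    (fun t ht => ?_) hs
  · simpa using h
  · have h1 := (hQ t ht).hasGradientAt.hasFDerivAt.comp_hasDerivWithinAt t
      (hasDerivWithinAt_q (hζ t ht))
    refine h1.congr_deriv ?_
    rw [InnerProductSpace.toDual_apply_apply, levelField]
    simp only [Prod.smul_fst, real_inner_smul_right]
    rw [div_mul_cancel₀ _ (hy t ht), level_L_eq hζ ht]

lemma level_time {s : ℝ} (hs : s ∈ 𝕀) : HasDerivWithinAt (fun s => (ζ s).2.1)
    ((ζ 0).2.2 / ⟪∇ Q (ζ s).1.1, (ζ s).1.2⟫) 𝕀 s :=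
  (hasDerivWithinAt_t (hζ s hs)).congr_deriv (by simp [levelField, level_L_eq hζ hs])

lemma level_line (hu : ∀ s ∈ 𝕀, u s = 0) {s : ℝ} (hs : s ∈ 𝕀) : (ζ s).1.2 = (ζ 0).1.2 ∧
      (ζ s).1.1 = (ζ 0).1.1 + ((ζ s).2.1 - (ζ 0).2.1) • (ζ 0).1.2 := by
  have hp : ∀ s ∈ 𝕀, (ζ s).1.2 = (ζ 0).1.2 := fun s hs =>
    eq_of_hasDerivWithinAt_zero (f := fun s => (ζ s).1.2)
      (fun t ht => (hasDerivWithinAt_p (hζ t ht)).congr_deriv (by simp [levelField, hu t ht])) hs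
  refine ⟨hp s hs, ?_⟩
  have h := eq_of_hasDerivWithinAt_zero (f := fun s => (ζ s).1.1 - (ζ s).2.1 • (ζ 0).1.2)
    (fun t ht => ((hasDerivWithinAt_q (hζ t ht)).sub
      ((hasDerivWithinAt_t (hζ t ht)).smul_const (ζ 0).1.2)).congr_deriv (by
        simp [levelField, hp t ht])) hs
  rw [sub_eq_iff_eq_add] at h
  rw [h, sub_smul]
  abel

/-- The level motion along the force is an orbit of the Hamiltonian system. -/
lemma level_orbit {G : Set (Config d)} {V : Config d → ℝ} (hG : ∀ s ∈ 𝕀, (ζ s).1.1 ∈ G)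
    (hQ : ∀ s ∈ 𝕀, 𝒞 (1 + 1 : ℕ) Q (ζ s).1.1)
    (hy : ∀ s ∈ 𝕀, 0 < ⟪∇ Q (ζ s).1.1, (ζ s).1.2⟫ * (ζ 0).2.2)
    (hu : ∀ s ∈ 𝕀, u s = -∇ V (ζ s).1.1) :
    StrictMonoOn (fun s => (ζ s).2.1) 𝕀 ∧
    ∃ σ : ℝ → ℝ, (∀ s ∈ 𝕀, σ (ζ s).2.1 = s) ∧
      (∀ τ ∈ Icc (ζ 0).2.1 (ζ 1).2.1, σ τ ∈ 𝕀 ∧ (ζ (σ τ)).2.1 = τ) ∧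
      OrbitOn G V (ζ 0).2.1 (ζ 1).2.1 fun τ => (ζ (σ τ)).1 := by
  have hc : ContinuousOn ζ 𝕀 := fun s hs => (hζ s hs).continuousWithinAt
  have hne : ∀ s ∈ 𝕀, ⟪∇ Q (ζ s).1.1, (ζ s).1.2⟫ ≠ (0 : ℝ) := fun s hs h => by
    have := hy s hs
    rw [h, zero_mul] at this
    exact lt_irrefl _ this
  have hcc : ContinuousOn (fun s => (ζ 0).2.2 / ⟪∇ Q (ζ s).1.1, (ζ s).1.2⟫) 𝕀 := by
    refine continuousOn_const.div (ContinuousOn.inner (𝕜 := ℝ) (fun s hs => ?_) hc.fst.snd) hne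
    exact ContinuousAt.comp_continuousWithinAt (f := fun s => (ζ s).1.1)
      (ContDiffAt.gradient (hQ s hs)).continuousAt (hc.fst.fst s hs)
  obtain ⟨σ, h1, h2, h3⟩ := exists_reparam (ζ := fun s => (ζ s).1)
    (v := fun s => ((ζ s).1.2, u s)) (t := fun s => (ζ s).2.1) (fun s hs => level_time hζ hs) hcc
    (fun s hs => by
      have h4 : (ζ 0).2.2 / ⟪∇ Q (ζ s).1.1, (ζ s).1.2⟫ =
        (⟪∇ Q (ζ s).1.1, (ζ s).1.2⟫ * (ζ 0).2.2) / ⟪∇ Q (ζ s).1.1, (ζ s).1.2⟫ ^ 2 := by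
        have := hne s hs
        field_simp
      rw [h4]
      have := hne s hs
      exact div_pos (hy s hs) (by positivity))
    (fun s hs => (hasDerivWithinAt_phase (hζ s hs)).congr_deriv (by
      simp [levelField, level_L_eq hζ hs]))
  refine ⟨h3, σ, fun s hs => (h1 s hs).2, fun τ hτ => ⟨(h2 τ hτ).1, (h2 τ hτ).2.1⟩,
    fun τ hτ => ⟨hG _ (h2 τ hτ).1, ?_⟩⟩
  have := (h2 τ hτ).2.2
  rwa [hu _ (h2 τ hτ).1] at this

end LevelSol

end Level

namespace SteepExpPotential

variable {d r : ℕ} {B : BilliardTable d r} {P : SteepExpPotential B} {j : Fin B.pieces}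

/-- In the ball of radius `D` around the state, momenta are transversal to the level sets. -/
def IsLevelBall (P : SteepExpPotential B) (z₀ : State d) (D y₀ : ℝ) : Prop :=
  0 < D ∧ 0 < y₀ ∧ ∀ᶠ ε in 𝓝₀, ∀ z ∈ closedBall z₀ D, y₀ ≤ |⟪∇ (P.Q ε) z.1.1, z.1.2⟫| ∧
    0 < ⟪∇ (P.Q ε) z.1.1, z.1.2⟫ * ⟪∇ (P.Q 0) z₀.1.1, z₀.1.2⟫

lemma tendsto_inner_gradient (P : SteepExpPotential B) {z₀ : State d} (h : z₀.1.1 ∈ P.Dt) :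
    Tendsto (fun w : ℝ × State d => ⟪∇ (P.Q w.1) w.2.1.1, w.2.1.2⟫) (𝓝₀ ×ˢ 𝓝 z₀)
      (𝓝 ⟪∇ (P.Q 0) z₀.1.1, z₀.1.2⟫) := by
  have h1 : Tendsto (fun w : ℝ × State d => (w.1, w.2.1.1)) (𝓝₀ ×ˢ 𝓝 z₀) (𝓝₀ ×ˢ 𝓝 z₀.1.1) :=
    tendsto_fst.prodMk (tendsto_snd.fst_nhds.fst_nhds)
  have h2 : Tendsto (fun w : ℝ × State d => w.2.1.2) (𝓝₀ ×ˢ 𝓝 z₀) (𝓝 z₀.1.2) :=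
    tendsto_snd.fst_nhds.snd_nhds
  exact ((P.tendsto_gradient_Q h).comp h1).inner h2

lemma exists_isLevelBall (P : SteepExpPotential B) {z₀ : State d} (h : z₀.1.1 ∈ P.Dt)
    (hy : ⟪∇ (P.Q 0) z₀.1.1, z₀.1.2⟫ ≠ (0 : ℝ)) :
    ∃ D > 0, ∃ y₀, ∀ D' ≤ D, 0 < D' → P.IsLevelBall z₀ D' y₀ := by
  set y := ⟪∇ (P.Q 0) z₀.1.1, z₀.1.2⟫ with hy'
  have ht := P.tendsto_inner_gradient h
  rw [← hy'] at ht
  have h1 : |y| / 2 < |y| := half_lt_self (abs_pos.2 hy)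
  have h2 : 0 < y * y := mul_self_pos.2 hy
  obtain ⟨D, hD, h3⟩ := Filter.Eventually.exists_closedBall
    (p := fun ε (z : State d) => |y| / 2 < |⟪∇ (P.Q ε) z.1.1, z.1.2⟫| ∧
      0 < ⟪∇ (P.Q ε) z.1.1, z.1.2⟫ * y)
    ((ht.abs.eventually_const_lt h1).and ((ht.mul_const y).eventually_const_lt h2))
  exact ⟨D, hD, |y| / 2, fun D' hD' h0 => ⟨h0, half_pos (abs_pos.2 hy), (h3 D' hD').mono
    fun ε hε z hz => ⟨(hε z hz).1.le, (hε z hz).2⟩⟩⟩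

def CloseFlows (r : ℕ) (X Y : ℝ → ℝ → State d → State d) (z₀ : State d) (D ρ : ℝ) : Prop :=
  (∀ᶠ ε in 𝓝₀, ∀ z ∈ closedBall z₀ ρ,
    FlowIn (X ε) (fun _ => z₀) D z ∧ FlowIn (Y ε) (fun _ => z₀) D z) ∧
  Tendsto (fun w : ℝ × State d => flowMap (X w.1) 1 w.2) (𝓝₀ ×ˢ 𝓝 z₀) (𝓝 z₀) ∧
  Tendsto (fun w : ℝ × State d => flowMap (Y w.1) 1 w.2) (𝓝₀ ×ˢ 𝓝 z₀) (𝓝 z₀) ∧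
  CRel 𝓝₀ (nuExp r) r (fun ε => flowMap (X ε) 1) (fun ε => flowMap (Y ε) 1)
    (fun _ => closedBall z₀ ρ) (fun _ => closedBall z₀ ρ)

noncomputable def freeLevel (P : SteepExpPotential B) (ε : ℝ) (_ : ℝ) (z : State d) : State d :=
  levelField (∇ (P.Q ε) z.1.1) 0 z

lemma mem_ball_q {z₀ z : State d} {D R : ℝ} (hD : D ≤ R) (hz : z ∈ closedBall z₀ D) :
    z.1.1 ∈ closedBall z₀.1.1 R := by
  rw [mem_closedBall, dist_eq_norm] at hz ⊢
  exact ((z - z₀).q_le.trans hz).trans hD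

lemma norm_le_of_mem_closedBall {E : Type} [NormedAddCommGroup E] {z₀ z : E} {D : ℝ}
    (hz : z ∈ closedBall z₀ D) : ‖z‖ ≤ ‖z₀‖ + D := by
  rw [mem_closedBall, dist_eq_norm] at hz
  linarith [norm_le_norm_sub_add (a := z) (b := z₀)]

lemma IsPatch.level_flow (hr : 1 ≤ r) {z₀ : State d} {R D y₀ : ℝ}
    (h : P.IsPatch j (closedBall z₀.1.1 R)) (hDR : D ≤ R) (hb : P.IsLevelBall z₀ D y₀)
    (hL : z₀.2.2 = 0) : ∃ ρ > 0, ∀ (X : ℝ → ℝ → State d → State d) (m : ℝ × ℝ → ℝ)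
      (M : ℝ → ℝ → ℝ) (b : ℝ), 0 ≤ b →
      CRel (𝓝₀ ×ˢ 𝓟 𝕀) m r (fun i => X i.1 i.2)
        (fun i => P.freeLevel i.1 i.2) (fun _ => closedBall z₀ D)
        (fun _ => closedBall z₀ D) →
      (∀ᶠ ε in 𝓝₀, ∀ s ∈ 𝕀, ∀ z ∈ closedBall z₀ D, 𝒞 r (uncurry (X ε)) (s, z)) →
      IsWeight 𝓝₀ (nuExp r) m M b →
      CloseFlows r X P.freeLevel z₀ D ρ := by
  set C := max 1 (y₀⁻¹ * max (‖z₀‖ + D) 1) with hC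
  refine ⟨D * exp (-C) / 4, by have := hb.1; positivity, fun X m M b hb0 hXY hX hM => ?_⟩
  have hin : ∀ s : ℝ, ∀ z : State d, ‖z - (fun _ : ℝ => z₀) s‖ ≤ D ↔ z ∈ closedBall z₀ D :=
    fun s z => mem_closedBall_iff_norm.symm
  have key := CRel.flow_tube (X := X) (Y := P.freeLevel) (c := fun _ => z₀) (v := fun _ => 0)
    (C := C) (d := D) (e := fun _ => 0) hr (le_max_left _ _) hb.1 hb0 hXY
    (hX.mono fun ε hε s hs z hz => hε s hs z ((hin s z).1 hz)) ?_
    (fun s _ => hasDerivWithinAt_const _ _ _) ?_ tendsto_const_nhds hM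
    (eventually_mem_nhdsWithin.mono fun ε hε => (nuExp_pos hε).le) tendsto_nuExp
  · exact key
  · filter_upwards [hb.2.2, P.eventually_lt] with ε h1 h2 s hs z hz
    have hz' := (hin s z).1 hz
    exact contDiffAt_levelField (h.contDiffAt (mem_ball_q hDR hz')
      (Ioo_subset_Ico_self h2)).gradient_q contDiffAt_const contDiffAt_snd fun h0 => by
      have := (h1 z hz').2
      rw [h0, zero_mul] at this
      exact lt_irrefl _ this
  · filter_upwards [hb.2.2] with ε h1 s hs z hz
    have hz' := (hin s z).1 hz
    have h2 := h1 z hz'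
    have h3 : |z.2.2| ≤ ‖z - z₀‖ := by simpa [hL] using (z - z₀).l_le
    have h4 : ‖(((z.1.2, 0), ((1 : ℝ), (0 : ℝ))) : State d)‖ ≤ max (‖z₀‖ + D) 1 := by
      have := z.p_le.trans (norm_le_of_mem_closedBall hz')
      simp only [Prod.norm_def, norm_zero, norm_one]
      refine max_le (max_le (this.trans (le_max_left _ _)) ?_) (max_le (le_max_right _ _) ?_)
      · exact zero_le_one.trans (le_max_right _ _)
      · exact zero_le_one.trans (le_max_right _ _)
    have h5 : 0 < |⟪∇ (P.Q ε) z.1.1, z.1.2⟫| := hb.2.1.trans_le h2.1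
    rw [sub_zero, add_zero, freeLevel, levelField, norm_smul, norm_div, Real.norm_eq_abs,
      Real.norm_eq_abs]
    calc |z.2.2| / |⟪∇ (P.Q ε) z.1.1, z.1.2⟫| *
          ‖(((z.1.2, 0), ((1 : ℝ), (0 : ℝ))) : State d)‖
        ≤ ‖z - z₀‖ / y₀ * max (‖z₀‖ + D) 1 := by
          have := hb.2.1
          gcongr
          exact h2.1
      _ = (y₀⁻¹ * max (‖z₀‖ + D) 1) * ‖z - z₀‖ := by ring
      _ ≤ C * ‖z - z₀‖ := by
          gcongr
          exact le_max_right _ _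

end SteepExpPotential

lemma CRel.tendsto {ι E F : Type} [NormedAddCommGroup E] [NormedSpace ℝ E] [NormedAddCommGroup F]
    [NormedSpace ℝ F] {l : Filter ι} {κ : ι → ℝ} {k : ℕ} {f g : ι → E → F} {A : Set E}
    (h : CRel l κ k f g (fun _ => A) (fun _ => A)) (hκ : Tendsto κ l (𝓝 0)) {x : E} {y : F}
    (hA : A ∈ 𝓝 x) (hg : Tendsto (fun w : ι × E => g w.1 w.2) (l ×ˢ 𝓝 x) (𝓝 y)) :
    Tendsto (fun w : ι × E => f w.1 w.2) (l ×ˢ 𝓝 x) (𝓝 y) := by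
  obtain ⟨C, hC⟩ := h.cr.of_le (Nat.zero_le k)
  have h1 : Tendsto (fun w : ι × E => f w.1 w.2 - g w.1 w.2) (l ×ˢ 𝓝 x) (𝓝 0) := by
    have h2 : Tendsto (fun w : ι × E => C * κ w.1) (l ×ˢ 𝓝 x) (𝓝 0) := by
      simpa using (hκ.comp tendsto_fst).const_mul C
    have hA' : ∀ᶠ y in 𝓝 x, y ∈ A := hA
    refine squeeze_zero_norm' ?_ h2
    filter_upwards [hC.prod_mk hA'] with w hw
    simpa using hw.1.2 w.2 hw.2 w.2 hw.2
  simpa using h1.add hg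

namespace SteepExpPotential

variable {d r : ℕ} {B : BilliardTable d r} {P : SteepExpPotential B} {j : Fin B.pieces}

lemma exists_subset_intTable (P : SteepExpPotential B) {K : Set (Config d)} (hK : IsCompact K)
    (hKD : K ⊆ interior B.D) : ∃ c > 0, ∀ᶠ ε in 𝓝₀, K ⊆ P.intTable ε \ thickening c B.corner := by
  have hdis : Disjoint K B.corner :=
    disjoint_left.2 fun x hx hc => B.notMem_corner_of_interior (hKD hx) hc
  obtain ⟨c, hc, hc'⟩ := hdis.exists_thickenings hK B.isClosed_corner
  refine ⟨c, hc, ?_⟩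
  filter_upwards [P.eventually_subset_interior_table (tendsto_deltaExp (r := r)) hK hKD] with ε h x
      hx
  exact ⟨interior_subset (h x hx), fun hx' =>
    disjoint_left.1 hc' (self_subset_thickening hc K hx) hx'⟩

noncomputable def trueLevel (P : SteepExpPotential B) (ε : ℝ) (_ : ℝ) (z : State d) : State d :=
  levelField (∇ (P.Q ε) z.1.1) (-∇ (P.V ε) z.1.1) z

lemma eventually_nuExp_nonneg {ι : Type} {l : Filter ι} {e : ι → ℝ} (he : Tendsto e l 𝓝₀) :
    ∀ᶠ i in l, 0 ≤ nuExp r (e i) :=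
  (he.eventually eventually_mem_nhdsWithin).mono fun _ hi => (nuExp_pos hi).le

lemma isCompact_level_set (C₁ C₂ y₀ : ℝ) : IsCompact {x : ℝ × Config d × State d |
    ‖x.1‖ ≤ 1 ∧ ‖x.2.1‖ ≤ C₁ ∧ ‖x.2.2‖ ≤ C₂ ∧ y₀ ≤ |⟪x.2.1, x.2.2.1.2⟫|} := by
  have h1 := (isCompact_closedBall (0 : ℝ) 1).prod
    ((isCompact_closedBall (0 : Config d) C₁).prod (isCompact_closedBall (0 : State d) C₂))
  refine h1.of_isClosed_subset ?_ fun x hx => ?_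
  · refine (isClosed_le (by fun_prop) (by fun_prop)).and ((isClosed_le (by fun_prop)
      (by fun_prop)).and ((isClosed_le (by fun_prop) (by fun_prop)).and
      (isClosed_le (by fun_prop) (by fun_prop))))
  · exact ⟨mem_closedBall_zero_iff.2 hx.1, mem_closedBall_zero_iff.2 hx.2.1,
      mem_closedBall_zero_iff.2 hx.2.2.1⟩

lemma ne_of_le_abs {y₀ y : ℝ} (h0 : 0 < y₀) (h : y₀ ≤ |y|) : y ≠ 0 := abs_pos.1 (h0.trans_le h)

lemma BoundaryDominated.level_flow (hP : P.BoundaryDominated) (hr : 1 ≤ r) {z₀ : State d}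
    {R D y₀ : ℝ} (h : P.IsPatch j (closedBall z₀.1.1 R)) (hDR : D ≤ R)
    (hRD : closedBall z₀.1.1 R ⊆ interior B.D) (hb : P.IsLevelBall z₀ D y₀)
    (hL : z₀.2.2 = 0) : ∃ ρ > 0, CloseFlows r P.trueLevel P.freeLevel z₀ D ρ := by
  obtain ⟨ρ, hρ, hflow⟩ := h.level_flow hr hDR hb hL
  refine ⟨ρ, hρ, hflow _ _ _ 1 zero_le_one ?_ ?_
    (isWeight_const (eventually_nuExp_nonneg tendsto_id))⟩
  · obtain ⟨c, hc, hsub⟩ := P.exists_subset_intTable (isCompact_closedBall z₀.1.1 R) hRD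
    obtain ⟨C₁, hC₁⟩ := h.exists_bound_gradient
    have he : Tendsto (Prod.fst : ℝ × ℝ → ℝ) (𝓝₀ ×ˢ 𝓟 𝕀) 𝓝₀ := tendsto_fst
    have h0 := eventually_nuExp_nonneg (r := r) he
    have h1 := (tendsto_nuExp (r := r).comp he).eventually_le_const one_pos
    have hAA : ∀ᶠ i in 𝓝₀ ×ˢ 𝓟 𝕀, closedBall z₀ D ⊆
      closedBall z₀ D := .of_forall fun _ => subset_rfl
    have hU := hP.cRel_gradient (r := r) hc he (A := fun _ => closedBall z₀.1.1 R)
      (A' := fun _ => closedBall z₀.1.1 R) (he.eventually hsub)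
      (.of_forall fun _ => subset_rfl) (R := ‖z₀.1.1‖ + R)
      (.of_forall fun _ z hz => mem_closedBall_zero_iff.2 (norm_le_of_mem_closedBall hz))
    have hq : ∀ᶠ i in 𝓝₀ ×ˢ 𝓟 𝕀, MapsTo (State.qL (d := d))
        (closedBall z₀ D) (closedBall z₀.1.1 R) :=
      .of_forall fun _ z hz => mem_ball_q hDR hz
    have hbd : ∀ᶠ i in 𝓝₀ ×ˢ 𝓟 𝕀, closedBall z₀ D ⊆
        closedBall 0 (‖z₀‖ + D) := .of_forall fun _ z hz =>
      mem_closedBall_zero_iff.2 (norm_le_of_mem_closedBall hz)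
    have hU2 := hU.comp (CRel.clm State.qL hbd h0) h0 h1 hAA hq hq
    have hG := h.cRel_smooth (r := r) he (A := fun _ => closedBall z₀ D) (R' := ‖z₀‖ + D)
      (.of_forall fun _ z hz => ⟨mem_ball_q hDR hz, norm_le_of_mem_closedBall hz⟩)
      (w := fun _ => (0 : ℝ)) (R'' := 1) (by simp) (H := fun x => (x.2.1, x.2.2))
      (isCompact_level_set C₁ (‖z₀‖ + D) y₀)
      (fun x _ => contDiffAt_snd.fst.prodMk contDiffAt_snd.snd) (by
        filter_upwards [he.eventually hC₁, he.eventually hb.2.2] with i hi hi' z hz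
        exact ⟨by simp, hi.1 _ (mem_ball_q hDR hz), norm_le_of_mem_closedBall hz, (hi' z hz).1⟩) h0
    have hall := hG.prodMk hU2 h0
    have hbdU : ∃ C₃, ∀ᶠ i in 𝓝₀ ×ˢ 𝓟 𝕀, ∀ z ∈ closedBall z₀ D,
        ‖∇ (P.V i.1) z.1.1‖ ≤ C₃ ∧ 0 ≤ C₃ := by
      obtain ⟨C, hC⟩ := hU.cr.of_le (Nat.zero_le r)
      refine ⟨max C 0, ?_⟩
      filter_upwards [hC, h1, h0] with i hi hi' h0i z hz
      have := hi.2 _ (mem_ball_q hDR hz) _ (mem_ball_q hDR hz)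
      simp only [sub_self, norm_zero, zero_add, sub_zero, norm_neg] at this
      exact ⟨this.trans ((mul_le_mul_of_nonneg_right (le_max_left _ _) h0i).trans
        (mul_le_of_le_one_right (le_max_right _ _) hi')), le_max_right _ _⟩
    obtain ⟨C₃, hC₃⟩ := hbdU
    have hK : IsCompact {x : (Config d × State d) × Config d | (‖x.1.1‖ ≤ C₁ ∧ ‖x.1.2‖ ≤ ‖z₀‖ + D ∧
        ‖x.2‖ ≤ C₃) ∧ y₀ ≤ |⟪x.1.1, x.1.2.1.2⟫|} := by
      have h1 := ((isCompact_closedBall (0 : Config d) C₁).prod (isCompact_closedBall (0 : State d)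
        (‖z₀‖ + D))).prod (isCompact_closedBall (0 : Config d) C₃)
      refine h1.of_isClosed_subset ?_ fun x hx => ?_
      · exact ((isClosed_le (by fun_prop) (by fun_prop)).and ((isClosed_le (by fun_prop)
          (by fun_prop)).and (isClosed_le (by fun_prop) (by fun_prop)))).and
          (isClosed_le (by fun_prop) (by fun_prop))
      · exact ⟨⟨mem_closedBall_zero_iff.2 hx.1.1, mem_closedBall_zero_iff.2 hx.1.2.1⟩,
          mem_closedBall_zero_iff.2 hx.1.2.2⟩
    exact hall.smooth_comp (G := fun x => levelField x.1.1 x.2 x.1.2) hK (fun x hx =>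
      contDiffAt_levelField contDiffAt_fst.fst contDiffAt_snd contDiffAt_fst.snd
        (ne_of_le_abs hb.2.1 hx.2)) h0 h1 hAA (by
        filter_upwards [he.eventually hC₁, he.eventually hb.2.2, hC₃] with i hi hi' hi'' z hz
        exact ⟨⟨hi.1 _ (mem_ball_q hDR hz), norm_le_of_mem_closedBall hz,
          (norm_neg _).le.trans (hi'' z hz).1⟩, (hi' z hz).1⟩) (by
        filter_upwards [he.eventually hC₁, he.eventually hb.2.2, hC₃] with i hi hi' hi'' z hz
        exact ⟨⟨hi.1 _ (mem_ball_q hDR hz), norm_le_of_mem_closedBall hz, by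
          simpa using (hi'' z hz).2⟩, (hi' z hz).1⟩)
  · filter_upwards [hb.2.2, P.eventually_lt] with ε h1 h2 s hs z hz
    have hq := mem_ball_q hDR hz
    have h3 := (h.contDiffAt hq (Ioo_subset_Ico_self h2)).gradient_q (s := s)
    have h4 := (P.contDiffAt_V h2 (h.subset_domain hq)).gradient_q (s := s)
    exact contDiffAt_levelField h3 h4.neg contDiffAt_snd (ne_of_le_abs hb.2.1 (h1 z hz).1)

/-- The level motion from the level `s₀` to the level `s₁`, with the force of the barrier. -/
noncomputable def barrierLevel (P : SteepExpPotential B) (s₀ s₁ : ℝ → ℝ) (ε s : ℝ) (z : State d) :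
    State d :=
  levelField (∇ (P.Q ε) z.1.1)
    ((exp (-(s₀ ε + s * (s₁ ε - s₀ ε)) / ε) / ε) • ∇ (P.Q ε) z.1.1) z

lemma isWeight_barrier {s₀ s₁ : ℝ → ℝ} {a : ℝ} (ha : 0 < a)
    (hs : ∀ᶠ ε in 𝓝₀, etaExp r ε ≤ s₀ ε ∧ etaExp r ε ≤ s₁ ε ∧ a ≤ |s₁ ε - s₀ ε|) :
    IsWeight 𝓝₀ (nuExp r)
      (fun i : ℝ × ℝ => exp (-(s₀ i.1 + i.2 * (s₁ i.1 - s₀ i.1)) / i.1) / i.1)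
      (fun ε s => (exp (-s₀ ε / ε) - exp (-(s₀ ε + s * (s₁ ε - s₀ ε)) / ε)) /
        (s₁ ε - s₀ ε)) a⁻¹ := by
  filter_upwards [hs, eventually_mem_nhdsWithin] with ε h hε
  obtain ⟨h1, h2, h3⟩ := h
  have hε : 0 < ε := hε
  set Δ := s₁ ε - s₀ ε with hΔ
  have hΔ0 : Δ ≠ 0 := ne_of_le_abs ha h3
  have hder : ∀ s ∈ 𝕀, HasDerivWithinAt
      (fun s => (exp (-s₀ ε / ε) - exp (-(s₀ ε + s * Δ) / ε)) / Δ)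
      (exp (-(s₀ ε + s * Δ) / ε) / ε) 𝕀 s := by
    intro s _
    have h4 : HasDerivAt (fun s => -(s₀ ε + s * Δ) / ε) (-Δ / ε) s := by
      simpa using ((((hasDerivAt_id s).mul_const Δ).const_add (s₀ ε)).neg).div_const ε
    have h5 := ((h4.exp.const_sub (exp (-s₀ ε / ε))).div_const Δ).hasDerivWithinAt (s := 𝕀)
    refine h5.congr_deriv ?_
    field_simp
  have hle : ∀ s ∈ 𝕀, exp (-(s₀ ε + s * Δ) / ε) ≤ nuExp r ε := fun s hs => by
    rw [← exp_neg_etaExp (r := r) hε, Real.exp_le_exp]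
    gcongr
    have : s₀ ε + s * Δ = (1 - s) * s₀ ε + s * s₁ ε := by rw [hΔ]; ring
    rw [this]
    nlinarith [hs.1, hs.2]
  refine ⟨by simp, fun s hs => ⟨by positivity, hder s hs, ?_, ?_⟩⟩
  · have := sub_lt_of_hasDerivWithinAt (c := 0) hder (fun s _ => by positivity)
      (s := 0) (by simp) hs hs.1
    simpa using this
  · refine (le_abs_self _).trans ?_
    rw [abs_div, inv_mul_eq_div]
    have h6 := hle s hs
    have h7 := hle 0 (by simp)
    simp only [zero_mul, add_zero] at h7
    have := nuExp_pos (r := r) hε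
    gcongr
    rw [abs_le]
    constructor
    · linarith [Real.exp_pos (-s₀ ε / ε)]
    · linarith [Real.exp_pos (-(s₀ ε + s * Δ) / ε)]

lemma IsPatch.barrier_flow (hr : 1 ≤ r) {z₀ : State d} {R D y₀ : ℝ}
    (h : P.IsPatch j (closedBall z₀.1.1 R)) (hDR : D ≤ R) (hb : P.IsLevelBall z₀ D y₀)
    (hL : z₀.2.2 = 0) : ∃ ρ > 0, ∀ (s₀ s₁ : ℝ → ℝ) (a : ℝ), 0 < a →
      (∀ᶠ ε in 𝓝₀, etaExp r ε ≤ s₀ ε ∧ etaExp r ε ≤ s₁ ε ∧ a ≤ |s₁ ε - s₀ ε|) →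
      CloseFlows r (P.barrierLevel s₀ s₁) P.freeLevel z₀ D ρ := by
  obtain ⟨ρ, hρ, hflow⟩ := h.level_flow hr hDR hb hL
  refine ⟨ρ, hρ, fun s₀ s₁ a ha hs => hflow _ _ _ a⁻¹ (inv_pos.2 ha).le ?_ ?_
    (isWeight_barrier ha hs)⟩
  · obtain ⟨C₁, hC₁⟩ := h.exists_bound_gradient
    have he : Tendsto (Prod.fst : ℝ × ℝ → ℝ) (𝓝₀ ×ˢ 𝓟 𝕀) 𝓝₀ := tendsto_fst
    have hm : ∀ᶠ i in 𝓝₀ ×ˢ 𝓟 𝕀, 0 ≤ exp (-(s₀ i.1 + i.2 * (s₁ i.1 - s₀ i.1)) / i.1) / i.1 :=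
      (he.eventually eventually_mem_nhdsWithin).mono fun i hi =>
        div_nonneg (Real.exp_pos _).le (le_of_lt hi)
    have hin : ∀ᶠ i in 𝓝₀ ×ˢ 𝓟 𝕀, ∀ z ∈ closedBall z₀ D,
        ((0 : ℝ), ∇ (P.Q i.1) z.1.1, z) ∈ {x : ℝ × Config d × State d |
          ‖x.1‖ ≤ 1 ∧ ‖x.2.1‖ ≤ C₁ ∧ ‖x.2.2‖ ≤ ‖z₀‖ + D ∧ y₀ ≤ |⟪x.2.1, x.2.2.1.2⟫|} := by
      filter_upwards [he.eventually hC₁, he.eventually hb.2.2] with i hi hi' z hz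
      exact ⟨by simp, hi.1 _ (mem_ball_q hDR hz), norm_le_of_mem_closedBall hz, (hi' z hz).1⟩
    have hball : ∀ᶠ i : ℝ × ℝ in 𝓝₀ ×ˢ 𝓟 𝕀, ∀ z ∈ closedBall z₀ D,
        z.1.1 ∈ closedBall z₀.1.1 R ∧ ‖z‖ ≤ ‖z₀‖ + D :=
      .of_forall fun _ z hz => ⟨mem_ball_q hDR hz, norm_le_of_mem_closedBall hz⟩
    have hY := h.cRel_smooth he (A := fun _ => closedBall z₀ D) hball
      (w := fun _ => (0 : ℝ)) (R'' := 1) (by simp)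
      (H := fun x => levelField x.2.1 0 x.2.2) (isCompact_level_set C₁ (‖z₀‖ + D) y₀)
      (fun x hx => contDiffAt_levelField contDiffAt_snd.fst contDiffAt_const contDiffAt_snd.snd
        (ne_of_le_abs hb.2.1 hx.2.2.2)) hin hm
    have hZ := h.cRel_smooth he (A := fun _ => closedBall z₀ D) hball
      (w := fun _ => (0 : ℝ)) (R'' := 1) (by simp)
      (H := fun x => (x.2.2.2.2 / ⟪x.2.1, x.2.2.1.2⟫) •
        ((((0 : Config d), x.2.1), ((0 : ℝ), (0 : ℝ))) : State d))
      (isCompact_level_set C₁ (‖z₀‖ + D) y₀)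
      (fun x hx => by
        have hp : 𝒞 (⊤ : ℕ∞) (fun x : ℝ × Config d × State d => x.2.2.1.2) x :=
          contDiffAt_snd.snd.fst.snd
        exact (contDiffAt_snd.snd.snd.snd.div (contDiffAt_snd.fst.inner ℝ hp)
          (ne_of_le_abs hb.2.1 hx.2.2.2)).smul ((contDiffAt_const.prodMk contDiffAt_snd.fst).prodMk
            contDiffAt_const)) hin hm
    have hX := hY.add (CRel.smul_index hm hZ.left hZ.cr) hm
    refine hX.congr (.of_forall fun i x _ => .of_forall fun z => ?_)
      (.of_forall fun i x _ => .of_forall fun z => ?_)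
    · simp only [barrierLevel, levelField]
      ext <;> simp
      ring
    · simp [freeLevel]
  · filter_upwards [hb.2.2, P.eventually_lt] with ε h1 h2 s hs z hz
    have hq := mem_ball_q hDR hz
    have h3 := (h.contDiffAt hq (Ioo_subset_Ico_self h2)).gradient_q (s := s)
    have h4 : 𝒞 r (fun w : ℝ × State d =>
        exp (-(s₀ ε + w.1 * (s₁ ε - s₀ ε)) / ε) / ε) (s, z) := by
      have : ContDiff ℝ r (fun w : ℝ × State d =>
        exp (-(s₀ ε + w.1 * (s₁ ε - s₀ ε)) / ε) / ε) := by fun_prop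
      exact this.contDiffAt
    exact contDiffAt_levelField h3 (h4.smul h3) contDiffAt_snd (ne_of_le_abs hb.2.1 (h1 z hz).1)

end SteepExpPotential

/-! ### Related maps near a point -/

/-- Near `x` the families `f` and `g` are `C^r`-close, and they take `x` to `y` in the limit. -/
structure LocRel (r : ℕ) {E F : Type} [NormedAddCommGroup E] [NormedSpace ℝ E]
    [NormedAddCommGroup F] [NormedSpace ℝ F] (f g : ℝ → E → F) (x : E) (y : F) : Prop where
  rel : ∃ ρ > 0, CRel 𝓝₀ (nuExp r) r f g (fun _ => closedBall x ρ) (fun _ => closedBall x ρ)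
  tendsto_left : Tendsto (fun w : ℝ × E => f w.1 w.2) (𝓝₀ ×ˢ 𝓝 x) (𝓝 y)
  tendsto_right : Tendsto (fun w : ℝ × E => g w.1 w.2) (𝓝₀ ×ˢ 𝓝 x) (𝓝 y)

section LocRel

variable {r : ℕ} {E F H : Type} [NormedAddCommGroup E] [NormedSpace ℝ E]
  [NormedAddCommGroup F] [NormedSpace ℝ F] [NormedAddCommGroup H] [NormedSpace ℝ H]
  {f g f' g' : ℝ → E → F} {x : E} {y : F}

omit [NormedSpace ℝ E] [NormedSpace ℝ F] in
lemma tendsto_lift (h : Tendsto (fun w : ℝ × E => f w.1 w.2) (𝓝₀ ×ˢ 𝓝 x) (𝓝 y)) :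
    Tendsto (fun w : ℝ × E => (w.1, f w.1 w.2)) (𝓝₀ ×ˢ 𝓝 x) (𝓝₀ ×ˢ 𝓝 y) :=
  tendsto_fst.prodMk h

lemma nuExp_nonneg_eventually : ∀ᶠ ε in 𝓝₀, 0 ≤ nuExp r ε :=
  eventually_mem_nhdsWithin.mono fun _ hε => (nuExp_pos hε).le

lemma nuExp_le_one_eventually : ∀ᶠ ε in 𝓝₀, nuExp r ε ≤ 1 :=
  (tendsto_nuExp (r := r)).eventually_le_const one_pos

lemma LocRel.of_cRel {ρ : ℝ} (hρ : 0 < ρ) (h : CRel 𝓝₀ (nuExp r) r f g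
      (fun _ => closedBall x ρ) (fun _ => closedBall x ρ))
    (hg : Tendsto (fun w : ℝ × E => g w.1 w.2) (𝓝₀ ×ˢ 𝓝 x) (𝓝 y)) : LocRel r f g x y :=
  ⟨⟨ρ, hρ, h⟩, h.tendsto tendsto_nuExp (closedBall_mem_nhds x hρ) hg, hg⟩

lemma LocRel.comp {f' g' : ℝ → F → H} {z : H} (h' : LocRel r f' g' y z) (h : LocRel r f g x y) :
    LocRel r (fun ε => f' ε ∘ f ε) (fun ε => g' ε ∘ g ε) x z := by
  obtain ⟨ρ, hρ, h1⟩ := h.rel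
  obtain ⟨ρ', hρ', h2⟩ := h'.rel
  have hb := closedBall_mem_nhds y hρ'
  obtain ⟨a, ha, ha'⟩ := Filter.Eventually.exists_closedBall
    (p := fun ε z => f ε z ∈ closedBall y ρ' ∧ g ε z ∈ closedBall y ρ')
    ((h.tendsto_left.eventually_mem hb).and (h.tendsto_right.eventually_mem hb))
  refine ⟨⟨min ρ a, lt_min hρ ha, ?_⟩, h'.tendsto_left.comp (tendsto_lift h.tendsto_left),
    h'.tendsto_right.comp (tendsto_lift h.tendsto_right)⟩
  have hs : ∀ᶠ ε in 𝓝₀, closedBall x (min ρ a) ⊆ closedBall x ρ :=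
    .of_forall fun _ => closedBall_subset_closedBall (min_le_left _ _)
  exact h2.comp (h1.mono_set hs hs) nuExp_nonneg_eventually nuExp_le_one_eventually
    (.of_forall fun _ => subset_rfl)
    ((ha' _ (min_le_right _ _)).mono fun ε hε z hz => (hε z hz).1)
    ((ha' _ (min_le_right _ _)).mono fun ε hε z hz => (hε z hz).2)

lemma LocRel.fixed [FiniteDimensional ℝ E] {G : E → F} {x : E}
    (hG : ∀ᶠ z in 𝓝 x, 𝒞 (⊤ : ℕ∞) G z) : LocRel r (fun _ => G) (fun _ => G) x (G x) := by
  obtain ⟨ρ, hρ, h⟩ := nhds_basis_closedBall.mem_iff.1 hG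
  have := FiniteDimensional.proper ℝ E
  have hs : ∀ᶠ ε in 𝓝₀, closedBall x ρ ⊆ closedBall x ρ := .of_forall fun _ => subset_rfl
  exact LocRel.of_cRel hρ (CRel.fixed (isCompact_closedBall x ρ) h hs hs nuExp_nonneg_eventually)
    (hG.self_of_nhds.continuousAt.tendsto.comp tendsto_snd)

end LocRel

namespace SteepExpPotential

variable {d r : ℕ} {B : BilliardTable d r} {P : SteepExpPotential B} {j : Fin B.pieces}

lemma IsPatch.cRel_Q {q : Config d} {R : ℝ} (h : P.IsPatch j (closedBall q R)) :
    CRel 𝓝₀ (nuExp r) r (fun ε => P.Q ε) (fun ε => P.Q ε)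
      (fun _ => closedBall q R) (fun _ => closedBall q R) := by
  obtain ⟨C, hC0, hC⟩ := P.exists_bound_iteratedFDeriv_Q (isCompact_closedBall q R) h.subset_Dt
  have hc : ∀ᶠ ε in 𝓝₀, ∀ x ∈ closedBall q R, 𝒞 r (P.Q ε) x :=
    P.eventually_lt.mono fun ε hε x hx =>
      (h.contDiffAt hx (Ioo_subset_Ico_self hε)).of_le (by exact_mod_cast Nat.le_succ r)
  refine CRel.of_iteratedFDeriv (C := C) (R := ‖q‖ + R) hc hc (fun k hk => ?_)
    (.of_forall fun _ x hx => mem_closedBall_zero_iff.2 (norm_le_of_mem_closedBall hx))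
    nuExp_nonneg_eventually nuExp_le_one_eventually (.of_forall fun _ => subset_rfl)
  filter_upwards [hC, nuExp_nonneg_eventually (r := r), P.eventually_lt] with ε h1 h3 h4
  refine ⟨fun x hx => h1 _ (by omega) x hx, fun x hx y hy => ?_⟩
  have h5 := (convex_closedBall q R).norm_image_sub_le_of_norm_fderiv_le (𝕜 := ℝ)
    (f := iteratedFDeriv ℝ k (P.Q ε)) (C := C)
    (fun z hz => (h.contDiffAt hz (Ioo_subset_Ico_self h4)).differentiableAt_iteratedFDeriv (by
        exact_mod_cast Nat.lt_succ_of_le hk))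
    (fun z hz => by
      rw [norm_fderiv_iteratedFDeriv]
      exact h1 _ (by omega) z hz) hy hx
  refine h5.trans ?_
  gcongr
  linarith

/-- Puts the level to be reached, relative to the present one, into the parameter. -/
noncomputable def setLevel (P : SteepExpPotential B) (j : Fin B.pieces) (s : ℝ → ℝ) (ε : ℝ)
    (z : State d) : State d :=
  (z.1, (z.2.1, s ε - (P.Q ε z.1.1 - P.Qval j)))

lemma IsPatch.locRel_setLevel {z : State d} {R a : ℝ} {s : ℝ → ℝ} (hR : 0 < R)
    (h : P.IsPatch j (closedBall z.1.1 R)) (hs : Tendsto s 𝓝₀ (𝓝 a)) :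
    LocRel r (P.setLevel j s) (P.setLevel j s) z (z.1, (z.2.1, a - (P.Q 0 z.1.1 - P.Qval j))) := by
  have h0 := nuExp_nonneg_eventually (r := r)
  have hbd : ∀ᶠ ε in 𝓝₀, closedBall z R ⊆
      closedBall 0 (‖z‖ + R) := .of_forall fun _ z hz =>
    mem_closedBall_zero_iff.2 (norm_le_of_mem_closedBall hz)
  have hq : ∀ᶠ ε in 𝓝₀, MapsTo (State.qL (d := d)) (closedBall z R)
      (closedBall z.1.1 R) := .of_forall fun _ z hz => mem_ball_q le_rfl hz
  have h1 := h.cRel_Q.comp (CRel.clm State.qL hbd h0) h0 nuExp_le_one_eventually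
    (.of_forall fun _ => subset_rfl) hq hq
  have hsb : ∀ᶠ ε in 𝓝₀, ‖s ε + P.Qval j‖ ≤ ‖a + P.Qval j‖ + 1 :=
    (hs.add_const (P.Qval j)).norm.eventually_le_const (by linarith)
  have h2 := (CRel.const (A := fun _ => closedBall z R) (A' := fun _ => closedBall z R)
    (k := r) _ hsb h0).add (h1.clm_left (-ContinuousLinearMap.id ℝ ℝ) h0) h0
  have h3 := (CRel.clm (k := r) (A := fun _ => closedBall z R)
    (fst ℝ (Config d × Config d) (ℝ × ℝ)) hbd h0).prodMk
      ((CRel.clm (k := r) (State.tL (d := d)) hbd h0).prodMk h2 h0) h0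
  have e : ∀ (ε : ℝ) (x : State d), (fst ℝ (Config d × Config d) (ℝ × ℝ) x,
      (State.tL (d := d) x, s ε + P.Qval j + (-ContinuousLinearMap.id ℝ ℝ)
        ((P.Q ε ∘ State.qL (d := d)) x))) = P.setLevel j s ε x := fun ε x => by
    simp only [setLevel, State.qL, State.tL]
    ext1
    · rfl
    · ext1
      · rfl
      · simp
        ring
  refine LocRel.of_cRel hR (h3.congr (.of_forall fun ε x _ => .of_forall fun y => e ε y)
    (.of_forall fun ε x _ => .of_forall fun y => e ε y)) ?_
  have hz : z.1.1 ∈ P.Dt := h.subset_Dt (mem_closedBall_self hR.le)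
  have h4 : Tendsto (fun w : ℝ × State d => (w.1, w.2.1.1)) (𝓝₀ ×ˢ 𝓝 z) (𝓝₀ ×ˢ 𝓝 z.1.1) :=
    tendsto_fst.prodMk (tendsto_snd.fst_nhds.fst_nhds)
  have h5 := (P.tendsto_Q hz).comp h4
  exact (tendsto_snd.fst_nhds).prodMk_nhds
    ((tendsto_snd.snd_nhds.fst_nhds).prodMk_nhds
      ((hs.comp tendsto_fst).sub (h5.sub_const _)))

lemma CloseFlows.mono_ball {X Y : ℝ → ℝ → State d → State d} {z₀ z₁ : State d} {D ρ ρ' : ℝ}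
    (h : CloseFlows r X Y z₀ D ρ) (hz : dist z₁ z₀ + ρ' ≤ ρ) :
    CRel 𝓝₀ (nuExp r) r (fun ε => flowMap (X ε) 1) (fun ε => flowMap (Y ε) 1)
    (fun _ => closedBall z₁ ρ') (fun _ => closedBall z₁ ρ') := by
  have hs : ∀ᶠ ε in 𝓝₀, closedBall z₁ ρ' ⊆ closedBall z₀ ρ :=
    .of_forall fun _ => Metric.closedBall_subset_closedBall' (by linarith)
  exact h.2.2.2.mono_set hs hs

lemma IsPatch.freeLevel_sol {ε D : ℝ} {z₀ z : State d} (hε : ε ∈ Ioo 0 P.ε₁) {R : ℝ}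
    (h : P.IsPatch j (closedBall z₀.1.1 R)) (hDR : D ≤ R)
    (hy : ∀ z ∈ closedBall z₀ D, ⟪∇ (P.Q ε) z.1.1, z.1.2⟫ ≠ (0 : ℝ))
    (hz : FlowIn (P.freeLevel ε) (fun _ => z₀) D z) {s : ℝ} (hs : s ∈ 𝕀) :
    flowMap (P.freeLevel ε) s z =
      ((z.1.1 + ((flowMap (P.freeLevel ε) s z).2.1 - z.2.1) • z.1.2, z.1.2),
        ((flowMap (P.freeLevel ε) s z).2.1, z.2.2)) ∧
    P.Q ε (flowMap (P.freeLevel ε) s z).1.1 = P.Q ε z.1.1 + s * z.2.2 := by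
  have hin : ∀ s ∈ 𝕀, flowMap (P.freeLevel ε) s z ∈ closedBall z₀ D := fun s hs =>
      mem_closedBall_iff_norm.2 (hz.2 s hs)
  have hsol : ∀ s ∈ 𝕀, HasDerivWithinAt (fun s => flowMap (P.freeLevel ε) s z)
    (levelField (∇ (P.Q ε) (flowMap (P.freeLevel ε) s z).1.1) ((fun _ => 0 : ℝ → Config d) s)
      (flowMap (P.freeLevel ε) s z)) 𝕀 s := hz.1.2
  have h1 := level_L_eq hsol hs
  have h2 := level_line hsol (fun _ _ => rfl) hs
  have h3 := level_Q_eq hsol (fun s hs => h.differentiableAt (mem_ball_q hDR (hin s hs))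
    (Ioo_subset_Ico_self hε)) (fun s hs => hy _ (hin s hs)) hs
  simp only [hz.1.1] at h1 h2 h3
  exact ⟨Prod.ext (Prod.ext h2.2 h2.1) (Prod.ext rfl h1), h3⟩

lemma CloseFlows.locRel_of_mem {X : ℝ → ℝ → State d → State d} {z₀ z₁ : State d} {R D ρ y₀ τ : ℝ}
    (h : P.IsPatch j (closedBall z₀.1.1 R)) (hDR : D ≤ R) (hb : P.IsLevelBall z₀ D y₀)
    (hX : CloseFlows r X P.freeLevel z₀ D ρ) (hz : z₁ ∈ ball z₀ ρ)
    (hz' : (((z₁.1.1 + τ • z₁.1.2, z₁.1.2), (z₁.2.1 + τ, z₁.2.2)) : State d) ∈ ball z₀ D)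
    (hQ : P.Q 0 (z₁.1.1 + τ • z₁.1.2) = P.Q 0 z₁.1.1 + z₁.2.2) :
    LocRel r (fun ε => flowMap (X ε) 1) (fun ε => flowMap (P.freeLevel ε) 1) z₁
      ((z₁.1.1 + τ • z₁.1.2, z₁.1.2), (z₁.2.1 + τ, z₁.2.2)) := by
  have hρ' : 0 < ρ - dist z₁ z₀ := sub_pos.2 hz
  refine LocRel.of_cRel hρ' (hX.mono_ball (by linarith)) ?_
  set G : ℝ → State d → State d := fun τ z => ((z.1.1 + τ • z.1.2, z.1.2), (z.2.1 + τ, z.2.2))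
    with hG
  have hGc : Continuous (fun w : ℝ × State d => G w.1 w.2) := by
    simp only [hG]
    fun_prop
  have hG1 : Tendsto (fun w : ℝ × State d => G τ w.2) (𝓝₀ ×ˢ 𝓝 z₁) (𝓝 (G τ z₁)) :=
    ((hGc.comp (Continuous.prodMk_right τ)).tendsto z₁).comp tendsto_snd
  have hev : ∀ᶠ w : ℝ × State d in 𝓝₀ ×ˢ 𝓝 z₁, FlowIn (P.freeLevel w.1) (fun _ => z₀) D w.2 := by
    filter_upwards [hX.1.prod_mk (isOpen_ball.mem_nhds hz)] with w hw
    exact (hw.1 w.2 (ball_subset_closedBall hw.2)).2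
  have hev2 : ∀ᶠ w : ℝ × State d in 𝓝₀ ×ˢ 𝓝 z₁, ∀ z ∈ closedBall z₀ D,
    y₀ ≤ |⟪∇ (P.Q w.1) z.1.1, z.1.2⟫| := by
    filter_upwards [hb.2.2.prod_inl _] with w hw z hz using (hw z hz).1
  have hev3 : ∀ᶠ w : ℝ × State d in 𝓝₀ ×ˢ 𝓝 z₁, G τ w.2 ∈ closedBall z₀ D :=
    hG1.eventually_mem (mem_of_superset (isOpen_ball.mem_nhds hz') ball_subset_closedBall)
  have hev4 : ∀ᶠ w : ℝ × State d in 𝓝₀ ×ˢ 𝓝 z₁, w.1 ∈ Ioo 0 P.ε₁ :=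
    P.eventually_lt.prod_inl _
  have key : ∀ᶠ w : ℝ × State d in 𝓝₀ ×ˢ 𝓝 z₁, flowMap (P.freeLevel w.1) 1 w.2 =
        G ((flowMap (P.freeLevel w.1) 1 w.2).2.1 - w.2.2.1) w.2 ∧
      |((flowMap (P.freeLevel w.1) 1 w.2).2.1 - w.2.2.1) - τ| ≤
        y₀⁻¹ * |P.Q w.1 w.2.1.1 + w.2.2.2 - P.Q w.1 (G τ w.2).1.1| := by
    filter_upwards [hev, hev2, hev3, hev4] with w h1 h2 h3 h4
    have h01 : (1 : ℝ) ∈ 𝕀 := by simp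
    obtain ⟨e1, e2⟩ := h.freeLevel_sol h4 hDR (fun z hz => ne_of_le_abs hb.2.1 (h2 z hz)) h1 h01
    have hend : flowMap (P.freeLevel w.1) 1 w.2 ∈ closedBall z₀ D := mem_closedBall_iff_norm.2 (h1.2
        1 h01)
    set τ' := (flowMap (P.freeLevel w.1) 1 w.2).2.1 - w.2.2.1 with hτ'
    have e3 : flowMap (P.freeLevel w.1) 1 w.2 = G τ' w.2 := by
      rw [e1]
      simp only [hG, hτ']
      congr 2
      ring
    refine ⟨e3, ?_⟩
    rw [e3, one_mul] at e2
    rw [e3] at hend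
    rw [← e2]
    have hseg : ∀ u ∈ 𝕀, G (τ + u * (τ' - τ)) w.2 ∈ closedBall z₀ D := by
      intro u hu
      have := (convex_closedBall z₀ D) h3 hend (sub_nonneg.2 hu.2) hu.1 (by ring)
      convert this using 1
      simp only [hG]
      ext1
      · ext1
        · simp only [Prod.fst_add, Prod.smul_fst]
          module
        · simp only [Prod.fst_add, Prod.smul_fst, Prod.snd_add, Prod.smul_snd]
          module
      · ext1
        · simp
          ring
        · simp
          ring
    have hder : ∀ u ∈ 𝕀, HasDerivAt (fun u => P.Q w.1 (G (τ + u * (τ' - τ)) w.2).1.1)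
        (⟪∇ (P.Q w.1) (G (τ + u * (τ' - τ)) w.2).1.1, w.2.1.2⟫ * (τ' - τ)) u := by
      intro u hu
      have d1 := (h.differentiableAt (mem_ball_q hDR (hseg u hu))
        (Ioo_subset_Ico_self h4)).hasGradientAt.hasFDerivAt
      have d2 : HasDerivAt (fun u : ℝ => w.2.1.1 + (τ + u * (τ' - τ)) • w.2.1.2)
          ((τ' - τ) • w.2.1.2) u := by
        have := ((((hasDerivAt_id u).mul_const (τ' - τ)).const_add τ).smul_const
          w.2.1.2).const_add w.2.1.1
        simpa using this
      refine (d1.comp_hasDerivAt u d2).congr_deriv ?_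
      rw [InnerProductSpace.toDual_apply_apply, real_inner_smul_right]
      exact mul_comm _ _
    obtain ⟨u, hu, hu'⟩ := exists_hasDerivAt_eq_slope _ _ zero_lt_one
      (fun u hu => (hder u hu).continuousAt.continuousWithinAt)
      (fun u hu => hder u (Ioo_subset_Icc_self hu))
    simp only [one_mul, zero_mul, add_zero, sub_zero, div_one, add_sub_cancel] at hu'
    rw [← hu', abs_mul, inv_mul_eq_div, le_div_iff₀ hb.2.1, mul_comm]
    exact mul_le_mul_of_nonneg_right (h2 _ (hseg u (Ioo_subset_Icc_self hu))) (abs_nonneg _)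
  have hz0 : z₁.1.1 ∈ closedBall z₀.1.1 R := by
    have h1 := hX.1
    obtain ⟨ε, h1, h2⟩ := (hX.1.and eventually_mem_nhdsWithin).exists
    have h3 := h1 z₁ (ball_subset_closedBall hz)
    have h4 := h3.2.2 0 (by simp)
    rw [h3.2.1.1, ← dist_eq_norm] at h4
    exact mem_ball_q hDR h4
  have hz1 := mem_ball_q hDR (ball_subset_closedBall hz')
  have t1 : Tendsto (fun w : ℝ × State d => P.Q w.1 w.2.1.1) (𝓝₀ ×ˢ 𝓝 z₁) (𝓝 (P.Q 0 z₁.1.1)) :=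
    (P.tendsto_Q (h.subset_Dt hz0)).comp (tendsto_fst.prodMk
      (tendsto_snd.fst_nhds.fst_nhds))
  have t2 : Tendsto (fun w : ℝ × State d => P.Q w.1 (G τ w.2).1.1) (𝓝₀ ×ˢ 𝓝 z₁)
      (𝓝 (P.Q 0 (G τ z₁).1.1)) :=
    (P.tendsto_Q (h.subset_Dt hz1)).comp (tendsto_fst.prodMk
      (hG1.fst_nhds.fst_nhds))
  have t3 : Tendsto (fun w : ℝ × State d => y₀⁻¹ *
      |P.Q w.1 w.2.1.1 + w.2.2.2 - P.Q w.1 (G τ w.2).1.1|) (𝓝₀ ×ˢ 𝓝 z₁) (𝓝 0) := by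
    have := (((t1.add (tendsto_snd.snd_nhds.snd_nhds)).sub
      t2).abs).const_mul y₀⁻¹
    simpa [hG, hQ] using this
  have t4 : Tendsto (fun w : ℝ × State d => (flowMap (P.freeLevel w.1) 1 w.2).2.1 - w.2.2.1)
      (𝓝₀ ×ˢ 𝓝 z₁) (𝓝 τ) := by
    rw [tendsto_iff_norm_sub_tendsto_zero]
    exact squeeze_zero' (.of_forall fun _ => norm_nonneg _) (key.mono fun w hw => hw.2) t3
  have t5 := (hGc.tendsto (τ, z₁)).comp (t4.prodMk_nhds tendsto_snd)
  refine t5.congr' ?_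
  filter_upwards [key] with w hw
  exact hw.1.symm

end SteepExpPotential

/-! ### Motion in the interior -/

section Orbit

variable {d : ℕ} {G : Set (Config d)} {V : Config d → ℝ} {a b c : ℝ} {γ γ' : ℝ → Phase d}

lemma OrbitOn.mono (h : OrbitOn G V a c γ) {a' c' : ℝ} (ha : a ≤ a') (hc : c' ≤ c) :
    OrbitOn G V a' c' γ := fun s hs =>
  ⟨(h s ⟨ha.trans hs.1, hs.2.trans hc⟩).1, (h s ⟨ha.trans hs.1, hs.2.trans hc⟩).2.mono
    (Icc_subset_Icc ha hc)⟩

lemma OrbitOn.congr (h : OrbitOn G V a b γ) (e : EqOn γ' γ (Icc a b)) : OrbitOn G V a b γ' :=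
  fun s hs => by
    rw [e hs]
    exact ⟨(h s hs).1, (h s hs).2.congr (fun x hx => e hx) (e hs)⟩

lemma hasDerivWithinAt_union {E : Type} [NormedAddCommGroup E] [NormedSpace ℝ E] {f : ℝ → E} {v : E}
    {s : ℝ} (h : s ∈ Icc a b → HasDerivWithinAt f v (Icc a b) s)
    (h' : s ∈ Icc b c → HasDerivWithinAt f v (Icc b c) s) (hs : s ∈ Icc a c) :
    HasDerivWithinAt f v (Icc a c) s := by
  rcases lt_trichotomy s b with hb | rfl | hb
  · exact (h ⟨hs.1, hb.le⟩).mono_of_mem_nhdsWithin (mem_nhdsWithin.2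
      ⟨Iio b, isOpen_Iio, hb, fun x hx => ⟨hx.2.1, le_of_lt hx.1⟩⟩)
  · exact ((h ⟨hs.1, le_rfl⟩).union (h' ⟨le_rfl, hs.2⟩)).mono Icc_subset_Icc_union_Icc
  · exact (h' ⟨hb.le, hs.2⟩).mono_of_mem_nhdsWithin (mem_nhdsWithin.2
      ⟨Ioi b, isOpen_Ioi, hb, fun x hx => ⟨le_of_lt hx.1, hx.2.2⟩⟩)

lemma OrbitOn.union (h : OrbitOn G V a b γ) (h' : OrbitOn G V b c γ) :
    OrbitOn G V a c γ := by
  intro s hs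
  refine ⟨?_, hasDerivWithinAt_union (fun hs' => (h s hs').2) (fun hs' => (h' s hs').2) hs⟩
  rcases le_total s b with hb | hb
  · exact (h s ⟨hs.1, hb⟩).1
  · exact (h' s ⟨hb, hs.2⟩).1

lemma OrbitOn.glue (h : OrbitOn G V a b γ)
    (h' : OrbitOn G V b c γ') (e : γ b = γ' b) :
    ∃ γ'', OrbitOn G V a c γ'' ∧ EqOn γ'' γ (Icc a b) ∧ EqOn γ'' γ' (Icc b c) := by
  set f : ℝ → Phase d := fun s => if s ≤ b then γ s else γ' s with hf
  have e1 : EqOn f γ (Icc a b) := fun s hs => if_pos hs.2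
  have e2 : EqOn f γ' (Icc b c) := fun s hs => by
    rcases hs.1.eq_or_lt with rfl | hs'
    · simp [hf, e]
    · exact if_neg (not_le.2 hs')
  exact ⟨f, (h.congr e1).union (h'.congr e2), e1, e2⟩
end Orbit

namespace SteepExpPotential

variable {d r : ℕ} {B : BilliardTable d r} {P : SteepExpPotential B} {j : Fin B.pieces}

/-- An orbit of the Hamiltonian system leads from the state `z` to the state `z'`, through `S`. -/
def Arc (P : SteepExpPotential B) (ε : ℝ) (S : Set (Phase d)) (z z' : State d) : Prop :=
  z.2.1 ≤ z'.2.1 ∧ ∃ γ : ℝ → Phase d, OrbitOn P.domain (P.V ε) z.2.1 z'.2.1 γ ∧ γ z.2.1 = z.1 ∧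
    γ z'.2.1 = z'.1 ∧ ∀ s ∈ Ioo z.2.1 z'.2.1, γ s ∈ S

lemma Arc.mono {ε : ℝ} {S S' : Set (Phase d)} {z z' : State d} (h : P.Arc ε S z z') (hS : S ⊆ S') :
    P.Arc ε S' z z' := by
  obtain ⟨h0, γ, h1, h2, h3, h4⟩ := h
  exact ⟨h0, γ, h1, h2, h3, fun s hs => hS (h4 s hs)⟩

lemma Arc.trans {ε : ℝ} {S : Set (Phase d)} {z z' z'' : State d} (h : P.Arc ε S z z')
    (h' : P.Arc ε S z' z'') (hz : z'.1 ∈ S) : P.Arc ε S z z'' := by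
  obtain ⟨h0, γ, h1, h2, h3, h4⟩ := h
  obtain ⟨h0', γ', h1', h2', h3', h4'⟩ := h'
  obtain ⟨f, e0, e1, e2⟩ := h1.glue h1' (h3.trans h2'.symm)
  refine ⟨h0.trans h0', f, e0, ?_, ?_, fun s hs => ?_⟩
  · rw [e1 ⟨le_rfl, h0⟩, h2]
  · rw [e2 ⟨h0', le_rfl⟩, h3']
  · rcases lt_trichotomy s z'.2.1 with hs' | rfl | hs'
    · rw [e1 ⟨hs.1.le, hs'.le⟩]
      exact h4 s ⟨hs.1, hs'⟩
    · rw [e1 ⟨hs.1.le, le_rfl⟩, h3]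
      exact hz
    · rw [e2 ⟨hs'.le, hs.2.le⟩]
      exact h4' s ⟨hs', hs.2⟩

def core (P : SteepExpPotential B) (c M ε : ℝ) : Set (Phase d) :=
  {x | x.1 ∈ P.intTable ε \ thickening c B.corner ∧ x.1 ∈ interior (P.auxTable ε) ∧ ‖x‖ ≤ M}

lemma core_mono {c c' M M' ε : ℝ} (hc : c' ≤ c) (hM : M ≤ M') : P.core c M ε ⊆ P.core c' M' ε :=
  fun _ hx => ⟨⟨hx.1.1, fun h => hx.1.2 (Metric.thickening_mono hc _ h)⟩, hx.2.1, hx.2.2.trans hM⟩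

noncomputable def intField (P : SteepExpPotential B) (ε : ℝ) (_ : ℝ) (z : State d) : State d :=
  z.2.2 • ((z.1.2, -∇ (P.V ε) z.1.1), ((1 : ℝ), (0 : ℝ)))

def freeField (_ : ℝ) (z : State d) : State d := z.2.2 • ((z.1.2, 0), (1, 0))

def freeFlow (s : ℝ) (z : State d) : State d :=
  ((z.1.1 + (s * z.2.2) • z.1.2, z.1.2), (z.2.1 + s * z.2.2, z.2.2))

def freeMap (z : State d) : State d := ((z.1.1 + z.2.2 • z.1.2, z.1.2), (z.2.1 + z.2.2, z.2.2))

lemma contDiffAt_intField {ε : ℝ} (hε : ε ∈ Ioo 0 P.ε₁) {s : ℝ} {z : State d}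
    (hz : z.1.1 ∈ P.domain) : 𝒞 r (uncurry (P.intField ε)) (s, z) := by
  exact contDiffAt_snd.snd.snd.smul ((contDiffAt_snd.fst.snd.prodMk
    (P.contDiffAt_V hε hz).gradient_q.neg).prodMk (contDiffAt_const.prodMk contDiffAt_const))

lemma _root_.OrbitOn.flowMap_eq (hr : 1 ≤ r) {ε a b t L : ℝ} (hε : ε ∈ Ioo 0 P.ε₁) {γ : ℝ → Phase d}
    (h : OrbitOn P.domain (P.V ε) a b γ) (ht : t ∈ Icc a b) (hL : t + L ∈ Icc a b) :
    (flowMap (P.intField ε) 0 (γ t, (t, L)) = (γ t, (t, L)) ∧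
      IsSol (P.intField ε) (fun s => flowMap (P.intField ε) s (γ t, (t, L))) ∧
      RegAlong r (P.intField ε) (fun s => flowMap (P.intField ε) s (γ t, (t, L)))) ∧
    ∀ s ∈ 𝕀, flowMap (P.intField ε) s (γ t, (t, L)) = (γ (t + s * L), (t + s * L, L)) := by
  set ζ : ℝ → State d := fun s => (γ (t + s * L), (t + s * L, L)) with hζ
  have hin : ∀ s ∈ 𝕀, t + s * L ∈ Icc a b := fun s hs => by
    have := (convex_Icc a b) ht hL (sub_nonneg.2 hs.2) hs.1 (by ring)
    convert this using 1
    simp only [smul_eq_mul]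
    ring
  have hsol : IsSol (P.intField ε) ζ := by
    intro s hs
    have h1 : HasDerivWithinAt (fun s : ℝ => t + s * L) L 𝕀 s := by
      simpa using (((hasDerivAt_id s).mul_const L).const_add t).hasDerivWithinAt (s := 𝕀)
    have h2 := (h _ (hin s hs)).2.scomp s h1 hin
    have h3 := h2.prodMk (h1.prodMk (hasDerivWithinAt_const s 𝕀 L))
    refine h3.congr_deriv ?_
    simp [intField, hζ]
  have hreg : RegAlong r (P.intField ε) ζ := fun s hs => contDiffAt_intField hε (h _ (hin s hs)).1
  have e : ζ 0 = (γ t, (t, L)) := by simp [hζ]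
  have h1 := flowMap_eqOn hsol (hreg.of_le hr)
  have h2 := flowMap_isSol hsol (hreg.of_le hr)
  rw [e] at h1 h2
  refine ⟨⟨h2.1, h2.2, fun s hs => ?_⟩, fun s hs => h1 hs⟩
  have := hreg s hs
  rwa [← h1 hs] at this

lemma isSol_free (z : State d) : IsSol freeField fun s => freeFlow s z := by
  intro s hs
  have h1 : HasDerivAt (fun s : ℝ => s * z.2.2) z.2.2 s := by
    simpa using (hasDerivAt_id s).mul_const z.2.2
  have h2 := (((h1.smul_const z.1.2).const_add z.1.1).prodMk (hasDerivAt_const s z.1.2)).prodMk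
    ((h1.const_add z.2.1).prodMk (hasDerivAt_const s z.2.2))
  refine h2.hasDerivWithinAt.congr_deriv ?_
  simp [freeField, freeFlow]

lemma BoundaryDominated.cRel_flow (hP : P.BoundaryDominated) (hr : 1 ≤ r) {ι : Type} {l : Filter ι}
    {e : ι → ℝ} (he : Tendsto e l 𝓝₀) {A A' : ι → Set (State d)} {c M : ℝ} (hc : 0 < c)
    (hA : ∀ᶠ i in l, A i ⊆ A' i) (hM : ∀ᶠ i in l, A' i ⊆ closedBall 0 M)
    (hγ : ∀ᶠ i in l, ∀ z ∈ A i, ∃ (a b : ℝ) (γ : ℝ → Phase d),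
      OrbitOn P.domain (P.V (e i)) a b γ ∧ γ z.2.1 = z.1 ∧ z.2.1 ∈ Icc a b ∧
      z.2.1 + z.2.2 ∈ Icc a b ∧
      ∀ s ∈ 𝕀, γ (z.2.1 + s * z.2.2) ∈ P.core c M (e i)) :
    CRel l (fun i => nuExp r (e i)) r (fun i => flowMap (P.intField (e i)) 1) (fun _ => freeMap)
      A A' := by
  obtain ⟨k, rfl⟩ : ∃ k, r = k + 1 := ⟨r - 1, by omega⟩
  set M' := max M 0 with hM'
  have hM0 : 0 ≤ M' := le_max_right _ _
  set R := 2 * M' + M' * M' with hR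
  have h0 : ∀ᶠ i in l, 0 ≤ nuExp (k + 1) (e i) := he.eventually nuExp_nonneg_eventually
  have h1 : ∀ᶠ i in l, nuExp (k + 1) (e i) ≤ 1 := he.eventually nuExp_le_one_eventually
  have hflow : ∀ᶠ i in l, ∀ z ∈ A i, (FlowJet (k + 1) (P.intField (e i)) (flowMap (P.intField (e
      i))) z ∧
      𝒞 (k + 1 : ℕ) (flowMap (P.intField (e i)) 1) z) ∧
      ∀ s ∈ 𝕀, flowMap (P.intField (e i)) s z ∈
        {z : State d | z.1 ∈ P.core c M (e i) ∧ ‖z‖ ≤ R} := by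
    filter_upwards [hγ, he.eventually P.eventually_lt, hA, hM] with i h2 h3 h4 h5 z hz
    obtain ⟨a, b, γ, g1, g2, g3, g4, g5⟩ := h2 z hz
    obtain ⟨⟨f1, f2, f3⟩, f4⟩ := g1.flowMap_eq hr h3 g3 g4
    have hz' : (γ z.2.1, (z.2.1, z.2.2)) = z := by rw [g2]
    rw [hz'] at f1 f2 f3 f4
    refine ⟨flowMap_of_isSol f1 f2 f3, fun s hs => ⟨?_, ?_⟩⟩
    · rw [f4 s hs]
      exact g5 s hs
    · have hzM := (mem_closedBall_zero_iff.1 (h5 (h4 hz))).trans (le_max_left M 0)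
      have ht := z.t_le.trans hzM
      have hL := z.l_le.trans hzM
      rw [f4 s hs]
      refine max_le (((g5 s hs).2.2.trans (le_max_left M 0)).trans ?_) (max_le ?_ ?_)
      · nlinarith
      · have : |z.2.1 + s * z.2.2| ≤ |z.2.1| + 1 * |z.2.2| := by
          refine (abs_add_le _ _).trans ?_
          rw [abs_mul, abs_of_nonneg hs.1]
          gcongr
          exact hs.2
        refine this.trans ?_
        nlinarith
      · exact hL.trans (by nlinarith)
  have hfree : ∀ᶠ i in l, ∀ z ∈ A' i, FlowJet (k + 1) freeField freeFlow z ∧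
      ∀ s ∈ 𝕀, freeFlow s z ∈ closedBall 0 R := by
    filter_upwards [hM] with i h5 z hz
    refine ⟨LocalFlow.flowJet (.of_forall fun y => ⟨by simp [freeFlow], isSol_free y⟩)
      fun s hs => ?_, fun s hs => ?_⟩
    · have : ContDiff ℝ (k + 1 : ℕ) (fun w : ℝ × State d =>
        w.2.2.2 • ((w.2.1.2, (0 : Config d)), ((1 : ℝ), (0 : ℝ)))) := by fun_prop
      exact this.contDiffAt
    · have hzM := (mem_closedBall_zero_iff.1 (h5 hz)).trans (le_max_left M 0)
      have hq := z.q_le.trans hzM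
      have hp := z.p_le.trans hzM
      have ht := z.t_le.trans hzM
      have hL := z.l_le.trans hzM
      have hs1 : |s * z.2.2| ≤ M' := by
        rw [abs_mul, abs_of_nonneg hs.1]
        calc s * |z.2.2| ≤ 1 * M' := by gcongr; exact hs.2
          _ = M' := one_mul _
      rw [mem_closedBall_zero_iff]
      refine max_le (max_le ?_ ?_) (max_le ?_ ?_)
      · refine (norm_add_le _ _).trans ?_
        rw [norm_smul, Real.norm_eq_abs]
        have : |s * z.2.2| * ‖z.1.2‖ ≤ M' * M' := by gcongr
        linarith
      · exact hp.trans (by nlinarith)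
      · refine (abs_add_le _ _).trans ?_
        nlinarith
      · exact hL.trans (by nlinarith)
  refine ⟨hflow.mono fun i hi z hz => (hi z hz).1.2, .of_forall fun _ z _ => ?_, ?_⟩
  · have : ContDiff ℝ (k + 1 : ℕ) (freeMap (d := d)) := by
      unfold freeMap
      fun_prop
    exact this.contDiffAt
  have he' : Tendsto (fun j : ι × ℝ => e j.1) (l ×ˢ 𝓟 𝕀) 𝓝₀ := he.comp tendsto_fst
  have h0' : ∀ᶠ j in l ×ˢ 𝓟 𝕀, 0 ≤ nuExp (k + 1) (e j.1) := h0.prod_inl _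
  have h1' : ∀ᶠ j in l ×ˢ 𝓟 𝕀, nuExp (k + 1) (e j.1) ≤ 1 := h1.prod_inl _
  have hXY : CRel (l ×ˢ 𝓟 𝕀) (fun j => nuExp (k + 1) (e j.1)) (k + 1)
      (fun j => P.intField (e j.1) j.2)
      (fun j => freeField j.2) (fun j => {z : State d | z.1 ∈ P.core c M (e j.1) ∧ ‖z‖ ≤ R})
      (fun _ => closedBall 0 R) := by
    have hsub : ∀ᶠ j in l ×ˢ 𝓟 𝕀, {z : State d | z.1 ∈ P.core c M (e j.1) ∧ ‖z‖ ≤ R} ⊆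
        closedBall 0 R := .of_forall fun _ z hz => mem_closedBall_zero_iff.2 hz.2
    have hbb : ∀ᶠ j in l ×ˢ 𝓟 𝕀, closedBall (0 : State d) R ⊆ closedBall 0 R :=
      .of_forall fun _ => subset_rfl
    have hU := hP.cRel_gradient (r := k + 1) hc he'
      (A := fun j => {q | q ∈ P.intTable (e j.1) \ thickening c B.corner ∧ ‖q‖ ≤ R})
      (A' := fun _ => closedBall 0 R)
      (.of_forall fun _ q hq => hq.1) (R := R)
      (.of_forall fun _ z hz => mem_closedBall_zero_iff.2 hz.2)
      (.of_forall fun _ => subset_rfl)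
    have hU2 := hU.comp (CRel.clm (A := fun j : ι × ℝ =>
        {z : State d | z.1 ∈ P.core c M (e j.1) ∧ ‖z‖ ≤ R}) State.qL hbb h0') h0' h1' hsub
      (.of_forall fun _ z hz => ⟨hz.1.1, z.q_le.trans hz.2⟩)
      (.of_forall fun _ z hz => mem_closedBall_zero_iff.2
        (z.q_le.trans (mem_closedBall_zero_iff.1 hz)))
    have hall := hU2.prodMk (CRel.clm (ContinuousLinearMap.id ℝ (State d)) hbb h0') h0'
    obtain ⟨C, hC⟩ := hU2.cr.exists_bound h0' h1' hsub
    refine hall.smooth_comp (G := fun x : Config d × State d =>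
      x.2.2.2 • ((x.2.1.2, x.1), ((1 : ℝ), (0 : ℝ))))
      ((isCompact_closedBall (0 : Config d) C).prod (isCompact_closedBall (0 : State d) R))
      (fun x _ => ?_) h0' h1' hsub ?_ ?_
    · have : ContDiff ℝ (⊤ : ℕ∞) (fun x : Config d × State d =>
        x.2.2.2 • ((x.2.1.2, x.1), ((1 : ℝ), (0 : ℝ)))) := by fun_prop
      exact this.contDiffAt
    · exact hC.mono fun j hj z hz =>
        ⟨mem_closedBall_zero_iff.2 (hj.1 z hz), mem_closedBall_zero_iff.2 hz.2⟩
    · exact hC.mono fun j hj z hz => ⟨mem_closedBall_zero_iff.2 (hj.2 z hz), hz⟩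
  have key := CR.flow (R := R) (φ := fun i => flowMap (P.intField (e i)))
    (ψ := fun _ => freeFlow) (X := fun i => P.intField (e i)) (Y := fun _ => freeField) hXY.cr
    (.of_forall fun i s _ z hz => mem_closedBall_zero_iff.2 hz.2)
    (.of_forall fun _ _ _ => subset_rfl)
    (hflow.mono fun i hi z hz => ⟨(hi z hz).1.1, (hi z hz).2⟩) hfree (isWeight_const h0) zero_le_one
        h0 h1
  refine key.congr (.of_forall fun _ _ _ => EventuallyEq.rfl)
    (.of_forall fun _ _ _ => .of_forall fun z => ?_)
  simp [freeMap, freeFlow]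

lemma intField_arc {ε : ℝ} {ζ : ℝ → State d} (h : IsSol (P.intField ε) ζ)
    (hL : 0 < (ζ 0).2.2) (hG : ∀ s ∈ 𝕀, (ζ s).1.1 ∈ P.domain) {S : Set (Phase d)}
    (hS : ∀ s ∈ 𝕀, (ζ s).1 ∈ S) :
    P.Arc ε S (ζ 0) (ζ 1) ∧ (ζ 1).2 = ((ζ 0).2.1 + (ζ 0).2.2, (ζ 0).2.2) := by
  have hl : ∀ s ∈ 𝕀, (ζ s).2.2 = (ζ 0).2.2 := fun s hs =>
    eq_of_hasDerivWithinAt_zero (f := fun s => (ζ s).2.2)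
      (fun t ht => (hasDerivWithinAt_l (h t ht)).congr_deriv (by simp [intField])) hs
  have ht : ∀ s ∈ 𝕀, HasDerivWithinAt (fun s => (ζ s).2.1) (ζ 0).2.2 𝕀 s :=
    fun s hs => (hasDerivWithinAt_t (h s hs)).congr_deriv (by simp [intField, hl s hs])
  obtain ⟨σ, h1, h2, h3⟩ := exists_reparam (ζ := fun s => (ζ s).1)
    (v := fun s => ((ζ s).1.2, -∇ (P.V ε) (ζ s).1.1)) (t := fun s => (ζ s).2.1) ht
    continuousOn_const (fun s hs => hL) (fun s hs => (hasDerivWithinAt_phase (h s hs)).congr_deriv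
        (by
      simp [intField, hl s hs]))
  have h01 : (1 : ℝ) ∈ 𝕀 := by simp
  refine ⟨⟨(h1 1 h01).1.1, fun τ => (ζ (σ τ)).1, fun τ hτ => ⟨hG _ (h2 τ hτ).1, (h2 τ hτ).2.2⟩,
    ?_, ?_, fun s hs => hS _ (h2 s (Ioo_subset_Icc_self hs)).1⟩, ?_⟩
  · simp only [(h1 0 (by simp)).2]
  · simp only [(h1 1 h01).2]
  · have := eq_add_of_hasDerivWithinAt ht h01
    ext1
    · simpa using this
    · exact hl 1 h01

lemma BoundaryDominated.exists_flight (hP : P.BoundaryDominated) (hr : 1 ≤ r) {z₀ : State d}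
    (hL : 0 < z₀.2.2) (hseg : ∀ s ∈ 𝕀, z₀.1.1 + (s * z₀.2.2) • z₀.1.2 ∈ interior B.D) :
    LocRel r (fun ε => flowMap (P.intField ε) 1) (fun _ => freeMap) z₀ (freeMap z₀) ∧
    ∃ c > 0, ∃ M, ∀ᶠ w in 𝓝₀ ×ˢ 𝓝 z₀,
      (w.2.1 ∈ P.core c M w.1 ∧ (flowMap (P.intField w.1) 1 w.2).1 ∈ P.core c M w.1 ∧
        P.Arc w.1 (P.core c M w.1) w.2 (flowMap (P.intField w.1) 1 w.2) ∧
        (flowMap (P.intField w.1) 1 w.2).2 = (w.2.2.1 + w.2.2.2, w.2.2.2)) ∧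
      ∀ s ∈ 𝕀, w.2.1.1 + (s * w.2.2.2) • w.2.1.2 ∈ interior (P.auxTable w.1) := by
  set f : ℝ → State d := fun s => freeFlow s z₀ with hf
  have hfc : Continuous fun s : ℝ => z₀.1.1 + (s * z₀.2.2) • z₀.1.2 := by fun_prop
  set K₀ : Set (Config d) := (fun s : ℝ => z₀.1.1 + (s * z₀.2.2) • z₀.1.2) '' 𝕀 with hK₀
  have hK₀c : IsCompact K₀ := isCompact_Icc.image hfc
  obtain ⟨δ, hδ, hδD⟩ := hK₀c.exists_cthickening_subset_open isOpen_interior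
    (by rintro _ ⟨s, hs, rfl⟩; exact hseg s hs)
  have hKc : IsCompact (Metric.cthickening δ K₀) := hK₀c.cthickening
  obtain ⟨c, hc, hsub⟩ := P.exists_subset_intTable hKc hδD
  have haux := P.eventually_subset_interior_table (tendsto_etaExp (r := r)) hKc hδD
  obtain ⟨Kb, hKb⟩ := hP.exists_bound hc
  set a := min δ 1 with ha
  have ha0 : 0 < a := lt_min hδ one_pos
  obtain ⟨M', hfM⟩ := isCompact_Icc.exists_bound_of_continuousOn (isSol_free z₀).continuousOn
  set M := M' + 1
  have hq : ∀ s ∈ 𝕀, ∀ x : State d, ‖x - f s‖ ≤ a → x.1.1 ∈ Metric.cthickening δ K₀ ∧ ‖x‖ ≤ M := by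
    intro s hs x hx
    refine ⟨Metric.mem_cthickening_of_dist_le _ (f s).1.1 _ _ ⟨s, hs, rfl⟩ ?_, ?_⟩
    · rw [dist_eq_norm]
      exact ((x - f s).q_le.trans hx).trans (min_le_left _ _)
    · have h1 := norm_le_norm_sub_add x (f s)
      have h2 := hfM s hs
      have h3 : a ≤ 1 := min_le_right _ _
      linarith
  have hDdom : ∀ x ∈ Metric.cthickening δ K₀, x ∈ P.domain := fun x hx => Or.inl (hδD hx)
  set C := max 1 (‖z₀.1.2‖ + 1 + z₀.2.2) with hC
  have hMeM : ∀ᶠ ε in 𝓝₀, ∀ s ∈ 𝕀, ∀ x : State d, ‖x - f s‖ ≤ a → x.1 ∈ P.core c M ε := by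
    filter_upwards [hsub, haux] with ε h1 h2 s hs x hx
    obtain ⟨h3, h4⟩ := hq s hs x hx
    exact ⟨h1 h3, h2 _ h3, (norm_fst_le x).trans h4⟩
  have key := flow_tube_aux (l := 𝓝₀) (κ := nuExp r) (X := P.intField) (c := f)
    (v := fun _ => ((z₀.2.2 • z₀.1.2, 0), (z₀.2.2, 0))) (C := C) (d := a) (D := 0) (m := fun _ => 0)
    (M := fun _ _ => 0) (b := 0) (e := fun ε => (z₀.2.2 + 1) * (|Kb| * nuExp r ε)) hr (le_max_left _
        _)
    ha0 le_rfl
    (P.eventually_lt.mono fun ε hε s hs x hx => contDiffAt_intField hε (hDdom _ (hq s hs x hx).1))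
    (fun s hs => (isSol_free z₀ s hs).congr_deriv (by simp [freeField, freeFlow])) ?_ ?_
    (.of_forall fun ε => by simpa using isPrimitive_zero) tendsto_nuExp
  · obtain ⟨hflow, hlim⟩ := key
    have hf0 : f 0 = z₀ := by simp [hf, freeFlow]
    have hf1 : f 1 = freeMap z₀ := by simp [hf, freeFlow, freeMap]
    rw [hf0] at hflow hlim
    set ρ := min (a * exp (-C) / 4) (z₀.2.2 / 2) with hρ
    have hρ0 : 0 < ρ := lt_min (by positivity) (half_pos hL)
    have hpos : ∀ z ∈ closedBall z₀ ρ, 0 < z.2.2 := fun z hz => by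
      rw [mem_closedBall, dist_eq_norm] at hz
      have h1 := (z - z₀).l_le.trans (hz.trans (min_le_right _ _))
      have h2 := (abs_le.1 h1).1
      simp only [Prod.snd_sub] at h2
      linarith
    have harc : ∀ᶠ ε in 𝓝₀, ∀ z ∈ closedBall z₀ ρ,
        (∀ s ∈ 𝕀, (flowMap (P.intField ε) s z).1 ∈ P.core c M ε) ∧
        P.Arc ε (P.core c M ε) z (flowMap (P.intField ε) 1 z) ∧
        (flowMap (P.intField ε) 1 z).2 = (z.2.1 + z.2.2, z.2.2) ∧ flowMap (P.intField ε) 0 z = z :=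
            by
      filter_upwards [hflow, hMeM] with ε h1 h2 z hz
      obtain ⟨⟨f1, f2⟩, f3⟩ := h1 z (closedBall_subset_closedBall (min_le_left _ _) hz)
      have h4 : ∀ s ∈ 𝕀, (flowMap (P.intField ε) s z).1 ∈ P.core c M ε :=
        fun s hs => h2 s hs _ (f3 s hs)
      obtain ⟨a1, a2⟩ := intField_arc f2 (by rw [f1]; exact hpos z hz)
        (fun s hs => hDdom _ (hq s hs _ (f3 s hs)).1) h4
      rw [f1] at a1 a2
      exact ⟨h4, a1, a2, f1⟩
    refine ⟨LocRel.of_cRel hρ0 (hP.cRel_flow hr tendsto_id hc (M := ‖z₀‖ + ρ + M)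
      (.of_forall fun _ => subset_rfl) (.of_forall fun _ z hz =>
        mem_closedBall_zero_iff.2 ((norm_le_of_mem_closedBall hz).trans (by
          have := (norm_nonneg _).trans (hfM 0 (by simp))
          linarith))) ?_) ?_, c, hc, M, ?_⟩
    · filter_upwards [harc, P.eventually_lt] with ε h1 h2 z hz
      obtain ⟨a1, ⟨a0, γ, g1, g2, g3, g4⟩, a3, a4⟩ := h1 z hz
      have a5 : (flowMap (P.intField ε) 1 z).2.1 = z.2.1 + z.2.2 := by rw [a3]
      have hz0 := hpos z hz
      have b1 : z.2.1 ∈ Icc z.2.1 (z.2.1 + z.2.2) := ⟨le_rfl, by linarith⟩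
      have b2 : z.2.1 + z.2.2 ∈ Icc z.2.1 (z.2.1 + z.2.2) := ⟨by linarith, le_rfl⟩
      rw [a5] at g1
      refine ⟨z.2.1, z.2.1 + z.2.2, γ, g1, g2, b1, b2, fun s hs => ?_⟩
      have := (g1.flowMap_eq hr h2 b1 b2).2 s hs
      rw [g2] at this
      have h5 := a1 s hs
      rw [show z = (z.1, (z.2.1, z.2.2)) from rfl, this] at h5
      refine core_mono le_rfl ?_ h5
      have := norm_nonneg z₀
      linarith
    · have : Continuous (freeMap (d := d)) := by
        unfold freeMap
        fun_prop
      exact (this.tendsto z₀).comp tendsto_snd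
    · have hseg' : ∀ᶠ z in 𝓝 z₀, ∀ s ∈ 𝕀,
          z.1.1 + (s * z.2.2) • z.1.2 ∈ Metric.cthickening δ K₀ := by
        refine isCompact_Icc.eventually_forall_of_forall_eventually fun s hs => ?_
        have h1 : Continuous fun w : State d × ℝ => w.1.1.1 + (w.2 * w.1.2.2) • w.1.1.2 := by
            fun_prop
        exact (h1.tendsto (z₀, s)).eventually (mem_of_superset (Metric.isOpen_thickening.mem_nhds
          (self_subset_thickening hδ K₀ ⟨s, hs, rfl⟩)) (Metric.thickening_subset_cthickening _ _))
      have hb : ∀ᶠ z in 𝓝 z₀, z ∈ closedBall z₀ ρ := closedBall_mem_nhds z₀ hρ0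
      filter_upwards [harc.prod_mk hb, haux.prod_mk hseg'] with w h1 h2
      obtain ⟨a1, a2, a3, a4⟩ := h1.1 w.2 h1.2
      refine ⟨⟨?_, a1 1 (by simp), a2, a3⟩, fun s hs => h2.1 _ (h2.2 s hs)⟩
      have := a1 0 (by simp)
      rwa [a4] at this
  · filter_upwards [hKb, hsub, nuExp_nonneg_eventually (r := r)] with ε h1 h2 h0 s hs x hx
    have hgrad : ‖∇ (P.V ε) x.1.1‖ ≤ |Kb| * nuExp r ε := by
      have h3 := h1 _ (h2 (hq s hs x hx).1) 1 le_rfl (by omega)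
      rw [norm_iteratedFDeriv_one] at h3
      have h4 : ‖∇ (P.V ε) x.1.1‖ = ‖fderiv ℝ (P.V ε) x.1.1‖ := (dualIso d).norm_map _
      rw [h4]
      exact h3.trans (mul_le_mul_of_nonneg_right (le_abs_self _) h0)
    have hx1 : ‖x - f s‖ ≤ 1 := hx.trans (min_le_right _ _)
    have hl : |x.2.2 - z₀.2.2| ≤ ‖x - f s‖ := (x - f s).l_le
    have hp : ‖x.1.2 - z₀.1.2‖ ≤ ‖x - f s‖ := (x - f s).p_le
    have n0 := norm_nonneg (x - f s)
    have n1 := norm_nonneg z₀.1.2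
    have hC1 : ‖z₀.1.2‖ + 1 + z₀.2.2 ≤ C := le_max_right _ _
    have hC2 : 1 ≤ C := le_max_left _ _
    have he0 : 0 ≤ (z₀.2.2 + 1) * (|Kb| * nuExp r ε) := by positivity
    simp only [mul_zero, add_zero]
    have hCn := mul_le_mul_of_nonneg_right hC1 n0
    have hCn' := mul_le_mul_of_nonneg_right hC2 n0
    have hxl : |x.2.2| ≤ z₀.2.2 + 1 := by
      have := abs_sub_abs_le_abs_sub x.2.2 z₀.2.2
      rw [abs_of_pos hL] at this
      linarith
    simp only [intField]
    refine max_le (max_le ?_ ?_) (max_le ?_ ?_)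
    · have e : x.2.2 • x.1.2 - z₀.2.2 • z₀.1.2 = (x.2.2 - z₀.2.2) • z₀.1.2 +
          ((x.2.2 - z₀.2.2) • (x.1.2 - z₀.1.2) + z₀.2.2 • (x.1.2 - z₀.1.2)) := by module
      simp only [Prod.fst_sub, Prod.smul_fst]
      rw [e]
      refine (norm_add₃_le).trans ?_ |> fun h => (congrArg norm (add_assoc _ _ _)).ge.trans h
      rw [norm_smul, norm_smul, norm_smul, Real.norm_eq_abs, Real.norm_eq_abs, abs_of_pos hL]
      have b1 : |x.2.2 - z₀.2.2| * ‖z₀.1.2‖ ≤ ‖x - f s‖ * ‖z₀.1.2‖ := by gcongr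
      have b2 : |x.2.2 - z₀.2.2| * ‖x.1.2 - z₀.1.2‖ ≤ ‖x - f s‖ * 1 := by
        gcongr
        exact hp.trans hx1
      have b3 : z₀.2.2 * ‖x.1.2 - z₀.1.2‖ ≤ z₀.2.2 * ‖x - f s‖ := by gcongr
      nlinarith
    · simp only [Prod.fst_sub, Prod.smul_fst, Prod.snd_sub, Prod.smul_snd, sub_zero]
      rw [norm_smul, norm_neg, Real.norm_eq_abs]
      have : |x.2.2| * ‖∇ (P.V ε) x.1.1‖ ≤ (z₀.2.2 + 1) * (|Kb| * nuExp r ε) := by gcongr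
      nlinarith
    · simp only [Prod.fst_sub, Prod.smul_fst, Prod.snd_sub, Prod.smul_snd, smul_eq_mul, mul_one,
        Real.norm_eq_abs]
      linarith
    · simp only [Prod.smul_snd, Prod.snd_sub, smul_eq_mul, mul_zero, sub_zero, norm_zero]
      nlinarith
  · simpa using ((tendsto_nuExp (r := r)).const_mul |Kb|).const_mul (z₀.2.2 + 1)

lemma IsPatch.level_arc (hr : 1 ≤ r) {ε R D y₀ : ℝ} {z₀ z : State d} (hε : ε ∈ Ioo 0 P.ε₁)
    (h : P.IsPatch j (closedBall z₀.1.1 R)) (hDR : D ≤ R) {X : ℝ → State d → State d}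
    {u : ℝ → Config d} (hF : FlowIn X (fun _ => z₀) D z)
    (hX : ∀ s ∈ 𝕀, X s (flowMap X s z) =
      levelField (∇ (P.Q ε) (flowMap X s z).1.1) (u s) (flowMap X s z)) (hy0 : 0 < y₀)
    (hy : ∀ x ∈ closedBall z₀ D, y₀ ≤ |⟪∇ (P.Q ε) x.1.1, x.1.2⟫| ∧
      0 < ⟪∇ (P.Q ε) x.1.1, x.1.2⟫ * z.2.2)
    (hu : ∀ s ∈ 𝕀, P.Q ε (flowMap X s z).1.1 = P.Q ε z.1.1 + s * z.2.2 →
      u s = -∇ (P.V ε) (flowMap X s z).1.1) :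
    (∀ s ∈ 𝕀, flowMap X s z ∈ closedBall z₀ D ∧
      P.Q ε (flowMap X s z).1.1 = P.Q ε z.1.1 + s * z.2.2 ∧ (flowMap X s z).2.2 = z.2.2) ∧
    ∀ s s', 0 ≤ s → s ≤ s' → s' ≤ 1 →
      P.Arc ε {x | ∃ v ∈ Ioo s s', (flowMap X v z).1 = x} (flowMap X s z) (flowMap X s' z) ∧
      (flowMap X s' z).2.1 - (flowMap X s z).2.1 ≤ |z.2.2| / y₀ * (s' - s) := by
  have hin : ∀ s ∈ 𝕀, flowMap X s z ∈ closedBall z₀ D := fun s hs => mem_closedBall_iff_norm.2 (hF.2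
      s hs)
  have hsol : ∀ s ∈ 𝕀, HasDerivWithinAt (fun s => flowMap X s z)
      (levelField (∇ (P.Q ε) (flowMap X s z).1.1) (u s) (flowMap X s z)) 𝕀 s :=
    fun s hs => (hF.1.2 s hs).congr_deriv (hX s hs)
  have hQd : ∀ s ∈ 𝕀, DifferentiableAt ℝ (P.Q ε) (flowMap X s z).1.1 := fun s hs =>
    h.differentiableAt (mem_ball_q hDR (hin s hs)) (Ioo_subset_Ico_self hε)
  have hQ := fun s (hs : s ∈ 𝕀) => level_Q_eq hsol hQd
    (fun s hs => ne_of_le_abs hy0 (hy _ (hin s hs)).1) hs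
  have hL := fun s (hs : s ∈ 𝕀) => level_L_eq hsol hs
  simp only [hF.1.1] at hQ hL
  refine ⟨fun s hs => ⟨hin s hs, hQ s hs, hL s hs⟩, fun s s' h0 hss h1 => ?_⟩
  obtain ⟨m1, σ, m2, m3, m4⟩ := level_orbit (G := P.domain) (V := P.V ε) hsol
    (fun s hs => h.subset_domain (mem_ball_q hDR (hin s hs)))
    (fun s hs => (h.contDiffAt (mem_ball_q hDR (hin s hs)) (Ioo_subset_Ico_self hε)).of_le (by
      exact_mod_cast Nat.succ_le_succ hr))
    (fun s hs => by
      rw [hF.1.1]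
      exact (hy _ (hin s hs)).2) (fun s hs => hu s hs (hQ s hs))
  have hs : s ∈ 𝕀 := ⟨h0, hss.trans h1⟩
  have hs' : s' ∈ 𝕀 := ⟨h0.trans hss, h1⟩
  have e0 : (0 : ℝ) ∈ 𝕀 := by simp
  have e1 : (1 : ℝ) ∈ 𝕀 := by simp
  have l0 := m1.monotoneOn e0 hs hs.1
  have l1 := m1.monotoneOn hs hs' hss
  have l2 := m1.monotoneOn hs' e1 hs'.2
  refine ⟨⟨l1, fun τ => (flowMap X (σ τ) z).1, m4.mono l0 l2, ?_, ?_, fun τ hτ => ⟨σ τ, ?_, rfl⟩⟩,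
      ?_⟩
  · simp only [m2 s hs]
  · simp only [m2 s' hs']
  · obtain ⟨b1, b2⟩ := m3 τ ⟨l0.trans hτ.1.le, hτ.2.le.trans l2⟩
    constructor
    · rw [← m1.lt_iff_lt hs b1, b2]
      exact hτ.1
    · rw [← m1.lt_iff_lt b1 hs', b2]
      exact hτ.2
  · have := (convex_Icc (0 : ℝ) 1).norm_image_sub_le_of_norm_hasDerivWithin_le (C := |z.2.2| / y₀)
      (fun s hs => level_time hsol hs) (fun s hs => by
        rw [hF.1.1, Real.norm_eq_abs, abs_div]
        gcongr
        exact (hy _ (hin s hs)).1) hs hs'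
    rw [Real.norm_eq_abs, Real.norm_eq_abs, abs_of_nonneg (sub_nonneg.2 hss)] at this
    exact (le_abs_self _).trans this

/-! ### Motion near the boundary -/

/-- Free motion leads from the state `z` to the state `z'`, through `S`. -/
def _root_.Line (S : Set (Config d)) (z z' : State d) : Prop :=
  z.2.1 ≤ z'.2.1 ∧ z'.1 = (z.1.1 + (z'.2.1 - z.2.1) • z.1.2, z.1.2) ∧
    ∀ s ∈ Ioo 0 (z'.2.1 - z.2.1), z.1.1 + s • z.1.2 ∈ S

lemma _root_.Line.mono {S S' : Set (Config d)} {z z' : State d} (h : Line S z z') (hS : S ⊆ S') :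
    Line S' z z' :=
  ⟨h.1, h.2.1, fun s hs => hS (h.2.2 s hs)⟩

lemma _root_.Line.trans {S : Set (Config d)} {z z' z'' : State d} (h : Line S z z')
    (h' : Line S z' z'') (hz : z'.1.1 ∈ S) : Line S z z'' := by
  obtain ⟨h1, h2, h3⟩ := h
  obtain ⟨h1', h2', h3'⟩ := h'
  rw [h2] at h2' h3' hz
  simp only at h2' h3' hz
  refine ⟨h1.trans h1', ?_, fun s hs => ?_⟩
  · rw [h2']
    ext1
    · simp only
      module
    · rfl
  · rcases lt_trichotomy s (z'.2.1 - z.2.1) with h | rfl | h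
    · exact h3 s ⟨hs.1, h⟩
    · exact hz
    · have := h3' (s - (z'.2.1 - z.2.1)) ⟨by linarith, by linarith [hs.2]⟩
      convert this using 1
      module

lemma IsPatch.exists_core {q : Config d} {R D M : ℝ} (h : P.IsPatch j (closedBall q R))
    (hD : D < R) : ∃ c > 0, ∀ᶠ ε in 𝓝₀, ∀ x : Phase d, x.1 ∈ closedBall q D →
      P.Qval j + deltaExp r ε ≤ P.Q ε x.1 → ‖x‖ ≤ M → x ∈ P.core c M ε := by
  have hdis : Disjoint (closedBall q R) B.corner :=
    disjoint_left.2 fun x hx hc => h.notMem_corner x hx hc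
  obtain ⟨c, hc, hc'⟩ := hdis.exists_thickenings (isCompact_closedBall q R) B.isClosed_corner
  refine ⟨c, hc, ?_⟩
  filter_upwards [P.eventually_lt, eventually_lt_one] with ε h1 h2 x hx hQ hM
  have hxR : x.1 ∈ closedBall q R := closedBall_subset_closedBall hD.le hx
  have hn : closedBall q R ∈ 𝓝 x.1 :=
    mem_of_superset (isOpen_ball.mem_nhds ((mem_closedBall.1 hx).trans_lt hD))
      ball_subset_closedBall
  refine ⟨⟨(h.mem_table hxR _ _).2 hQ, fun hx' => disjoint_left.1 hc'
    (self_subset_thickening hc _ hxR) hx'⟩, h.mem_interior hn (Ioo_subset_Ico_self h1) ?_, hM⟩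
  have := etaExp_lt_deltaExp (r := r) h1.1 h2
  linarith

lemma _root_.closedBall_mem_nhds_of_lt {q x : Config d} {D R : ℝ} (hx : x ∈ closedBall q D)
    (hD : D < R) : closedBall q R ∈ 𝓝 x :=
  mem_of_superset (isOpen_ball.mem_nhds ((mem_closedBall.1 hx).trans_lt hD)) ball_subset_closedBall

lemma IsLevelBall.eventually_pos {z₀ : State d} {D y₀ : ℝ} (hb : P.IsLevelBall z₀ D y₀) :
    ∀ᶠ ε in 𝓝₀, ∀ L, 0 < ⟪∇ (P.Q 0) z₀.1.1, z₀.1.2⟫ * L →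
      ∀ x ∈ closedBall z₀ D, y₀ ≤ |⟪∇ (P.Q ε) x.1.1, x.1.2⟫| ∧
        0 < ⟪∇ (P.Q ε) x.1.1, x.1.2⟫ * L := by
  filter_upwards [hb.2.2] with ε h L hL x hx
  refine ⟨(h x hx).1, ?_⟩
  have h1 := mul_pos (h x hx).2 hL
  have h2 : 0 < ⟪∇ (P.Q 0) z₀.1.1, z₀.1.2⟫ ^ 2 := by
    have : ⟪∇ (P.Q 0) z₀.1.1, z₀.1.2⟫ ≠ (0 : ℝ) := fun h0 => by simp [h0] at hL
    positivity
  refine pos_of_mul_pos_left (b := ⟪∇ (P.Q 0) z₀.1.1, z₀.1.2⟫ ^ 2) ?_ h2.le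
  convert h1 using 1
  ring

lemma IsPatch.freeLevel_line {X : ℝ → ℝ → State d → State d} {z₀ : State d} {R D ρ y₀ : ℝ}
    (h : P.IsPatch j (closedBall z₀.1.1 R)) (hDR : D ≤ R) (hb : P.IsLevelBall z₀ D y₀)
    (hX : CloseFlows r X P.freeLevel z₀ D ρ) : ∀ᶠ ε in 𝓝₀, ∀ z ∈ closedBall z₀ ρ,
      0 < ⟪∇ (P.Q 0) z₀.1.1, z₀.1.2⟫ * z.2.2 →
      Line {x | x ∈ closedBall z₀.1.1 D ∧ ∃ v ∈ Ioo (0 : ℝ) 1, P.Q ε x = P.Q ε z.1.1 + v * z.2.2}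
        z (flowMap (P.freeLevel ε) 1 z) ∧
      (flowMap (P.freeLevel ε) 1 z).1.1 ∈ closedBall z₀.1.1 D ∧
      P.Q ε (flowMap (P.freeLevel ε) 1 z).1.1 = P.Q ε z.1.1 + z.2.2 := by
  filter_upwards [hX.1, hb.eventually_pos, P.eventually_lt] with ε h1 h2 h3 z hz hL
  have hF := (h1 z hz).2
  have hy := h2 _ hL
  have key := fun s (hs : s ∈ 𝕀) =>
    h.freeLevel_sol h3 hDR (fun x hx => ne_of_le_abs hb.2.1 (hy x hx).1) hF hs
  have hin : ∀ s ∈ 𝕀, flowMap (P.freeLevel ε) s z ∈ closedBall z₀ D := fun s hs =>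
      mem_closedBall_iff_norm.2 (hF.2 s hs)
  have hsol : ∀ s ∈ 𝕀, HasDerivWithinAt (fun s => flowMap (P.freeLevel ε) s z)
      (levelField (∇ (P.Q ε) (flowMap (P.freeLevel ε) s z).1.1) ((fun _ => 0 : ℝ → Config d) s)
        (flowMap (P.freeLevel ε) s z)) 𝕀 s := hF.1.2
  have e0 : (0 : ℝ) ∈ 𝕀 := by simp
  have e1 : (1 : ℝ) ∈ 𝕀 := by simp
  have htime := fun s (hs : s ∈ 𝕀) => level_time hsol hs
  simp only [hF.1.1] at htime
  have hmono := sub_lt_of_hasDerivWithinAt (c := 0) htime (fun s hs => by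
    have h4 := (hy _ (hin s hs)).2
    rcases mul_pos_iff.1 h4 with h5 | h5
    · exact (div_pos h5.2 h5.1).le
    · exact (div_pos_of_neg_of_neg h5.2 h5.1).le) e0 e1 zero_le_one
  rw [zero_mul, hF.1.1] at hmono
  refine ⟨⟨by linarith, (congrArg Prod.fst (key 1 e1).1), fun τ hτ => ?_⟩, mem_ball_q le_rfl (hin 1
      e1), by
    rw [(key 1 e1).2, one_mul]⟩
  have hc : ContinuousOn (fun s => (flowMap (P.freeLevel ε) s z).2.1) 𝕀 := fun s hs =>
    (htime s hs).continuousWithinAt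
  have him := intermediate_value_Ioo zero_le_one hc
  simp only [hF.1.1] at him
  obtain ⟨s, hs, hs'⟩ := him (show τ + z.2.1 ∈ Ioo _ _ from ⟨by linarith [hτ.1], by linarith
      [hτ.2]⟩)
  have hs1 := Ioo_subset_Icc_self hs
  have h4 := congrArg (fun z : State d => z.1.1) (key s hs1).1
  have h5 := (key s hs1).2
  simp only at hs' h4
  rw [hs', add_sub_cancel_right] at h4
  have h6 := mem_ball_q le_rfl (hin s hs1)
  rw [h4] at h5 h6
  exact ⟨h6, s, hs, h5⟩

lemma IsPatch.barrier_arc (hr : 1 ≤ r) {s₀ s₁ : ℝ → ℝ} {z₀ : State d} {R D ρ y₀ : ℝ}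
    (h : P.IsPatch j (closedBall z₀.1.1 R)) (hDR : D ≤ R) (hb : P.IsLevelBall z₀ D y₀)
    (hX : CloseFlows r (P.barrierLevel s₀ s₁) P.freeLevel z₀ D ρ) :
    ∀ᶠ ε in 𝓝₀, ∀ z ∈ closedBall z₀ ρ, P.Q ε z.1.1 = P.Qval j + s₀ ε →
      z.2.2 = s₁ ε - s₀ ε → 0 < ⟪∇ (P.Q 0) z₀.1.1, z₀.1.2⟫ * z.2.2 →
      flowMap (P.barrierLevel s₀ s₁ ε) 0 z = z ∧
      (∀ s ∈ 𝕀, flowMap (P.barrierLevel s₀ s₁ ε) s z ∈ closedBall z₀ D ∧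
        P.Q ε (flowMap (P.barrierLevel s₀ s₁ ε) s z).1.1 = P.Qval j + (s₀ ε + s * (s₁ ε - s₀ ε))) ∧
      ∀ s s', 0 ≤ s → s ≤ s' → s' ≤ 1 →
        P.Arc ε {x | ∃ v ∈ Ioo s s', (flowMap (P.barrierLevel s₀ s₁ ε) v z).1 = x}
          (flowMap (P.barrierLevel s₀ s₁ ε) s z) (flowMap (P.barrierLevel s₀ s₁ ε) s' z) ∧
        (flowMap (P.barrierLevel s₀ s₁ ε) s' z).2.1 - (flowMap (P.barrierLevel s₀ s₁ ε) s z).2.1 ≤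
          |s₁ ε - s₀ ε| / y₀ * (s' - s) := by
  filter_upwards [hX.1, hb.eventually_pos, P.eventually_lt] with ε h1 h2 h3 z hz hQ hL hpos
  have hF := (h1 z hz).1
  obtain ⟨a1, a2⟩ := h.level_arc hr h3 hDR (u := fun s =>
    (exp (-(s₀ ε + s * (s₁ ε - s₀ ε)) / ε) / ε) • ∇ (P.Q ε)
      (flowMap (P.barrierLevel s₀ s₁ ε) s z).1.1) hF (fun s hs => rfl) hb.2.1 (h2 _ hpos)
    (fun s hs hQs => by
      have hmem : flowMap (P.barrierLevel s₀ s₁ ε) s z ∈ closedBall z₀ D :=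
          mem_closedBall_iff_norm.2 (hF.2 s hs)
      rw [h.gradient_V (mem_ball_q hDR hmem) h3, neg_neg, hQs, hQ, hL]
      congr 5
      ring)
  rw [hL] at a2
  refine ⟨hF.1.1, fun s hs => ⟨(a1 s hs).1, ?_⟩, a2⟩
  rw [(a1 s hs).2.1, hQ, hL]
  ring

lemma IsPatch.true_arc (hr : 1 ≤ r) {z₀ : State d} {R D ρ y₀ : ℝ}
    (h : P.IsPatch j (closedBall z₀.1.1 R)) (hDR : D ≤ R) (hb : P.IsLevelBall z₀ D y₀)
    (hX : CloseFlows r P.trueLevel P.freeLevel z₀ D ρ) :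
    ∀ᶠ ε in 𝓝₀, ∀ z ∈ closedBall z₀ ρ, 0 < ⟪∇ (P.Q 0) z₀.1.1, z₀.1.2⟫ * z.2.2 →
      P.Q ε (flowMap (P.trueLevel ε) 1 z).1.1 = P.Q ε z.1.1 + z.2.2 ∧
      P.Arc ε {x | ∃ z' ∈ closedBall z₀ D, z'.1 = x} z (flowMap (P.trueLevel ε) 1 z) ∧
      flowMap (P.trueLevel ε) 1 z ∈ closedBall z₀ D ∧ z ∈ closedBall z₀ D := by
  filter_upwards [hX.1, hb.eventually_pos, P.eventually_lt] with ε h1 h2 h3 z hz hpos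
  have hF := (h1 z hz).1
  obtain ⟨a1, a2⟩ := h.level_arc hr h3 hDR (u := fun s =>
    -∇ (P.V ε) (flowMap (P.trueLevel ε) s z).1.1) hF (fun s hs => rfl) hb.2.1 (h2 _ hpos)
    (fun s hs hQs => rfl)
  have e1 : (1 : ℝ) ∈ 𝕀 := by simp
  have a3 := (a2 0 1 le_rfl zero_le_one le_rfl).1
  have a4 := (a1 0 (by simp)).1
  rw [hF.1.1] at a3 a4
  refine ⟨by simpa using (a1 1 e1).2.1, a3.mono ?_, (a1 1 e1).1, a4⟩
  rintro _ ⟨v, hv, rfl⟩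
  exact ⟨_, (a1 v (Ioo_subset_Icc_self hv)).1, rfl⟩

/-- The orbit runs from the boundary of the auxiliary table into the interior region. -/
def Leaves (P : SteepExpPotential B) (ε c M K : ℝ) (z z' : State d) : Prop :=
  ∃ y : State d, P.Arc ε {x | x.1 ∈ interior (P.auxTable ε)} z y ∧ y.1 ∈ P.core c M ε ∧
    P.Arc ε (P.core c M ε) y z' ∧ z'.1 ∈ P.core c M ε ∧ y.2.1 - z.2.1 ≤ K * nuExp r ε

/-- The orbit runs from the interior region to the boundary of the auxiliary table. -/
def Enters (P : SteepExpPotential B) (ε c M K : ℝ) (z z' : State d) : Prop :=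
  ∃ y : State d, z.1 ∈ P.core c M ε ∧ P.Arc ε (P.core c M ε) z y ∧ y.1 ∈ P.core c M ε ∧
    P.Arc ε {x | x.1 ∈ interior (P.auxTable ε)} y z' ∧ z'.2.1 - y.2.1 ≤ K * nuExp r ε

lemma eventually_step (P : SteepExpPotential B) {q p w : Config d} {t κ : ℝ} (hq : q ∈ P.Dt)
    (hw : 0 < ⟪∇ (P.Q 0) q, w⟫) {U V : Set (State d)} (hU : U ∈ 𝓝 (((q, p), (t, 0)) : State d))
    (hV : V ∈ 𝓝 (((q, p), (t, 0)) : State d)) : ∀ᶠ u in 𝓝₀, 0 < u ∧ P.Q 0 q < P.Q 0 (q + u • w) ∧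
      (((q + u • w, p), (t + κ * u, κ * (P.Q 0 (q + u • w) - P.Q 0 q))) : State d) ∈ U ∧
      (((q, p), (t, κ * (P.Q 0 (q + u • w) - P.Q 0 q))) : State d) ∈ V := by
  have h1 := P.contDiffAt_Q ⟨le_rfl, P.ε₁_pos⟩ hq
  have h2 : Tendsto (fun u : ℝ => q + u • w) (𝓝 0) (𝓝 q) :=
    Continuous.tendsto' (by fun_prop) _ _ (by simp)
  have h3 : Tendsto (fun u => t + κ * u) (𝓝 0) (𝓝 t) :=
    Continuous.tendsto' (by fun_prop) _ _ (by simp)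
  have h4 : Tendsto (fun u : ℝ => κ * (P.Q 0 (q + u • w) - P.Q 0 q)) (𝓝 0) (𝓝 0) := by
    have := ((h1.continuousAt.tendsto.comp h2).sub_const (P.Q 0 q)).const_mul κ
    rwa [sub_self, mul_zero] at this
  filter_upwards [eventually_mem_nhdsWithin, eventually_gt_of_inner_pos
      (h1.differentiableAt (by exact_mod_cast Nat.succ_ne_zero r)) hw,
    nhdsWithin_le_nhds ((h2.prodMk_nhds tendsto_const_nhds).prodMk_nhds (h3.prodMk_nhds h4) hU),
    nhdsWithin_le_nhds (tendsto_const_nhds.prodMk_nhds (tendsto_const_nhds.prodMk_nhds h4) hV)]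
    with u a b c d using ⟨a, b, c, d⟩

lemma eventually_lt_const_etaExp {a : ℝ} (ha : 0 < a) :
    ∀ᶠ ε in 𝓝₀, 0 < etaExp r ε ∧ etaExp r ε < deltaExp r ε ∧ deltaExp r ε < a ∧
      etaExp r ε < a / 2 := by
  filter_upwards [eventually_mem_nhdsWithin, eventually_lt_one,
    (tendsto_deltaExp (r := r)).eventually_lt_const ha,
    (tendsto_etaExp (r := r)).eventually_lt_const (half_pos ha)] with ε h1 h2 h3 h4
  exact ⟨etaExp_pos h1 h2, etaExp_lt_deltaExp h1 h2, h3, h4⟩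

lemma IsPatch.exists_leave (hr : 1 ≤ r) {z₀ : State d} {R : ℝ} (hR : 0 < R)
    (h : P.IsPatch j (closedBall z₀.1.1 R)) (hQ : P.Q 0 z₀.1.1 = P.Qval j)
    (hy : 0 < ⟪∇ (P.Q 0) z₀.1.1, z₀.1.2⟫) : ∀ᶠ u in 𝓝₀,
      ∃ (f g : ℝ → State d → State d) (a c M K : ℝ), 0 < c ∧
        LocRel r f g z₀ ((z₀.1.1 + u • z₀.1.2, z₀.1.2), (z₀.2.1 + u, a)) ∧
        ∀ᶠ w in 𝓝₀ ×ˢ 𝓝 z₀, P.Q w.1 w.2.1.1 = P.Qval j + etaExp r w.1 →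
          P.Leaves w.1 c M K w.2 (f w.1 w.2) ∧
          Line (interior (P.auxTable w.1)) w.2 (g w.1 w.2) ∧
          (g w.1 w.2).1.1 ∈ interior (P.auxTable w.1) := by
  have hDt : z₀.1.1 ∈ P.Dt := h.subset_Dt (mem_closedBall_self hR.le)
  set z₁ : State d := (z₀.1, (z₀.2.1, 0)) with hz₁
  have h₁ : P.IsPatch j (closedBall z₁.1.1 R) := h
  obtain ⟨D₀, hD₀, y₀, hlev⟩ := P.exists_isLevelBall (z₀ := z₁) hDt hy.ne'
  set D := min D₀ (R / 2) with hD
  have hD0 : 0 < D := lt_min hD₀ (half_pos hR)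
  have hDR : D < R := (min_le_right _ _).trans_lt (half_lt_self hR)
  have hb := hlev D (min_le_left _ _) hD0
  obtain ⟨ρ, hρ, hflow⟩ := IsPatch.barrier_flow (z₀ := z₁) hr h hDR.le hb rfl
  set M := ‖z₁‖ + D with hM
  obtain ⟨c, hc, hcore⟩ := h.exists_core (M := M) hDR
  obtain ⟨Kδ, hKδ⟩ := eventually_deltaExp_le (r := r)
  filter_upwards [P.eventually_step (p := z₀.1.2) (κ := 1) hDt hy (ball_mem_nhds z₁ hD0)
    (ball_mem_nhds z₁ hρ)] with u ⟨_, hu3, hu2, hu1⟩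
  simp only [one_mul, hQ] at hu1 hu2 hu3
  set a := P.Q 0 (z₀.1.1 + u • z₀.1.2) - P.Qval j with ha
  have ha0 : 0 < a := sub_pos.2 hu3
  have hη := eventually_lt_const_etaExp (r := r) ha0
  have hX := hflow (etaExp r) (fun _ => a) (a / 2) (half_pos ha0) (hη.mono fun ε hε =>
    ⟨le_rfl, by linarith [hε.1], (le_abs_self _).trans' (by linarith)⟩)
  have hset := IsPatch.locRel_setLevel (z := z₀) hR h (s := fun _ => a) tendsto_const_nhds
  rw [hQ, sub_self, sub_zero] at hset
  have hbar := CloseFlows.locRel_of_mem (z₀ := z₁) (z₁ := (z₀.1, (z₀.2.1, a))) (τ := u) h₁ hDR.le hb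
      hX hu1 hu2
    (by simp only [ha, hQ]; ring)
  refine ⟨_, _, a, c, M, Kδ / y₀, hc, hbar.comp hset, ?_⟩
  have hmem := hset.tendsto_left.eventually_mem (isOpen_ball.mem_nhds hu1)
  filter_upwards [hmem, (h₁.barrier_arc (z₀ := z₁) hr hDR.le hb hX).prod_inl _, (h₁.freeLevel_line
      (z₀ := z₁) hDR.le hb hX).prod_inl _,
    hη.prod_inl _, hcore.prod_inl _, hKδ.prod_inl _, P.eventually_lt.prod_inl _] with w h1 h2 h3 h4
        h5 h6 h7 hw
  obtain ⟨e1, e2, e3, e4⟩ := h4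
  have hz := ball_subset_closedBall h1
  have hL : (P.setLevel j (fun _ => a) w.1 w.2).2.2 = a - etaExp r w.1 := by
    simp only [setLevel, hw]
    ring
  have hpos : 0 < ⟪∇ (P.Q 0) z₁.1.1, z₁.1.2⟫ * (P.setLevel j (fun _ => a) w.1 w.2).2.2 := by
    rw [hL]
    exact mul_pos hy (by linarith)
  obtain ⟨f0, f1, f2⟩ := h2 _ hz hw hL hpos
  obtain ⟨g1, g2, g3⟩ := h3 _ hz hpos
  have hd : 0 < a - etaExp r w.1 := by linarith
  set s := (deltaExp r w.1 - etaExp r w.1) / (a - etaExp r w.1) with hs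
  have hs0 : 0 ≤ s := div_nonneg (by linarith) hd.le
  have hs1 : s ≤ 1 := (div_le_one hd).2 (by linarith)
  have hsd : s * (a - etaExp r w.1) = deltaExp r w.1 - etaExp r w.1 := div_mul_cancel₀ _ hd.ne'
  have hin : ∀ v ∈ Icc s 1, (flowMap (P.barrierLevel (etaExp r) (fun _ => a) w.1) v
      (P.setLevel j (fun _ => a) w.1 w.2)).1 ∈ P.core c M w.1 := fun v hv => by
    have hv' : v ∈ 𝕀 := ⟨hs0.trans hv.1, hv.2⟩
    refine h5 _ (mem_ball_q (z₀ := z₁) le_rfl (f1 v hv').1) ?_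
      ((norm_fst_le _).trans (norm_le_of_mem_closedBall (f1 v hv').1))
    rw [(f1 v hv').2]
    have := mul_le_mul_of_nonneg_right hv.1 hd.le
    linarith
  have haux : ∀ x ∈ closedBall z₀.1.1 D, P.Qval j + etaExp r w.1 < P.Q w.1 x →
      x ∈ interior (P.auxTable w.1) := fun x hx hx' =>
    h.mem_interior (closedBall_mem_nhds_of_lt hx hDR) (Ioo_subset_Ico_self h7) hx'
  have A1 := (f0 ▸ (f2 0 s le_rfl hs0 hs1).1 : P.Arc w.1 _ w.2 _).mono
    (S' := {x | x.1 ∈ interior (P.auxTable w.1)}) (by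
      rintro _ ⟨v, hv, rfl⟩
      have hv' : v ∈ 𝕀 := ⟨hv.1.le, hv.2.le.trans hs1⟩
      refine haux _ (mem_ball_q (z₀ := z₁) le_rfl (f1 v hv').1) ?_
      rw [(f1 v hv').2]
      have := mul_pos hv.1 hd
      linarith)
  have A2 := (f2 s 1 hs0 hs1 le_rfl).1.mono (S' := P.core c M w.1) (by
    rintro _ ⟨v, hv, rfl⟩
    exact hin v ⟨hv.1.le, hv.2.le⟩)
  refine ⟨⟨_, A1, hin s ⟨le_rfl, hs1⟩, A2, hin 1 ⟨hs1, le_rfl⟩, ?_⟩, g1.mono ?_, ?_⟩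
  · have h8 := (f2 0 s le_rfl hs0 hs1).2
    rw [f0, abs_of_pos hd, sub_zero] at h8
    have hy0 := hb.2.1
    refine h8.trans ?_
    rw [div_mul_eq_mul_div, mul_comm, hsd, div_mul_eq_mul_div]
    gcongr
    linarith
  · rintro x ⟨hx, v, hv, hx'⟩
    refine haux x hx ?_
    rw [hx', hL]
    have := mul_pos hv.1 hd
    simp only [setLevel]
    linarith
  · refine haux _ g2 ?_
    rw [comp_apply, g3, hL]
    simp only [setLevel]
    linarith

lemma IsPatch.exists_enter (hP : P.BoundaryDominated) (hr : 1 ≤ r) {z₀ : State d} {R : ℝ}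
    (hR : 0 < R) (h : P.IsPatch j (closedBall z₀.1.1 R)) (hQ : P.Q 0 z₀.1.1 = P.Qval j)
    (hy : ⟪∇ (P.Q 0) z₀.1.1, z₀.1.2⟫ < 0) {u₀ : ℝ} (hu₀ : 0 < u₀) : ∃ u ∈ Ioo 0 u₀,
      ∃ (f g : ℝ → State d → State d) (b c M K : ℝ), 0 < c ∧ ∀ z : State d,
        z.1 = (z₀.1.1 - u • z₀.1.2, z₀.1.2) → z.2.1 = z₀.2.1 - u →
        LocRel r f g z (z₀.1, (z₀.2.1, b)) ∧ ∀ᶠ w in 𝓝₀ ×ˢ 𝓝 z,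
          (P.Enters w.1 c M K w.2 (f w.1 w.2) ∧ P.Q w.1 (f w.1 w.2).1.1 = P.Qval j + etaExp r w.1) ∧
          Line (interior (P.auxTable w.1)) w.2 (g w.1 w.2) ∧
            P.Q w.1 (g w.1 w.2).1.1 = P.Qval j + etaExp r w.1 := by
  have hDt : z₀.1.1 ∈ P.Dt := h.subset_Dt (mem_closedBall_self hR.le)
  set z₁ : State d := (z₀.1, (z₀.2.1, 0)) with hz₁
  have h₁ : P.IsPatch j (closedBall z₁.1.1 R) := h
  obtain ⟨D₀, hD₀, y₀, hlev⟩ := P.exists_isLevelBall (z₀ := z₁) hDt hy.ne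
  set D := min D₀ (R / 2) with hD
  have hD0 : 0 < D := lt_min hD₀ (half_pos hR)
  have hDR : D < R := (min_le_right _ _).trans_lt (half_lt_self hR)
  have hb := hlev D (min_le_left _ _) hD0
  obtain ⟨ρ, hρ, hflow⟩ := IsPatch.barrier_flow (z₀ := z₁) hr h hDR.le hb rfl
  obtain ⟨Kδ, hKδ⟩ := eventually_deltaExp_le (r := r)
  set q := z₀.1.1
  set p := z₀.1.2
  set t := z₀.2.1
  have hsmall : ∀ᶠ u in 𝓝₀, u < u₀ / 2 :=
    eventually_nhdsWithin_of_eventually_nhds (eventually_lt_nhds (half_pos hu₀))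
  have hqc : ContinuousAt (fun x : State d => x.1.1) z₁ := by fun_prop
  have hyc : ContinuousAt (fun x : State d => ⟪∇ (P.Q 0) x.1.1, x.1.2⟫) z₁ :=
    (ContinuousAt.comp (g := ∇ (P.Q 0)) (ContDiffAt.gradient
      (P.contDiffAt_Q ⟨le_rfl, P.ε₁_pos⟩ hDt)).continuousAt hqc).inner (𝕜 := ℝ)
      continuous_fst.snd.continuousAt
  obtain ⟨v, ⟨hv, ha0, ⟨⟨hvρ, hvy⟩, hvin⟩, hvD⟩, hv0⟩ := ((P.eventually_step (p := p) (w := -p)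
    (κ := -1) hDt (by rw [inner_neg_right]; linarith) (inter_mem (inter_mem (ball_mem_nhds z₁ hρ)
    (hyc.eventually_lt_const hy)) (hqc (ball_mem_nhds q hR))) (ball_mem_nhds z₁ hD0)).and
    hsmall).exists
  simp only [neg_one_mul, hQ, smul_neg, ← sub_eq_add_neg, mem_ofPred_eq, mem_preimage]
    at ha0 hvρ hvy hvin hvD
  set a := P.Q 0 (q - v • p) - P.Qval j with ha
  replace ha0 : 0 < a := sub_pos.2 ha0
  set qa := q - v • p with hqa
  set ta := t - v with hta
  set za : State d := ((qa, p), (ta, 0)) with hza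
  have hqaQ : P.Q 0 qa = P.Qval j + a := by rw [ha]; ring
  have hqaD : qa ∈ interior B.D := (h.mem_interior_D (ball_subset_closedBall hvin)).2 (by linarith)
  obtain ⟨Ra, hRa, hRa'⟩ := nhds_basis_closedBall.mem_iff.1
    (inter_mem (isOpen_ball.mem_nhds hvin) (isOpen_interior.mem_nhds hqaD))
  have hRaR : closedBall qa Ra ⊆ closedBall q R := fun x hx => ball_subset_closedBall (hRa' hx).1
  have ha' : P.IsPatch j (closedBall za.1.1 Ra) := h.mono hRaR
  have hRaD : closedBall za.1.1 Ra ⊆ interior B.D := fun x hx => (hRa' hx).2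
  obtain ⟨Da₀, hDa₀, ya, hleva⟩ := P.exists_isLevelBall (z₀ := za)
    (ha'.subset_Dt (mem_closedBall_self hRa.le)) hvy.ne
  set Da := min Da₀ Ra with hDa
  have hDa0 : 0 < Da := lt_min hDa₀ hRa
  have hDaR : Da ≤ Ra := min_le_right _ _
  have hba := hleva Da (min_le_left _ _) hDa0
  obtain ⟨ρa, hρa, hXa⟩ := hP.level_flow hr ha' hDaR hRaD hba rfl
  obtain ⟨v', ⟨hv', hb0, ⟨hv'ρ, hv'in⟩, hv'D⟩, hv'0⟩ := ((P.eventually_step (p := p) (w := -p)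
    (κ := -1) (ha'.subset_Dt (mem_closedBall_self hRa.le)) (by rw [inner_neg_right]; linarith)
    (inter_mem (ball_mem_nhds za hρa) ((continuous_fst.fst.continuousAt (x := za))
    (ball_mem_nhds qa hRa))) (ball_mem_nhds za hDa0)).and hsmall).exists
  simp only [neg_one_mul, smul_neg, ← sub_eq_add_neg, mem_preimage] at hb0 hv'ρ hv'in hv'D
  set b := -(P.Q 0 (qa - v' • p) - P.Q 0 qa) with hb'
  replace hb0 : b < 0 := neg_lt_zero.2 (sub_pos.2 hb0)
  replace hb' : b = a - (P.Q 0 (qa - v' • p) - P.Qval j) := by rw [hb', hqaQ]; ring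
  obtain ⟨Rh, hRh, hRh'⟩ := nhds_basis_closedBall.mem_iff.1 (isOpen_ball.mem_nhds hv'in)
  have hh : P.IsPatch j (closedBall (qa - v' • p) Rh) :=
    ha'.mono (hRh'.trans ball_subset_closedBall)
  set M := max (‖z₁‖ + D) (‖za‖ + Da) with hM
  obtain ⟨c₁, hc₁, hcore⟩ := h.exists_core (M := M) hDR
  obtain ⟨c₂, hc₂, hsub⟩ := P.exists_subset_intTable (isCompact_closedBall za.1.1 Ra) hRaD
  have haux₂ := P.eventually_subset_interior_table (tendsto_etaExp (r := r))
    (isCompact_closedBall za.1.1 Ra) hRaD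
  have hη := eventually_lt_const_etaExp (r := r) ha0
  have hX := hflow (fun _ => a) (etaExp r) (a / 2) (half_pos ha0) (hη.mono fun ε hε =>
    ⟨by linarith [hε.1], le_rfl, by
      rw [abs_sub_comm]
      exact (le_abs_self _).trans' (by linarith)⟩)
  refine ⟨v + v', ⟨by linarith, by linarith⟩, fun ε => flowMap (P.barrierLevel (fun _ => a) (etaExp
      r) ε) 1 ∘
      (P.setLevel j (etaExp r) ε ∘ (flowMap (P.trueLevel ε) 1 ∘ P.setLevel j (fun _ => a) ε)),
    fun ε => flowMap (P.freeLevel ε) 1 ∘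
      (P.setLevel j (etaExp r) ε ∘ (flowMap (P.freeLevel ε) 1 ∘ P.setLevel j (fun _ => a) ε)),
    -a, min c₁ c₂, M, Kδ / y₀, lt_min hc₁ hc₂, fun z hz1 hz2 => ?_⟩
  have hz1' : z.1 = (qa - v' • p, p) := by
    rw [hz1, hqa]
    ext1
    · module
    · rfl
  have hz2' : z.2.1 = ta - v' := by rw [hz2, hta]; ring
  have hset₁ := IsPatch.locRel_setLevel (r := r) (z := z) (R := Rh) (s := fun _ => a) hRh
    (by rw [hz1']; exact hh) tendsto_const_nhds
  rw [hz1', hz2', ← hb'] at hset₁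
  have htrue := CloseFlows.locRel_of_mem (z₁ := ((qa - v' • p, p), (ta - v', b))) (τ := v') ha' hDaR
      hba hXa
    hv'ρ (by simpa using hv'D) (by simp only [sub_add_cancel, hb', hqaQ]; ring)
  simp only [sub_add_cancel] at htrue
  have hset₂ := IsPatch.locRel_setLevel (r := r) (z := ((qa, p), (ta, b))) (R := Ra) (s := etaExp r)
      hRa
    ha' tendsto_etaExp
  simp only [hqaQ, add_sub_cancel_left, zero_sub] at hset₂
  have hbar := CloseFlows.locRel_of_mem (z₀ := z₁) (z₁ := ((qa, p), (ta, -a))) (τ := v) h₁ hDR.le hb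
      hX hvρ
    (by simpa [hqa, hta] using hvD) (by
      simp only [hqa, sub_add_cancel, hQ] at hqaQ ⊢
      rw [hqaQ]
      ring)
  simp only [hqa, hta, sub_add_cancel] at hbar
  rw [← hqa, ← hta] at hbar
  have hl2 := htrue.comp hset₁
  have hl3 := hset₂.comp hl2
  refine ⟨hbar.comp hl3, ?_⟩
  have hneg : ∀ᶠ w in 𝓝₀ ×ˢ 𝓝 z, (P.setLevel j (fun _ => a) w.1 w.2).2.2 < 0 :=
    (hset₁.tendsto_left.snd_nhds.snd_nhds).eventually_lt_const hb0
  filter_upwards [hset₁.tendsto_left.eventually_mem (isOpen_ball.mem_nhds hv'ρ), hneg,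
    hl3.tendsto_left.eventually_mem (isOpen_ball.mem_nhds hvρ),
    hl3.tendsto_right.eventually_mem (isOpen_ball.mem_nhds hvρ),
    (ha'.true_arc hr hDaR hba hXa).prod_inl _, (ha'.freeLevel_line hDaR hba hXa).prod_inl _,
    (h₁.barrier_arc (z₀ := z₁) hr hDR.le hb hX).prod_inl _, (h₁.freeLevel_line (z₀ := z₁) hDR.le hb
        hX).prod_inl _,
    hη.prod_inl _, hcore.prod_inl _, hKδ.prod_inl _, P.eventually_lt.prod_inl _, hsub.prod_inl _,
        haux₂.prod_inl _]
    with w m1 m2 m3 m4 m5 m6 m7 m8 m9 m10 m11 m12 m13 m14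
  have n1 := ball_subset_closedBall m1
  have n3 := ball_subset_closedBall m3
  have n4 := ball_subset_closedBall m4
  simp only [comp_apply] at n3 n4 ⊢
  set x₁ := P.setLevel j (fun _ => a) w.1 w.2 with hx₁
  have hx₁L : P.Q w.1 x₁.1.1 + x₁.2.2 = P.Qval j + a := by
    simp only [hx₁, setLevel]
    ring
  have hpos₁ : 0 < ⟪∇ (P.Q 0) za.1.1, za.1.2⟫ * x₁.2.2 := mul_pos_of_neg_of_neg hvy m2
  obtain ⟨t1, t2, t3, t4⟩ := m5 _ n1 hpos₁
  obtain ⟨l1, l2, l3⟩ := m6 _ n1 hpos₁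
  rw [hx₁L] at t1 l3
  set x₂ := flowMap (P.trueLevel w.1) 1 x₁ with hx₂
  set y₂ := flowMap (P.freeLevel w.1) 1 x₁ with hy₂
  obtain ⟨e1, e2, e3, e4⟩ := m9
  have hd : 0 < a - etaExp r w.1 := by linarith
  have hL₂ : (P.setLevel j (etaExp r) w.1 x₂).2.2 = etaExp r w.1 - a := by
    simp only [setLevel, t1]
    ring
  have hL₂' : (P.setLevel j (etaExp r) w.1 y₂).2.2 = etaExp r w.1 - a := by
    simp only [setLevel, l3]
    ring
  have hpos₂ : 0 < ⟪∇ (P.Q 0) z₁.1.1, z₁.1.2⟫ * (P.setLevel j (etaExp r) w.1 x₂).2.2 := by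
    rw [hL₂]
    exact mul_pos_of_neg_of_neg hy (by linarith)
  have hpos₂' : 0 < ⟪∇ (P.Q 0) z₁.1.1, z₁.1.2⟫ * (P.setLevel j (etaExp r) w.1 y₂).2.2 := by
    rw [hL₂']
    exact mul_pos_of_neg_of_neg hy (by linarith)
  obtain ⟨f0, f1, f2⟩ := m7 _ n3 t1 hL₂ hpos₂
  obtain ⟨g1, g2, g3⟩ := m8 _ n4 hpos₂'
  set s := (a - deltaExp r w.1) / (a - etaExp r w.1) with hs
  have hs0 : 0 ≤ s := div_nonneg (by linarith) hd.le
  have hs1 : s ≤ 1 := (div_le_one hd).2 (by linarith)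
  have hsd : s * (a - etaExp r w.1) = a - deltaExp r w.1 := div_mul_cancel₀ _ hd.ne'
  have hcore₁ : ∀ v ∈ Icc 0 s, (flowMap (P.barrierLevel (fun _ => a) (etaExp r) w.1) v
      (P.setLevel j (etaExp r) w.1 x₂)).1 ∈ P.core (min c₁ c₂) M w.1 := fun v hv => by
    have hv' : v ∈ 𝕀 := ⟨hv.1, hv.2.trans hs1⟩
    refine core_mono (min_le_left _ _) le_rfl (m10 _ (mem_ball_q (z₀ := z₁) le_rfl (f1 v hv').1) ?_
      (((norm_fst_le _).trans (norm_le_of_mem_closedBall (f1 v hv').1)).trans (le_max_left _ _)))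
    rw [(f1 v hv').2]
    have := mul_le_mul_of_nonneg_right hv.2 hd.le
    linarith
  have hcore₂ : ∀ x ∈ closedBall za Da, x.1 ∈ P.core (min c₁ c₂) M w.1 := fun x hx =>
    core_mono (min_le_right _ _) le_rfl ⟨m13 (mem_ball_q hDaR hx), m14 _ (mem_ball_q hDaR hx),
      ((norm_fst_le _).trans (norm_le_of_mem_closedBall hx)).trans (le_max_right _ _)⟩
  have haux : ∀ x ∈ closedBall q D, P.Qval j + etaExp r w.1 < P.Q w.1 x →
      x ∈ interior (P.auxTable w.1) := fun x hx hx' =>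
    h.mem_interior (closedBall_mem_nhds_of_lt hx hDR) (Ioo_subset_Ico_self m12) hx'
  have A1 : P.Arc w.1 (P.core (min c₁ c₂) M w.1) w.2 x₂ := t2.mono (by
    rintro _ ⟨z', hz', rfl⟩
    exact hcore₂ z' hz')
  have A2 := (f0 ▸ (f2 0 s le_rfl hs0 hs1).1 : P.Arc w.1 _ x₂ _).mono
    (S' := P.core (min c₁ c₂) M w.1) (by
      rintro _ ⟨v, hv, rfl⟩
      exact hcore₁ v ⟨hv.1.le, hv.2.le⟩)
  refine ⟨⟨⟨_, hcore₂ x₁ t4, A1.trans A2 (hcore₂ _ t3), hcore₁ s ⟨hs0, le_rfl⟩,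
    (f2 s 1 hs0 hs1 le_rfl).1.mono ?_, ?_⟩, ?_⟩, ?_, ?_⟩
  · rintro _ ⟨v, hv, rfl⟩
    have hv' : v ∈ 𝕀 := ⟨hs0.trans hv.1.le, hv.2.le⟩
    refine haux _ (mem_ball_q (z₀ := z₁) le_rfl (f1 v hv').1) ?_
    rw [(f1 v hv').2]
    have := mul_lt_mul_of_pos_right hv.2 hd
    linarith
  · have h8 := (f2 s 1 hs0 hs1 le_rfl).2
    rw [abs_sub_comm, abs_of_pos hd] at h8
    have hy0 := hb.2.1
    refine h8.trans ?_
    have h9 : (a - etaExp r w.1) / y₀ * (1 - s) = (deltaExp r w.1 - etaExp r w.1) / y₀ := by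
      rw [div_mul_eq_mul_div, mul_one_sub, mul_comm _ s, hsd]
      congr 1
      ring
    rw [h9, div_mul_eq_mul_div]
    exact div_le_div_of_nonneg_right (by linarith) hy0.le
  · rw [(f1 1 (by simp)).2]
    ring
  · have L1 : Line (interior (P.auxTable w.1)) w.2 y₂ := l1.mono fun x hx =>
      m14 x (closedBall_subset_closedBall hDaR hx.1)
    have L2 : Line (interior (P.auxTable w.1)) y₂ (flowMap (P.freeLevel w.1) 1
        (P.setLevel j (etaExp r) w.1 y₂)) := g1.mono (by
      rintro x ⟨hx, v, hv, hx'⟩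
      refine haux x hx ?_
      rw [hx', hL₂']
      have h9 := mul_lt_mul_of_pos_right hv.2 hd
      simp only [setLevel]
      rw [l3]
      linarith)
    exact L1.trans L2 (m14 _ (closedBall_subset_closedBall hDaR l2))
  · rw [g3, hL₂']
    simp only [setLevel]
    rw [l3]
    ring

end SteepExpPotential

/-! ### The reflection by the steep wall -/

section Wall

variable {d : ℕ}

/-- The component of `p` orthogonal to the unit vector `n`. -/
noncomputable def tang (n p : Config d) : Config d := p - ⟪p, n⟫ • n

/-- Twice the kinetic energy which is left for the motion along `n`. -/
noncomputable def normalEnergy (n : Config d) (z : State d) : ℝ := 2 * z.2.2 - ⟪tang n z.1.2, tang n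
    z.1.2⟫

noncomputable def kickDen (n : Config d) (x : ℝ) (g : Config d) (z : State d) : ℝ :=
  ⟪g, n⟫ * √(normalEnergy n z) + x * ⟪tang n z.1.2, g⟫

/-- The rate of the momentum along `g`, if the ratio `x` of the momentum along `n` to its maximal
value is used as the time. -/
noncomputable def kick (n : Config d) (x : ℝ) (g : Config d) (z : State d) : ℝ :=
  2 * normalEnergy n z / kickDen n x g z

noncomputable def wallField (n : Config d) (x : ℝ) (g : Config d) (μ : ℝ) (z : State d) : State d :=
  kick n x g z • ((μ • z.1.2, g), (μ, (0 : ℝ)))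

variable {n : Config d}

lemma inner_tang_self (hn : ‖n‖ = 1) (p : Config d) : ⟪tang n p, n⟫ = (0 : ℝ) := by
  rw [tang, inner_sub_left, real_inner_smul_left, real_inner_self_eq_norm_sq, hn]
  ring

lemma inner_self_eq_tang (hn : ‖n‖ = 1) (p : Config d) :
    ⟪p, p⟫ = ⟪tang n p, tang n p⟫ + ⟪p, n⟫ ^ 2 := by
  have h : (⟪n, n⟫ : ℝ) = 1 := by rw [real_inner_self_eq_norm_sq, hn]; norm_num
  simp only [tang, inner_sub_left, inner_sub_right, real_inner_smul_left, real_inner_smul_right, h,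
    real_inner_comm n p]
  ring

section Smooth

variable {E : Type} [NormedAddCommGroup E] [NormedSpace ℝ E] {k : WithTop ℕ∞} {x : E → ℝ}
  {g : E → Config d} {μ : E → ℝ} {z : E → State d} {e : E}

lemma contDiffAt_tang (hz : 𝒞 k z e) : 𝒞 k (fun e => tang n (z e).1.2) e := by
  have hp : 𝒞 k (fun e => (z e).1.2) e := hz.fst.snd
  exact hp.sub ((hp.inner ℝ contDiffAt_const).smul contDiffAt_const)

lemma contDiffAt_normalEnergy (hz : 𝒞 k z e) :
    𝒞 k (fun e => normalEnergy n (z e)) e :=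
  (contDiffAt_const.mul hz.snd.snd).sub ((contDiffAt_tang hz).inner ℝ (contDiffAt_tang hz))

lemma contDiffAt_kick (hx : 𝒞 k x e) (hg : 𝒞 k g e) (hz : 𝒞 k z e)
    (h1 : normalEnergy n (z e) ≠ 0) (h2 : kickDen n (x e) (g e) (z e) ≠ 0) :
    𝒞 k (fun e => kick n (x e) (g e) (z e)) e :=
  (contDiffAt_const.mul (contDiffAt_normalEnergy hz)).div
    (((hg.inner ℝ contDiffAt_const).mul ((contDiffAt_normalEnergy hz).sqrt h1)).add
      (hx.mul ((contDiffAt_tang hz).inner ℝ hg))) h2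

lemma contDiffAt_wallField (hx : 𝒞 k x e) (hg : 𝒞 k g e)
    (hμ : 𝒞 k μ e) (hz : 𝒞 k z e)
    (h1 : normalEnergy n (z e) ≠ 0) (h2 : kickDen n (x e) (g e) (z e) ≠ 0) :
    𝒞 k (fun e => wallField n (x e) (g e) (μ e) (z e)) e :=
  (contDiffAt_kick hx hg hz h1 h2).smul (((hμ.smul hz.fst.snd).prodMk hg).prodMk
    (hμ.prodMk contDiffAt_const))

lemma continuous_normalEnergy : Continuous (normalEnergy n) :=
  continuous_iff_continuousAt.2 fun _ =>
    (contDiffAt_normalEnergy (k := 0) (z := id) contDiffAt_id).continuousAt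

lemma continuous_kickDen :
    Continuous (fun w : ℝ × Config d × State d => kickDen n w.1 w.2.1 w.2.2) := by
  have h1 : Continuous fun w : ℝ × Config d × State d => normalEnergy n w.2.2 :=
    continuous_normalEnergy.comp (continuous_snd.comp continuous_snd)
  have h2 : Continuous fun w : ℝ × Config d × State d => tang n w.2.2.1.2 := by
    unfold tang
    fun_prop
  unfold kickDen
  fun_prop

end Smooth

section Sol

variable {ζ : ℝ → State d} {g : ℝ → Config d} {μ : ℝ → ℝ}
  (hζ : ∀ s ∈ 𝕀, HasDerivWithinAt ζ (wallField n (2 * s - 1) (g s) (μ s) (ζ s)) 𝕀 s)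

include hζ

lemma wall_L_eq {s : ℝ} (hs : s ∈ 𝕀) : (ζ s).2.2 = (ζ 0).2.2 :=
  eq_of_hasDerivWithinAt_zero (f := fun s => (ζ s).2.2)
    (fun t ht => (hasDerivWithinAt_l (hζ t ht)).congr_deriv (by simp [wallField])) hs

lemma wall_p {s : ℝ} (hs : s ∈ 𝕀) :
    HasDerivWithinAt (fun s => (ζ s).1.2) (kick n (2 * s - 1) (g s) (ζ s) • g s) 𝕀 s :=
  (hasDerivWithinAt_p (hζ s hs)).congr_deriv (by simp [wallField])

variable (hn : ‖n‖ = 1) (hE : ∀ s ∈ 𝕀, 0 < normalEnergy n (ζ s))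
  (hK : ∀ s ∈ 𝕀, kickDen n (2 * s - 1) (g s) (ζ s) ≠ 0)
  (h0 : 2 * (ζ 0).2.2 = ⟪(ζ 0).1.2, (ζ 0).1.2⟫) (h0' : ⟪(ζ 0).1.2, n⟫ < (0 : ℝ))

include hn hE hK h0 h0'

lemma wall_normal {s : ℝ} (hs : s ∈ 𝕀) :
    ⟪(ζ s).1.2, n⟫ = (2 * s - 1) * √(normalEnergy n (ζ s)) := by
  have key : ∀ s ∈ 𝕀, HasDerivWithinAt
      (fun s => ⟪(ζ s).1.2, n⟫ - (2 * s - 1) * √(normalEnergy n (ζ s))) 0 𝕀 s := by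
    intro s hs
    have hp := wall_p hζ hs
    set k := kick n (2 * s - 1) (g s) (ζ s) with hk
    have h1 : HasDerivWithinAt (fun s => ⟪(ζ s).1.2, n⟫) (k * ⟪g s, n⟫) 𝕀 s := by
      have := hp.inner ℝ (hasDerivWithinAt_const s 𝕀 n)
      simpa [real_inner_smul_left] using this
    have h2 : HasDerivWithinAt (fun s => tang n (ζ s).1.2) (k • g s - (k * ⟪g s, n⟫) • n)
        𝕀 s := hp.sub (h1.smul_const n)
    have h3 : HasDerivWithinAt (fun s => normalEnergy n (ζ s)) (-(2 * k * ⟪tang n (ζ s).1.2, g s⟫))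
        𝕀 s := by
      have h4 := ((hasDerivWithinAt_const s 𝕀 (2 : ℝ)).mul
        (hasDerivWithinAt_l (hζ s hs))).sub (h2.inner ℝ h2)
      refine h4.congr_deriv ?_
      simp only [wallField, Prod.smul_snd, smul_zero, inner_sub_left, inner_sub_right,
        real_inner_smul_left, real_inner_smul_right, inner_tang_self hn,
        real_inner_comm (tang n (ζ s).1.2) n, real_inner_comm (tang n (ζ s).1.2) (g s)]
      ring
    have h5 := h3.sqrt (hE s hs).ne'
    have h6 : HasDerivWithinAt (fun s : ℝ => 2 * s - 1) 2 𝕀 s := by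
      simpa using (((hasDerivAt_id s).const_mul 2).sub_const 1).hasDerivWithinAt (s := 𝕀)
    refine (h1.sub (h6.mul h5)).congr_deriv ?_
    have h7 := Real.sq_sqrt (hE s hs).le
    have h8 := (Real.sqrt_pos.2 (hE s hs)).ne'
    have h9 : k * kickDen n (2 * s - 1) (g s) (ζ s) = 2 * normalEnergy n (ζ s) :=
      div_mul_cancel₀ _ (hK s hs)
    rw [kickDen] at h9
    field_simp
    nlinarith
  have h1 := eq_of_hasDerivWithinAt_zero key hs
  have h2 : normalEnergy n (ζ 0) = ⟪(ζ 0).1.2, n⟫ ^ 2 := by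
    rw [normalEnergy, h0, inner_self_eq_tang hn]
    ring
  simp only [h2, Real.sqrt_sq_eq_abs, abs_of_neg h0'] at h1
  linarith

lemma wall_energy {s : ℝ} (hs : s ∈ 𝕀) :
    (ζ 0).2.2 - ⟪(ζ s).1.2, (ζ s).1.2⟫ / 2 = normalEnergy n (ζ s) * (1 - (2 * s - 1) ^ 2) / 2 := by
  have h1 := wall_normal hζ hn hE hK h0 h0' hs
  have h2 := inner_self_eq_tang hn (ζ s).1.2
  have h3 := Real.sq_sqrt (hE s hs).le
  rw [h1, mul_pow, h3] at h2
  have h4 : normalEnergy n (ζ s) = 2 * (ζ s).2.2 - ⟪tang n (ζ s).1.2, tang n (ζ s).1.2⟫ := rfl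
  rw [wall_L_eq hζ hs] at h4
  linarith

/-- If the gradient is constant, the result is the elastic reflection. -/
lemma wall_reflect {G : Config d} (hg : ∀ s ∈ 𝕀, g s = G) (hG : G ≠ 0) :
    (ζ 1).1.2 = reflectMomentum (‖G‖⁻¹ • G) (ζ 0).1.2 := by
  have e1 : (1 : ℝ) ∈ 𝕀 := by simp
  have hGG : (⟪G, G⟫ : ℝ) ≠ 0 := inner_self_ne_zero.2 hG
  have key : ∀ s ∈ 𝕀, HasDerivWithinAt
      (fun s => (ζ s).1.2 - (⟪(ζ s).1.2, G⟫ / ⟪G, G⟫) • G) 0 𝕀 s := by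
    intro s hs
    have hp := wall_p hζ hs
    rw [hg s hs] at hp
    set k := kick n (2 * s - 1) G (ζ s) with hk
    have h1 : HasDerivWithinAt (fun s => ⟪(ζ s).1.2, G⟫) (k * ⟪G, G⟫) 𝕀 s := by
      have := hp.inner ℝ (hasDerivWithinAt_const s 𝕀 G)
      simpa [real_inner_smul_left] using this
    refine (hp.sub ((h1.div_const _).smul_const G)).congr_deriv ?_
    rw [mul_div_cancel_right₀ _ hGG, sub_self]
  have h1 := eq_of_hasDerivWithinAt_zero key e1
  set v := (⟪(ζ 1).1.2, G⟫ - ⟪(ζ 0).1.2, G⟫) / ⟪G, G⟫ with hv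
  have h2 : (ζ 1).1.2 = (ζ 0).1.2 + v • G := by
    rw [hv, sub_div, sub_smul]
    rw [sub_eq_iff_eq_add] at h1
    refine h1.trans ?_
    abel
  have h3 := wall_normal hζ hn hE hK h0 h0' e1
  have h4 := wall_energy hζ hn hE hK h0 h0' e1
  have h5 := Real.sqrt_pos.2 (hE 1 e1)
  have hv0 : v ≠ 0 := fun h => by
    rw [h, zero_smul, add_zero] at h2
    rw [h2] at h3
    linarith
  have h6 : v * (2 * ⟪(ζ 0).1.2, G⟫ + v * ⟪G, G⟫) = 0 := by
    rw [h2] at h4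
    simp only [inner_add_left, inner_add_right, real_inner_smul_left, real_inner_smul_right,
      real_inner_comm (ζ 0).1.2 G] at h4
    linarith
  have h7 : v = -2 * ⟪(ζ 0).1.2, G⟫ / ⟪G, G⟫ := by
    rw [eq_div_iff hGG]
    linarith [(mul_eq_zero.1 h6).resolve_left hv0]
  have hGn : ‖G‖ ≠ 0 := norm_ne_zero_iff.2 hG
  rw [h2, reflectMomentum, h7, smul_smul, sub_eq_add_neg, ← neg_smul, real_inner_smul_right,
    real_inner_self_eq_norm_sq]
  congr 2
  field_simp

end Sol

end Wall

section Weight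

variable {r : ℕ}

/-- A bound for the inverse of the slope of the barrier, and its primitive. -/
noncomputable def wallWeight (r : ℕ) (c : ℝ) (i : ℝ × ℝ) : ℝ :=
  i.1 * ((nuExp r i.1 + 2 * c * (1 - i.2))⁻¹ + (nuExp r i.1 + 2 * c * i.2)⁻¹)

noncomputable def wallPrim (r : ℕ) (c : ℝ) (ε s : ℝ) : ℝ :=
  ε / (2 * c) * ((log (nuExp r ε + 2 * c * s) - log (nuExp r ε)) +
    (log (nuExp r ε + 2 * c) - log (nuExp r ε + 2 * c * (1 - s))))

lemma isWeight_wall {c : ℝ} (hc : 0 < c) : IsWeight 𝓝₀ (nuExp r) (wallWeight r c)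
    (wallPrim r c) (1 / c * (1 + 2 * c + 1)) := by
  filter_upwards [eventually_mem_nhdsWithin, eventually_lt_one, nuExp_le_one_eventually (r := r)]
    with ε hε hε1 hν1
  have hε0 : 0 < ε := hε
  have hν := nuExp_pos (r := r) hε0
  set ν := nuExp r ε with hνd
  refine ⟨by simp [wallPrim], fun s hs => ?_⟩
  have h1 : 0 < ν + 2 * c * s := by nlinarith [hs.1]
  have h2 : 0 < ν + 2 * c * (1 - s) := by nlinarith [hs.2]
  have l1 : log ν ≤ log (ν + 2 * c * s) := Real.log_le_log hν (by nlinarith [hs.1])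
  have l2 : log (ν + 2 * c * (1 - s)) ≤ log (ν + 2 * c) :=
    Real.log_le_log h2 (by nlinarith [hs.1])
  have l3 : log (ν + 2 * c * s) ≤ log (ν + 2 * c) := Real.log_le_log h1 (by nlinarith [hs.2])
  have l4 : log ν ≤ log (ν + 2 * c * (1 - s)) := Real.log_le_log hν (by nlinarith [hs.2])
  refine ⟨mul_nonneg hε0.le (add_nonneg (inv_nonneg.2 h2.le) (inv_nonneg.2 h1.le)), ?_,
    mul_nonneg (by positivity) (by linarith), ?_⟩
  · have d1 : HasDerivAt (fun s : ℝ => ν + 2 * c * s) (2 * c) s := by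
      simpa using ((hasDerivAt_id s).const_mul (2 * c)).const_add ν
    have d2 : HasDerivAt (fun s : ℝ => ν + 2 * c * (1 - s)) (-(2 * c)) s := by
      simpa using (((hasDerivAt_id s).const_sub 1).const_mul (2 * c)).const_add ν
    have := (((d1.log h1.ne').sub_const (log ν)).add
      ((d2.log h2.ne').const_sub (log (ν + 2 * c)))).const_mul (ε / (2 * c))
    refine this.hasDerivWithinAt.congr_deriv ?_
    simp only [wallWeight, ← hνd]
    field_simp
    ring
  · have u1 : log (ν + 2 * c) ≤ 1 + 2 * c := by
      have := Real.log_le_sub_one_of_pos (show 0 < ν + 2 * c by positivity)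
      linarith
    have u2 : -log ν ≤ 1 / ν := by
      have := Real.one_sub_inv_le_log_of_pos hν
      rw [one_div]
      linarith
    have u3 : ε ≤ ν * ν := by
      have e : ν = ε ^ (1 / ((r : ℝ) + 2)) := rfl
      rw [e, ← Real.rpow_add hε0]
      conv_lhs => rw [← Real.rpow_one ε]
      refine Real.rpow_le_rpow_of_exponent_ge hε0 hε1.le ?_
      rw [← add_div, div_le_one (by positivity)]
      have : (0 : ℝ) ≤ r := by positivity
      linarith
    have u4 : ε / ν ≤ ν := (div_le_iff₀ hν).2 u3
    have u5 : ε ≤ ν := u3.trans (mul_le_of_le_one_left hν.le hν1)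
    have u6 : ε * (log (ν + 2 * c) - log ν) ≤ (1 + 2 * c + 1) * ν := by
      have v1 : ε * (1 + 2 * c) ≤ ν * (1 + 2 * c) := by gcongr
      have v2 : ε * (1 / ν) ≤ ν := by rwa [mul_one_div]
      have v3 : ε * (log (ν + 2 * c) - log ν) ≤ ε * ((1 + 2 * c) + 1 / ν) := by
        gcongr
        linarith
      nlinarith
    calc wallPrim r c ε s ≤ ε / (2 * c) * (2 * (log (ν + 2 * c) - log ν)) := by
          rw [wallPrim, ← hνd]
          gcongr
          linarith
      _ = 1 / c * (ε * (log (ν + 2 * c) - log ν)) := by field_simp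
      _ ≤ 1 / c * ((1 + 2 * c + 1) * ν) := by gcongr
      _ = 1 / c * (1 + 2 * c + 1) * ν := by ring

lemma le_wallWeight {c ε s : ℝ} (hc : 0 < c) (hε : 0 < ε) (hs : s ∈ 𝕀) :
    0 ≤ ε / (nuExp r ε + c * (1 - (2 * s - 1) ^ 2)) ∧
      ε / (nuExp r ε + c * (1 - (2 * s - 1) ^ 2)) ≤ 1 * wallWeight r c (ε, s) := by
  have hν := nuExp_pos (r := r) hε
  set ν := nuExp r ε with hνd
  have h1 : 0 < ν + 2 * c * s := by nlinarith [hs.1]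
  have h2 : 0 < ν + 2 * c * (1 - s) := by nlinarith [hs.2]
  have e : 1 - (2 * s - 1) ^ 2 = 4 * s * (1 - s) := by ring
  have hw : 0 ≤ s * (1 - s) := mul_nonneg hs.1 (sub_nonneg.2 hs.2)
  rw [e]
  have h3 : 0 < ν + c * (4 * s * (1 - s)) := by nlinarith
  refine ⟨(div_pos hε h3).le, ?_⟩
  rw [one_mul, wallWeight, div_eq_mul_inv]
  simp only [← hνd]
  gcongr
  rcases le_total s (1 / 2) with h | h
  · refine (inv_anti₀ h1 ?_).trans (le_add_of_nonneg_left (inv_nonneg.2 h2.le))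
    nlinarith [mul_nonneg hc.le (mul_nonneg hs.1 (sub_nonneg.2 h))]
  · refine (inv_anti₀ h2 ?_).trans (le_add_of_nonneg_right (inv_nonneg.2 h1.le))
    nlinarith [mul_nonneg hc.le (mul_nonneg (sub_nonneg.2 h) (sub_nonneg.2 hs.2))]

end Weight

namespace SteepExpPotential

variable {d r : ℕ} {B : BilliardTable d r} {P : SteepExpPotential B} {j : Fin B.pieces}

/-- The motion in the wall, with the momentum along `n` as the time. -/
noncomputable def bounce (P : SteepExpPotential B) (n : Config d) (ε s : ℝ) (z : State d) : State d
    :=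
  wallField n (2 * s - 1) (∇ (P.Q ε) z.1.1)
    (ε / (nuExp r ε + normalEnergy n z * (1 - (2 * s - 1) ^ 2) / 2)) z

noncomputable def mirror (P : SteepExpPotential B) (n : Config d) (ε s : ℝ) (z : State d) : State d
    :=
  wallField n (2 * s - 1) (∇ (P.Q ε) z.1.1) 0 z

/-- The reflection at the tangent plane of the boundary. -/
noncomputable def wallPath (n : Config d) (z : State d) (s : ℝ) : State d :=
  ((z.1.1, z.1.2 - (2 * ⟪z.1.2, n⟫ * s) • n), z.2)

lemma tang_wallPath {n : Config d} (hn : ‖n‖ = 1) (z : State d) (s : ℝ) :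
    tang n (wallPath n z s).1.2 = tang n z.1.2 := by
  have h : (⟪n, n⟫ : ℝ) = 1 := by rw [real_inner_self_eq_norm_sq, hn]; norm_num
  simp only [tang, wallPath, inner_sub_left, real_inner_smul_left, h]
  module

lemma normalEnergy_wallPath {n : Config d} (hn : ‖n‖ = 1) {z : State d}
    (hL : 2 * z.2.2 = ⟪z.1.2, z.1.2⟫) (s : ℝ) :
    normalEnergy n (wallPath n z s) = ⟪z.1.2, n⟫ ^ 2 := by
  rw [normalEnergy, tang_wallPath hn]
  have := inner_self_eq_tang hn z.1.2
  change 2 * z.2.2 - _ = _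
  linarith

lemma kickDen_wallPath {n : Config d} (hn : ‖n‖ = 1) {z : State d}
    (hL : 2 * z.2.2 = ⟪z.1.2, z.1.2⟫) (hz : ⟪z.1.2, n⟫ < (0 : ℝ)) (x s a : ℝ) :
    kickDen n x (a • n) (wallPath n z s) = -(a * ⟪z.1.2, n⟫) := by
  have h : (⟪n, n⟫ : ℝ) = 1 := by rw [real_inner_self_eq_norm_sq, hn]; norm_num
  rw [kickDen, normalEnergy_wallPath hn hL, Real.sqrt_sq_eq_abs, abs_of_neg hz, tang_wallPath hn,
    real_inner_smul_right, inner_tang_self hn, real_inner_smul_left, h]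
  ring

lemma wallField_wallPath {n : Config d} (hn : ‖n‖ = 1) {z : State d}
    (hL : 2 * z.2.2 = ⟪z.1.2, z.1.2⟫) (hz : ⟪z.1.2, n⟫ < (0 : ℝ)) (x s : ℝ) {a : ℝ} (ha : 0 < a) :
    wallField n x (a • n) 0 (wallPath n z s) =
      (((0 : Config d), -(2 * ⟪z.1.2, n⟫) • n), ((0 : ℝ), (0 : ℝ))) := by
  rw [wallField, kick, kickDen_wallPath hn hL hz, normalEnergy_wallPath hn hL]
  ext1
  · ext1
    · simp
    · simp only [Prod.smul_fst, Prod.smul_snd, smul_smul]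
      congr 1
      field_simp
  · simp

lemma hasDerivAt_wallPath (n : Config d) (z : State d) (s : ℝ) :
    HasDerivAt (wallPath n z) (((0 : Config d), -(2 * ⟪z.1.2, n⟫) • n), ((0 : ℝ), (0 : ℝ))) s := by
  have h1 : HasDerivAt (fun s : ℝ => z.1.2 - (2 * ⟪z.1.2, n⟫ * s) • n) (-(2 * ⟪z.1.2, n⟫) • n) s :=
      by
    have := (((hasDerivAt_id s).const_mul (2 * ⟪z.1.2, n⟫)).smul_const n).const_sub z.1.2
    simpa using this
  exact ((hasDerivAt_const s z.1.1).prodMk h1).prodMk (hasDerivAt_const s z.2)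

lemma isCompact_wall_set (n : Config d) (R₀ C₁ R' c₀ k₀ : ℝ) :
    IsCompact {x : (ℝ × ℝ) × Config d × State d | (‖x.1‖ ≤ R₀ ∧ ‖x.2.1‖ ≤ C₁ ∧ ‖x.2.2‖ ≤ R') ∧
      0 ≤ x.1.2 ∧ c₀ ≤ normalEnergy n x.2.2 ∧ k₀ ≤ kickDen n x.1.1 x.2.1 x.2.2} := by
  have h1 := (isCompact_closedBall (0 : ℝ × ℝ) R₀).prod
    ((isCompact_closedBall (0 : Config d) C₁).prod (isCompact_closedBall (0 : State d) R'))
  refine h1.of_isClosed_subset ?_ fun x hx => ?_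
  · have h2 : Continuous fun x : (ℝ × ℝ) × Config d × State d => normalEnergy n x.2.2 :=
      continuous_normalEnergy.comp (continuous_snd.comp continuous_snd)
    have h3 : Continuous fun x : (ℝ × ℝ) × Config d × State d => kickDen n x.1.1 x.2.1 x.2.2 :=
      continuous_kickDen.comp ((continuous_fst.comp continuous_fst).prodMk continuous_snd)
    exact ((isClosed_le (by fun_prop) (by fun_prop)).and ((isClosed_le (by fun_prop)
      (by fun_prop)).and (isClosed_le (by fun_prop) (by fun_prop)))).and
      ((isClosed_le (by fun_prop) (by fun_prop)).and ((isClosed_le continuous_const h2).and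
        (isClosed_le continuous_const h3)))
  · exact ⟨mem_closedBall_zero_iff.2 hx.1.1, mem_closedBall_zero_iff.2 hx.1.2.1,
      mem_closedBall_zero_iff.2 hx.1.2.2⟩

/-- In the tube of radius `D` around the reflection, the fields are defined. -/
lemma IsPatch.exists_wall_tube {z₀ : State d} {R : ℝ} (hR : 0 < R)
    (h : P.IsPatch j (closedBall z₀.1.1 R)) {n : Config d} (hn : ‖n‖ = 1) {a : ℝ} (ha : 0 < a)
    (hg : ∇ (P.Q 0) z₀.1.1 = a • n) (hL : 2 * z₀.2.2 = ⟪z₀.1.2, z₀.1.2⟫)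
    (hz : ⟪z₀.1.2, n⟫ < (0 : ℝ)) : ∃ D > 0, ∃ c > 0, ∃ k > 0, D ≤ R ∧
      (c ≤ ⟪z₀.1.2, n⟫ ^ 2 ∧ k ≤ -(a * ⟪z₀.1.2, n⟫)) ∧
      ∀ᶠ ε in 𝓝₀, ∀ s ∈ 𝕀, ∀ z, ‖z - wallPath n z₀ s‖ ≤ D →
        c ≤ normalEnergy n z ∧ k ≤ kickDen n (2 * s - 1) (∇ (P.Q ε) z.1.1) z := by
  set σ : ℝ := ⟪z₀.1.2, n⟫ with hσ
  have hc : 0 < σ ^ 2 := by have := hz.ne; positivity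
  have hk : 0 < -(a * σ) := by nlinarith
  have key : ∀ s ∈ 𝕀, ∀ᶠ w in (𝓝₀ ×ˢ 𝓝 (0 : State d)) ×ˢ 𝓝 s,
      σ ^ 2 / 2 < normalEnergy n (wallPath n z₀ w.2 + w.1.2) ∧
      -(a * σ) / 2 < kickDen n (2 * w.2 - 1)
        (∇ (P.Q w.1.1) (wallPath n z₀ w.2 + w.1.2).1.1) (wallPath n z₀ w.2 + w.1.2) := by
    intro s _
    have f1 : Tendsto (fun w : (ℝ × State d) × ℝ => w.1.1)
        ((𝓝₀ ×ˢ 𝓝 (0 : State d)) ×ˢ 𝓝 s) 𝓝₀ := tendsto_fst.comp tendsto_fst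
    have f2 : Tendsto (fun w : (ℝ × State d) × ℝ => w.1.2)
        ((𝓝₀ ×ˢ 𝓝 (0 : State d)) ×ˢ 𝓝 s) (𝓝 0) := tendsto_snd.comp tendsto_fst
    have f3 : Tendsto (fun w : (ℝ × State d) × ℝ => wallPath n z₀ w.2)
        ((𝓝₀ ×ˢ 𝓝 (0 : State d)) ×ˢ 𝓝 s) (𝓝 (wallPath n z₀ s)) :=
      (hasDerivAt_wallPath n z₀ s).continuousAt.tendsto.comp tendsto_snd
    have hw := f3.add f2
    rw [add_zero] at hw
    have f4 : Tendsto (fun w : (ℝ × State d) × ℝ => (wallPath n z₀ w.2 + w.1.2).1.1)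
        ((𝓝₀ ×ˢ 𝓝 (0 : State d)) ×ˢ 𝓝 s) (𝓝 z₀.1.1) :=
      hw.fst_nhds.fst_nhds
    have hG := (P.tendsto_gradient_Q (h.subset_Dt (mem_closedBall_self hR.le))).comp (f1.prodMk f4)
    rw [hg] at hG
    have hx : Tendsto (fun w : (ℝ × State d) × ℝ => 2 * w.2 - 1)
        ((𝓝₀ ×ˢ 𝓝 (0 : State d)) ×ˢ 𝓝 s) (𝓝 (2 * s - 1)) :=
      (tendsto_snd.const_mul 2).sub_const 1
    have t1 := (continuous_normalEnergy (n := n)).tendsto _ |>.comp hw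
    have t2 := (continuous_kickDen (n := n)).tendsto _ |>.comp (hx.prodMk_nhds (hG.prodMk_nhds hw))
    simp only [normalEnergy_wallPath hn hL, kickDen_wallPath hn hL hz, ← hσ] at t1 t2
    exact (t1.eventually_const_lt (half_lt_self hc)).and (t2.eventually_const_lt (half_lt_self hk))
  obtain ⟨D, hD, h1⟩ := Filter.Eventually.exists_closedBall
    (p := fun ε y => ∀ s ∈ 𝕀, σ ^ 2 / 2 < normalEnergy n (wallPath n z₀ s + y) ∧
      -(a * σ) / 2 < kickDen n (2 * s - 1)
        (∇ (P.Q ε) (wallPath n z₀ s + y).1.1) (wallPath n z₀ s + y))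
    (isCompact_Icc.eventually_forall_prod key)
  refine ⟨min D R, lt_min hD hR, σ ^ 2 / 2, half_pos hc, -(a * σ) / 2, half_pos hk, min_le_right _
      _,
    ⟨by linarith, by linarith⟩, ?_⟩
  filter_upwards [h1 _ (min_le_left D R)] with ε hε s hs z hz'
  have := hε (z - wallPath n z₀ s) (mem_closedBall_zero_iff.2 hz') s hs
  simp only [add_sub_cancel] at this
  exact ⟨this.1.le, this.2.le⟩

set_option maxHeartbeats 600000 in
lemma IsPatch.bounce_flow (hr : 1 ≤ r) {z₀ : State d} {R : ℝ} (hR : 0 < R)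
    (h : P.IsPatch j (closedBall z₀.1.1 R)) {n : Config d} (hn : ‖n‖ = 1) {a : ℝ} (ha : 0 < a)
    (hg : ∇ (P.Q 0) z₀.1.1 = a • n) (hL : 2 * z₀.2.2 = ⟪z₀.1.2, z₀.1.2⟫)
    (hz : ⟪z₀.1.2, n⟫ < (0 : ℝ)) : ∃ D ≤ R, ∃ ρ > 0,
      (∀ᶠ ε in 𝓝₀, ∀ s ∈ 𝕀, ∀ z, ‖z - wallPath n z₀ s‖ ≤ D →
        (0 < normalEnergy n z ∧ 0 < kickDen n (2 * s - 1) (∇ (P.Q ε) z.1.1) z) ∧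
        𝒞 r (uncurry (P.bounce n ε)) (s, z)) ∧
      (∀ᶠ ε in 𝓝₀, ∀ z ∈ closedBall z₀ ρ,
        FlowIn (P.bounce n ε) (wallPath n z₀) D z ∧ FlowIn (P.mirror n ε) (wallPath n z₀) D z) ∧
      LocRel r (fun ε => flowMap (P.bounce n ε) 1) (fun ε => flowMap (P.mirror n ε) 1) z₀
        (wallPath n z₀ 1) := by
  obtain ⟨D, hD, c₀, hc₀, k₀, hk₀, hDR, ⟨hcσ, hkσ⟩, htube⟩ := h.exists_wall_tube hR hn ha hg hL hz
  obtain ⟨C₁, hC₁⟩ := h.exists_bound_gradient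
  set C₂ := max (max C₁ 0) ‖a • n‖ with hC₂
  set c := c₀ / 2 with hc
  have hc0 : 0 < c := half_pos hc₀
  set R' := ‖z₀‖ + 2 * |(⟪z₀.1.2, n⟫ : ℝ)| + D with hR'
  set R₀ := max 1 (1 / c) with hR₀
  set K := {x : (ℝ × ℝ) × Config d × State d | (‖x.1‖ ≤ R₀ ∧ ‖x.2.1‖ ≤ C₂ ∧ ‖x.2.2‖ ≤ R') ∧
      0 ≤ x.1.2 ∧ c₀ ≤ normalEnergy n x.2.2 ∧ k₀ ≤ kickDen n x.1.1 x.2.1 x.2.2} with hKdef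
  have hK : IsCompact K := isCompact_wall_set n _ _ _ _ _
  have hpath : ∀ s ∈ 𝕀, ‖wallPath n z₀ s‖ ≤ ‖z₀‖ + 2 * |(⟪z₀.1.2, n⟫ : ℝ)| := by
    intro s hs
    have e : wallPath n z₀ s = z₀ - (((0 : Config d), (2 * ⟪z₀.1.2, n⟫ * s) • n), ((0 : ℝ), (0 :
        ℝ))) := by
      ext1
      · ext1 <;> simp [wallPath]
      · exact (sub_zero _).symm
    rw [e]
    refine (norm_sub_le _ _).trans (add_le_add_right ?_ _)
    simp only [Prod.norm_def, norm_zero, norm_smul, hn, mul_one]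
    rw [Real.norm_eq_abs, abs_mul, abs_mul, abs_of_nonneg hs.1, abs_two]
    have := abs_nonneg (⟪z₀.1.2, n⟫ : ℝ)
    simp only [max_self]
    refine max_le (max_le (by positivity) ?_) (by positivity)
    exact mul_le_of_le_one_right (by positivity) hs.2
  have hbd : ∀ s ∈ 𝕀, ∀ z, ‖z - wallPath n z₀ s‖ ≤ D → z.1.1 ∈ closedBall z₀.1.1 R ∧ ‖z‖ ≤ R' := by
    intro s hs z hz'
    refine ⟨?_, ?_⟩
    · exact mem_closedBall_iff_norm.2 (((z - wallPath n z₀ s).q_le.trans hz').trans hDR)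
    · linarith [norm_le_norm_sub_add (a := z) (b := wallPath n z₀ s), hpath s hs]
  set l := 𝓝₀ ×ˢ 𝓟 𝕀 with hl
  have he : Tendsto (Prod.fst : ℝ × ℝ → ℝ) l 𝓝₀ := tendsto_fst
  have hIcc : ∀ᶠ i : ℝ × ℝ in l, i.2 ∈ 𝕀 :=
    (tendsto_snd (f := 𝓝₀) (g := 𝓟 𝕀)).eventually (mem_principal_self _)
  have hpos : ∀ᶠ i : ℝ × ℝ in l, 0 < i.1 := he.eventually eventually_mem_nhdsWithin
  have hy1 : ∀ s ∈ 𝕀, 0 ≤ 1 - (2 * s - 1) ^ 2 ∧ |2 * s - 1| ≤ 1 := fun s hs =>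
    ⟨by nlinarith [mul_nonneg hs.1 (sub_nonneg.2 hs.2)], abs_le.2 ⟨by linarith [hs.1], by linarith
        [hs.2]⟩⟩
  set w : ℝ × ℝ → ℝ × ℝ := fun i =>
    (2 * i.2 - 1, (1 - (2 * i.2 - 1) ^ 2) / (nuExp r i.1 + c * (1 - (2 * i.2 - 1) ^ 2))) with hw
  have hwb : ∀ ε > 0, ∀ s ∈ 𝕀, 0 ≤ (w (ε, s)).2 ∧ ‖w (ε, s)‖ ≤ R₀ := by
    intro ε hε s hs
    have hν := nuExp_pos (r := r) hε
    obtain ⟨h1, h2⟩ := hy1 s hs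
    set y := 1 - (2 * s - 1) ^ 2 with hy
    have h3 : 0 ≤ (w (ε, s)).2 := div_nonneg h1 (by positivity)
    refine ⟨h3, ?_⟩
    rw [Prod.norm_def]
    refine max_le (h2.trans (le_max_left _ _)) ?_
    rw [Real.norm_of_nonneg h3]
    refine le_trans ?_ (le_max_right _ _)
    simp only [hw, ← hy]
    rw [div_le_div_iff₀ (by positivity) hc0]
    nlinarith
  have hKmem : ∀ᶠ ε in 𝓝₀, ∀ s ∈ 𝕀, ∀ z, ‖z - wallPath n z₀ s‖ ≤ D →
      (w (ε, s), ∇ (P.Q ε) z.1.1, z) ∈ K := by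
    filter_upwards [htube, hC₁, eventually_mem_nhdsWithin] with ε h1 h2 h3 s hs z hz'
    obtain ⟨b1, b2⟩ := hbd s hs z hz'
    obtain ⟨b3, b4⟩ := hwb ε h3 s hs
    exact ⟨⟨b4, (h2.1 _ b1).trans ((le_max_left _ _).trans (le_max_left _ _)), b2⟩, b3, h1 s hs z
        hz'⟩
  have hKref : ∀ ε > 0, ∀ s ∈ 𝕀, (w (ε, s), a • n, wallPath n z₀ s) ∈ K := by
    intro ε hε s hs
    obtain ⟨b3, b4⟩ := hwb ε hε s hs
    refine ⟨⟨b4, le_max_right _ _, (hpath s hs).trans (by linarith)⟩, b3, ?_, ?_⟩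
    · rw [normalEnergy_wallPath hn hL]
      exact hcσ
    · rw [kickDen_wallPath hn hL hz]
      exact hkσ
  set H₁ : (ℝ × ℝ) × Config d × State d → State d := fun x => wallField n x.1.1 x.2.1 0 x.2.2 with
      hH₁
  set H₂ : (ℝ × ℝ) × Config d × State d → State d := fun x =>
    ((1 + (normalEnergy n x.2.2 / 2 - c) * x.1.2)⁻¹ * kick n x.1.1 x.2.1 x.2.2) •
      ((x.2.2.1.2, (0 : Config d)), ((1 : ℝ), (0 : ℝ))) with hH₂
  have hx1 : ∀ x : (ℝ × ℝ) × Config d × State d, 𝒞 (⊤ : ℕ∞)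
      (fun x : (ℝ × ℝ) × Config d × State d => x.1.1) x := fun x => contDiffAt_fst.fst
  have hH₁s : ∀ x ∈ K, 𝒞 (⊤ : ℕ∞) H₁ x := fun x hx =>
    contDiffAt_wallField (hx1 x) contDiffAt_snd.fst contDiffAt_const contDiffAt_snd.snd
      (hc₀.trans_le hx.2.2.1).ne' (hk₀.trans_le hx.2.2.2).ne'
  have hF : ∀ x ∈ K, 0 < 1 + (normalEnergy n x.2.2 / 2 - c) * x.1.2 := fun x hx => by
    have h1 : 0 ≤ normalEnergy n x.2.2 / 2 - c := by linarith [hx.2.2.1]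
    have := mul_nonneg h1 hx.2.1
    linarith
  have hH₂s : ∀ x ∈ K, 𝒞 (⊤ : ℕ∞) H₂ x := fun x hx => by
    have e1 : 𝒞 (⊤ : ℕ∞) (fun x : (ℝ × ℝ) × Config d × State d =>
        normalEnergy n x.2.2) x := contDiffAt_normalEnergy contDiffAt_snd.snd
    have e2 : 𝒞 (⊤ : ℕ∞) (fun x : (ℝ × ℝ) × Config d × State d => x.1.2) x :=
      contDiffAt_fst.snd
    have e3 : 𝒞 (⊤ : ℕ∞) (fun x : (ℝ × ℝ) × Config d × State d => x.2.2.1.2) x :=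
      contDiffAt_snd.snd.fst.snd
    exact ((contDiffAt_const.add (((e1.div_const 2).sub contDiffAt_const).mul e2)).inv
      (hF x hx).ne' |>.mul (contDiffAt_kick (hx1 x) contDiffAt_snd.fst contDiffAt_snd.snd
      (hc₀.trans_le hx.2.2.1).ne' (hk₀.trans_le hx.2.2.2).ne')).smul
      ((e3.prodMk contDiffAt_const).prodMk contDiffAt_const)
  set A : ℝ × ℝ → Set (State d) := fun i => closedBall (wallPath n z₀ i.2) D with hA
  have hmemA : ∀ (s : ℝ) (z : State d), z ∈ closedBall (wallPath n z₀ s) D ↔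
      ‖z - wallPath n z₀ s‖ ≤ D := fun s z => mem_closedBall_iff_norm
  have hAb : ∀ᶠ i in l, ∀ z ∈ A i, z.1.1 ∈ closedBall z₀.1.1 R ∧ ‖z‖ ≤ R' :=
    hIcc.mono fun i hi z hz' => hbd i.2 hi z ((hmemA _ _).1 hz')
  have hwl : ∀ᶠ i in l, ‖w i‖ ≤ R₀ := by
    filter_upwards [hpos, hIcc] with i h1 h2 using (hwb i.1 h1 i.2 h2).2
  have hml : ∀ᶠ i in l, ∀ z ∈ A i, (w i, ∇ (P.Q i.1) z.1.1, z) ∈ K := by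
    filter_upwards [he.eventually hKmem, hIcc] with i h1 h2 z hz' using h1 i.2 h2 z ((hmemA _ _).1
        hz')
  have hmw : ∀ᶠ i : ℝ × ℝ in l, 0 ≤ i.1 / (nuExp r i.1 + c * (1 - (2 * i.2 - 1) ^ 2)) ∧
      i.1 / (nuExp r i.1 + c * (1 - (2 * i.2 - 1) ^ 2)) ≤ 1 * wallWeight r c i := by
    filter_upwards [hpos, hIcc] with i h1 h2 using le_wallWeight hc0 h1 h2
  have hw0 : ∀ᶠ i in l, 0 ≤ wallWeight r c i := hmw.mono fun i hi => by linarith [hi.1.trans hi.2]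
  have hY := h.cRel_smooth he hAb hwl hK hH₁s hml hw0
  have hZ := h.cRel_smooth he hAb hwl hK hH₂s hml hw0
  have hX := hY.add ((CRel.smul_index (A' := A) (hmw.mono fun _ hi => hi.1) hZ.left
      hZ.cr).mono_weight
    (hmw.mono fun _ hi => hi.1) (hmw.mono fun _ hi => hi.2) hw0) hw0
  have hsplit : ∀ ε > 0, ∀ s ∈ 𝕀, ∀ (g : Config d) (z : State d), 0 < normalEnergy n z →
      H₁ (w (ε, s), g, z) + (ε / (nuExp r ε + c * (1 - (2 * s - 1) ^ 2))) • H₂ (w (ε, s), g, z) =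
        wallField n (2 * s - 1) g (ε / (nuExp r ε + normalEnergy n z * (1 - (2 * s - 1) ^ 2) / 2)) z
            := by
    intro ε hε s hs g z hE0
    have hν := nuExp_pos (r := r) hε
    have h1 := (hy1 s hs).1
    simp only [hH₁, hH₂, hw, wallField]
    set y := 1 - (2 * s - 1) ^ 2 with hy
    have h2 : 0 < nuExp r ε + c * y := by positivity
    have h3 : 0 < nuExp r ε + normalEnergy n z * y / 2 := by positivity
    have e : ε / (nuExp r ε + c * y) * (1 + (normalEnergy n z / 2 - c) * (y / (nuExp r ε + c *
        y)))⁻¹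
        = ε / (nuExp r ε + normalEnergy n z * y / 2) := by
      rw [← div_eq_mul_inv, div_div]
      congr 1
      field_simp
      ring
    rw [smul_smul, ← mul_assoc, e]
    generalize ε / (nuExp r ε + normalEnergy n z * y / 2) = μ
    ext1
    · ext1
      · simp [smul_smul, mul_comm]
      · simp
    · ext1
      · simp [mul_comm]
      · simp
  refine ⟨D, hDR, D * exp (-max 1 (((exists_lipschitzOnWith_of_contDiffAt hK fun x hx =>
    (hH₁s x hx).of_le (by exact_mod_cast le_top)).choose : ℝ) * (C₂ + 1))) / 4, by positivity, ?_⟩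
  have hLip := (exists_lipschitzOnWith_of_contDiffAt hK fun x hx =>
    (hH₁s x hx).of_le (by exact_mod_cast le_top)).choose_spec
  set Λ := (exists_lipschitzOnWith_of_contDiffAt hK fun x hx =>
    (hH₁s x hx).of_le (by exact_mod_cast le_top)).choose with hΛ
  have hfield : ∀ᶠ ε in 𝓝₀, ∀ s ∈ 𝕀, ∀ z, ‖z - wallPath n z₀ s‖ ≤ D →
      𝒞 r (uncurry (P.bounce n ε)) (s, z) ∧
      𝒞 r (uncurry (P.mirror n ε)) (s, z) := by
    filter_upwards [htube, P.eventually_lt] with ε h1 h2 s hs z hz'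
    have hG := (h.contDiffAt (hbd s hs z hz').1 (Ioo_subset_Ico_self h2)).gradient_q (s := s)
    have hx : 𝒞 r (fun w : ℝ × State d => 2 * w.1 - 1) (s, z) :=
      (contDiffAt_const.mul contDiffAt_fst).sub contDiffAt_const
    have e1 := hc₀.trans_le (h1 s hs z hz').1
    have e2 := (hk₀.trans_le (h1 s hs z hz').2).ne'
    refine ⟨contDiffAt_wallField hx hG ?_ contDiffAt_snd e1.ne' e2,
      contDiffAt_wallField hx hG contDiffAt_const contDiffAt_snd e1.ne' e2⟩
    refine contDiffAt_const.div (contDiffAt_const.add (((contDiffAt_normalEnergy contDiffAt_snd).mul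
      (contDiffAt_const.sub (hx.pow 2))).div_const 2)) ?_
    have := nuExp_pos (r := r) h2.1
    have := (hy1 s hs).1
    positivity
  have hXY : CRel l (wallWeight r c) r (fun i => P.bounce n i.1 i.2) (fun i => P.mirror n i.1 i.2) A
      A := by
    refine hX.congr ?_ (.of_forall fun i x _ => .of_forall fun z => ?_)
    · filter_upwards [hpos, hIcc, he.eventually htube] with i h1 h2 h3 x hx
      filter_upwards [continuous_normalEnergy.continuousAt.eventually (lt_mem_nhds
        (hc₀.trans_le (h3 i.2 h2 x ((hmemA _ _).1 hx)).1))] with z hz'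
      exact hsplit i.1 h1 i.2 h2 _ z hz'
    · simp only [hH₁, add_zero]
      rfl
  have key := CRel.flow_tube (X := P.bounce n) (Y := P.mirror n) (c := wallPath n z₀)
    (v := fun _ => (((0 : Config d), -(2 * ⟪z₀.1.2, n⟫) • n), ((0 : ℝ), (0 : ℝ))))
    (C := max 1 ((Λ : ℝ) * (C₂ + 1))) (d := D)
    (e := fun ε => Λ * ‖∇ (P.Q ε) z₀.1.1 - a • n‖) hr (le_max_left _ _) hD
    (by positivity : (0 : ℝ) ≤ 1 / c * (1 + 2 * c + 1)) hXY
    (hfield.mono fun ε hε s hs z hz' => (hε s hs z hz').1)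
    (hfield.mono fun ε hε s hs z hz' => (hε s hs z hz').2)
    (fun s _ => (hasDerivAt_wallPath n z₀ s).hasDerivWithinAt) ?_ ?_ (isWeight_wall hc0)
    nuExp_nonneg_eventually tendsto_nuExp
  · have e0 : wallPath n z₀ 0 = z₀ := by simp [wallPath]
    rw [e0] at key
    obtain ⟨k1, k2, k3, k4⟩ := key
    refine ⟨?_, k1, ⟨⟨_, by positivity, k4⟩, k2, k3⟩⟩
    filter_upwards [htube, hfield] with ε h1 h2 s hs z hz'
    exact ⟨⟨hc₀.trans_le (h1 s hs z hz').1, hk₀.trans_le (h1 s hs z hz').2⟩, (h2 s hs z hz').1⟩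
  · filter_upwards [hKmem, hC₁, eventually_mem_nhdsWithin] with ε h1 h2 h3 s hs z hz'
    have e1 := hLip.dist_le_mul _ (h1 s hs z hz') _ (hKref ε h3 s hs)
    have e2 : H₁ (w (ε, s), a • n, wallPath n z₀ s) =
        (((0 : Config d), -(2 * ⟪z₀.1.2, n⟫) • n), ((0 : ℝ), (0 : ℝ))) :=
      wallField_wallPath hn hL hz _ _ ha
    rw [e2, dist_eq_norm] at e1
    refine e1.trans ?_
    have e3 := h2.2 _ (hbd s hs z hz').1 _ (mem_closedBall_self hR.le)
    have e4 : ‖z.1.1 - z₀.1.1‖ ≤ ‖z - wallPath n z₀ s‖ := (z - wallPath n z₀ s).q_le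
    have e5 : ‖∇ (P.Q ε) z.1.1 - a • n‖ ≤
        C₂ * ‖z - wallPath n z₀ s‖ + ‖∇ (P.Q ε) z₀.1.1 - a • n‖ := by
      refine (norm_sub_le_norm_sub_add_norm_sub _ (∇ (P.Q ε) z₀.1.1) _).trans ?_
      gcongr
      refine e3.trans ?_
      gcongr
      exact (le_max_left _ _).trans (le_max_left _ _)
    have e6 : dist ((w (ε, s), ∇ (P.Q ε) z.1.1, z) : (ℝ × ℝ) × Config d × State d)
        (w (ε, s), a • n, wallPath n z₀ s) ≤ (C₂ + 1) * ‖z - wallPath n z₀ s‖ +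
          ‖∇ (P.Q ε) z₀.1.1 - a • n‖ := by
      have hC0 : 0 ≤ C₂ := (le_max_right _ _).trans (le_max_left _ _)
      have := norm_nonneg (z - wallPath n z₀ s)
      have := norm_nonneg (∇ (P.Q ε) z₀.1.1 - a • n)
      rw [Prod.dist_eq]
      refine max_le ((dist_self _).trans_le (by positivity)) ?_
      rw [Prod.dist_eq]
      refine max_le ?_ ?_
      · rw [dist_eq_norm]
        linarith
      · rw [dist_eq_norm]
        nlinarith
    calc (Λ : ℝ) * _ ≤ Λ * ((C₂ + 1) * ‖z - wallPath n z₀ s‖ +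
          ‖∇ (P.Q ε) z₀.1.1 - a • n‖) := by gcongr
      _ = Λ * (C₂ + 1) * ‖z - wallPath n z₀ s‖ + Λ * ‖∇ (P.Q ε) z₀.1.1 - a • n‖ := by ring
      _ ≤ _ := by
        gcongr
        exact le_max_right _ _
  · have e1 : Tendsto (fun ε => ∇ (P.Q ε) z₀.1.1) 𝓝₀ (𝓝 (a • n)) := by
      rw [← hg]
      exact (P.tendsto_gradient_Q (h.subset_Dt (mem_closedBall_self hR.le))).comp
        (tendsto_id.prodMk tendsto_const_nhds)
    simpa using ((e1.sub_const (a • n)).norm).const_mul (Λ : ℝ)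

/-- The phase point lies on the boundary, off the corners, and looks strictly outwards. -/
def _root_.Hits (Ω C : Set (Config d)) (x : Phase d) : Prop :=
  x.1 ∈ frontier Ω \ C ∧ ∃ n, IsInwardNormal Ω x.1 n ∧ ⟪x.2, n⟫ < (0 : ℝ)

/-- The elastic reflection at the boundary takes `x` to `x'`. -/
def _root_.Reflects (Ω C : Set (Config d)) (x x' : Phase d) : Prop :=
  x.1 ∈ frontier Ω \ C ∧ ∃ n, IsInwardNormal Ω x.1 n ∧ ⟪x.2, n⟫ < (0 : ℝ) ∧
    x' = (x.1, reflectMomentum n x.2)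

section Bounce

variable {ε : ℝ} {z₀ z : State d} {R D : ℝ} {n : Config d}
  (h : P.IsPatch j (closedBall z₀.1.1 R)) (hDR : D ≤ R) (hε : ε ∈ Ioo 0 P.ε₁) (hn : ‖n‖ = 1)
  (htube : ∀ s ∈ 𝕀, ∀ z, ‖z - wallPath n z₀ s‖ ≤ D →
    (0 < normalEnergy n z ∧ 0 < kickDen n (2 * s - 1) (∇ (P.Q ε) z.1.1) z) ∧
      𝒞 r (uncurry (P.bounce n ε)) (s, z))
  (hL : 2 * z.2.2 = ⟪z.1.2, z.1.2⟫) (hz : ⟪z.1.2, n⟫ < (0 : ℝ))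

include h hDR hε hn htube hL hz

lemma IsPatch.bounce_arc (hF : FlowIn (P.bounce n ε) (wallPath n z₀) D z)
    (hQ : P.Q ε z.1.1 = P.Qval j + etaExp r ε) :
    P.Arc ε {x | x.1 ∈ closedBall z₀.1.1 R ∧ P.Q ε x.1 < P.Qval j + etaExp r ε} z
      (flowMap (P.bounce n ε) 1 z) ∧ z.2.1 < (flowMap (P.bounce n ε) 1 z).2.1 ∧
      P.Q ε (flowMap (P.bounce n ε) 1 z).1.1 = P.Qval j + etaExp r ε := by
  have e0 : (0 : ℝ) ∈ 𝕀 := by simp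
  have e1 : (1 : ℝ) ∈ 𝕀 := by simp
  have hν := nuExp_pos (r := r) hε.1
  set ν := nuExp r ε with hνd
  set ζ : ℝ → State d := fun s => flowMap (P.bounce n ε) s z with hζd
  have hζ0 : ζ 0 = z := hF.1.1
  set g : ℝ → Config d := fun s => ∇ (P.Q ε) (ζ s).1.1 with hg
  set μ : ℝ → ℝ := fun s => ε / (ν + normalEnergy n (ζ s) * (1 - (2 * s - 1) ^ 2) / 2) with hμ
  have hsol : ∀ s ∈ 𝕀, HasDerivWithinAt ζ (wallField n (2 * s - 1) (g s) (μ s) (ζ s))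
    𝕀 s := hF.1.2
  have hE : ∀ s ∈ 𝕀, 0 < normalEnergy n (ζ s) := fun s hs => (htube s hs _ (hF.2 s hs)).1.1
  have hK : ∀ s ∈ 𝕀, 0 < kickDen n (2 * s - 1) (g s) (ζ s) := fun s hs =>
    (htube s hs _ (hF.2 s hs)).1.2
  have hL0 : 2 * (ζ 0).2.2 = ⟪(ζ 0).1.2, (ζ 0).1.2⟫ := by rw [hζ0, hL]
  have hz0 : ⟪(ζ 0).1.2, n⟫ < (0 : ℝ) := by rwa [hζ0]
  have hball : ∀ s ∈ 𝕀, (ζ s).1.1 ∈ closedBall z₀.1.1 R := fun s hs => by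
    exact mem_closedBall_iff_norm.2 (((ζ s - wallPath n z₀ s).q_le.trans (hF.2 s hs)).trans hDR)
  set k : ℝ → ℝ := fun s => kick n (2 * s - 1) (g s) (ζ s) with hk
  have hk0 : ∀ s ∈ 𝕀, 0 < k s := fun s hs => div_pos (mul_pos two_pos (hE s hs)) (hK s hs)
  set W : ℝ → ℝ := fun s => ν + ((ζ 0).2.2 - ⟪(ζ s).1.2, (ζ s).1.2⟫ / 2) with hW
  have hWeq : ∀ s ∈ 𝕀, W s = ν + normalEnergy n (ζ s) * (1 - (2 * s - 1) ^ 2) / 2 := fun s hs => by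
      rw [← wall_energy hsol hn hE (fun s hs => (hK s hs).ne') hL0 hz0 hs]
  have hx : ∀ s : ℝ, 1 - (2 * s - 1) ^ 2 = 4 * s * (1 - s) := fun s => by ring
  have hWν : ∀ s ∈ 𝕀, ν ≤ W s := fun s hs => by
    rw [hWeq s hs, hx]
    have := mul_nonneg (hE s hs).le (mul_nonneg hs.1 (sub_nonneg.2 hs.2))
    nlinarith
  have hW0 : ∀ s ∈ 𝕀, 0 < W s := fun s hs => hν.trans_le (hWν s hs)
  have hμW : ∀ s ∈ 𝕀, μ s = ε / W s := fun s hs => by rw [hWeq s hs]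
  have hq : ∀ s ∈ 𝕀, HasDerivWithinAt (fun s => (ζ s).1.1) ((k s * μ s) • (ζ s).1.2)
      𝕀 s := fun s hs => (hasDerivWithinAt_q (hsol s hs)).congr_deriv (by
    simp [wallField, smul_smul, hk])
  have hp := fun s hs => wall_p hsol (s := s) hs
  have hlevel : ∀ s ∈ 𝕀, P.Q ε (ζ s).1.1 - P.Qval j = -(ε * log (W s)) := by
    have h1 : ∀ s ∈ 𝕀, HasDerivWithinAt
        (fun s => P.Q ε (ζ s).1.1 + ε * log (W s)) 0 𝕀 s := by
      intro s hs
      have a1 := (h.differentiableAt (hball s hs)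
        (Ioo_subset_Ico_self hε)).hasGradientAt.hasFDerivAt.comp_hasDerivWithinAt s (hq s hs)
      have a2 := ((((hp s hs).inner ℝ (hp s hs)).div_const 2).const_sub (ζ 0).2.2).const_add ν
      have a3 := (a2.log (hW0 s hs).ne').const_mul ε
      refine (a1.add a3).congr_deriv ?_
      have hw := (hW0 s hs).ne'
      rw [InnerProductSpace.toDual_apply_apply, real_inner_smul_right, hμW s hs]
      simp only [real_inner_smul_left, real_inner_smul_right]
      change k s * (ε / W s) * ⟪g s, (ζ s).1.2⟫ +
        ε * (-((k s * ⟪(ζ s).1.2, g s⟫ + k s * ⟪g s, (ζ s).1.2⟫) / 2) / W s) = 0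
      rw [real_inner_comm (g s) (ζ s).1.2]
      ring
    intro s hs
    have h2 := eq_of_hasDerivWithinAt_zero h1 hs
    have h3 : W 0 = ν := by rw [hWeq 0 e0]; ring
    simp only [h3] at h2
    rw [hζ0, hQ, etaExp, ← hνd] at h2
    linarith
  have hgV : ∀ s ∈ 𝕀, -∇ (P.V ε) (ζ s).1.1 = (W s / ε) • g s := by
    intro s hs
    rw [h.gradient_V (hball s hs) hε, neg_neg, hlevel s hs, neg_neg, mul_div_cancel_left₀ _
        hε.1.ne',
      Real.exp_log (hW0 s hs)]
  have htime : ∀ s ∈ 𝕀, HasDerivWithinAt (fun s => (ζ s).2.1) (k s * μ s) 𝕀 s :=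
    fun s hs => (hasDerivWithinAt_t (hsol s hs)).congr_deriv (by simp [wallField, hk])
  have hkμ : ∀ s ∈ 𝕀, 0 < k s * μ s := fun s hs => by
    rw [hμW s hs]
    exact mul_pos (hk0 s hs) (div_pos hε.1 (hW0 s hs))
  have hcont : ContinuousOn (fun s => k s * μ s) 𝕀 := by
    have h1 : ContinuousOn (fun s => P.bounce n ε s (ζ s)) 𝕀 := fun s hs =>
      ContinuousAt.comp_continuousWithinAt (f := fun s => (s, ζ s))
        (g := uncurry (P.bounce n ε)) (htube s hs _ (hF.2 s hs)).2.continuousAt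
        (continuousWithinAt_id.prodMk (hsol s hs).continuousWithinAt)
    refine h1.snd.fst.congr fun s hs => ?_
    simp [bounce, wallField, hk, hμ, hg, hνd]
  obtain ⟨σ, -, h2, h3⟩ := exists_reparam (ζ := fun s => (ζ s).1)
    (v := fun s => ((ζ s).1.2, -∇ (P.V ε) (ζ s).1.1)) htime hcont hkμ
    (fun s hs => (hasDerivWithinAt_phase (hsol s hs)).congr_deriv (by
      rw [hgV s hs, hμW s hs]
      have hw := (hW0 s hs).ne'
      have := hε.1.ne'
      simp only [wallField, Prod.smul_mk, smul_smul]
      congr 2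
      · change k s = k s * (ε / W s) * (W s / ε)
        field_simp))
  have hlt : (ζ 0).2.1 < (ζ 1).2.1 := h3 e0 e1 zero_lt_one
  have hσ0 : σ (ζ 0).2.1 = 0 := h3.injOn (h2 _ ⟨le_rfl, hlt.le⟩).1 e0 (h2 _ ⟨le_rfl, hlt.le⟩).2.1
  have hσ1 : σ (ζ 1).2.1 = 1 := h3.injOn (h2 _ ⟨hlt.le, le_rfl⟩).1 e1 (h2 _ ⟨hlt.le, le_rfl⟩).2.1
  have hW1 : W 1 = ν := by rw [hWeq 1 e1]; ring
  have harc : P.Arc ε {x | x.1 ∈ closedBall z₀.1.1 R ∧ P.Q ε x.1 < P.Qval j + etaExp r ε}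
      (ζ 0) (ζ 1) := by
    refine ⟨hlt.le, fun τ => (ζ (σ τ)).1, fun τ hτ => ⟨h.subset_domain (hball _ (h2 τ hτ).1),
      (h2 τ hτ).2.2⟩, by simp only [hσ0], by simp only [hσ1], fun τ hτ => ?_⟩
    have hτ' := h2 τ (Ioo_subset_Icc_self hτ)
    refine ⟨hball _ hτ'.1, ?_⟩
    have hlog : log ν < log (W (σ τ)) := by
      refine Real.log_lt_log hν ?_
      have u0 : 0 < σ τ := hτ'.1.1.lt_of_ne fun he => by
        have := hτ'.2.1
        rw [← he] at this
        exact hτ.1.ne this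
      have u1 : σ τ < 1 := hτ'.1.2.lt_of_ne fun he => by
        have := hτ'.2.1
        rw [he] at this
        exact hτ.2.ne' this
      rw [hWeq _ hτ'.1, hx]
      have := mul_pos (hE _ hτ'.1) (mul_pos u0 (sub_pos.2 u1))
      nlinarith
    have h5 := hlevel _ hτ'.1
    have h6 := mul_lt_mul_of_pos_left hlog hε.1
    change P.Q ε (ζ (σ τ)).1.1 < _
    rw [etaExp, ← hνd]
    linarith
  rw [hζ0] at harc hlt
  refine ⟨harc, hlt, ?_⟩
  have h5 := hlevel 1 e1
  rw [hW1] at h5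
  change P.Q ε (ζ 1).1.1 = _
  rw [etaExp, ← hνd]
  linarith

lemma IsPatch.mirror_eq (hF : FlowIn (P.mirror n ε) (wallPath n z₀) D z) :
    (flowMap (P.mirror n ε) 1 z).1 = (z.1.1, reflectMomentum
      (‖∇ (P.Q ε) z.1.1‖⁻¹ • ∇ (P.Q ε) z.1.1) z.1.2) ∧
      (flowMap (P.mirror n ε) 1 z).2.1 = z.2.1 := by
  have e1 : (1 : ℝ) ∈ 𝕀 := by simp
  set ζ : ℝ → State d := fun s => flowMap (P.mirror n ε) s z with hζd
  have hζ0 : ζ 0 = z := hF.1.1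
  have hsol : ∀ s ∈ 𝕀, HasDerivWithinAt ζ
    (wallField n (2 * s - 1) (∇ (P.Q ε) (ζ s).1.1) 0 (ζ s)) 𝕀 s := hF.1.2
  have hq : ∀ s ∈ 𝕀, (ζ s).1.1 = z.1.1 := fun s hs => by
    rw [eq_of_hasDerivWithinAt_zero (f := fun s => (ζ s).1.1) (fun t ht =>
      (hasDerivWithinAt_q (hsol t ht)).congr_deriv (by simp [wallField])) hs, hζ0]
  have ht : (ζ 1).2.1 = z.2.1 := by
    rw [eq_of_hasDerivWithinAt_zero (f := fun s => (ζ s).2.1) (fun t ht =>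
      (hasDerivWithinAt_t (hsol t ht)).congr_deriv (by simp [wallField])) e1, hζ0]
  have hball : z.1.1 ∈ closedBall z₀.1.1 R := by
    rw [← hq 1 e1, mem_closedBall, dist_eq_norm]
    exact ((ζ 1 - wallPath n z₀ 1).q_le.trans (hF.2 1 e1)).trans hDR
  have h1 := wall_reflect hsol hn (fun s hs => (htube s hs _ (hF.2 s hs)).1.1)
    (fun s hs => (htube s hs _ (hF.2 s hs)).1.2.ne') (by rw [hζ0, hL]) (by rwa [hζ0])
    (fun s hs => by rw [hq s hs]) (h.gradient_ne hball (Ioo_subset_Ico_self hε))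
  rw [hζ0] at h1
  exact ⟨Prod.ext (hq 1 e1) h1, ht⟩

end Bounce

lemma IsPatch.mem_crossSection {O : Set (Config d)} (h : P.IsPatch j O) {ε : ℝ}
    (hε : ε ∈ Ioo 0 P.ε₁) {x : Phase d} (hx : O ∈ 𝓝 x.1)
    (hQ : P.Q ε x.1 = P.Qval j + etaExp r ε) (hy : 0 < ⟪∇ (P.Q ε) x.1, x.2⟫) :
    x ∈ crossSection (P.auxTable ε) B.corner := by
  refine ⟨⟨h.mem_frontier hx (Ioo_subset_Ico_self hε) hQ, h.notMem_corner _ (mem_of_mem_nhds hx)⟩,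
      _,
    h.isInwardNormal hx (Ioo_subset_Ico_self hε) hQ, ?_⟩
  rw [real_inner_smul_right, real_inner_comm]
  exact mul_pos (inv_pos.2 (norm_pos_iff.2 (h.gradient_ne (mem_of_mem_nhds hx)
    (Ioo_subset_Ico_self hε)))) hy

lemma IsPatch.reflects {O : Set (Config d)} (h : P.IsPatch j O) {ε : ℝ}
    (hε : ε ∈ Ioo 0 P.ε₁) {x : Phase d} (hx : O ∈ 𝓝 x.1)
    (hQ : P.Q ε x.1 = P.Qval j + etaExp r ε) (hy : ⟪∇ (P.Q ε) x.1, x.2⟫ < (0 : ℝ)) :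
    Reflects (P.auxTable ε) B.corner x (x.1, reflectMomentum
      (‖∇ (P.Q ε) x.1‖⁻¹ • ∇ (P.Q ε) x.1) x.2) := by
  refine ⟨⟨h.mem_frontier hx (Ioo_subset_Ico_self hε) hQ, h.notMem_corner _ (mem_of_mem_nhds hx)⟩,
      _,
    h.isInwardNormal hx (Ioo_subset_Ico_self hε) hQ, ?_, rfl⟩
  rw [real_inner_smul_right, real_inner_comm]
  exact mul_neg_of_pos_of_neg (inv_pos.2 (norm_pos_iff.2 (h.gradient_ne (mem_of_mem_nhds hx)
    (Ioo_subset_Ico_self hε)))) hy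

lemma _root_.Reflects.hits {Ω C : Set (Config d)} {x x' : Phase d} (h : Reflects Ω C x x') :
    Hits Ω C x := by
  obtain ⟨h1, n, h2, h3, -⟩ := h
  exact ⟨h1, n, h2, h3⟩

lemma IsPatch.exists_bounce (hr : 1 ≤ r) {z₀ : State d} {R : ℝ} (hR : 0 < R)
    (h : P.IsPatch j (closedBall z₀.1.1 R))
    (hy : ⟪∇ (P.Q 0) z₀.1.1, z₀.1.2⟫ < (0 : ℝ)) : ∃ f g K,
    LocRel r f g z₀ ((z₀.1.1, reflectMomentum
      (‖∇ (P.Q 0) z₀.1.1‖⁻¹ • ∇ (P.Q 0) z₀.1.1) z₀.1.2),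
        (z₀.2.1, ⟪z₀.1.2, z₀.1.2⟫ / 2)) ∧
    ∀ᶠ w in 𝓝₀ ×ˢ 𝓝 z₀, P.Q w.1 w.2.1.1 = P.Qval j + etaExp r w.1 →
      (P.Arc w.1 {x | x.1 ∉ closure (P.auxTable w.1)} w.2 (f w.1 w.2) ∧
        w.2.2.1 < (f w.1 w.2).2.1 ∧ (f w.1 w.2).2.1 - w.2.2.1 ≤ K * nuExp r w.1 ∧
        P.Q w.1 (f w.1 w.2).1.1 = P.Qval j + etaExp r w.1 ∧
        (f w.1 w.2).1 ∈ crossSection (P.auxTable w.1) B.corner) ∧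
      Reflects (P.auxTable w.1) B.corner w.2.1 (g w.1 w.2).1 ∧ (g w.1 w.2).2.1 = w.2.2.1 ∧
        P.Q w.1 (g w.1 w.2).1.1 = P.Qval j + etaExp r w.1 ∧
        (g w.1 w.2).1 ∈ crossSection (P.auxTable w.1) B.corner := by
  set G := ∇ (P.Q 0) z₀.1.1 with hG
  have hq0 : z₀.1.1 ∈ closedBall z₀.1.1 R := mem_closedBall_self hR.le
  have hG0 : G ≠ 0 := h.gradient_ne hq0 ⟨le_rfl, P.ε₁_pos⟩
  have hGn : 0 < ‖G‖ := norm_pos_iff.2 hG0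
  set n := ‖G‖⁻¹ • G with hn
  have hn1 : ‖n‖ = 1 := norm_smul_inv_norm (𝕜 := ℝ) hG0
  have hgn : G = ‖G‖ • n := by rw [hn, smul_smul, mul_inv_cancel₀ hGn.ne', one_smul]
  have hzn : ⟪z₀.1.2, n⟫ < (0 : ℝ) := by
    rw [hn, real_inner_smul_right, real_inner_comm]
    exact mul_neg_of_pos_of_neg (inv_pos.2 hGn) hy
  set e : State d → State d := fun z => (z.1, (z.2.1, ⟪z.1.2, z.1.2⟫ / 2)) with he
  set z₁ : State d := e z₀ with hz₁
  have he' : ContDiff ℝ (⊤ : ℕ∞) e := by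
    have h1 : ContDiff ℝ (⊤ : ℕ∞) fun z : State d => z.1.2 := contDiff_snd.comp contDiff_fst
    exact contDiff_fst.prodMk ((contDiff_fst.comp contDiff_snd).prodMk ((h1.inner ℝ h1).div_const
        2))
  have hel : LocRel r (fun _ => e) (fun _ => e) z₀ z₁ :=
    LocRel.fixed (.of_forall fun z => he'.contDiffAt)
  have hR2 : R / 2 < R := half_lt_self hR
  have h2 : P.IsPatch j (closedBall z₁.1.1 (R / 2)) := h.mono (closedBall_subset_closedBall hR2.le)
  obtain ⟨D, hDR, ρ, hρ, htube, hflow, hrel⟩ := h2.bounce_flow hr (half_pos hR) hn1 hGn hgn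
    (by simp only [hz₁, he]; ring) hzn
  obtain ⟨ρ', hρ', hrel'⟩ := hrel.rel
  obtain ⟨C, hC⟩ := hrel'.cr.of_le (Nat.zero_le r)
  have hend : wallPath n z₁ 1 = ((z₀.1.1, reflectMomentum n z₀.1.2),
      (z₀.2.1, ⟪z₀.1.2, z₀.1.2⟫ / 2)) := by
    simp [wallPath, hz₁, he, reflectMomentum]
  rw [hend] at hrel
  have hf := hrel.comp hel
  refine ⟨_, _, C, hf, ?_⟩
  set z₂ : State d := ((z₀.1.1, reflectMomentum n z₀.1.2), (z₀.2.1, ⟪z₀.1.2, z₀.1.2⟫ / 2)) with hz₂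
  have hy2 : 0 < ⟪∇ (P.Q 0) z₂.1.1, z₂.1.2⟫ := by
    simp only [hz₂, ← hG]
    have h1 : (⟪n, n⟫ : ℝ) = 1 := by rw [real_inner_self_eq_norm_sq, hn1]; norm_num
    rw [hgn, real_inner_smul_left, reflectMomentum, inner_sub_right, real_inner_smul_right, h1,
      real_inner_comm z₀.1.2 n]
    nlinarith [mul_pos hGn (neg_pos.2 hzn)]
  have hball : closedBall z₀.1.1 R ∈ 𝓝 z₀.1.1 := closedBall_mem_nhds _ hR
  have hfst : Tendsto (fun w : ℝ × State d => w.2.1.1) (𝓝₀ ×ˢ 𝓝 z₀) (𝓝 z₀.1.1) :=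
    tendsto_snd.fst_nhds.fst_nhds
  have hin : ∀ {F : ℝ → State d → State d}, Tendsto (fun w : ℝ × State d => F w.1 w.2)
      (𝓝₀ ×ˢ 𝓝 z₀) (𝓝 z₂) → ∀ᶠ w in 𝓝₀ ×ˢ 𝓝 z₀, closedBall z₀.1.1 R ∈ 𝓝 (F w.1 w.2).1.1 ∧
          0 < ⟪∇ (P.Q w.1) (F w.1 w.2).1.1, (F w.1 w.2).1.2⟫ := by
    intro F hF
    have t1 : Tendsto (fun w : ℝ × State d => (F w.1 w.2).1.1) (𝓝₀ ×ˢ 𝓝 z₀) (𝓝 z₀.1.1) :=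
      hF.fst_nhds.fst_nhds
    have t2 := (P.tendsto_inner_gradient (z₀ := z₂) (h.subset_Dt hq0)).comp (tendsto_lift hF)
    exact (t1.eventually (eventually_mem_nhds_iff.2 hball)).and (t2.eventually_const_lt hy2)
  have hstart : ∀ᶠ w : ℝ × State d in 𝓝₀ ×ˢ 𝓝 z₀, e w.2 ∈ closedBall z₁ (min ρ ρ') :=
    hel.tendsto_left.eventually_mem (closedBall_mem_nhds _ (lt_min hρ hρ'))
  have hpn : ∀ᶠ w : ℝ × State d in 𝓝₀ ×ˢ 𝓝 z₀, ⟪w.2.1.2, n⟫ < (0 : ℝ) := by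
    have t : Tendsto (fun w : ℝ × State d => w.2.1.2) (𝓝₀ ×ˢ 𝓝 z₀) (𝓝 z₀.1.2) :=
      tendsto_snd.fst_nhds.snd_nhds
    exact (t.inner (𝕜 := ℝ) tendsto_const_nhds).eventually_lt_const hzn
  have hpG := (P.tendsto_inner_gradient (z₀ := z₀) (h.subset_Dt hq0)).eventually_lt_const hy
  filter_upwards [hstart, hpn, hpG, hin (F := fun ε => flowMap (P.bounce n ε) 1 ∘ e)
      hf.tendsto_left,
    hin (F := fun ε => flowMap (P.mirror n ε) 1 ∘ e) hf.tendsto_right,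
    hfst.eventually (eventually_mem_nhds_iff.2 hball), P.eventually_lt.prod_inl _,
    htube.prod_inl _, hflow.prod_inl _, hC.prod_inl _]
    with w h1 h3 h4 h5 h6 h7 h8 h9 h10 h11 hQ
  have h1a := closedBall_subset_closedBall (min_le_left _ _) h1
  have h1b := closedBall_subset_closedBall (min_le_right _ _) h1
  have hLe : 2 * (e w.2).2.2 = ⟪(e w.2).1.2, (e w.2).1.2⟫ := by simp only [he]; ring
  obtain ⟨b1, b2, b3⟩ := h2.bounce_arc hDR h8 hn1 h9 hLe h3 (h10 _ h1a).1 hQ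
  obtain ⟨m1, m2⟩ := h2.mirror_eq hDR h8 hn1 h9 hLe h3 (h10 _ h1a).2
  have hclose := h11.2 _ h1b _ h1b
  rw [sub_self, norm_zero, zero_add] at hclose
  have ht := ((State.t_le _).trans hclose)
  refine ⟨⟨b1.mono fun x hx => h.notMem_closure (closedBall_mem_nhds_of_lt hx.1 hR2)
    (Ioo_subset_Ico_self h8) hx.2, b2, ?_, b3, h.mem_crossSection h8 h5.1 b3 h5.2⟩, ?_, m2, ?_,
    h.mem_crossSection h8 h6.1 ?_ h6.2⟩
  · have h12 : ((flowMap (P.bounce n w.1) 1 (e w.2)) - flowMap (P.mirror n w.1) 1 (e w.2)).2.1 =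
        (flowMap (P.bounce n w.1) 1 (e w.2)).2.1 - w.2.2.1 := by
      rw [Prod.snd_sub, Prod.fst_sub, m2]
    rw [h12] at ht
    exact (le_abs_self _).trans ht
  · have := h.reflects h8 h7 hQ h4
    simp only [comp_apply]
    rw [m1]
    exact this
  · simp only [comp_apply]
    rw [m1]
    exact hQ
  · simp only [comp_apply]
    rw [m1]
    exact hQ

end SteepExpPotential

section LocRel

variable {r : ℕ} {E F : Type} [NormedAddCommGroup E] [NormedSpace ℝ E] [NormedAddCommGroup F]
  [NormedSpace ℝ F] {f g : ℝ → E → F} {x : E} {y : F} {p : ℝ × F → Prop}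

lemma LocRel.left (h : LocRel r f g x y) (hp : ∀ᶠ w in 𝓝₀ ×ˢ 𝓝 y, p w) :
    ∀ᶠ w in 𝓝₀ ×ˢ 𝓝 x, p (w.1, f w.1 w.2) := (tendsto_lift h.tendsto_left).eventually hp

lemma LocRel.right (h : LocRel r f g x y) (hp : ∀ᶠ w in 𝓝₀ ×ˢ 𝓝 y, p w) :
    ∀ᶠ w in 𝓝₀ ×ˢ 𝓝 x, p (w.1, g w.1 w.2) := (tendsto_lift h.tendsto_right).eventually hp

lemma LocRel.exists_norm_sub_le (h : LocRel r f g x y) : ∃ C, ∀ᶠ w in 𝓝₀ ×ˢ 𝓝 x,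
    ‖f w.1 w.2 - g w.1 w.2‖ ≤ C * nuExp r w.1 := by
  obtain ⟨ρ, hρ, h1⟩ := h.rel
  obtain ⟨C, hC⟩ := h1.cr.of_le (Nat.zero_le r)
  have hb : ∀ᶠ z in 𝓝 x, z ∈ closedBall x ρ := closedBall_mem_nhds x hρ
  refine ⟨C, ?_⟩
  filter_upwards [hC.prod_mk hb] with w hw
  simpa using hw.1.2 _ hw.2 _ hw.2

end LocRel

namespace SteepExpPotential

variable {d r : ℕ} {B : BilliardTable d r} {P : SteepExpPotential B} {j : Fin B.pieces}

/-! ### From the interior to the wall and back -/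

lemma Enters.of_arc {ε c c' M M' K : ℝ} {z z' z'' : State d} (hz : z.1 ∈ P.core c M ε)
    (h : P.Arc ε (P.core c M ε) z z') (h' : P.Enters ε c' M' K z' z'') :
    P.Enters ε (min c c') (max M M') K z z'' := by
  have h1 := core_mono (P := P) (ε := ε) (min_le_left c c') (le_max_left M M')
  have h2 := core_mono (P := P) (ε := ε) (min_le_right c c') (le_max_right M M')
  obtain ⟨y, a1, a2, a3, a4, a5⟩ := h'
  exact ⟨y, h1 hz, (h.mono h1).trans (a2.mono h2) (h2 a1), h2 a3, a4, a5⟩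

lemma Leaves.arc {ε c c' M M' K : ℝ} {z z' z'' : State d} (h : P.Leaves ε c' M' K z z')
    (h' : P.Arc ε (P.core c M ε) z' z'') (hz : z''.1 ∈ P.core c M ε) :
    P.Leaves ε (min c c') (max M M') K z z'' := by
  have h1 := core_mono (P := P) (ε := ε) (min_le_left c c') (le_max_left M M')
  have h2 := core_mono (P := P) (ε := ε) (min_le_right c c') (le_max_right M M')
  obtain ⟨y, a1, a2, a3, a4, a5⟩ := h
  exact ⟨y, a1, h2 a2, (a3.mono h2).trans (h'.mono h1) (h2 a4), h1 hz, a5⟩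

/-- Puts the time which is left until `t` into the parameter. -/
def _root_.setTime (t : ℝ) (z : State d) : State d := (z.1, (z.2.1, t - z.2.1))

lemma _root_.locRel_setTime (t : ℝ) (z : State d) :
    LocRel r (fun _ => setTime t) (fun _ => setTime t) z (setTime t z) := by
  refine LocRel.fixed (.of_forall fun x => ContDiff.contDiffAt ?_)
  unfold setTime
  fun_prop

lemma BoundaryDominated.exists_flight_until (hP : P.BoundaryDominated) (hr : 1 ≤ r) {z₀ : State d}
    {t : ℝ} (ht : z₀.2.1 < t)
    (hseg : ∀ s ∈ Icc z₀.2.1 t, z₀.1.1 + (s - z₀.2.1) • z₀.1.2 ∈ interior B.D) :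
    LocRel r (fun ε => flowMap (P.intField ε) 1 ∘ setTime t) (fun _ => freeMap ∘ setTime t) z₀
      ((z₀.1.1 + (t - z₀.2.1) • z₀.1.2, z₀.1.2), (t, t - z₀.2.1)) ∧
    ∃ c > 0, ∃ M, ∀ᶠ w in 𝓝₀ ×ˢ 𝓝 z₀,
      (w.2.1 ∈ P.core c M w.1 ∧ (flowMap (P.intField w.1) 1 (setTime t w.2)).1 ∈ P.core c M w.1 ∧
        P.Arc w.1 (P.core c M w.1) w.2 (flowMap (P.intField w.1) 1 (setTime t w.2)) ∧
        (flowMap (P.intField w.1) 1 (setTime t w.2)).2.1 = t) ∧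
      Line (interior (P.auxTable w.1)) w.2 (freeMap (setTime t w.2)) ∧
        (freeMap (setTime t w.2)).2.1 = t ∧
        ∀ s ∈ Icc w.2.2.1 t, w.2.1.1 + (s - w.2.2.1) • w.2.1.2 ∈ interior (P.auxTable w.1) := by
  have hL : 0 < (setTime t z₀).2.2 := sub_pos.2 ht
  obtain ⟨h1, c, hc, M, h2⟩ := hP.exists_flight (z₀ := setTime t z₀) hr hL (fun s hs => by
    have := hseg (z₀.2.1 + s * (t - z₀.2.1)) ⟨by nlinarith [hs.1], by nlinarith [hs.2]⟩
    rwa [add_sub_cancel_left] at this)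
  have h3 := h1.comp (locRel_setTime t z₀)
  have e : freeMap (setTime t z₀) = ((z₀.1.1 + (t - z₀.2.1) • z₀.1.2, z₀.1.2), (t, t - z₀.2.1)) :=
      by
    simp [freeMap, setTime]
  rw [e] at h3
  have h4 : ∀ᶠ w : ℝ × State d in 𝓝₀ ×ˢ 𝓝 z₀, w.2.2.1 < t :=
    (tendsto_snd.snd_nhds.fst_nhds).eventually_lt_const ht
  refine ⟨h3, c, hc, M, ?_⟩
  filter_upwards [(locRel_setTime (r := r) t z₀).left h2, h4] with w hw hw'
  obtain ⟨⟨a1, a2, a3, a4⟩, a5⟩ := hw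
  have hline : ∀ s ∈ Icc w.2.2.1 t,
      w.2.1.1 + (s - w.2.2.1) • w.2.1.2 ∈ interior (P.auxTable w.1) := by
    intro s hs
    have h0 : 0 < t - w.2.2.1 := sub_pos.2 hw'
    have := a5 ((s - w.2.2.1) / (t - w.2.2.1)) ⟨div_nonneg (sub_nonneg.2 hs.1) h0.le,
      (div_le_one h0).2 (by linarith [hs.2])⟩
    simp only [setTime] at this
    rwa [div_mul_cancel₀ _ h0.ne'] at this
  refine ⟨⟨a1, a2, a3, by rw [a4]; simp [setTime]⟩, ⟨?_, ?_, fun s hs => ?_⟩, ?_, hline⟩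
  · simp [freeMap, setTime, hw'.le]
  · simp [freeMap, setTime]
  · simp only [freeMap, setTime, add_sub_cancel] at hs
    have := hline (w.2.2.1 + s) ⟨by linarith [hs.1], by linarith [hs.2]⟩
    rwa [add_sub_cancel_left] at this
  · simp [freeMap, setTime]

lemma IsPatch.exists_depart (hP : P.BoundaryDominated) (hr : 1 ≤ r) {z₀ : State d} {R : ℝ}
    (hR : 0 < R) (h : P.IsPatch j (closedBall z₀.1.1 R)) (hQ : P.Q 0 z₀.1.1 = P.Qval j)
    (hy : 0 < ⟪∇ (P.Q 0) z₀.1.1, z₀.1.2⟫) {t : ℝ} (ht : z₀.2.1 < t)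
    (hseg : ∀ s ∈ Ioc z₀.2.1 t, z₀.1.1 + (s - z₀.2.1) • z₀.1.2 ∈ interior B.D) :
    ∃ (f g : ℝ → State d → State d) (a c M K : ℝ), 0 < c ∧
      LocRel r f g z₀ ((z₀.1.1 + (t - z₀.2.1) • z₀.1.2, z₀.1.2), (t, a)) ∧
      ∀ᶠ w in 𝓝₀ ×ˢ 𝓝 z₀, P.Q w.1 w.2.1.1 = P.Qval j + etaExp r w.1 →
        (P.Leaves w.1 c M K w.2 (f w.1 w.2) ∧ (f w.1 w.2).2.1 = t) ∧
        Line (interior (P.auxTable w.1)) w.2 (g w.1 w.2) ∧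
        (g w.1 w.2).1.1 ∈ interior (P.auxTable w.1) ∧ (g w.1 w.2).2.1 = t := by
  obtain ⟨u, ⟨f₁, g₁, a, c₁, M₁, K, hc₁, h1, h2⟩, hu0, hut⟩ := ((h.exists_leave hr hR hQ hy).and
    (Ioo_mem_nhdsGT (sub_pos.2 ht))).exists
  set z₁ : State d := ((z₀.1.1 + u • z₀.1.2, z₀.1.2), (z₀.2.1 + u, a)) with hz₁
  obtain ⟨h3, c₂, hc₂, M₂, h4⟩ := hP.exists_flight_until (z₀ := z₁) hr (t := t)
    (by simp only [hz₁]; linarith) (fun s hs => by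
      have := hseg s ⟨by linarith [hs.1], hs.2⟩
      convert this using 1
      simp only [hz₁]
      module)
  have h5 := h3.comp h1
  have e : (((z₁.1.1 + (t - z₁.2.1) • z₁.1.2, z₁.1.2), (t, t - z₁.2.1)) : State d) =
      ((z₀.1.1 + (t - z₀.2.1) • z₀.1.2, z₀.1.2), (t, t - z₁.2.1)) := by
    simp only [hz₁]
    congr 2
    module
  rw [e] at h5
  refine ⟨_, _, _, min c₂ c₁, max M₂ M₁, K, lt_min hc₂ hc₁, h5, ?_⟩
  filter_upwards [h2, h1.left h4, h1.right h4] with w a1 a2 a3 hw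
  obtain ⟨b1, b2, b3⟩ := a1 hw
  obtain ⟨⟨-, d1, d2, d3⟩, -⟩ := a2
  obtain ⟨-, e1, e2, e3⟩ := a3
  have hlt := e1.1
  rw [e2] at hlt
  refine ⟨⟨b1.arc d2 d1, d3⟩, b2.trans e1 b3, ?_, e2⟩
  have := e3 t ⟨hlt, le_rfl⟩
  exact this

/-- From the interior to the wall, and the collision with it. -/
lemma IsPatch.exists_hit (hP : P.BoundaryDominated) (hr : 1 ≤ r) {z₀ z : State d} {R : ℝ}
    (hR : 0 < R) (h : P.IsPatch j (closedBall z₀.1.1 R)) (hQ : P.Q 0 z₀.1.1 = P.Qval j)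
    (hy : ⟪∇ (P.Q 0) z₀.1.1, z₀.1.2⟫ < 0) (ht : z.2.1 < z₀.2.1)
    (hz : z.1 = (z₀.1.1 - (z₀.2.1 - z.2.1) • z₀.1.2, z₀.1.2))
    (hseg : ∀ s ∈ Ico z.2.1 z₀.2.1, z.1.1 + (s - z.2.1) • z.1.2 ∈ interior B.D) :
    ∃ (f g f' g' : ℝ → State d → State d) (b c M K : ℝ), 0 < c ∧
      LocRel r f g z (z₀.1, (z₀.2.1, b)) ∧ LocRel r f' g' z ((z₀.1.1, reflectMomentum
        (‖∇ (P.Q 0) z₀.1.1‖⁻¹ • ∇ (P.Q 0) z₀.1.1) z₀.1.2),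
        (z₀.2.1, ⟪z₀.1.2, z₀.1.2⟫ / 2)) ∧
      ∀ᶠ w in 𝓝₀ ×ˢ 𝓝 z,
        (P.Enters w.1 c M K w.2 (f w.1 w.2) ∧ Hits (P.auxTable w.1) B.corner (f w.1 w.2).1 ∧
          P.Arc w.1 {x | x.1 ∉ closure (P.auxTable w.1)} (f w.1 w.2) (f' w.1 w.2) ∧
          (f w.1 w.2).2.1 < (f' w.1 w.2).2.1 ∧
          (f' w.1 w.2).2.1 - (f w.1 w.2).2.1 ≤ K * nuExp r w.1 ∧
          P.Q w.1 (f' w.1 w.2).1.1 = P.Qval j + etaExp r w.1 ∧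
          (f' w.1 w.2).1 ∈ crossSection (P.auxTable w.1) B.corner) ∧
        Line (interior (P.auxTable w.1)) w.2 (g w.1 w.2) ∧ w.2.1.1 ∈ interior (P.auxTable w.1) ∧
          w.2.2.1 < (g w.1 w.2).2.1 ∧
          Reflects (P.auxTable w.1) B.corner (g w.1 w.2).1 (g' w.1 w.2).1 ∧
          (g' w.1 w.2).2.1 = (g w.1 w.2).2.1 ∧
          P.Q w.1 (g' w.1 w.2).1.1 = P.Qval j + etaExp r w.1 := by
  obtain ⟨u, ⟨hu0, hut⟩, f₂, g₂, b, c₂, M₂, K₂, hc₂, henter⟩ := h.exists_enter hP hr hR hQ hy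
    (sub_pos.2 ht)
  obtain ⟨h3, c₁, hc₁, M₁, h4⟩ := hP.exists_flight_until (z₀ := z) hr (t := z₀.2.1 - u)
    (by linarith) (fun s hs => hseg s ⟨hs.1, by linarith [hs.2]⟩)
  set z₁ : State d := ((z.1.1 + (z₀.2.1 - u - z.2.1) • z.1.2, z.1.2), (z₀.2.1 - u, z₀.2.1 - u -
      z.2.1))
    with hz₁
  obtain ⟨h5, h6⟩ := henter z₁ (by
    simp only [hz₁, hz]
    congr 1
    module) rfl
  set z₂ : State d := (z₀.1, (z₀.2.1, b)) with hz₂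
  obtain ⟨f₃, g₃, K₃, h7, h8⟩ := IsPatch.exists_bounce (z₀ := z₂) hr hR h hy
  have h9 := h5.comp h3
  have h10 := h7.comp h9
  refine ⟨_, _, _, _, b, min c₁ c₂, max M₁ M₂, max K₂ K₃, lt_min hc₁ hc₂, h9, h10, ?_⟩
  have hlt : ∀ {F : ℝ → State d → State d}, Tendsto (fun w : ℝ × State d => F w.1 w.2)
      (𝓝₀ ×ˢ 𝓝 z) (𝓝 z₂) → ∀ᶠ w in 𝓝₀ ×ˢ 𝓝 z, w.2.2.1 < (F w.1 w.2).2.1 := by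
    intro F hF
    have t1 : Tendsto (fun w : ℝ × State d => w.2.2.1) (𝓝₀ ×ˢ 𝓝 z) (𝓝 z.2.1) :=
      tendsto_snd.snd_nhds.fst_nhds
    exact t1.eventually_lt (hF.snd_nhds.fst_nhds) ht
  filter_upwards [h4, h3.left h6, h3.right h6, h9.left h8,
    h9.right h8, nuExp_nonneg_eventually.prod_inl _,
    hlt (F := fun ε => g₂ ε ∘ freeMap ∘ setTime (z₀.2.1 - u)) h9.tendsto_right]
    with w a1 a2 a3 a4 a5 hν a6
  obtain ⟨⟨b1, b2, b3, b4⟩, b5, b6, b7⟩ := a1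
  obtain ⟨⟨d1, d2⟩, -⟩ := a2
  obtain ⟨-, d3, d4⟩ := a3
  obtain ⟨⟨e1, e2, e3, e4, e5⟩, e6, -⟩ := a4 d2
  obtain ⟨-, i1, i2, i3, i4⟩ := a5 d4
  have hle := b5.1
  rw [b6] at hle
  obtain ⟨y, y1, y2, y3, y4, y5⟩ := d1.of_arc b1 b3
  refine ⟨⟨⟨y, y1, y2, y3, y4, y5.trans ?_⟩, e6.hits, e1, e2, e3.trans ?_, e4, e5⟩,
    b5.trans d3 (b7 _ ⟨hle, le_rfl⟩), ?_, a6, i1, i2, i3⟩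
  · gcongr
    exact le_max_left _ _
  · gcongr
    exact le_max_right _ _
  · simpa using b7 _ ⟨le_rfl, hle⟩

end SteepExpPotential

/-! ### Billiard orbits -/

section Billiard

variable {d N N' : ℕ} {Ω C : Set (Config d)} {T : ℝ} {τ : Fin N → ℝ} {τ' : Fin N' → ℝ}
  {γ γ' : ℝ → Phase d}

def freeLine (x : Phase d) (s : ℝ) : Phase d := (x.1 + s • x.2, x.2)

lemma hasDerivAt_freeLine (x : Phase d) (a s : ℝ) :
    HasDerivAt (fun s => freeLine x (s - a)) ((freeLine x (s - a)).2, 0) s := by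
  have := ((((hasDerivAt_id s).sub_const a).smul_const x.2).const_add x.1).prodMk
    (hasDerivAt_const s x.2)
  simpa [freeLine] using this

lemma continuous_freeLine (x : Phase d) (a : ℝ) : Continuous fun s => freeLine x (s - a) :=
  continuous_iff_continuousAt.2 fun s => (hasDerivAt_freeLine x a s).continuousAt

lemma interior_frontier_false {x : Config d} (h : x ∈ interior Ω) (h' : x ∈ frontier Ω \ C) :
    False := h'.1.2 h

lemma IsBilliardOrbit.continuousWithinAt (h : IsBilliardOrbit Ω C T N τ γ) {s : ℝ}
    (hs : s ∈ Icc 0 T) (hτ : s ∉ range τ) : ContinuousWithinAt γ (Icc 0 T) s :=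
  (h.free s hs hτ).continuousWithinAt

lemma IsBilliardOrbit.eq_freeLine (h : IsBilliardOrbit Ω C T N τ γ) {a b : ℝ} (ha : 0 ≤ a)
    (hab : a ≤ b) (hb : b ≤ T) (hno : ∀ t ∈ Ioc a b, t ∉ range τ) : γ b = freeLine (γ a) (b - a) :=
        by
  rcases hab.eq_or_lt with rfl | hab
  · simp [freeLine]
  have hline : ∀ s ∈ Ioc a b, (γ b).2 = (γ s).2 ∧ (γ b).1 - (b - s) • (γ b).2 = (γ s).1 := by
    intro s hs
    have hfree : ∀ x ∈ Icc s b, HasDerivWithinAt γ ((γ x).2, 0) (Icc s b) x := fun x hx =>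
      (h.free x ⟨ha.trans (hs.1.le.trans hx.1), hx.2.trans hb⟩ (hno x ⟨hs.1.trans_le hx.1,
          hx.2⟩)).mono
        (Icc_subset_Icc (ha.trans hs.1.le) hb)
    have h2 : ∀ x ∈ Icc s b, (γ x).2 = (γ s).2 := fun x hx =>
      eq_of_hasDerivWithinAt_zero (f := fun x => (γ x).2) (fun t ht => (hfree t ht).snd) hx
    have h3 := eq_add_of_hasDerivWithinAt (f := fun x => (γ x).1) (c := (γ s).2)
      (fun t ht => ((fst ℝ (Config d)
        (Config d)).hasFDerivAt.comp_hasDerivWithinAt t (hfree t ht)).congr_deriv (h2 t ht)) ⟨hs.2,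
            le_rfl⟩
    have hb := h2 b ⟨hs.2, le_rfl⟩
    exact ⟨hb, by rw [hb, h3, add_sub_cancel_right]⟩
  have hnhds : Ioc a b ∈ 𝓝[>] a := Ioc_mem_nhdsGT hab
  have hsub : Ioc a b ⊆ Icc 0 T := fun x hx => ⟨ha.trans hx.1.le, hx.2.trans hb⟩
  have hin : 𝓝[>] a ≤ 𝓝[Icc 0 T] a := by
    rw [← nhdsWithin_Ioc_eq_nhdsGT hab]
    exact nhdsWithin_mono a hsub
  have haT : a ∈ Icc 0 T := ⟨ha, hab.le.trans hb⟩
  have hp : Tendsto (fun s => (γ s).2) (𝓝[>] a) (𝓝 (γ a).2) := by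
    by_cases hτ : a ∈ range τ
    · obtain ⟨j, rfl⟩ := hτ
      obtain ⟨-, n, p, -, -, -, h4, h5⟩ := h.collision j
      rwa [h5]
    · exact ((h.continuousWithinAt haT hτ).snd.tendsto).mono_left hin
  have e1 : (γ b).2 = (γ a).2 := tendsto_nhds_unique (tendsto_const_nhds.congr' (by
    filter_upwards [hnhds] with s hs using (hline s hs).1)) hp
  have e2 : (γ b).1 - (b - a) • (γ b).2 = (γ a).1 := by
    have h1 : Tendsto (fun s => (γ b).1 - (b - s) • (γ b).2) (𝓝[>] a)
        (𝓝 ((γ b).1 - (b - a) • (γ b).2)) := by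
      have : Continuous fun s : ℝ => (γ b).1 - (b - s) • (γ b).2 := by fun_prop
      exact (this.tendsto a).mono_left nhdsWithin_le_nhds
    refine tendsto_nhds_unique (h1.congr' ?_) ((h.continuousOn a haT).tendsto.mono_left hin)
    filter_upwards [hnhds] with s hs using (hline s hs).2
  ext1
  · simp only [freeLine]
    rw [← e2, ← e1, sub_add_cancel]
  · exact e1

lemma IsBilliardOrbit.reflects (h : IsBilliardOrbit Ω C T N τ γ) {a : ℝ} (ha : 0 ≤ a) (j : Fin N)
    (haj : a < τ j) (hno : ∀ t ∈ Ioo a (τ j), t ∉ range τ) :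
    Reflects Ω C (freeLine (γ a) (τ j - a)) (γ (τ j)) := by
  have hj := h.mem_Ioo j
  have hline : ∀ᶠ s in 𝓝[<] (τ j), γ s = freeLine (γ a) (s - a) := by
    filter_upwards [Ioo_mem_nhdsLT haj] with s hs
    exact h.eq_freeLine ha hs.1.le (hs.2.le.trans hj.2.le) fun t ht => hno t ⟨ht.1, ht.2.trans_lt
        hs.2⟩
  have hin : 𝓝[<] (τ j) ≤ 𝓝[Icc 0 T] (τ j) := by
    rw [← nhdsWithin_Ioo_eq_nhdsLT haj]
    exact nhdsWithin_mono _ fun x hx => ⟨ha.trans hx.1.le, hx.2.le.trans hj.2.le⟩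
  have hc := ((continuous_freeLine (γ a) a).tendsto (τ j)).mono_left
    (nhdsWithin_le_nhds (s := Iio (τ j)))
  have hc' := hc.congr' (hline.mono fun s hs => hs.symm)
  have e1 : (γ (τ j)).1 = (freeLine (γ a) (τ j - a)).1 := tendsto_nhds_unique
    ((h.continuousOn _ (Ioo_subset_Icc_self hj)).tendsto.mono_left hin)
    (hc'.fst_nhds)
  obtain ⟨h1, n, p, h2, h3, h4, -, h6⟩ := h.collision j
  have e2 : p = (freeLine (γ a) (τ j - a)).2 := tendsto_nhds_unique h4
    (hc'.snd_nhds)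
  rw [e1] at h1 h2
  rw [e2] at h3 h6
  exact ⟨h1, n, h2, h3, Prod.ext e1 h6⟩

lemma Reflects.unique {x x' x'' : Phase d} (h : Reflects Ω C x x') (h' : Reflects Ω C x x'') :
    x' = x'' := by
  obtain ⟨-, n, h1, -, rfl⟩ := h
  obtain ⟨-, n', h1', -, rfl⟩ := h'
  rw [h1.unique h1']

lemma IsBilliardOrbit.eqOn (h : IsBilliardOrbit Ω C T N τ γ) (h' : IsBilliardOrbit Ω C T N' τ' γ')
    (h0 : γ 0 = γ' 0) : EqOn γ γ' (Icc 0 T) := by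
  by_contra hne
  obtain ⟨b, hb, hb'⟩ : ∃ b ∈ Icc 0 T, γ b ≠ γ' b := by simpa [EqOn, and_assoc] using hne
  set S := {s | s ∈ Icc 0 T ∧ γ s ≠ γ' s} with hS
  have hbS : b ∈ S := ⟨hb, hb'⟩
  have hbd : BddBelow S := ⟨0, fun s hs => hs.1.1⟩
  set s := sInf S with hs
  have hs0 : 0 ≤ s := le_csInf ⟨b, hbS⟩ fun x hx => hx.1.1
  have hsb : s ≤ b := csInf_le hbd hbS
  have hsT : s ∈ Icc 0 T := ⟨hs0, hsb.trans hb.2⟩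
  have hbefore : ∀ x ∈ Ico 0 s, γ x = γ' x := fun x hx => by
    by_contra hx'
    exact not_le.2 hx.2 (csInf_le hbd ⟨⟨hx.1, hx.2.le.trans hsT.2⟩, hx'⟩)
  have hne : ∀ᶠ y in 𝓝[≠] s, y ∉ range τ ∧ y ∉ range τ' := by
    have := ((finite_range τ).union (finite_range τ')).sdiff (t := {s})
    filter_upwards [nhdsWithin_le_nhds (this.isClosed.isOpen_compl.mem_nhds (by simp)),
      self_mem_nhdsWithin] with y hy hys
    exact ⟨fun hm => hy ⟨.inl hm, hys⟩, fun hm => hy ⟨.inr hm, hys⟩⟩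
  have hat : γ s = γ' s := by
    rcases hs0.eq_or_lt with h1 | h1
    · rw [← h1, h0]
    obtain ⟨a, ha, ha'⟩ : ∃ a ∈ Ico 0 s, ∀ t ∈ Ioo a s, t ∉ range τ ∧ t ∉ range τ' := by
      obtain ⟨a, ha, ha'⟩ := (mem_nhdsLT_iff_exists_Ioo_subset' h1).1
        (hne.filter_mono (nhdsWithin_mono _ fun _ => ne_of_lt))
      exact ⟨max a 0, ⟨le_max_right _ _, max_lt ha h1⟩, fun t ht =>
        ha' ⟨(le_max_left _ _).trans_lt ht.1, ht.2⟩⟩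
    have hq : ∀ {M : ℕ} {σ : Fin M → ℝ} {η : ℝ → Phase d} (_ : IsBilliardOrbit Ω C T M σ η)
        (_ : ∀ t ∈ Ioo a s, t ∉ range σ), (s ∈ range σ → (freeLine (η a) (s - a)).1 ∈ frontier Ω \ C
            ∧
          Reflects Ω C (freeLine (η a) (s - a)) (η s)) ∧
        (s ∉ range σ → (freeLine (η a) (s - a)).1 ∈ interior Ω ∧ η s = freeLine (η a) (s - a)) := by
      intro M σ η g hno
      constructor
      · rintro ⟨j, hj⟩
        have := g.reflects ha.1 j (by rw [hj]; exact ha.2) (by rwa [hj])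
        rw [hj] at this
        exact ⟨this.1, this⟩
      · intro hns
        have e := g.eq_freeLine ha.1 ha.2.le hsT.2 fun t ht => by
          rcases ht.2.eq_or_lt with rfl | hlt
          · exact hns
          · exact hno t ⟨ht.1, hlt⟩
        exact ⟨e ▸ g.mem_interior s hsT hns, e⟩
    have h2 := hq h fun t ht => (ha' t ht).1
    have h3 := hq h' fun t ht => (ha' t ht).2
    rw [← hbefore a ha] at h3
    by_cases c1 : s ∈ range τ <;> by_cases c2 : s ∈ range τ'
    · exact (h2.1 c1).2.unique (h3.1 c2).2
    · exact (interior_frontier_false (h3.2 c2).1 (h2.1 c1).1).elim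
    · exact (interior_frontier_false (h2.2 c1).1 (h3.1 c2).1).elim
    · rw [(h2.2 c1).2, (h3.2 c2).2]
  have hafter : ∀ᶠ x in 𝓝[>] s, ∀ t ∈ Ioc s x, t ∉ range τ ∧ t ∉ range τ' := by
    obtain ⟨u, hu, hu'⟩ := mem_nhdsGT_iff_exists_Ioc_subset.1
      (hne.filter_mono (nhdsWithin_mono _ fun _ => ne_of_gt))
    filter_upwards [Ioc_mem_nhdsGT hu] with x hx t ht using hu' ⟨ht.1, ht.2.trans hx.2⟩
  obtain ⟨u, hu, hu'⟩ := mem_nhdsGT_iff_exists_Ioc_subset.1 hafter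
  obtain ⟨x, hx, hxu⟩ : ∃ x ∈ S, x < u := (csInf_lt_iff hbd ⟨b, hbS⟩).1 hu
  have hsx : s < x := (csInf_le hbd hx).lt_of_ne fun e => hx.2 (e ▸ hat)
  have h4 := hu' ⟨hsx, hxu.le⟩
  apply hx.2
  rw [h.eq_freeLine hs0 hsx.le hx.1.2 fun t ht => (h4 t ht).1,
    h'.eq_freeLine hs0 hsx.le hx.1.2 fun t ht => (h4 t ht).2, hat]

lemma IsBilliardOrbit.billiardFlow_eq (h : IsBilliardOrbit Ω C T N τ γ) (hT : 0 ≤ T) :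
    billiardFlow Ω C T (γ 0) = γ T := by
  have hex : ∃ γ' : ℝ → Phase d, (∃ (N : ℕ) (τ : Fin N → ℝ), IsBilliardOrbit Ω C T N τ γ') ∧
    γ' 0 = γ 0 := ⟨γ, ⟨N, τ, h⟩, rfl⟩
  rw [billiardFlow, dif_pos hex]
  obtain ⟨⟨N', τ', h'⟩, h0⟩ := hex.choose_spec
  exact h'.eqOn h h0 ⟨hT, le_rfl⟩

noncomputable def extendFree (T : ℝ) (γ : ℝ → Phase d) (s : ℝ) : Phase d :=
  if s ≤ T then γ s else freeLine (γ T) (s - T)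

lemma extendFree_of_le {s : ℝ} (hs : T ≤ s) : extendFree T γ s = freeLine (γ T) (s - T) := by
  rcases hs.eq_or_lt with rfl | hs
  · simp [extendFree, freeLine]
  · exact if_neg (not_le.2 hs)

lemma isBilliardOrbit_zero {x : Phase d} (hx : x.1 ∈ interior Ω) (τ : Fin 0 → ℝ) :
    IsBilliardOrbit Ω C 0 0 τ fun _ => x :=
  ⟨fun j => j.elim0, fun j => j.elim0, continuousOn_const, fun _ _ _ => hx, fun s hs _ => by
    rw [Icc_self] at hs ⊢
    rw [mem_singleton_iff.1 hs]
    exact hasDerivWithinAt_iff_hasFDerivWithinAt.2 (.of_subsingleton subsingleton_singleton), fun j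
        => j.elim0⟩

lemma IsBilliardOrbit.extend (h : IsBilliardOrbit Ω C T N τ γ) {T' : ℝ} (hT : T ≤ T')
    (hin : ∀ s ∈ Icc T T', (freeLine (γ T) (s - T)).1 ∈ interior Ω) :
    IsBilliardOrbit Ω C T' N τ (extendFree T γ) := by
  have e1 : EqOn (extendFree T γ) γ (Icc 0 T) := fun s hs => if_pos hs.2
  have e2 : EqOn (extendFree T γ) (fun s => freeLine (γ T) (s - T)) (Icc T T') := fun s hs =>
    extendFree_of_le hs.1
  have hτT : T ∉ range τ := fun ⟨j, hj⟩ => (h.mem_Ioo j).2.ne hj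
  have hd : ∀ s ∈ Icc 0 T', s ∉ range τ →
      HasDerivWithinAt (extendFree T γ) ((extendFree T γ s).2, 0) (Icc 0 T') s := by
    intro s hs hsτ
    refine hasDerivWithinAt_union (b := T) (fun hs' => ?_) (fun hs' => ?_) hs
    · rw [e1 hs']
      exact (h.free s hs' hsτ).congr e1 (e1 hs')
    · rw [e2 hs']
      exact (hasDerivAt_freeLine (γ T) T s).hasDerivWithinAt.congr e2 (e2 hs')
  have hnear : ∀ j, extendFree T γ =ᶠ[𝓝 (τ j)] γ := fun j => by
    filter_upwards [Iio_mem_nhds (h.mem_Ioo j).2] with s hs using if_pos (le_of_lt hs)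
  refine ⟨h.strictMono, fun j => Ioo_subset_Ioo_right hT (h.mem_Ioo j), fun s hs => ?_,
    fun s hs hsτ => ?_, hd, fun j => ?_⟩
  · by_cases hsτ : s ∈ range τ
    · obtain ⟨j, rfl⟩ := hsτ
      have h1 := (h.continuousOn _ (Ioo_subset_Icc_self (h.mem_Ioo j))).continuousAt
        (Icc_mem_nhds (h.mem_Ioo j).1 (h.mem_Ioo j).2)
      exact (h1.congr ((hnear j).mono fun s hs => by simp only [hs])).continuousWithinAt
    · exact (hd s hs hsτ).continuousWithinAt.fst
  · rcases le_total s T with h1 | h1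
    · rw [e1 ⟨hs.1, h1⟩]
      exact h.mem_interior s ⟨hs.1, h1⟩ hsτ
    · rw [e2 ⟨h1, hs.2⟩]
      exact hin s ⟨h1, hs.2⟩
  · obtain ⟨h1, n, p, h2, h3, h4, h5, h6⟩ := h.collision j
    have e S := (((hnear j).fun_comp Prod.snd).filter_mono (nhdsWithin_le_nhds (s := S))).symm
    rw [(hnear j).self_of_nhds]
    exact ⟨h1, n, p, h2, h3, h4.congr' (e _), h5.congr' (e _), h6⟩

lemma IsBilliardOrbit.snoc (h : IsBilliardOrbit Ω C T N τ γ) (hT0 : 0 ≤ T) {t T' : ℝ} (hTt : T < t)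
    (htT : t < T') (hin : ∀ s ∈ Ico T t, (freeLine (γ T) (s - T)).1 ∈ interior Ω) {x' : Phase d}
    (hx : Reflects Ω C (freeLine (γ T) (t - T)) x')
    (hin' : ∀ s ∈ Ioc t T', (freeLine x' (s - t)).1 ∈ interior Ω) :
    IsBilliardOrbit Ω C T' (N + 1) (Fin.snoc τ t : Fin (N + 1) → ℝ)
      (fun s => if s < t then extendFree T γ s else freeLine x' (s - t)) := by
  set η : ℝ → Phase d := fun s => if s < t then extendFree T γ s else freeLine x' (s - t) with hη
  have hext : ∀ T₁ ∈ Ico T t, IsBilliardOrbit Ω C T₁ N τ (extendFree T γ) := fun T₁ hT₁ =>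
    h.extend hT₁.1 fun s hs => hin s ⟨hs.1, hs.2.trans_lt hT₁.2⟩
  have hlt : ∀ {s}, s < t → η s = extendFree T γ s := fun hs => if_pos hs
  have hge : ∀ {s}, t ≤ s → η s = freeLine x' (s - t) := fun hs => if_neg (not_lt.2 hs)
  have hηt : η t = x' := by rw [hge le_rfl]; simp [freeLine]
  have hleft : ∀ {s}, s < t → η =ᶠ[𝓝 s] extendFree T γ := fun {s} hs => by
    filter_upwards [Iio_mem_nhds hs] with x hx using hlt hx
  have hmem : ∀ {s}, 0 ≤ s → s < t → ∃ T₁ ∈ Ico T t, s ∈ Icc 0 T₁ ∧ Icc 0 T₁ ∈ 𝓝[Icc 0 T'] s := by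
    intro s hs0 hs
    obtain ⟨m, h1, h2⟩ := exists_between (max_lt hs hTt)
    exact ⟨m, ⟨(le_max_right _ _).trans h1.le, h2⟩, ⟨hs0, (le_max_left _ _).trans h1.le⟩,
      mem_nhdsWithin.2 ⟨Iio m, isOpen_Iio, (le_max_left _ _).trans_lt h1,
        fun x hx => ⟨hx.2.1, le_of_lt hx.1⟩⟩⟩
  have hrange : ∀ {s}, s ∉ range (Fin.snoc τ t : Fin (N + 1) → ℝ) → s ∉ range τ ∧ s ≠ t := fun hs =>
    ⟨fun ⟨j, hj⟩ => hs ⟨j.castSucc, by rw [Fin.snoc_castSucc]; exact hj⟩,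
      fun e => hs ⟨Fin.last N, by rw [Fin.snoc_last]; exact e.symm⟩⟩
  have hτt : ∀ j, τ j < t := fun j => (h.mem_Ioo j).2.trans hTt
  have hd : ∀ s ∈ Icc 0 T', s ∉ range τ → s ≠ t → HasDerivWithinAt η ((η s).2, 0) (Icc 0 T') s := by
    intro s hs hsτ hst
    rcases hst.lt_or_gt with h1 | h1
    · obtain ⟨T₁, hT₁, hs', hn⟩ := hmem hs.1 h1
      have := ((hext T₁ hT₁).free s hs' hsτ).mono_of_mem_nhdsWithin hn
      rw [hlt h1]
      exact this.congr_of_eventuallyEq ((hleft h1).filter_mono nhdsWithin_le_nhds) (hlt h1)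
    · rw [hge h1.le]
      refine ((hasDerivAt_freeLine x' t s).congr_of_eventuallyEq ?_).hasDerivWithinAt
      filter_upwards [Ioi_mem_nhds h1] with x hx using hge (le_of_lt hx)
  have hfT : ∀ s ∈ Ico T t, η s = freeLine (γ T) (s - T) := fun s hs => by
    rw [hlt hs.2, extendFree_of_le hs.1]
  have htend : Tendsto η (𝓝[<] t) (𝓝 (freeLine (γ T) (t - T))) := by
    refine (((continuous_freeLine (γ T) T).tendsto t).mono_left nhdsWithin_le_nhds).congr' ?_
    filter_upwards [Ioo_mem_nhdsLT hTt] with s hs using (hfT s ⟨hs.1.le, hs.2⟩).symm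
  have htend' : Tendsto η (𝓝[>] t) (𝓝 x') := by
    have e := ((continuous_freeLine x' t).tendsto t).mono_left (nhdsWithin_le_nhds (s := Ioi t))
    rw [sub_self, show freeLine x' 0 = x' by simp [freeLine]] at e
    refine e.congr' ?_
    filter_upwards [self_mem_nhdsWithin] with s hs using (hge (le_of_lt hs)).symm
  obtain ⟨hx1, n, hn1, hn2, hn3⟩ := hx
  have hx'q : x'.1 = (freeLine (γ T) (t - T)).1 := by rw [hn3]
  refine ⟨fun i j hij => ?_, fun j => ?_, fun s hs => ?_, fun s hs hsτ => ?_,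
    fun s hs hsτ => hd s hs (hrange hsτ).1 (hrange hsτ).2, fun j => ?_⟩
  · induction j using Fin.lastCases with
    | last =>
      induction i using Fin.lastCases with
      | last => exact absurd hij (lt_irrefl _)
      | cast i => simpa using hτt i
    | cast j =>
      induction i using Fin.lastCases with
      | last => exact absurd hij (not_lt.2 (Fin.le_last _))
      | cast i => simpa using h.strictMono (Fin.castSucc_lt_castSucc_iff.1 hij)
  · induction j using Fin.lastCases with
    | last => simpa using ⟨hT0.trans_lt hTt, htT⟩
    | cast j => simpa using ⟨(h.mem_Ioo j).1, (hτt j).trans htT⟩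
  · rcases lt_trichotomy s t with h1 | rfl | h1
    · obtain ⟨T₁, hT₁, hs', hn⟩ := hmem hs.1 h1
      exact (((hext T₁ hT₁).continuousOn s hs').mono_of_mem_nhdsWithin hn).congr_of_eventuallyEq
        (((hleft h1).filter_mono nhdsWithin_le_nhds).mono fun x hx => by simp only [hx])
        (by simp only [hlt h1])
    · have : ContinuousAt (fun s => (η s).1) s := by
        refine continuousAt_iff_continuous_left'_right'.2 ⟨?_, ?_⟩
        · rw [ContinuousWithinAt, hηt, hx'q]
          exact htend.fst_nhds
        · rw [ContinuousWithinAt, hηt]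
          exact htend'.fst_nhds
      exact this.continuousWithinAt
    · exact (hd s hs (fun ⟨j, hj⟩ => (hτt j).not_gt (hj ▸ h1)) h1.ne').continuousWithinAt.fst
  · obtain ⟨h2, h3⟩ := hrange hsτ
    rcases h3.lt_or_gt with h1 | h1
    · obtain ⟨T₁, hT₁, hs', -⟩ := hmem hs.1 h1
      rw [hlt h1]
      exact (hext T₁ hT₁).mem_interior s hs' h2
    · rw [hge h1.le]
      exact hin' s ⟨h1, hs.2⟩
  · induction j using Fin.lastCases with
    | last =>
      rw [Fin.snoc_last, hηt, hx'q]
      refine ⟨hx1, n, (freeLine (γ T) (t - T)).2, hn1, hn2, htend.snd_nhds, ?_, ?_⟩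
      · have := htend'.snd_nhds
        rwa [hn3] at this
      · rw [hn3]
    | cast j =>
      rw [Fin.snoc_castSucc]
      obtain ⟨h1, n, p, h2, h3, h4, h5, h6⟩ := (hext T ⟨le_rfl, hTt⟩).collision j
      have e S := (((hleft (hτt j)).fun_comp Prod.snd).filter_mono (nhdsWithin_le_nhds (s :=
          S))).symm
      rw [hlt (hτt j)]
      exact ⟨h1, n, p, h2, h3, h4.congr' (e _), h5.congr' (e _), h6⟩

end Billiard

/-! ### Uniqueness of orbits -/

section Unique

lemma IsBilliardReturn.le {d : ℕ} {Ω C : Set (Config d)} {ρ ρ' ρ'' : Phase d} {t t' : ℝ}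
    (h : IsBilliardReturn Ω C ρ t ρ') (h' : IsBilliardReturn Ω C ρ t' ρ'') : t' ≤ t := by
  obtain ⟨-, h1, -, h2, h3, -⟩ := h
  by_contra hlt
  exact interior_frontier_false (h'.2.2.1 t ⟨h1, not_le.1 hlt⟩) (h2 ▸ h3)

lemma IsBilliardReturn.billiardMap_eq {d : ℕ} {Ω C : Set (Config d)} {ρ ρ' : Phase d} {t : ℝ}
    (h : IsBilliardReturn Ω C ρ t ρ') : billiardMap Ω C ρ = ρ' := by
  have hex : ∃ (ρ' : Phase d) (t : ℝ), IsBilliardReturn Ω C ρ t ρ' := ⟨ρ', t, h⟩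
  rw [billiardMap, dif_pos hex]
  obtain ⟨t', h'⟩ := hex.choose_spec
  obtain rfl := le_antisymm (h.le h') (h'.le h)
  obtain ⟨-, -, -, h2, -, n, h3, -, h4⟩ := h
  obtain ⟨-, -, -, h2', -, n', h3', -, h4'⟩ := h'
  have e := h2.trans h2'.symm
  rw [e] at h3
  exact Prod.ext e.symm (by rw [h4, h4', h3.unique h3'])

variable {d r : ℕ} {B : BilliardTable d r} {P : SteepExpPotential B} {ε : ℝ} {γ γ' : ℝ → Phase d}

lemma OrbitOn.eq (hr : 1 ≤ r) (hε : ε ∈ Ioo 0 P.ε₁) {a b t s : ℝ}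
    (h : OrbitOn P.domain (P.V ε) a b γ) (h' : OrbitOn P.domain (P.V ε) a b γ') (ht : t ∈ Icc a b)
    (hs : s ∈ Icc a b) (e : γ t = γ' t) : γ s = γ' s := by
  have hs' : t + (s - t) ∈ Icc a b := by rwa [add_sub_cancel]
  have h1 := (h.flowMap_eq hr hε ht hs').2 1 (by simp)
  have h2 := (h'.flowMap_eq hr hε ht hs').2 1 (by simp)
  rw [e, h2] at h1
  simpa using (congrArg Prod.fst h1).symm

lemma OrbitOn.smoothFlow_eq (hr : 1 ≤ r) (hε : ε ∈ Ioo 0 P.ε₁) {T t : ℝ}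
    (h : OrbitOn P.domain (P.V ε) 0 T γ) (ht : t ∈ Icc 0 T) :
    smoothFlow P.domain (P.V ε) t (γ 0) = γ t := by
  have hex : ∃ γ' : ℝ → Phase d, IsSmoothOrbit P.domain (P.V ε) t γ' ∧ γ' 0 = γ 0 :=
    ⟨γ, h.mono le_rfl ht.2, rfl⟩
  rw [smoothFlow, dif_pos hex]
  exact OrbitOn.eq hr hε hex.choose_spec.1 (h.mono le_rfl ht.2) ⟨le_rfl, ht.1⟩ ⟨ht.1, le_rfl⟩
    hex.choose_spec.2

lemma IsSmoothReturn.le (hr : 1 ≤ r) (hε : ε ∈ Ioo 0 P.ε₁) {Ω C : Set (Config d)}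
    {ρ ρ' ρ'' : Phase d} {t₁ t₂ t₁' t₂' : ℝ} (h : IsSmoothReturn P.domain (P.V ε) Ω C ρ t₁ t₂ ρ')
    (h' : IsSmoothReturn P.domain (P.V ε) Ω C ρ t₁' t₂' ρ'') :
    t₁' ≤ t₁ ∧ (t₁' ≤ t₁ → t₂' ≤ t₂) := by
  obtain ⟨-, h1, h2, γ, h3, h4, -, h5, -, -, h6, h7⟩ := h
  obtain ⟨-, h1', h2', γ', h3', h4', h8, -, -, h9, -⟩ := h'
  have e : ∀ {s}, 0 ≤ s → s ≤ t₂ → s ≤ t₂' → γ s = γ' s := fun {s} a b c =>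
    OrbitOn.eq hr hε (OrbitOn.mono h3 le_rfl b) (OrbitOn.mono h3' le_rfl c) ⟨le_rfl, a⟩ ⟨a, le_rfl⟩
      (h4.trans h4'.symm)
  constructor
  · by_contra! hlt
    rw [e h1.le h2.le (hlt.trans h2').le] at h5
    exact interior_frontier_false (h8 t₁ ⟨h1, hlt⟩) h5
  · intro hle
    by_contra! hlt
    have := e (h1.trans h2).le le_rfl hlt.le
    rw [h6] at this
    exact h9 t₂ ⟨hle.trans_lt h2, hlt⟩ (this ▸ frontier_subset_closure h7.1.1)

lemma IsSmoothReturn.poincareMap_eq (hr : 1 ≤ r) (hε : ε ∈ Ioo 0 P.ε₁) {Ω C : Set (Config d)}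
    {ρ ρ' : Phase d} {t₁ t₂ : ℝ} (h : IsSmoothReturn P.domain (P.V ε) Ω C ρ t₁ t₂ ρ') :
    poincareMap P.domain (P.V ε) Ω C ρ = ρ' := by
  have hex : ∃ (ρ' : Phase d) (t₁ t₂ : ℝ), IsSmoothReturn P.domain (P.V ε) Ω C ρ t₁ t₂ ρ' :=
    ⟨ρ', t₁, t₂, h⟩
  rw [poincareMap, dif_pos hex]
  obtain ⟨t₁', t₂', h'⟩ := hex.choose_spec
  have e := le_antisymm ((h'.le hr hε h).2 (h'.le hr hε h).1) ((h.le hr hε h').2 (h.le hr hε h').1)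
  obtain ⟨-, h1, h2, γ, h3, h4, -, -, -, -, h5, -⟩ := h
  obtain ⟨-, -, -, γ', h3', h4', -, -, -, -, h5', -⟩ := h'
  rw [← e] at h3' h5'
  rw [← h5, ← h5']
  exact OrbitOn.eq hr hε h3' h3 ⟨le_rfl, (h1.trans h2).le⟩ ⟨(h1.trans h2).le, le_rfl⟩
    (h4'.trans h4.symm)

lemma eventually_eventually_snd {E : Type} [TopologicalSpace E] {x : E} {p : ℝ × E → Prop}
    (h : ∀ᶠ w in 𝓝₀ ×ˢ 𝓝 x, p w) :
    ∀ᶠ w in 𝓝₀ ×ˢ 𝓝 x, ∀ᶠ y in 𝓝 w.2, p (w.1, y) := by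
  obtain ⟨pa, ha, pb, hb, hp⟩ := eventually_prod_iff.1 h
  filter_upwards [ha.prod_mk hb.eventually_nhds] with w hw
  exact hw.2.mono fun y hy => hp hw.1 hy

lemma CrNear.mono {f g : Phase d → Phase d} {ρ : Phase d} {c c' : ℝ} (h : CrNear r f g ρ c)
    (hc : c ≤ c') : CrNear r f g ρ c' :=
  ⟨h.1, h.2.1, fun k hk => (h.2.2 k hk).trans hc⟩

lemma CrNear.congr {f g f' g' : Phase d → Phase d} {ρ : Phase d} {c : ℝ} (h : CrNear r f g ρ c)
    (hf : f' =ᶠ[𝓝 ρ] f) (hg : g' =ᶠ[𝓝 ρ] g) : CrNear r f' g' ρ c :=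
  ⟨h.1.congr_of_eventuallyEq hf, h.2.1.congr_of_eventuallyEq hg, fun k hk => by
    rw [(hf.iteratedFDeriv ℝ k).eq_of_nhds, (hg.iteratedFDeriv ℝ k).eq_of_nhds]
    exact h.2.2 k hk⟩

/-- The flows are close at every time up to which the orbit has stayed in the interior region since
the time `t₀`, or after which it will stay there until `t₀`. -/
lemma SteepExpPotential.BoundaryDominated.exists_crNear (hP : P.BoundaryDominated) (hr : 1 ≤ r)
    {F G : ℝ → Phase d → Phase d} {ρ₀ x : Phase d} (h : LocRel r F G ρ₀ x) (t₀ T : ℝ) {c M : ℝ}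
    (hc : 0 < c) : ∃ K, ∀ᶠ w in 𝓝₀ ×ˢ 𝓝 ρ₀, ∀ t ∈ Icc 0 T,
      (∃ (a b : ℝ) (γ : ℝ → Phase d), OrbitOn P.domain (P.V w.1) a b γ ∧ γ t₀ = F w.1 w.2 ∧
        t₀ ∈ Icc a b ∧ t ∈ Icc a b ∧ ∀ s ∈ uIcc t₀ t, γ s ∈ P.core c M w.1) →
      CrNear r (fun ρ => (flowMap (P.intField w.1) 1 (F w.1 ρ, (t₀, t - t₀))).1)
        (fun ρ => freeLine (G w.1 ρ) (t - t₀)) w.2 (K * nuExp r w.1) := by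
  obtain ⟨R, hR, h1⟩ := h.rel
  obtain ⟨a, ha, ha'⟩ := Filter.Eventually.exists_closedBall
    (p := fun ε z => F ε z ∈ closedBall x 1 ∧ G ε z ∈ closedBall x 1)
    ((h.tendsto_left.eventually_mem (closedBall_mem_nhds x one_pos)).and
      (h.tendsto_right.eventually_mem (closedBall_mem_nhds x one_pos)))
  set l := 𝓝₀ ×ˢ 𝓟 (Icc 0 T) with hl
  set M' := max M (max (‖x‖ + 1) (max |t₀| (|T| + |t₀|))) with hM'
  set s := min R a with hs
  have he : Tendsto (fun i : ℝ × ℝ => i.1) l 𝓝₀ := tendsto_fst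
  have hν := he.eventually (nuExp_nonneg_eventually (r := r))
  have hν' := he.eventually (nuExp_le_one_eventually (r := r))
  have ht : ∀ᶠ i in l, i.2 ∈ Icc 0 T := tendsto_snd.eventually (mem_principal_self _)
  have habs : ∀ t ∈ Icc 0 T, |t - t₀| ≤ |T| + |t₀| := fun t ht => abs_le.2
    ⟨by linarith [ht.1, neg_abs_le t₀, le_abs_self t₀, abs_nonneg T],
      by linarith [ht.2, neg_abs_le t₀, le_abs_self T]⟩
  have hsR : ∀ᶠ i in l, closedBall ρ₀ s ⊆ closedBall ρ₀ R :=
    .of_forall fun _ => closedBall_subset_closedBall (min_le_left _ _)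
  set A' : ℝ × ℝ → Set (Phase d) := fun _ => closedBall ρ₀ s with hA'
  set Q : ℝ × ℝ → State d → Prop := fun i z => ∃ (a b : ℝ) (γ : ℝ → Phase d),
    OrbitOn P.domain (P.V i.1) a b γ ∧ γ z.2.1 = z.1 ∧ z.2.1 ∈ Icc a b ∧ z.2.1 + z.2.2 ∈ Icc a b ∧
      ∀ s ∈ 𝕀, γ (z.2.1 + s * z.2.2) ∈ P.core c M' i.1 with hQ
  set A : ℝ × ℝ → Set (Phase d) := fun i => {ρ | ρ ∈ A' i ∧ Q i (F i.1 ρ, (t₀, i.2 - t₀))} with hA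
  have hAA : ∀ᶠ i in l, A i ⊆ A' i := .of_forall fun i ρ hρ => hρ.1
  have h2 := (h1.reindex he).mono_set (A₁ := A) (A₁' := A') (by
    filter_upwards [hAA, hsR] with i h1 h2 using h1.trans h2) hsR
  have h3 := h2.prodMk (CRel.const (fun i : ℝ × ℝ => (t₀, i.2 - t₀)) (C := max |t₀| (|T| + |t₀|))
      (by
    filter_upwards [ht] with i hi
    exact max_le_max le_rfl (habs i.2 hi)) hν) hν
  have hbd : ∀ y ∈ closedBall x 1, ∀ i : ℝ × ℝ, i.2 ∈ Icc 0 T →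
      ((y, (t₀, i.2 - t₀)) : State d) ∈ closedBall 0 M' := fun y hy i hi => by
    rw [mem_closedBall_zero_iff]
    exact le_max_of_le_right <| max_le_max (norm_le_of_mem_closedBall hy) (max_le_max le_rfl (habs
        i.2 hi))
  have hmem := he.eventually (ha' s (min_le_right _ _))
  have h4 := hP.cRel_flow (c := c) (M := M') hr he (A := fun i => {z | z ∈ closedBall 0 M' ∧ Q i z})
    (A' := fun _ => closedBall 0 M') hc (.of_forall fun i z hz => hz.1)
    (.of_forall fun i => subset_rfl) ?_
  · have h5 := (h4.comp h3 hν hν' hAA (by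
      filter_upwards [hmem, ht] with i h1 h2 ρ hρ using ⟨hbd _ (h1 ρ hρ.1).1 i h2, hρ.2⟩) (by
      filter_upwards [hmem, ht] with i h1 h2 ρ hρ using hbd _ (h1 ρ hρ).2 i h2)).clm_left
      (fst ℝ (Phase d) (ℝ × ℝ)) hν
    obtain ⟨K, hK⟩ := h5.exists_iteratedFDeriv_sub_le hν hAA
    refine ⟨K, ?_⟩
    have h6 := eventually_prod_principal_iff.1 (hK.and (h5.left.and (h5.right.and hAA)))
    filter_upwards [h6.prod_mk (closedBall_mem_nhds ρ₀ (lt_min hR ha))] with w hw t ht hγ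
    obtain ⟨e1, e2, e3, e4⟩ := hw.1 t ht
    have hwA : w.2 ∈ A (w.1, t) := by
      refine ⟨hw.2, ?_⟩
      obtain ⟨a, b, γ, g1, g2, g3, g4, g5⟩ := hγ
      refine ⟨a, b, γ, g1, g2, g3, by simpa using g4, fun s hs =>
        SteepExpPotential.core_mono le_rfl (le_max_left _ _) (g5 _ ?_)⟩
      rw [← segment_eq_uIcc, segment_eq_image']
      exact ⟨s, hs, rfl⟩
    exact ⟨e2 _ hwA, e3 _ (e4 hwA), fun k hk => e1 _ hwA k hk⟩
  · exact .of_forall fun i z hz => hz.2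

end Unique

namespace SteepExpPotential

variable {d r : ℕ} {B : BilliardTable d r} {P : SteepExpPotential B}

/-! ### Passing one collision -/

lemma _root_.freeLine_zero (x : Phase d) : freeLine x 0 = x := by simp [freeLine]

lemma _root_.freeLine_add (x : Phase d) (s t : ℝ) : freeLine (freeLine x s) t = freeLine x (s + t)
    := by
  simp only [freeLine]
  congr 1
  module

lemma _root_.OrbitOn.step {ε T c M K c' M' K' : ℝ} {z f₁ f₂ f₃ : State d} {S : Set (Phase d)}
    {γ : ℝ → Phase d} (hT : 0 ≤ T) (h : OrbitOn P.domain (P.V ε) 0 T γ) (hz : z.2.1 = T)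
    (hzγ : γ T = z.1) (h₁ : P.Enters ε c M K z f₁) (h₂ : P.Arc ε S f₁ f₂)
    (h₃ : P.Leaves ε c' M' K' f₂ f₃) :
    ∃ (γ' : ℝ → Phase d) (s₁ s₂ : ℝ), OrbitOn P.domain (P.V ε) 0 f₃.2.1 γ' ∧ EqOn γ' γ (Icc 0 T) ∧
      γ' f₃.2.1 = f₃.1 ∧ (T ≤ s₁ ∧ s₁ ≤ f₁.2.1 ∧ f₁.2.1 - s₁ ≤ K * nuExp r ε) ∧
      (f₂.2.1 ≤ s₂ ∧ s₂ ≤ f₃.2.1 ∧ s₂ - f₂.2.1 ≤ K' * nuExp r ε) ∧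
      (∀ s ∈ Icc T s₁, γ' s ∈ P.core c M ε) ∧ ∀ s ∈ Icc s₂ f₃.2.1, γ' s ∈ P.core c' M' ε := by
  obtain ⟨y₁, a1, ⟨a2, γ₁, a3, a4, a5, a6⟩, a7, a8, a9⟩ := h₁
  obtain ⟨y₂, b1, b2, ⟨b3, γ₃, b4, b5, b6, b7⟩, b8, b9⟩ := h₃
  obtain ⟨m1, γ₂, m2, m3, m4, -⟩ := ((a8.mono (subset_univ _)).trans (h₂.mono (subset_univ _))
    (mem_univ _)).trans (b1.mono (subset_univ _)) (mem_univ _)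
  rw [hz] at a2 a3 a4 a6
  obtain ⟨η₁, e1, e2, e3⟩ := h.glue a3 (by rw [hzγ, a4])
  obtain ⟨η₂, i1, i2, i3⟩ := e1.glue m2 (by rw [e3 ⟨a2, le_rfl⟩, a5, m3])
  obtain ⟨η₃, k1, k2, k3⟩ := i1.glue b4 (by rw [i3 ⟨m1, le_rfl⟩, m4, b5])
  refine ⟨η₃, y₁.2.1, y₂.2.1, k1, fun s hs => ?_, by rw [k3 ⟨b3, le_rfl⟩, b6], ⟨a2, a8.1, a9⟩,
    ⟨b1.1, b3, b9⟩, fun s hs => ?_, fun s hs => ?_⟩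
  · rw [k2 ⟨hs.1, hs.2.trans (a2.trans m1)⟩, i2 ⟨hs.1, hs.2.trans a2⟩, e2 hs]
  · rw [k2 ⟨hT.trans hs.1, hs.2.trans m1⟩, i2 ⟨hT.trans hs.1, hs.2⟩, e3 hs]
    rcases hs.1.eq_or_lt with rfl | h1
    · rwa [a4]
    rcases hs.2.eq_or_lt with rfl | h2
    · rwa [a5]
    exact a6 s ⟨h1, h2⟩
  · rw [k3 hs]
    rcases hs.1.eq_or_lt with rfl | h1
    · rwa [b5]
    rcases hs.2.eq_or_lt with rfl | h2
    · rwa [b6]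
    exact b7 s ⟨h1, h2⟩

lemma _root_.IsBilliardOrbit.step {Ω C : Set (Config d)} {T T' : ℝ} {N : ℕ} {τ : Fin N → ℝ}
    {γ : ℝ → Phase d} {z g₁ g₂ g₃ : State d} (hT : 0 ≤ T) (h : IsBilliardOrbit Ω C T N τ γ)
    (hz : z.2.1 = T) (hzγ : γ T = z.1) (hzin : z.1.1 ∈ interior Ω) (h₁ : Line (interior Ω) z g₁)
    (hlt : z.2.1 < g₁.2.1) (hr : Reflects Ω C g₁.1 g₂.1) (ht : g₂.2.1 = g₁.2.1)
    (h₂ : Line (interior Ω) g₂ g₃) (hlt' : g₂.2.1 < T') (hT' : g₃.2.1 = T')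
    (hin : g₃.1.1 ∈ interior Ω) :
    ∃ γ' : ℝ → Phase d, IsBilliardOrbit Ω C T' (N + 1) (Fin.snoc τ g₂.2.1 : Fin (N + 1) → ℝ) γ' ∧
      γ' 0 = γ 0 ∧ γ' T' = g₃.1 ∧
      (∀ t ∈ Ico T g₂.2.1, billiardFlow Ω C t (γ 0) = freeLine z.1 (t - T)) ∧
      ∀ t ∈ Ioc g₂.2.1 T', billiardFlow Ω C t (γ 0) = freeLine g₃.1 (t - T') := by
  subst hz hT'
  obtain ⟨-, a1, a2⟩ := h₁
  obtain ⟨-, b1, b2⟩ := h₂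
  rw [← ht] at a1 a2 hlt
  have hline : ∀ s ∈ Ico z.2.1 g₂.2.1, (freeLine (γ z.2.1) (s - z.2.1)).1 ∈ interior Ω := by
    intro s hs
    rw [hzγ]
    rcases hs.1.eq_or_lt with rfl | h1
    · rwa [sub_self, freeLine_zero]
    · exact a2 _ ⟨sub_pos.2 h1, by linarith [hs.2]⟩
  have hline' : ∀ s ∈ Ioc g₂.2.1 g₃.2.1, (freeLine g₂.1 (s - g₂.2.1)).1 ∈ interior Ω := by
    intro s hs
    rcases hs.2.eq_or_lt with rfl | h1
    · rw [b1] at hin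
      exact hin
    · exact b2 _ ⟨sub_pos.2 hs.1, by linarith⟩
  have hrefl : Reflects Ω C (freeLine (γ z.2.1) (g₂.2.1 - z.2.1)) g₂.1 := by
    rw [hzγ]
    convert hr using 1
    exact a1.symm
  have hsn : ∀ t ∈ Ioc g₂.2.1 g₃.2.1, _ := fun t ht => h.snoc hT hlt ht.1 hline hrefl fun s hs =>
    hline' s ⟨hs.1, hs.2.trans ht.2⟩
  set η : ℝ → Phase d := fun s => if s < g₂.2.1 then extendFree z.2.1 γ s
    else freeLine g₂.1 (s - g₂.2.1) with hη
  have h0 : η 0 = γ 0 := by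
    rw [hη]
    simp only [hT.trans_lt hlt, if_true, extendFree, hT]
  have hge : ∀ {s}, g₂.2.1 ≤ s → η s = freeLine g₃.1 (s - g₃.2.1) := fun {s} hs => by
    have e : g₃.1 = freeLine g₂.1 (g₃.2.1 - g₂.2.1) := b1
    rw [e, freeLine_add]
    simp only [hη, not_lt.2 hs, if_false]
    congr 1
    ring
  refine ⟨η, hsn _ ⟨hlt', le_rfl⟩, h0, by rw [hge hlt'.le, sub_self, freeLine_zero], fun t ht => ?_,
    fun t ht => ?_⟩
  · have := (h.extend ht.1 fun s hs => hline s ⟨hs.1, hs.2.trans_lt ht.2⟩).billiardFlow_eq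
      (hT.trans ht.1)
    rw [extendFree_of_le ht.1, hzγ] at this
    rwa [extendFree, if_pos hT] at this
  · have := (hsn t ht).billiardFlow_eq (hT.trans (hlt.trans ht.1).le)
    rwa [h0, hge ht.1.le] at this

/-! ### Shadowing of billiard orbits -/

/-- The smooth orbit of `ρ` follows its billiard orbit on `[0, T]`; they end at `F ρ` and `G ρ`. -/
def Shadows (P : SteepExpPotential B) (T : ℝ) (N : ℕ) (K ε : ℝ) (F G : Phase d → Phase d)
    (ρ : Phase d) : Prop :=
  ∃ (τ a b : Fin N → ℝ) (γb γs : ℝ → Phase d),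
    (IsBilliardOrbit (P.auxTable ε) B.corner T N τ γb ∧ γb 0 = ρ ∧ γb T = G ρ) ∧
    (OrbitOn P.domain (P.V ε) 0 T γs ∧ γs 0 = ρ ∧ γs T = F ρ) ∧
    (∀ j, τ j ∈ Icc (a j) (b j) ∧ b j - a j ≤ K * nuExp r ε) ∧
    ∀ t ∈ Icc 0 T, (∀ j, t ∉ Icc (a j) (b j)) → (γs t).1 ∈ P.intTable ε ∧
      CrNear r (smoothFlow P.domain (P.V ε) t) (billiardFlow (P.auxTable ε) B.corner t) ρ
        (K * nuExp r ε)

lemma _root_.locRel_lift (t : ℝ) (x : Phase d) : LocRel r (fun _ ρ => ((ρ, (t, 0)) : State d))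
    (fun _ ρ => ((ρ, (t, 0)) : State d)) x (x, (t, 0)) :=
  LocRel.fixed (G := fun ρ : Phase d => ((ρ, (t, 0)) : State d))
    (.of_forall fun x => ContDiff.contDiffAt (by fun_prop))

lemma _root_.LocRel.phase {f g : ℝ → Phase d → State d} {x : Phase d} {y : State d}
    (h : LocRel r f g x y) : LocRel r (fun ε ρ => (f ε ρ).1) (fun ε ρ => (g ε ρ).1) x y.1 :=
  (LocRel.fixed (G := fun z : State d => z.1)
    (.of_forall fun x => ContDiff.contDiffAt (by fun_prop))).comp h

lemma _root_.OrbitOn.phase_eq (hr : 1 ≤ r) {ε a b t s : ℝ} (hε : ε ∈ Ioo 0 P.ε₁) {γ : ℝ → Phase d}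
    (h : OrbitOn P.domain (P.V ε) a b γ) (ht : t ∈ Icc a b) (hs : s ∈ Icc a b) :
    γ s = (flowMap (P.intField ε) 1 (γ t, (t, s - t))).1 := by
  rw [(h.flowMap_eq hr hε ht (by rwa [add_sub_cancel])).2 1 (by simp)]
  simp

lemma BoundaryDominated.exists_shadows_zero (hP : P.BoundaryDominated) (hr : 1 ≤ r) {T : ℝ}
    (hT : 0 ≤ T) {x : Phase d} (hx : ∀ s ∈ Icc 0 T, (freeLine x s).1 ∈ interior B.D) :
    ∃ (F G : ℝ → Phase d → Phase d) (K : ℝ), LocRel r F G x (freeLine x T) ∧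
      ∀ᶠ w in 𝓝₀ ×ˢ 𝓝 x, P.Shadows T 0 K w.1 (F w.1) (G w.1) w.2 := by
  obtain ⟨T', hTT', hT'⟩ : ∃ T' > T, ∀ s ∈ Icc 0 T', (freeLine x s).1 ∈ interior B.D := by
    have h1 : (fun s => (freeLine x s).1) ⁻¹' interior B.D ∈ 𝓝[≥] T :=
      nhdsWithin_le_nhds ((isOpen_interior.preimage (by unfold freeLine; fun_prop)).mem_nhds
        (hx T ⟨hT, le_rfl⟩))
    obtain ⟨u, hu, hu'⟩ := mem_nhdsGE_iff_exists_Icc_subset.1 h1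
    refine ⟨u, hu, fun s hs => ?_⟩
    rcases le_total s T with h | h
    · exact hx s ⟨hs.1, h⟩
    · exact hu' ⟨h, hs.2⟩
  have hflight := fun t (ht : 0 < t) (htT : t ≤ T') => hP.exists_flight_until hr (z₀ := (x, (0, 0)))
    (t := t) ht fun s hs => by simpa [freeLine] using hT' s ⟨hs.1, hs.2.trans htT⟩
  obtain ⟨-, c, hc, M, h1⟩ := hflight T' (hT.trans_lt hTT') le_rfl
  obtain ⟨F, G, hFG, hF⟩ : ∃ F G : ℝ → Phase d → Phase d, LocRel r F G x (freeLine x T) ∧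
      ∀ ε ρ, F ε ρ = (if T = 0 then ρ else (flowMap (P.intField ε) 1 (ρ, (0, T - 0))).1) ∧
        G ε ρ = freeLine ρ T := by
    rcases hT.eq_or_lt with rfl | hT0
    · rw [freeLine_zero]
      exact ⟨_, _, LocRel.fixed (G := id) (.of_forall fun x => contDiff_id.contDiffAt),
        fun ε ρ => ⟨by simp, by simp [freeLine_zero]⟩⟩
    · have h2 := ((hflight T hT0 hTT'.le).1.comp (locRel_lift 0 x)).phase
      simp only [sub_zero] at h2
      exact ⟨_, _, h2, fun ε ρ => ⟨by simp [hT0.ne', setTime], by simp [freeMap, setTime,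
          freeLine]⟩⟩
  obtain ⟨K, hK⟩ := hP.exists_crNear hr
    (LocRel.fixed (r := r) (G := id) (.of_forall fun x : Phase d => contDiff_id.contDiffAt))
    0 T (M := M) hc
  have h3 : ∀ᶠ w in 𝓝₀ ×ˢ 𝓝 x, (∃ γ, OrbitOn P.domain (P.V w.1) 0 T' γ ∧ γ 0 = w.2 ∧
      ∀ s ∈ Icc 0 T', γ s ∈ P.core c M w.1) ∧
      ∀ s ∈ Icc 0 T', (freeLine w.2 s).1 ∈ interior (P.auxTable w.1) := by
    filter_upwards [(locRel_lift (r := r) 0 x).left h1] with w hw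
    obtain ⟨⟨a1, a2, ⟨a3, γ, a4, a5, a6, a7⟩, a8⟩, -, -, a9⟩ := hw
    rw [a8] at a3 a4 a6 a7
    refine ⟨⟨γ, a4, a5, fun s hs => ?_⟩, fun s hs => by simpa [freeLine] using a9 s hs⟩
    rcases hs.1.eq_or_lt with rfl | h1
    · rw [a5]
      exact a1
    rcases hs.2.eq_or_lt with rfl | h2
    · rw [a6]
      exact a2
    exact a7 s ⟨h1, h2⟩
  have hbil : ∀ {w : ℝ × Phase d}, (∀ s ∈ Icc 0 T', (freeLine w.2 s).1 ∈ interior (P.auxTable w.1))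
      →
      ∀ t ∈ Icc 0 T, IsBilliardOrbit (P.auxTable w.1) B.corner t 0 Fin.elim0
        (extendFree 0 fun _ => w.2) := fun {w} h t ht =>
    (isBilliardOrbit_zero (by simpa [freeLine] using h 0 ⟨le_rfl, hT.trans hTT'.le⟩) _).extend ht.1
      fun s hs => by
        rw [sub_zero]
        exact h s ⟨hs.1, hs.2.trans (ht.2.trans hTT'.le)⟩
  have hb0 : ∀ {w : ℝ × Phase d} {t : ℝ}, 0 ≤ t → extendFree 0 (fun _ => w.2) t = freeLine w.2 t :=
    fun h => by rw [extendFree_of_le h, sub_zero]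
  have hlt : ∀ᶠ w : ℝ × Phase d in 𝓝₀ ×ˢ 𝓝 x, w.1 ∈ Ioo 0 P.ε₁ := P.eventually_lt.prod_inl _
  refine ⟨F, G, K, hFG, ?_⟩
  filter_upwards [h3, eventually_eventually_snd h3, hlt, hK] with w hw hw' hε hKw
  obtain ⟨⟨γ, e1, e2, e3⟩, e4⟩ := hw
  have hm : ∀ {t}, t ∈ Icc 0 T → t ∈ Icc 0 T' := fun ht => ⟨ht.1, ht.2.trans hTT'.le⟩
  refine ⟨Fin.elim0, Fin.elim0, Fin.elim0, _, γ, ⟨hbil e4 T ⟨hT, le_rfl⟩, ?_, ?_⟩,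
    ⟨e1.mono le_rfl hTT'.le, e2, ?_⟩, fun j => j.elim0, fun t ht _ => ⟨(e3 t (hm ht)).1.1, ?_⟩⟩
  · rw [hb0 le_rfl, freeLine_zero]
  · rw [hb0 hT, (hF _ _).2]
  · rw [(hF _ _).1]
    split_ifs with h0
    · rw [h0, e2]
    · rw [← e2]
      exact e1.phase_eq hr hε ⟨le_rfl, hT.trans hTT'.le⟩ (hm ⟨hT, le_rfl⟩)
  · refine (hKw t ht ⟨0, T', γ, e1, e2, ⟨le_rfl, hT.trans hTT'.le⟩, hm ht, fun s hs => ?_⟩).congr ?_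
      ?_
    · rw [uIcc_of_le ht.1] at hs
      exact e3 s ⟨hs.1, hs.2.trans (hm ht).2⟩
    · filter_upwards [hw'] with ρ ⟨⟨γ', f1, f2, _⟩, _⟩
      rw [← f2, f1.smoothFlow_eq hr hε (hm ht)]
      exact f1.phase_eq hr hε ⟨le_rfl, hT.trans hTT'.le⟩ (hm ht)
    · filter_upwards [hw'] with ρ ⟨_, f3⟩
      have := (hbil (w := (w.1, ρ)) f3 t ht).billiardFlow_eq ht.1
      rw [hb0 ht.1, hb0 le_rfl, freeLine_zero] at this
      rw [sub_zero]
      exact this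

lemma _root_.LocRel.continuousAt_right {E F : Type} [NormedAddCommGroup E] [NormedSpace ℝ E]
    [NormedAddCommGroup F] [NormedSpace ℝ F] {f g : ℝ → E → F} {x : E} {y : F}
    (h : LocRel r f g x y) : ∀ᶠ w in 𝓝₀ ×ˢ 𝓝 x, ContinuousAt (g w.1) w.2 := by
  obtain ⟨ρ, hρ, h1⟩ := h.rel
  filter_upwards [h1.right.prod_mk (closedBall_mem_nhds x hρ)] with w hw
  exact (hw.1 _ hw.2).continuousAt

lemma exists_isPatch_of_reflects (P : SteepExpPotential B) {x x' : Phase d}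
    (h : Reflects B.D B.corner x x') : ∃ j, P.Q 0 x.1 = P.Qval j ∧ (∃ R > 0,
      P.IsPatch j (closedBall x.1 R)) ∧ ⟪∇ (P.Q 0) x.1, x.2⟫ < (0 : ℝ) ∧
      x' = (x.1, reflectMomentum (‖∇ (P.Q 0) x.1‖⁻¹ • ∇ (P.Q 0) x.1) x.2) ∧
      0 < ⟪∇ (P.Q 0) x.1, x'.2⟫ := by
  obtain ⟨h1, n, h2, h3, h4⟩ := h
  obtain ⟨j, hQ, R, hR, hp⟩ := P.exists_isPatch h1
  have hn := h2.unique (hp.isInwardNormal_D (closedBall_mem_nhds _ hR) hQ)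
  have hG : 0 < ‖∇ (P.Q 0) x.1‖ := norm_pos_iff.2
    (hp.gradient_ne (mem_closedBall_self hR.le) ⟨le_rfl, P.ε₁_pos⟩)
  have hGn : ∇ (P.Q 0) x.1 = ‖∇ (P.Q 0) x.1‖ • n := by rw [hn, smul_inv_smul₀ hG.ne']
  refine ⟨j, hQ, ⟨R, hR, hp⟩, ?_, by rw [← hn, h4], ?_⟩
  · rw [hGn, real_inner_smul_left, real_inner_comm]
    exact mul_neg_of_pos_of_neg hG h3
  · rw [hGn, real_inner_smul_left, h4, reflectMomentum, inner_sub_right, real_inner_smul_right,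
      real_inner_self_eq_norm_sq, h2.1, real_inner_comm]
    exact mul_pos hG (by linarith)

lemma BoundaryDominated.exists_shadows_succ (hP : P.BoundaryDominated) (hr : 1 ≤ r)
    {T' τ₀ T : ℝ} (hT' : 0 ≤ T') (hτ : T' < τ₀) (hτT : τ₀ < T) {N : ℕ} {ρ₀ x x' : Phase d}
    {F G : ℝ → Phase d → Phase d} {K : ℝ} (hFG : LocRel r F G ρ₀ x)
    (hS : ∀ᶠ w in 𝓝₀ ×ˢ 𝓝 ρ₀, P.Shadows T' N K w.1 (F w.1) (G w.1) w.2)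
    (hin : ∀ s ∈ Ico T' τ₀, (freeLine x (s - T')).1 ∈ interior B.D)
    (hx : Reflects B.D B.corner (freeLine x (τ₀ - T')) x')
    (hin' : ∀ s ∈ Ioc τ₀ T, (freeLine x' (s - τ₀)).1 ∈ interior B.D) :
    ∃ (F' G' : ℝ → Phase d → Phase d) (K' : ℝ), LocRel r F' G' ρ₀ (freeLine x' (T - τ₀)) ∧
      ∀ᶠ w in 𝓝₀ ×ˢ 𝓝 ρ₀, P.Shadows T (N + 1) K' w.1 (F' w.1) (G' w.1) w.2 := by
  obtain ⟨y, hyx⟩ : ∃ y, y = freeLine x (τ₀ - T') := ⟨_, rfl⟩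
  rw [← hyx] at hx
  obtain ⟨j, hQ, ⟨R, hR, hp⟩, hy, hx', hy'⟩ := P.exists_isPatch_of_reflects hx
  have hx1 : x'.1 = y.1 := by rw [hx']
  obtain ⟨f₁, g₁, f₂, g₂, b, c₁, M₁, K₁, hc₁, h1, h2, h3⟩ := hp.exists_hit hP hr (z₀ := (y, (τ₀,
      0)))
    (z := (x, (T', 0))) hR hQ hy hτ (by simp [hyx, freeLine]) hin
  simp only [← hx'] at h2
  have hdep := IsPatch.exists_depart (z₀ := (x', (τ₀, ⟪y.2, y.2⟫ / 2))) (j := j) hP hr hR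
    (by rw [hx1]; exact hp) (by rw [hx1]; exact hQ) (by rw [hx1]; exact hy') hτT hin'
  obtain ⟨f₃, g₃, a, c₃, M₃, K₃, hc₃, h4, h5⟩ := hdep
  have hz := (locRel_lift (r := r) T' x).comp hFG
  have h2z := h2.comp hz
  have hF' := (h4.comp h2z).phase
  obtain ⟨C, hC⟩ := h2z.exists_norm_sub_le
  obtain ⟨Ka, hKa⟩ := hP.exists_crNear hr hFG T' T (M := M₁) hc₁
  obtain ⟨Kb, hKb⟩ := hP.exists_crNear hr hF' T T (M := M₃) hc₃
  set vF : ℝ → Phase d → State d := fun ε ρ => f₂ ε (F ε ρ, (T', 0)) with hvF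
  set vG : ℝ → Phase d → State d := fun ε ρ => g₂ ε (G ε ρ, (T', 0)) with hvG
  set F' : ℝ → Phase d → Phase d := fun ε ρ => (f₃ ε (vF ε ρ)).1 with hF'd
  set G' : ℝ → Phase d → Phase d := fun ε ρ => (g₃ ε (vG ε ρ)).1 with hG'd
  change LocRel r F' G' ρ₀ _ at hF'
  have hlt : ∀ᶠ w : ℝ × Phase d in 𝓝₀ ×ˢ 𝓝 ρ₀, w.1 ∈ Ioo 0 P.ε₁ := P.eventually_lt.prod_inl _
  have hD : ∀ᶠ w in 𝓝₀ ×ˢ 𝓝 ρ₀, ∃ (τ a b : Fin N → ℝ) (γb γs : ℝ → Phase d) (s₁ s₂ : ℝ),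
      (IsBilliardOrbit (P.auxTable w.1) B.corner T (N + 1)
        (Fin.snoc τ (vG w.1 w.2).2.1 : Fin (N + 1) → ℝ) γb ∧ γb 0 = w.2 ∧ γb T = G' w.1 w.2) ∧
      ((∀ t ∈ Ico T' (vG w.1 w.2).2.1, billiardFlow (P.auxTable w.1) B.corner t w.2 =
        freeLine (G w.1 w.2) (t - T')) ∧ ∀ t ∈ Ioc (vG w.1 w.2).2.1 T,
        billiardFlow (P.auxTable w.1) B.corner t w.2 = freeLine (G' w.1 w.2) (t - T)) ∧
      (OrbitOn P.domain (P.V w.1) 0 T γs ∧ γs 0 = w.2 ∧ γs T = F' w.1 w.2 ∧ γs T' = F w.1 w.2) ∧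
      (T' ≤ s₁ ∧ s₁ ≤ (vF w.1 w.2).2.1 ∧ (vF w.1 w.2).2.1 - s₁ ≤ (K₁ + K₁) * nuExp r w.1) ∧
      ((vF w.1 w.2).2.1 ≤ s₂ ∧ s₂ ≤ T ∧ s₂ - (vF w.1 w.2).2.1 ≤ K₃ * nuExp r w.1) ∧
      ((∀ s ∈ Icc T' s₁, γs s ∈ P.core c₁ M₁ w.1) ∧ ∀ s ∈ Icc s₂ T, γs s ∈ P.core c₃ M₃ w.1) ∧
      (∀ j, τ j ∈ Icc (a j) (b j) ∧ b j - a j ≤ K * nuExp r w.1) ∧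
      ∀ t ∈ Icc 0 T', (∀ j, t ∉ Icc (a j) (b j)) → (γs t).1 ∈ P.intTable w.1 ∧
        CrNear r (smoothFlow P.domain (P.V w.1) t) (billiardFlow (P.auxTable w.1) B.corner t) w.2
          (K * nuExp r w.1) := by
    have hbefore : ∀ᶠ w in 𝓝₀ ×ˢ 𝓝 ρ₀, (vG w.1 w.2).2.1 < T :=
      ((h2z.tendsto_right.snd_nhds.fst_nhds).eventually_lt_const hτT)
    filter_upwards [hS, hz.left h3, hz.right h3, h2z.left h5, h2z.right h5, hbefore]
      with w w1 w2 w3 w4 w5 w6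
    obtain ⟨τ, a, b, γb, γs, ⟨a1, a2, a3⟩, ⟨a4, a5, a6⟩, a7, a8⟩ := w1
    obtain ⟨⟨e1, -, e3, e4, e5, e6, -⟩, -⟩ := w2
    obtain ⟨-, i1, i2, i3, i4, i5, i6⟩ := w3
    obtain ⟨⟨k1, k2⟩, -⟩ := w4 e6
    obtain ⟨-, k3, k4, k5⟩ := w5 i6
    obtain ⟨γ', s₁, s₂, l1, l2, l3, ⟨l4, l5, l6⟩, l7, l8, l9⟩ := a4.step hT' rfl a6 e1 e3 k1
    rw [k2] at l1 l3 l7 l9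
    obtain ⟨η, m1, m2, m3, m4, m5⟩ := a1.step hT' rfl a3 i2 i1 i3 i4 i5 k3 w6 k5 k4
    rw [a2] at m2 m4 m5
    refine ⟨τ, a, b, η, γ', s₁, s₂, ⟨m1, m2, m3⟩, ⟨m4, m5⟩, ⟨l1, ?_, l3, ?_⟩, ⟨l4, l5.trans e4.le,
        ?_⟩,
      l7, ⟨l8, l9⟩, a7, fun t ht htj => ?_⟩
    · rw [l2 ⟨le_rfl, hT'⟩, a5]
    · rw [l2 ⟨hT', le_rfl⟩, a6]
    · simp only [hvF, comp_apply] at e5 l6 ⊢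
      linarith
    · rw [l2 ht]
      exact a8 t ht htj
  refine ⟨F', G', max K (max (K₁ + K₁ + K₃ + 2 * C) (max Ka Kb)), ?_, ?_⟩
  · exact hF'
  filter_upwards [hD, eventually_eventually_snd hD, h2z.continuousAt_right, hC, hKa, hKb, hlt,
    nuExp_nonneg_eventually.prod_inl _] with w w1 w2 w3 w4 w5 w6 hε hν
  obtain ⟨τ, a, b, γb, γs, s₁, s₂, a1, -, ⟨a2, a3, a4, a5⟩, ⟨a6, a7, a8⟩, ⟨a9, a10, a11⟩, ⟨a12,
      a13⟩,
    a14, a15⟩ := w1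
  have hcont : ContinuousAt (fun ρ => (vG w.1 ρ).2.1) w.2 := w3.snd.fst
  set σ := (vG w.1 w.2).2.1 with hσ
  have hc : |(vF w.1 w.2).2.1 - σ| ≤ C * nuExp r w.1 :=
    (State.t_le (vF w.1 w.2 - vG w.1 w.2)).trans w4
  have hc' := abs_le.1 hc
  have hK1 : ∀ {k}, k ≤ max K (max (K₁ + K₁ + K₃ + 2 * C) (max Ka Kb)) →
    k * nuExp r w.1 ≤ max K (max (K₁ + K₁ + K₃ + 2 * C) (max Ka Kb)) * nuExp r w.1 :=
    fun h => mul_le_mul_of_nonneg_right h hν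
  have hT : T' ≤ T := (hτ.trans hτT).le
  refine ⟨Fin.snoc τ σ, Fin.snoc a (min s₁ σ), Fin.snoc b (max s₂ σ), γb, γs, a1, ⟨a2, a3, a4⟩,
    fun j => ?_, fun t ht hj => ?_⟩
  · induction j using Fin.lastCases with
    | last =>
      simp only [Fin.snoc_last]
      refine ⟨⟨min_le_right _ _, le_max_right _ _⟩,
        le_trans ?_ (hK1 ((le_max_left _ _).trans (le_max_right _ _)))⟩
      have e1 : max s₂ σ ≤ (vF w.1 w.2).2.1 + K₃ * nuExp r w.1 + C * nuExp r w.1 :=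
        max_le (by linarith [abs_nonneg ((vF w.1 w.2).2.1 - σ)]) (by linarith)
      have e2 : (vF w.1 w.2).2.1 - (K₁ + K₁) * nuExp r w.1 - C * nuExp r w.1 ≤ min s₁ σ :=
        le_min (by linarith [abs_nonneg ((vF w.1 w.2).2.1 - σ)]) (by linarith)
      linarith
    | cast j =>
      simp only [Fin.snoc_castSucc]
      exact ⟨(a14 j).1, (a14 j).2.trans (hK1 (le_max_left _ _))⟩
  · have hlast := hj (Fin.last N)
    simp only [Fin.snoc_last, mem_Icc, not_and_or, not_le, lt_min_iff, max_lt_iff] at hlast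
    rcases le_or_gt t T' with h | h
    · obtain ⟨e1, e2⟩ := a15 t ⟨ht.1, h⟩ fun j => by simpa using hj j.castSucc
      exact ⟨e1, e2.mono (hK1 (le_max_left _ _))⟩
    rcases hlast with ⟨e1, e2⟩ | ⟨e1, e2⟩
    · refine ⟨(a12 t ⟨h.le, e1.le⟩).1.1, (CrNear.congr (w5 t ht ⟨0, T, γs, a2, a5, ⟨hT', hT⟩, ht,
        fun s hs => ?_⟩) ?_ ?_).mono (hK1 ((le_max_left _ _).trans
          ((le_max_right _ _).trans (le_max_right _ _))))⟩
      · rw [uIcc_of_le h.le] at hs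
        exact a12 s ⟨hs.1, hs.2.trans e1.le⟩
      · filter_upwards [w2] with ρ hρ
        obtain ⟨-, -, -, -, γ', -, -, -, -, ⟨b1, b2, -, b3⟩, -⟩ := hρ
        rw [← b2, b1.smoothFlow_eq hr hε ht, b2, ← b3]
        exact b1.phase_eq hr hε ⟨hT', hT⟩ ht
      · filter_upwards [w2, hcont.eventually_const_lt e2] with ρ hρ hρ'
        obtain ⟨-, -, -, -, -, -, -, -, ⟨b1, -⟩, -⟩ := hρ
        exact b1 t ⟨h.le, hρ'⟩
    · refine ⟨(a13 t ⟨e1.le, ht.2⟩).1.1, (CrNear.congr (w6 t ht ⟨0, T, γs, a2, a4,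
        ⟨hT'.trans hT, le_rfl⟩, ht, fun s hs => ?_⟩) ?_ ?_).mono (hK1 ((le_max_right _ _).trans
          ((le_max_right _ _).trans (le_max_right _ _))))⟩
      · rw [uIcc_of_ge ht.2] at hs
        exact a13 s ⟨e1.le.trans hs.1, hs.2⟩
      · filter_upwards [w2] with ρ hρ
        obtain ⟨-, -, -, -, γ', -, -, -, -, ⟨b1, b2, b3, -⟩, -⟩ := hρ
        change _ = (flowMap (P.intField w.1) 1 (F' w.1 ρ, (T, t - T))).1
        rw [← b2, b1.smoothFlow_eq hr hε ht, b2, ← b3]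
        exact b1.phase_eq hr hε ⟨hT'.trans hT, le_rfl⟩ ht
      · filter_upwards [w2, hcont.eventually_lt_const e2] with ρ hρ hρ'
        obtain ⟨-, -, -, -, -, -, -, -, ⟨-, b1⟩, -⟩ := hρ
        exact b1 t ⟨hρ', ht.2⟩

lemma _root_.IsBilliardOrbit.init {Ω C : Set (Config d)} {T T' : ℝ} {N : ℕ} {τ : Fin (N + 1) → ℝ}
    {γ : ℝ → Phase d} (h : IsBilliardOrbit Ω C T (N + 1) τ γ) (h1 : ∀ j : Fin N, τ j.castSucc < T')
    (h2 : T' < τ (Fin.last N)) : IsBilliardOrbit Ω C T' N (fun j => τ j.castSucc) γ := by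
  have hT : T' ≤ T := (h2.trans (h.mem_Ioo _).2).le
  have hr : ∀ s ∈ Icc 0 T', s ∉ range (fun j : Fin N => τ j.castSucc) → s ∉ range τ := by
    rintro s hs hsr ⟨j, rfl⟩
    induction j using Fin.lastCases with
    | last => exact not_lt.2 hs.2 h2
    | cast j => exact hsr ⟨j, rfl⟩
  have hsub : Icc 0 T' ⊆ Icc 0 T := Icc_subset_Icc_right hT
  exact ⟨fun i j hij => h.strictMono (Fin.castSucc_lt_castSucc_iff.2 hij),
    fun j => ⟨(h.mem_Ioo _).1, h1 j⟩, h.continuousOn.mono hsub,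
    fun s hs hsr => h.mem_interior s (hsub hs) (hr s hs hsr),
    fun s hs hsr => (h.free s (hsub hs) (hr s hs hsr)).mono hsub, fun j => h.collision _⟩

lemma BoundaryDominated.exists_shadows (hP : P.BoundaryDominated) (hr : 1 ≤ r) {N : ℕ} :
    ∀ {T : ℝ} {τ : Fin N → ℝ} {γ : ℝ → Phase d}, 0 ≤ T → IsBilliardOrbit B.D B.corner T N τ γ →
      ∃ (F G : ℝ → Phase d → Phase d) (K : ℝ), LocRel r F G (γ 0) (γ T) ∧
        ∀ᶠ w in 𝓝₀ ×ˢ 𝓝 (γ 0), P.Shadows T N K w.1 (F w.1) (G w.1) w.2 := by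
  induction N with
  | zero =>
    intro T τ γ hT h
    have hr0 : ∀ s, s ∉ range τ := fun s ⟨j, _⟩ => j.elim0
    have e : ∀ s ∈ Icc 0 T, γ s = freeLine (γ 0) s := fun s hs => by
      have := h.eq_freeLine le_rfl hs.1 hs.2 fun t _ => hr0 t
      rwa [sub_zero] at this
    rw [e T ⟨hT, le_rfl⟩]
    exact hP.exists_shadows_zero hr hT fun s hs => e s hs ▸ h.mem_interior s hs (hr0 s)
  | succ N ih =>
    intro T τ γ hT h
    have hl := h.mem_Ioo (Fin.last N)
    obtain ⟨T', h0, h1, h2⟩ : ∃ T', 0 < T' ∧ (∀ j : Fin N, τ j.castSucc < T') ∧ T' < τ (Fin.last N)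
        := by
      exact (((eventually_gt_nhds hl.1).filter_mono nhdsWithin_le_nhds).and ((eventually_all.2
        fun j : Fin N => (eventually_gt_nhds (h.strictMono (Fin.castSucc_lt_last j))).filter_mono
          nhdsWithin_le_nhds).and (eventually_mem_nhdsWithin (s := Iio (τ (Fin.last N)))))).exists
    have hno : ∀ s ∈ Ioc T' T, s ≠ τ (Fin.last N) → s ∉ range τ := by
      rintro s hs hsl ⟨j, rfl⟩
      induction j using Fin.lastCases with
      | last => exact hsl rfl
      | cast j => exact not_lt.2 hs.1.le (h1 j)
    obtain ⟨F, G, K, hFG, hS⟩ := ih h0.le (h.init h1 h2)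
    have e1 : ∀ s ∈ Ico T' (τ (Fin.last N)), γ s = freeLine (γ T') (s - T') := fun s hs =>
      h.eq_freeLine h0.le hs.1 (hs.2.trans hl.2).le fun t ht =>
        hno t ⟨ht.1, (ht.2.trans_lt (hs.2.trans hl.2)).le⟩ (ht.2.trans_lt hs.2).ne
    have e2 : ∀ s ∈ Icc (τ (Fin.last N)) T, γ s = freeLine (γ (τ (Fin.last N))) (s - τ (Fin.last N))
        :=
      fun s hs => h.eq_freeLine hl.1.le hs.1 hs.2 fun t ht =>
        hno t ⟨h2.trans ht.1, ht.2.trans hs.2⟩ ht.1.ne'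
    have hT' : T' ∉ range τ := by
      rintro ⟨j, rfl⟩
      induction j using Fin.lastCases with
      | last => exact lt_irrefl _ h2
      | cast j => exact lt_irrefl _ (h1 j)
    rw [e2 T ⟨hl.2.le, le_rfl⟩]
    refine hP.exists_shadows_succ hr h0.le h2 hl.2 hFG hS (fun s hs => ?_)
      (h.reflects h0.le _ h2 fun t ht => hno t ⟨ht.1, (ht.2.trans hl.2).le⟩ ht.2.ne) fun s hs => ?_
    · rw [← e1 s hs]
      refine h.mem_interior s ⟨h0.le.trans hs.1, (hs.2.trans hl.2).le⟩ ?_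
      rcases hs.1.eq_or_lt with rfl | h3
      · exact hT'
      · exact hno s ⟨h3, (hs.2.trans hl.2).le⟩ hs.2.ne
    · rw [← e2 s ⟨hs.1.le, hs.2⟩]
      exact h.mem_interior s ⟨(hl.1.trans hs.1).le, hs.2⟩ (hno s ⟨h2.trans hs.1, hs.2⟩ hs.1.ne')

/-! ### The maps -/

lemma _root_.LocRel.exists_comp_sub_le {E E' F : Type} [NormedAddCommGroup E] [NormedSpace ℝ E]
    [NormedAddCommGroup E'] [NormedSpace ℝ E'] [FiniteDimensional ℝ E] [FiniteDimensional ℝ E']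
    [NormedAddCommGroup F] [NormedSpace ℝ F] {f g : ℝ → E → F} {x₀ : E} {y : F}
    (h : LocRel r f g x₀ y) : ∃ K, ∀ᶠ w in 𝓝₀ ×ˢ 𝓝 x₀, ∀ (σ : E' → E) (x : E'), σ x = w.2 →
      𝒞 r σ x → (∀ k, 1 ≤ k → k ≤ r → ‖iteratedFDeriv ℝ k σ x‖ ≤ 1) →
      𝒞 r (f w.1 ∘ σ) x ∧ 𝒞 r (g w.1 ∘ σ) x ∧ ∀ k ≤ r,
        ‖iteratedFDeriv ℝ k (f w.1 ∘ σ) x - iteratedFDeriv ℝ k (g w.1 ∘ σ) x‖ ≤ K * nuExp r w.1 :=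
            by
  obtain ⟨ρ, hρ, h1⟩ := h.rel
  set S : Set (E' → E) := {σ | 𝒞 r σ 0 ∧ σ 0 ∈ closedBall x₀ ρ ∧
    ∀ k, 1 ≤ k → k ≤ r → ‖iteratedFDeriv ℝ k σ 0‖ ≤ 1} with hS
  set l := 𝓝₀ ×ˢ 𝓟 S with hl
  have he : Tendsto (fun i : ℝ × (E' → E) => i.1) l 𝓝₀ := tendsto_fst
  have hν := he.eventually (nuExp_nonneg_eventually (r := r))
  have hν' := he.eventually (nuExp_le_one_eventually (r := r))
  have hs : ∀ᶠ i in l, i.2 ∈ S := tendsto_snd.eventually (mem_principal_self _)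
  have hc : ∀ᶠ i in l, ∀ x ∈ ({0} : Set E'), 𝒞 r i.2 x := by
    filter_upwards [hs] with i hi x hx
    rw [mem_singleton_iff.1 hx]
    exact hi.1
  have hsub : ∀ᶠ i in l, ({0} : Set E') ⊆ {0} := .of_forall fun _ => subset_rfl
  have h2 : CRel l (fun i => nuExp r i.1) r (fun i => i.2) (fun i => i.2) (fun _ => ({0} : Set E'))
      (fun _ => {0}) := by
    refine CRel.of_iteratedFDeriv (C := max (‖x₀‖ + ρ) 1) (R := 0) hc hc (fun k hk => ?_)
      (.of_forall fun _ => by simp) hν hν' hsub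
    filter_upwards [hs, hν] with i hi hνi
    refine ⟨fun x hx => ?_, fun x hx x' hx' => ?_⟩
    · rw [mem_singleton_iff.1 hx]
      rcases k.eq_zero_or_pos with rfl | h0
      · rw [norm_iteratedFDeriv_zero]
        exact (norm_le_of_mem_closedBall hi.2.1).trans (le_max_left _ _)
      · exact (hi.2.2 k h0 hk).trans (le_max_right _ _)
    · rw [mem_singleton_iff.1 hx, mem_singleton_iff.1 hx', sub_self, norm_zero]
      exact mul_nonneg (zero_le_one.trans (le_max_right _ _)) (add_nonneg (norm_nonneg _) hνi)
  have hmt : ∀ᶠ i in l, MapsTo i.2 ({0} : Set E') (closedBall x₀ ρ) := by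
    filter_upwards [hs] with i hi x hx
    rw [mem_singleton_iff.1 hx]
    exact hi.2.1
  have h3 := (h1.reindex he).comp h2 hν hν' hsub hmt hmt
  obtain ⟨K, hK⟩ := h3.exists_iteratedFDeriv_sub_le hν hsub
  refine ⟨K, ?_⟩
  have h4 := eventually_prod_principal_iff.1 (hK.and (h3.left.and h3.right))
  filter_upwards [h4.prod_mk (closedBall_mem_nhds x₀ hρ)] with w hw σ x hx hσ hσk
  have htr : ∀ {H : Type} [NormedAddCommGroup H] [NormedSpace ℝ H] (φ : E' → H), 𝒞 r φ x ↔
      𝒞 r (fun z => φ (x + z)) 0 := fun φ => by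
    refine ⟨fun h => ContDiffAt.comp (g := φ) (f := fun z => x + z) 0 (by simpa using h)
      (contDiffAt_const.add contDiffAt_id), fun h => ?_⟩
    have := ContDiffAt.comp (g := fun z => φ (x + z)) (f := fun z => z - x) x (by simpa using h)
      (contDiffAt_id.sub contDiffAt_const)
    exact this.congr_of_eventuallyEq (.of_forall fun z => by simp)
  have hmem : (fun z => σ (x + z)) ∈ S := by
    refine ⟨(htr σ).1 hσ, by simpa [hx] using hw.2, fun k h0 hk => ?_⟩
    rw [iteratedFDeriv_comp_add_left, add_zero]
    exact hσk k h0 hk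
  obtain ⟨e1, e2, e3⟩ := hw.1 _ hmem
  refine ⟨(htr _).2 (e2 0 rfl), (htr _).2 (e3 0 rfl), fun k hk => ?_⟩
  have := e1 0 rfl k hk
  have e : ∀ φ : E → F, iteratedFDeriv ℝ k (φ ∘ fun z => σ (x + z)) 0 = iteratedFDeriv ℝ k (φ ∘ σ) x
      :=
    fun φ => by
      change iteratedFDeriv ℝ k (fun z => (φ ∘ σ) (x + z)) 0 = _
      rw [iteratedFDeriv_comp_add_left, add_zero]
  rwa [e, e] at this

lemma exists_isPatch_of_mem_crossSection (P : SteepExpPotential B) {x : Phase d}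
    (h : x ∈ crossSection B.D B.corner) : ∃ j, P.Q 0 x.1 = P.Qval j ∧ (∃ R > 0,
      P.IsPatch j (closedBall x.1 R)) ∧ 0 < ⟪∇ (P.Q 0) x.1, x.2⟫ := by
  obtain ⟨h1, n, h2, h3⟩ := h
  obtain ⟨j, hQ, R, hR, hp⟩ := P.exists_isPatch h1
  have hG : 0 < ‖∇ (P.Q 0) x.1‖⁻¹ := inv_pos.2 (norm_pos_iff.2
    (hp.gradient_ne (mem_closedBall_self hR.le) ⟨le_rfl, P.ε₁_pos⟩))
  refine ⟨j, hQ, ⟨R, hR, hp⟩, pos_of_mul_pos_right ?_ hG.le⟩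
  rw [← real_inner_smul_left, ← h2.unique (hp.isInwardNormal_D (closedBall_mem_nhds _ hR) hQ),
    real_inner_comm]
  exact h3

lemma BoundaryDominated.exists_return (hP : P.BoundaryDominated) (hr : 1 ≤ r) {ρ₀ ρ₁ : Phase d}
    {t₀ : ℝ} (h : IsBilliardReturn B.D B.corner ρ₀ t₀ ρ₁) :
    ∃ (F G : ℝ → Phase d → Phase d) (K : ℝ), LocRel r F G ρ₀ ρ₁ ∧ ∀ᶠ w in 𝓝₀ ×ˢ 𝓝 ρ₀,
      w.2 ∈ crossSection (P.auxTable w.1) B.corner →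
        (∃ t, IsBilliardReturn (P.auxTable w.1) B.corner w.2 t (G w.1 w.2)) ∧
        ∃ t₁ t₂, IsSmoothReturn P.domain (P.V w.1) (P.auxTable w.1) B.corner w.2 t₁ t₂ (F w.1 w.2) ∧
          t₂ - t₁ ≤ K * nuExp r w.1 := by
  obtain ⟨hρ₀, ht₀, hseg, hq, hfr, n, hn, hpn, hp1⟩ := h
  obtain ⟨y, hyx⟩ : ∃ y, y = freeLine ρ₀ t₀ := ⟨_, rfl⟩
  have hy1 : y.1 = ρ₁.1 := by rw [hyx, hq]; rfl
  have hrefl : Reflects B.D B.corner y ρ₁ :=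
    ⟨hy1 ▸ hfr, n, hy1 ▸ hn, by rw [hyx]; exact hpn, Prod.ext hy1.symm (by rw [hp1, hyx]; rfl)⟩
  obtain ⟨i, hQi, ⟨R, hR, hpi⟩, hyi⟩ := P.exists_isPatch_of_mem_crossSection hρ₀
  obtain ⟨j, hQj, ⟨R', hR', hpj⟩, hyj, hρ₁, -⟩ := P.exists_isPatch_of_reflects hrefl
  obtain ⟨f₁, g₁, a, c₁, M₁, K₁, hc₁, h1, h2⟩ := IsPatch.exists_depart (z₀ := (ρ₀, (0, 0))) (t := t₀
      / 2)
    hP hr hR hpi hQi hyi (half_pos ht₀) fun s hs => hseg _ ⟨by simpa using hs.1, by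
      simp only [sub_zero]
      linarith [hs.2]⟩
  set x : Phase d := (ρ₀.1 + (t₀ / 2 - 0) • ρ₀.2, ρ₀.2) with hx
  obtain ⟨f₂, g₂, f₃, g₃, b, c₂, M₂, K₂, hc₂, h3, h4, h5⟩ := hpj.exists_hit hP hr (z₀ := (y, (t₀,
      0)))
    (z := (x, (t₀ / 2, a))) hR' hQj hyj (by simpa using half_lt_self ht₀) (by
      simp only [hyx, freeLine, hx]
      congr 1
      module) fun s hs => by
      convert hseg s ⟨(half_pos ht₀).trans_le hs.1, hs.2⟩ using 1
      simp only [hx]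
      module
  simp only [← hρ₁] at h4
  have hz := h1.comp (locRel_lift (r := r) 0 ρ₀)
  have hcs : ∀ᶠ w : ℝ × Phase d in 𝓝₀ ×ˢ 𝓝 ρ₀, w.1 ∈ Ioo 0 P.ε₁ ∧ closedBall ρ₀.1 R ∈ 𝓝 w.2.1 :=
    P.eventually_lt.prod_mk (continuous_fst.continuousAt.eventually
      (eventually_mem_nhds_iff.2 (closedBall_mem_nhds ρ₀.1 hR)))
  refine ⟨_, _, K₂, (h4.comp hz).phase, ?_⟩
  filter_upwards [(locRel_lift (r := r) 0 ρ₀).left h2, hz.left h5, hz.right h5, hcs]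
    with w w1 w2 w3 ⟨hε, hn⟩ hw
  obtain ⟨⟨⟨y₁, a1, a2, a3, a4, -⟩, a6⟩, a7, a8, a9⟩ :=
    w1 (hpi.eq_of_mem_frontier hn (Ioo_subset_Ico_self hε) hw.1.1)
  obtain ⟨⟨⟨y₂, b1, b2, b3, b4, -⟩, b6, b7, b8, b9, -, b11⟩, -⟩ := w2
  obtain ⟨-, k1, k2, k3, k4, k5, -⟩ := w3
  have hcore : ∀ {c M}, P.core c M w.1 ⊆ {x : Phase d | x.1 ∈ interior (P.auxTable w.1)} :=
    fun hx => hx.2.1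
  obtain ⟨m1, γ₁, m2, m3, m4, m5⟩ := (((a1.trans (a3.mono hcore) (hcore a2)).trans (b2.mono hcore)
    (hcore a4)).trans b4 (hcore b3))
  obtain ⟨n1, γ₂, n2, n3, n4, n5⟩ := b7
  obtain ⟨γ, e1, e2, e3⟩ := OrbitOn.glue m2 n2 (m4.trans n3.symm)
  have hpos : 0 < (f₂ w.1 (f₁ w.1 (w.2, (0, 0)))).2.1 := (half_pos ht₀).trans_le
    (a6.symm.le.trans (b2.1.trans b4.1))
  constructor
  · obtain ⟨l1, l2, l3⟩ := a7.trans k1 a8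
    have hlt := k3
    simp only [comp_apply, sub_zero] at k2 k3 k4 l2 l3 hlt
    rw [a9] at hlt
    obtain ⟨o1, ν, o2, o3, o4⟩ := k4
    rw [l2] at o1 o2 o3 o4
    refine ⟨(g₂ w.1 (g₁ w.1 (w.2, (0, 0)))).2.1, hw, (half_pos ht₀).trans hlt, l3, ?_, ?_, ν, ?_,
        o3, ?_⟩
    · exact congrArg Prod.fst o4
    · rw [comp_apply, comp_apply, o4]
      exact o1
    · rw [comp_apply, comp_apply, o4]
      exact o2
    · exact congrArg Prod.snd o4
  · have e4 : γ (f₂ w.1 (f₁ w.1 (w.2, (0, 0)))).2.1 = (f₂ w.1 (f₁ w.1 (w.2, (0, 0)))).1 :=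
      (e2 ⟨m1, le_rfl⟩).trans m4
    refine ⟨_, _, ⟨hw, hpos, b8, γ, e1, ?_, fun s hs => ?_, ?_, ?_, fun s hs => ?_, ?_, b11⟩, b9⟩
    · rw [e2 ⟨le_rfl, m1⟩]
      exact m3
    · rw [e2 (Ioo_subset_Icc_self hs)]
      exact m5 s hs
    · exact e4 ▸ b6.1
    · exact e4 ▸ b6.2
    · rw [e3 (Ioo_subset_Icc_self hs)]
      exact n5 s hs
    · exact (e3 ⟨n1, le_rfl⟩).trans n4

end SteepExpPotential

theorem mainTheorem8 {d r : ℕ} (hr : 1 ≤ r) (B : BilliardTable d r) (P : SteepExpPotential B)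
    (hP : P.BoundaryDominated) :
    (etaExp r =O[𝓝[>] (0 : ℝ)] fun ε => ε * Real.log ε) ∧
    (∀ (T : ℝ) (N : ℕ) (τ₀ : Fin N → ℝ) (γ₀ : ℝ → Phase d), 0 ≤ T →
      IsBilliardOrbit B.D B.corner T N τ₀ γ₀ → ‖(γ₀ 0).2‖ = 1 →
      ∃ U ∈ 𝓝 (γ₀ 0), ∃ K : ℝ, ∀ᶠ ε in 𝓝[>] (0 : ℝ), ∀ ρ ∈ U,
        ∃ (τ a b : Fin N → ℝ) (γb γs : ℝ → Phase d),
          IsBilliardOrbit (P.auxTable ε) B.corner T N τ γb ∧ γb 0 = ρ ∧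
          IsSmoothOrbit P.domain (P.V ε) T γs ∧ γs 0 = ρ ∧
          (∀ j, τ j ∈ Icc (a j) (b j) ∧ b j - a j ≤ K * ε ^ (1 / ((r : ℝ) + 2))) ∧
          ∀ t ∈ Icc 0 T, (∀ j, t ∉ Icc (a j) (b j)) →
            (γs t).1 ∈ P.intTable ε ∧
            CrNear r (smoothFlow P.domain (P.V ε) t) (billiardFlow (P.auxTable ε) B.corner t) ρ
              (K * ε ^ (1 / ((r : ℝ) + 2)))) ∧
    (∀ (ρ₀ ρ₁ : Phase d) (t₀ : ℝ), IsBilliardReturn B.D B.corner ρ₀ t₀ ρ₁ → ‖ρ₀.2‖ = 1 →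
      ∃ U ∈ 𝓝 ρ₀, ∃ K : ℝ, ∀ᶠ ε in 𝓝[>] (0 : ℝ),
        ∀ ρ ∈ U ∩ crossSection (P.auxTable ε) B.corner,
          (∃ t ρ', IsBilliardReturn (P.auxTable ε) B.corner ρ t ρ') ∧
          (∃ t₁ t₂ ρ', IsSmoothReturn P.domain (P.V ε) (P.auxTable ε) B.corner ρ t₁ t₂ ρ' ∧
            t₂ - t₁ ≤ K * ε ^ (1 / ((r : ℝ) + 2))) ∧
          CrNearOn r (crossSection (P.auxTable ε) B.corner)
            (poincareMap P.domain (P.V ε) (P.auxTable ε) B.corner)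
            (billiardMap (P.auxTable ε) B.corner) ρ (K * ε ^ (1 / ((r : ℝ) + 2)))) := by
  refine ⟨etaExp_isBigO, fun T N τ₀ γ₀ hT h _ => ?_, fun ρ₀ ρ₁ t₀ h _ => ?_⟩
  · obtain ⟨F, G, K, -, hS⟩ := hP.exists_shadows hr hT h
    obtain ⟨pa, ha, pb, hb, hp⟩ := eventually_prod_iff.1 hS
    refine ⟨{ρ | pb ρ}, hb, K, ha.mono fun ε hε ρ hρ => ?_⟩
    obtain ⟨τ, a, b, γb, γs, ⟨h1, h2, -⟩, ⟨h3, h4, -⟩, h5, h6⟩ := hp hε hρ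
    exact ⟨τ, a, b, γb, γs, h1, h2, h3, h4, h5, h6⟩
  · obtain ⟨F, G, K, hFG, hS⟩ := hP.exists_return hr h
    obtain ⟨K', hK'⟩ := hFG.exists_comp_sub_le (E' := Phase d)
    obtain ⟨pa, ha, pb, hb, hp⟩ := eventually_prod_iff.1 (hS.and hK')
    refine ⟨{ρ | ∀ᶠ y in 𝓝 ρ, pb y}, hb.eventually_nhds, max K K', ?_⟩
    filter_upwards [ha, P.eventually_lt, nuExp_nonneg_eventually (r := r)] with ε h1 hε hν ρ hρ
    obtain ⟨h2, h3⟩ := hp h1 hρ.1.self_of_nhds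
    obtain ⟨⟨t, h4⟩, t₁, t₂, h5, h6⟩ := h2 hρ.2
    refine ⟨⟨t, _, h4⟩, ⟨t₁, t₂, _, h5, h6.trans (mul_le_mul_of_nonneg_right (le_max_left _ _) hν)⟩,
      fun σ x hx hσ hσS hσk => ?_⟩
    have key : ∀ᶠ y in 𝓝 x, poincareMap P.domain (P.V ε) (P.auxTable ε) B.corner (σ y) = F ε (σ y) ∧
        billiardMap (P.auxTable ε) B.corner (σ y) = G ε (σ y) := by
      filter_upwards [hσS, hσ.continuousAt.eventually (hx ▸ hρ.1)] with y hy hy'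
      obtain ⟨⟨t, i1⟩, t₁, t₂, i2, -⟩ := (hp h1 hy').1 hy
      exact ⟨i2.poincareMap_eq hr hε, i1.billiardMap_eq⟩
    exact (CrNear.congr (h3 σ x hx hσ hσk) (key.mono fun y hy => hy.1)
      (key.mono fun y hy => hy.2)).mono (mul_le_mul_of_nonneg_right (le_max_right _ _) hν)
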